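/- For a finite simple graph $G=(V,E)$ let $M(G)=\begin{bmatrix} I & B\\ B^{\mathsf T} & I\end{bmatrix}$, where $B\in\{0,1\}^{V\times E}$ is the vertex-edge incidence matrix of $G$, and let $\Delta(G)$ be the maximum of $|\det M'|$ over all square submatrices $M'$ of $M(G)$ (with the empty submatrix allowed and having determinant $1$). Theorem. There is an algorithm that, given any integer $\Delta\ge 1$ and any finite simple graph $G=(V,E)$ presented by the numbers $|V|$, $|E|$ and a list of its edges, either computes $\Delta(G)$ or correctly reports that $\Delta(G)>\Delta$, in time $O\bigl(|V|+|E|+2^{O(\Delta\log\Delta)}\bigr)$. Precisely: there are one program $P$ for a random access machine and one constant $C\in\mathbb{N}$, independent of $\Delta$ and $G$, such that for every integer $\Delta\ge 1$, every finite simple graph $G$, every numbering of its vertices by $0,\dots,|V|-1$ and every list of its edges, $P$ halts on this input after at most $T:=C\,\bigl(|V|+|E|+2^{C\,\Delta\log_2\Delta}\bigr)$ steps, and either outputs $\Delta(G)$, or reports that $\Delta(G)>\Delta$, in which case this inequality holds. The machine has finitely many registers and zero-initialised arrays of integers; a step is loading a constant, adding or subtracting two registers, reading or writing an array cell addressed by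 a register, a no-operation, or comparing two registers to control a branch or a loop; and all numbers computed during the run have absolute value at most $T^{C}$, i.e. words of $O(\log T)$ bits suffice. -/

import Mathlib

/-! ### The constraint matrix of the total matching problem and its largest subdeterminant -/

/-- The largest value of `|det A'|` over the square submatrices `A'` of an integer matrix `A`.
A `k × k` submatrix is given by `k` distinct rows and `k` distinct columns; the empty submatrix
(`k = 0`, determinant `1`) is allowed, so that the value of an empty matrix is `1`. -/
noncomputable def maxSubdet {ι κ : Type*} (A : Matrix ι κ ℤ) : ℕ :=
  sSup {d : ℕ | ∃ (k : ℕ) (r : Fin k ↪ ι) (c : Fin k ↪ κ), d = (A.submatrix r c).det.natAbs}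

/-- For a finite matrix the supremum in the definition of `maxSubdet` is a maximum. -/
theorem isGreatest_maxSubdet {ι κ : Type*} [Finite ι] (A : Matrix ι κ ℤ) [Finite κ] :
    IsGreatest {d : ℕ | ∃ (k : ℕ) (r : Fin k ↪ ι) (c : Fin k ↪ κ),
      d = (A.submatrix r c).det.natAbs} (maxSubdet A) := by
  set S : Set ℕ := {d : ℕ | ∃ (k : ℕ) (r : Fin k ↪ ι) (c : Fin k ↪ κ),
    d = (A.submatrix r c).det.natAbs} with hS
  have hne : S.Nonempty := ⟨_, 0, Function.Embedding.ofIsEmpty, Function.Embedding.ofIsEmpty, rfl⟩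
  have hfin : S.Finite := by
    let f : (Σ k : Fin (Nat.card ι + 1), (Fin k ↪ ι) × (Fin k ↪ κ)) → ℕ :=
      fun x => (A.submatrix x.2.1 x.2.2).det.natAbs
    refine (Set.finite_range f).subset ?_
    rintro d ⟨k, r, c, rfl⟩
    have hk : k ≤ Nat.card ι := by
      simpa using Nat.card_le_card_of_injective r r.injective
    exact ⟨⟨⟨k, Nat.lt_succ_of_le hk⟩, r, c⟩, rfl⟩
  exact ⟨Nat.sSup_mem hne hfin.bddAbove, fun d hd => le_csSup hfin.bddAbove hd⟩

namespace SimpleGraph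

/-- The constraint matrix `M(G) = [I B; Bᵀ I]` of the total matching problem, where `B` is the
vertex-edge incidence matrix of `G`. -/
noncomputable def totalMatchingMatrix {V : Type*} (G : SimpleGraph V) :
    Matrix (V ⊕ G.edgeSet) (V ⊕ G.edgeSet) ℤ :=
  open Classical in
  let B : Matrix V G.edgeSet ℤ := (G.incMatrix ℤ).submatrix id Subtype.val
  Matrix.fromBlocks 1 B B.transpose 1

/-- The parameter `Δ(G)`: the maximum of `|det M'|` over the square submatrices `M'` of `M(G)`. -/
noncomputable def subdetDelta {V : Type*} (G : SimpleGraph V) : ℕ :=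
  maxSubdet G.totalMatchingMatrix

end SimpleGraph

/-! ### Random access machines, with a step count

A machine has registers and zero-initialised arrays, numbered by the natural numbers (a program
mentions only finitely many of them). Registers and array cells hold integers, and array cells are
addressed by integers. The instructions are loading a constant, addition, subtraction, and reading
or writing an array cell whose address is in a register; they are combined by sequencing,
branching, and loops, both controlled by comparing two registers. -/

namespace RAM

/-- The memory of the machine. -/
structure State where
  /-- contents of the registers -/
  reg : ℕ → ℤ
  /-- contents of the arrays: `arr a i` is cell `i` of array `a` -/
  arr : ℕ → ℤ → ℤ

/-- The state in which register `x` has been overwritten by `v`. -/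
def State.setReg (s : State) (x : ℕ) (v : ℤ) : State :=
  { s with reg := Function.update s.reg x v }

/-- The state in which cell `i` of array `a` has been overwritten by `v`. -/
def State.setArr (s : State) (a : ℕ) (i v : ℤ) : State :=
  { s with arr := Function.update s.arr a (Function.update (s.arr a) i v) }

/-- Programs. -/
inductive Program where
  /-- do nothing -/
  | skip
  /-- `x := k` for a constant `k` -/
  | const (x : ℕ) (k : ℤ)
  /-- `x := y + z` -/
  | add (x y z : ℕ)
  /-- `x := y - z` -/
  | sub (x y z : ℕ)
  /-- `x := a[y]` -/
  | load (x a y : ℕ)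
  /-- `a[y] := x` -/
  | store (a y x : ℕ)
  /-- first `p`, then `q` -/
  | seq (p q : Program)
  /-- if `y < z` then `p` else `q` -/
  | ite (y z : ℕ) (p q : Program)
  /-- while `y < z` do `p` -/
  | while (y z : ℕ) (p : Program)

/-- `Exec W p s t s'`: started in state `s`, program `p` halts in state `s'` after exactly `t`
steps, and every number that it computes lies in the word range `[-W, W]`. Every instruction and
every evaluation of a test takes one step. An instruction whose result leaves the word range
has no execution. -/
inductive Exec (W : ℕ) : Program → State → ℕ → State → Prop where
  | skip (s : State) : Exec W .skip s 1 s
  | const (s : State) (x : ℕ) (k : ℤ) (h : |k| ≤ W) :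
      Exec W (.const x k) s 1 (s.setReg x k)
  | add (s : State) (x y z : ℕ) (h : |s.reg y + s.reg z| ≤ W) :
      Exec W (.add x y z) s 1 (s.setReg x (s.reg y + s.reg z))
  | sub (s : State) (x y z : ℕ) (h : |s.reg y - s.reg z| ≤ W) :
      Exec W (.sub x y z) s 1 (s.setReg x (s.reg y - s.reg z))
  | load (s : State) (x a y : ℕ) :
      Exec W (.load x a y) s 1 (s.setReg x (s.arr a (s.reg y)))
  | store (s : State) (a y x : ℕ) :
      Exec W (.store a y x) s 1 (s.setArr a (s.reg y) (s.reg x))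
  | seq {p q : Program} {s s' s'' : State} {t t' : ℕ}
      (hp : Exec W p s t s') (hq : Exec W q s' t' s'') :
      Exec W (.seq p q) s (t + t') s''
  | ite_true {y z : ℕ} {p q : Program} {s s' : State} {t : ℕ}
      (h : s.reg y < s.reg z) (hp : Exec W p s t s') :
      Exec W (.ite y z p q) s (t + 1) s'
  | ite_false {y z : ℕ} {p q : Program} {s s' : State} {t : ℕ}
      (h : ¬ s.reg y < s.reg z) (hq : Exec W q s t s') :
      Exec W (.ite y z p q) s (t + 1) s'
  | while_true {y z : ℕ} {p : Program} {s s' s'' : State} {t t' : ℕ}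
      (h : s.reg y < s.reg z) (hp : Exec W p s t s') (hw : Exec W (.while y z p) s' t' s'') :
      Exec W (.while y z p) s (t + t' + 1) s''
  | while_false {y z : ℕ} {p : Program} {s : State} (h : ¬ s.reg y < s.reg z) :
      Exec W (.while y z p) s 1 s

/-- The machine is deterministic: the program and the initial state determine the number of steps
and the final state. -/
theorem Exec.deterministic {W W' : ℕ} {p : Program} {s s₁ s₂ : State} {t₁ t₂ : ℕ}
    (h₁ : Exec W p s t₁ s₁) (h₂ : Exec W' p s t₂ s₂) : t₁ = t₂ ∧ s₁ = s₂ := by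
  induction h₁ generalizing t₂ s₂ with
  | skip | const | add | sub | load | store => cases h₂; exact ⟨rfl, rfl⟩
  | seq _ _ ih ih' =>
    cases h₂ with
    | seq a b =>
      obtain ⟨rfl, rfl⟩ := ih a
      obtain ⟨rfl, rfl⟩ := ih' b
      exact ⟨rfl, rfl⟩
  | ite_true h _ ih =>
    cases h₂ with
    | ite_true _ a => obtain ⟨rfl, rfl⟩ := ih a; exact ⟨rfl, rfl⟩
    | ite_false h' _ => exact absurd h h'
  | ite_false h _ ih =>
    cases h₂ with
    | ite_true h' _ => exact absurd h' h
    | ite_false _ a => obtain ⟨rfl, rfl⟩ := ih a; exact ⟨rfl, rfl⟩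
  | while_true h _ _ ih ih' =>
    cases h₂ with
    | while_true _ a b =>
      obtain ⟨rfl, rfl⟩ := ih a
      obtain ⟨rfl, rfl⟩ := ih' b
      exact ⟨rfl, rfl⟩
    | while_false h' => exact absurd h h'
  | while_false h =>
    cases h₂ with
    | while_true h' _ _ => exact absurd h' h
    | while_false _ => exact ⟨rfl, rfl⟩

end RAM

/-! ### Graphs as inputs -/

/-- An edge list of a finite graph: a numbering of the vertices by `0, …, |V| - 1`, and a list of
pairs of vertices in which every edge occurs exactly once, as one of its two ordered pairs
of endpoints. -/
structure EdgeList {V : Type*} (G : SimpleGraph V) where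
  /-- the numbering of the vertices -/
  num : V ≃ Fin (Nat.card V)
  /-- the order in which the edges are listed -/
  edge : Fin (Nat.card G.edgeSet) ≃ G.edgeSet
  /-- the endpoint of the `i`-th edge that is written first -/
  fst : Fin (Nat.card G.edgeSet) → V
  /-- the endpoint of the `i`-th edge that is written second -/
  snd : Fin (Nat.card G.edgeSet) → V
  /-- these are the endpoints of the `i`-th edge -/
  edge_eq : ∀ i, (edge i : Sym2 V) = s(fst i, snd i)

/-- Every finite graph has an edge list. -/
theorem EdgeList.exists_edgeList {V : Type*} [Finite V] (G : SimpleGraph V) :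
    Nonempty (EdgeList G) :=
  ⟨{ num := Finite.equivFin V
     edge := (Finite.equivFin G.edgeSet).symm
     fst := fun i => (Quot.out ((Finite.equivFin G.edgeSet).symm i : Sym2 V)).1
     snd := fun i => (Quot.out ((Finite.equivFin G.edgeSet).symm i : Sym2 V)).2
     edge_eq := fun i => (Quot.out_eq ((Finite.equivFin G.edgeSet).symm i : Sym2 V)).symm }⟩

/-- The initial state on input `(D, G)`, where `G` is given by an edge list: registers `0`, `1`, `2`
hold `D`, `|V|`, `|E|`; cell `i < |E|` of array `0` (of array `1`) holds the number of the first
(second) endpoint of the `i`-th edge; everything else is `0`. -/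
noncomputable def EdgeList.initState {V : Type*} {G : SimpleGraph V} (e : EdgeList G) (D : ℕ) :
    RAM.State where
  reg := fun x =>
    if x = 0 then (D : ℤ)
    else if x = 1 then (Nat.card V : ℤ)
    else if x = 2 then (Nat.card G.edgeSet : ℤ)
    else 0
  arr := fun a i =>
    if h : 0 ≤ i ∧ i.toNat < Nat.card G.edgeSet then
      if a = 0 then ((e.num (e.fst ⟨i.toNat, h.2⟩) : ℕ) : ℤ)
      else if a = 1 then ((e.num (e.snd ⟨i.toNat, h.2⟩) : ℕ) : ℤ)
      else 0
    else 0

/-- The resource bound `C · (n + m + 2 ^ (C · D · log D))` for a graph with `n` vertices and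
`m` edges. -/
noncomputable def resourceBound (C D n m : ℕ) : ℝ :=
  C * (n + m + (2 : ℝ) ^ ((C : ℝ) * (D * Real.logb 2 D)))

/-! ### Subdeterminants as numbers of solutions over the circle group -/

/-! Determinants are replaced by numbers of solutions. A nonsingular integer matrix `B` has exactly
|det B| solutions of `B y = 0` over the circle group ℝ/ℤ (`card_circleKer`). If some variables are
forced to zero and some equations are dropped, the solution set is either infinite or has at most
`maxSubdet` elements (`card_minorSol_le`). So the largest subdeterminant is the largest finite
number of solutions of such a system. Unlike determinants, solution sets can be cut, glued and
multiplied locally in a graph.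

The matrix M(G) is the identity plus the adjacency matrix of the graph that arises from G by
subdividing every edge once; its equations say that the values in a closed neighbourhood sum to
zero. Along a path of vertices of degree two, write the values as differences `z t = x (t + 1) - x
t` of potentials. A vanishing value then says `x (t + 1) = x (t + 2)`, and an equation says `x t = x
(t + 3)`. Therefore all that a path imposes on its two first and two last values is encoded by an
equivalence relation on six points (`exists_setoidRel_eq`). There are finitely many of these, and
three more inner vertices never lose a possibility, so the set of possible relations is eventually
periodic in the length with period three (`exists_pathTypes_periodic`). Another consequence:
applying any map of the circle to the potentials gives new solutions, so a nonzero solution all of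
whose conditions are equalities of potentials comes with infinitely many others
(`exists_family_of_ne_zero`).

Accordingly G is treated as a `PathGraph`, a multigraph whose edges stand for paths, and
`PathGraph.counts` collects the finite solution numbers. This set does not change if a vertex of
degree two is contracted (`PathGraph.counts_contract`), if a length is replaced by one with the same
path types, or if a component that is a path is deleted (`PathGraph.IsolatedEdge.counts_delEdge`).

What survives is small. Each component that is a cycle contributes a factor of at least two
(`PathGraph.exists_two_pow_le_of_loops`). Disjoint stars at vertices of degree at least three,
separated by a colouring with four colours, multiply to a large number, which bounds the sum of
these degrees by 16 Δ(G) (`PathGraph.sum_edgeDeg_le`). Hence at most 17 Δ(G) edges remain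
(`EdgeList.card_keep_le`). If more than 17 Δ are counted, then Δ(G) > Δ; otherwise the remaining
paths, of bounded length, are expanded again into a matrix of order N = O(Δ), and all its minors are
tabulated by expansion along the last row. The table has 4 ^ N cells, and everything about it is
bounded by a multiple of N ^ (4 N), that is, by 2 ^ O(Δ log Δ).

The preprocessing is linear because one pass over the vertices suffices for the contraction and
because two edge slots per vertex are enough to find the edges at a vertex of degree two. -/

instance : Infinite UnitAddCircle :=
  have : Infinite (Set.Ico (0 : ℝ) (0 + 1)) := (Set.Ico_infinite (by norm_num)).to_subtype
  Infinite.of_injective _ (AddCircle.equivIco (1 : ℝ) 0).symm.injective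

/-- The points on which a homogeneous integer system vanishes in a power of the circle group. -/
def circleKer {ι κ : Type*} [Fintype κ] (B : Matrix ι κ ℤ) : AddSubgroup (κ → UnitAddCircle) where
  carrier := {y | ∀ i, ∑ j, B i j • y j = 0}
  zero_mem' := by simp
  add_mem' := by
    intro x y hx hy i
    simp [smul_add, Finset.sum_add_distrib, hx i, hy i]
  neg_mem' := by
    intro x hx i
    simp [hx i]

theorem mem_circleKer {ι κ : Type*} [Fintype κ] {B : Matrix ι κ ℤ} {y : κ → UnitAddCircle} :
    y ∈ circleKer B ↔ ∀ i, ∑ j, B i j • y j = 0 := Iff.rfl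

theorem UnitAddCircle.coe_eq_zero_iff_int (x : ℝ) :
    (x : UnitAddCircle) = 0 ↔ ∃ n : ℤ, (n : ℝ) = x := by
  rw [AddCircle.coe_eq_zero_iff]
  simp

/-- The kernel of `B` on the torus ℝⁿ/ℤⁿ is B⁻¹ℤⁿ/ℤⁿ, which `B` identifies with ℤⁿ/Bℤⁿ; the index of
the lattice Bℤⁿ is |det B|. -/
theorem card_circleKer {ι : Type*} [Fintype ι] [DecidableEq ι] (B : Matrix ι ι ℤ)
    (hB : B.det ≠ 0) : Nat.card (circleKer B) = B.det.natAbs := by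
  set Br : Matrix ι ι ℝ := B.map (Int.cast) with hBr
  have hdet : IsUnit Br.det := by
    have : Br.det = (B.det : ℝ) := (Int.cast_det B).symm
    rw [this]
    exact isUnit_iff_ne_zero.2 (by exact_mod_cast hB)
  have hinj : Function.Injective B.mulVecLin := by
    rw [← LinearMap.ker_eq_bot, LinearMap.ker_eq_bot']
    intro m hm
    exact Matrix.eq_zero_of_mulVec_eq_zero hB (by simpa using hm)
  let e := LinearEquiv.ofInjective B.mulVecLin hinj
  have h1 := Submodule.natAbs_det_equiv _ e
  have h2 : (LinearMap.range B.mulVecLin).subtype ∘ₗ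
      AddMonoidHom.toIntLinearMap (e : (ι → ℤ) →+ LinearMap.range B.mulVecLin) = B.mulVecLin := by
    ext; rfl
  rw [h2, ← Matrix.toLin'_apply', LinearMap.det_toLin'] at h1
  rw [h1]
  -- the homomorphism `z ↦ B⁻¹ z`
  have key : ∀ z : ι → ℤ, (fun i => (((Br⁻¹.mulVec (fun j => (z j : ℝ))) i : ℝ) : UnitAddCircle))
      ∈ circleKer B := by
    intro z i
    have : ∑ j, B i j • (((Br⁻¹.mulVec (fun j => (z j : ℝ))) j : ℝ) : UnitAddCircle)
        = (((Br.mulVec (Br⁻¹.mulVec (fun j => (z j : ℝ)))) i : ℝ) : UnitAddCircle) := by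
      rw [Matrix.mulVec, dotProduct]
      rw [← QuotientAddGroup.mk'_apply, map_sum]
      refine Finset.sum_congr rfl fun j _ => ?_
      rw [← QuotientAddGroup.mk'_apply, ← map_zsmul]
      simp [hBr]
    rw [this, Matrix.mulVec_mulVec, Matrix.mul_nonsing_inv _ hdet, Matrix.one_mulVec,
      UnitAddCircle.coe_eq_zero_iff_int]
    exact ⟨_, rfl⟩
  let φ : (ι → ℤ) →+ circleKer B :=
    { toFun := fun z => ⟨_, key z⟩
      map_zero' := by
        ext i
        have : (fun _ : ι => (0 : ℝ)) = 0 := rfl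
        simp [this]
      map_add' := by
        intro x y
        ext i
        have : (fun j => ((x j : ℝ) + (y j : ℝ))) = (fun j => (x j : ℝ)) + fun j => (y j : ℝ) := rfl
        simp [this, Matrix.mulVec_add] }
  have hφ : Function.Surjective φ := by
    rintro ⟨y, hy⟩
    choose x hx using fun i => QuotientAddGroup.mk_surjective (y i)
    have hz : ∀ i, ∃ n : ℤ, (n : ℝ) = (Br.mulVec x) i := by
      intro i
      rw [← UnitAddCircle.coe_eq_zero_iff_int, ← hy i]
      rw [Matrix.mulVec, dotProduct]
      rw [← QuotientAddGroup.mk'_apply, map_sum]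
      refine Finset.sum_congr rfl fun j _ => ?_
      rw [← hx j, ← QuotientAddGroup.mk'_apply, ← map_zsmul]
      simp [hBr]
    choose z hz using hz
    refine ⟨z, ?_⟩
    ext i
    have : (fun j => (z j : ℝ)) = Br.mulVec x := funext hz
    change (((Br⁻¹.mulVec (fun j => (z j : ℝ))) i : ℝ) : UnitAddCircle) = y i
    rw [this, Matrix.mulVec_mulVec, Matrix.nonsing_inv_mul _ hdet, Matrix.one_mulVec, ← hx i]
  -- B⁻¹z is integral exactly if z lies in Bℤⁿ, so the first isomorphism theorem identifies the
  -- solutions with ℤⁿ/Bℤⁿ.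
  have hker : φ.ker = (LinearMap.range B.mulVecLin).toAddSubgroup := by
    ext z
    rw [AddMonoidHom.mem_ker, Submodule.mem_toAddSubgroup, LinearMap.mem_range]
    constructor
    · intro h
      have h' : ∀ i, ∃ n : ℤ, (n : ℝ) = (Br⁻¹.mulVec (fun j => (z j : ℝ))) i := by
        intro i
        rw [← UnitAddCircle.coe_eq_zero_iff_int]
        exact congrFun (congrArg Subtype.val h) i
      choose n hn using h'
      refine ⟨n, ?_⟩
      have h3 : Br.mulVec (fun i => (n i : ℝ)) = fun j => (z j : ℝ) := by
        rw [show (fun i => (n i : ℝ)) = _ from funext hn, Matrix.mulVec_mulVec,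
          Matrix.mul_nonsing_inv _ hdet, Matrix.one_mulVec]
      ext i
      have h4 := congrFun h3 i
      simp only [Matrix.mulVec, dotProduct, hBr, Matrix.map_apply] at h4
      simp only [Matrix.mulVecLin_apply, Matrix.mulVec, dotProduct]
      exact_mod_cast h4
    · rintro ⟨n, rfl⟩
      ext i
      change (((Br⁻¹.mulVec (fun j => ((B.mulVecLin n j : ℤ) : ℝ))) i : ℝ) : UnitAddCircle) = 0
      have h3 : (fun j => ((B.mulVecLin n j : ℤ) : ℝ)) = Br.mulVec fun i => (n i : ℝ) := by
        ext j
        simp [Matrix.mulVec, dotProduct, hBr]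
      rw [h3, Matrix.mulVec_mulVec, Matrix.nonsing_inv_mul _ hdet, Matrix.one_mulVec,
        UnitAddCircle.coe_eq_zero_iff_int]
      exact ⟨_, rfl⟩
  have h5 := Nat.card_congr (QuotientAddGroup.quotientKerEquivOfSurjective φ hφ).toEquiv
  rw [← h5, hker]
  rfl

/-- The solutions, supported on the columns `R`, of the equations given by the rows `C`. -/
def minorSol {ι κ : Type*} [Fintype κ] (A : Matrix ι κ ℤ) (R : Set κ) (C : Set ι) :
    Set (κ → UnitAddCircle) :=
  {y | (∀ j ∉ R, y j = 0) ∧ ∀ i ∈ C, ∑ j, A i j • y j = 0}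

/-- Solutions supported on the chosen columns are restricted to them, and extended by zero in the
other direction. Repeated rows do no harm, so `r` need not be injective. -/
theorem card_minorSol_range {ι κ μ ν : Type*} [Fintype κ] [Fintype ν]
    (A : Matrix ι κ ℤ) (r : μ → ι) (c : ν ↪ κ) :
    Nat.card (minorSol A (Set.range c) (Set.range r)) = Nat.card (circleKer (A.submatrix r c)) := by
  classical
  have hsum : ∀ (y : κ → UnitAddCircle), (∀ j ∉ Set.range c, y j = 0) → ∀ i,
      ∑ j, A i j • y j = ∑ j, A i (c j) • y (c j) := by
    intro y hy i
    refine (Fintype.sum_of_injective c c.injective _ _ ?_ ?_).symm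
    · intro j hj
      simp [hy j hj]
    · intro j; rfl
  have hext : ∀ (y : ν → UnitAddCircle) (j), Function.extend c y 0 (c j) = y j :=
    fun y j => c.injective.extend_apply _ _ _
  have hext' : ∀ (y : ν → UnitAddCircle), ∀ j ∉ Set.range c, Function.extend c y 0 j = 0 :=
    fun y j hj => Function.extend_apply' _ _ _ (by simpa using hj)
  refine Nat.card_congr
    { toFun := fun y => ⟨fun j => y.1 (c j), ?_⟩
      invFun := fun y => ⟨Function.extend c y.1 0, hext' _, ?_⟩
      left_inv := ?_
      right_inv := ?_ }
  · intro i
    have := y.2.2 (r i) ⟨i, rfl⟩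
    rw [hsum _ y.2.1] at this
    exact this
  · rintro _ ⟨i, rfl⟩
    rw [hsum _ (hext' _)]
    simp only [hext]
    exact y.2 i
  · rintro ⟨y, hy, hy'⟩
    ext j
    by_cases hj : j ∈ Set.range c
    · obtain ⟨k, rfl⟩ := hj
      exact hext _ _
    · simp only [hext' _ j hj, hy j hj]
  · rintro ⟨y, hy⟩
    ext j
    exact hext _ _

/-- An integral kernel vector `x` can be scaled by every circle element; dividing by `x j ≠ 0` first
makes coordinate `j` run through the whole circle. -/
theorem minorSol_infinite {ι κ : Type*} [Fintype κ] (A : Matrix ι κ ℤ) (R : Set κ) (C : Set ι)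
    (x : κ → ℤ) (hx : x ≠ 0) (hR : ∀ j ∉ R, x j = 0) (hC : ∀ i ∈ C, ∑ j, A i j * x j = 0) :
    (minorSol A R C).Infinite := by
  obtain ⟨j, hj⟩ := Function.ne_iff.1 hx
  have : (minorSol A R C).SurjOn (fun y => y j) Set.univ := by
    intro u _
    obtain ⟨t, rfl⟩ := QuotientAddGroup.mk_surjective u
    refine ⟨fun i => x i • ((t / x j : ℝ) : UnitAddCircle), ⟨?_, ?_⟩, ?_⟩
    · intro i hi
      simp [hR i hi]
    · intro i hi
      simp only [smul_smul]
      rw [← Finset.sum_smul, hC i hi, zero_smul]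
    · simp only
      rw [← QuotientAddGroup.mk_zsmul]
      congr 1
      have : (x j : ℝ) ≠ 0 := by exact_mod_cast hj
      rw [zsmul_eq_mul]
      field_simp
  intro hfin
  have h1 := (hfin.image (fun y => y j)).subset this
  exact Set.infinite_univ h1

theorem minorSol_anti {ι κ : Type*} [Fintype κ] (A : Matrix ι κ ℤ) (R : Set κ) {C C' : Set ι}
    (h : C ⊆ C') : minorSol A R C' ⊆ minorSol A R C :=
  fun _ hy => ⟨hy.1, fun i hi => hy.2 i (h hi)⟩

/-- Finiteness excludes integral, hence rational, kernel vectors. So the columns in `R` are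
independent on the rows in `C`, and `R.card` independent rows can be selected there. -/
theorem exists_minor_of_minorSol_finite {ι κ : Type*} [Finite ι] [Fintype κ] (A : Matrix ι κ ℤ)
    (R : Set κ) (C : Set ι) (hfin : (minorSol A R C).Finite) :
    ∃ r : R ↪ ι, (∀ i, r i ∈ C) ∧ ∃ _ : Fintype R, ∃ _ : DecidableEq R,
      (A.submatrix r (Subtype.val : R → κ)).det ≠ 0 := by
  classical
  have : Fintype R := Fintype.ofFinite _
  have : Fintype ι := Fintype.ofFinite _
  let B : Matrix C R ℚ := Matrix.of fun i j => (A i j : ℚ)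
  have hinj : Function.Injective B.mulVec := by
    have : Function.Injective B.mulVecLin := by
      rw [← LinearMap.ker_eq_bot, LinearMap.ker_eq_bot']
      intro q hq
      by_contra hne
      -- Clearing the denominators of a rational kernel vector produces the integral one that
      -- `minorSol_infinite` needs.
      obtain ⟨⟨b, hb⟩, hbx⟩ := IsLocalization.exist_integer_multiples_of_finite
        (nonZeroDivisors ℤ) q
      choose x hx using hbx
      have hb0 : (b : ℚ) ≠ 0 := by exact_mod_cast nonZeroDivisors.ne_zero hb
      have hx' : ∀ j, (x j : ℚ) = b * q j := by
        intro j
        have := hx j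
        simpa using this
      refine minorSol_infinite A R C (fun j => if h : j ∈ R then x ⟨j, h⟩ else 0) ?_ ?_ ?_ hfin
      · intro h0
        apply hne
        ext j
        have h1 := congrFun h0 j
        simp only [Subtype.coe_prop, dif_pos, Pi.zero_apply] at h1
        have h2 := hx' j
        rw [h1] at h2
        rw [Int.cast_zero, eq_comm, mul_eq_zero] at h2
        exact h2.resolve_left hb0
      · intro j hj
        simp [hj]
      · intro i hi
        have h1 := congrFun hq ⟨i, hi⟩
        simp only [Matrix.mulVecLin_apply, Matrix.mulVec, dotProduct, Pi.zero_apply, B,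
            Matrix.of_apply] at h1
        have h2 : ((∑ j, A i j * (if h : j ∈ R then x ⟨j, h⟩ else 0) : ℤ) : ℚ) = 0 := by
          have h3 : ∑ j, A i j * (if h : j ∈ R then x ⟨j, h⟩ else 0)
              = ∑ j : R, A i j * x j := by
            refine (Fintype.sum_of_injective (Subtype.val : R → κ) Subtype.val_injective _ _
              ?_ ?_).symm
            · intro j hj
              have : j ∉ R := by simpa using hj
              simp [this]
            · intro j
              simp
          rw [h3]
          push_cast
          simp only [hx']
          rw [show ∑ j : R, (A i j : ℚ) * (b * q j) = b * ∑ j : R, (A i j : ℚ) * q j by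
            rw [Finset.mul_sum]; exact Finset.sum_congr rfl fun _ _ => by ring]
          rw [h1, mul_zero]
        exact_mod_cast h2
    exact this
  have hrank : Module.finrank ℚ (Submodule.span ℚ (Set.range B.row)) = Fintype.card R := by
    rw [← Matrix.rank_eq_finrank_span_row]
    have := LinearMap.finrank_range_of_inj (f := B.mulVecLin) hinj
    rw [Matrix.rank, this]
    simp
  obtain ⟨μ, a, ha, hspan, hli⟩ := exists_linearIndependent' ℚ B.row
  have : Finite μ := Finite.of_injective a ha
  have : Fintype μ := Fintype.ofFinite _
  have hcard : Fintype.card μ = Fintype.card R := by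
    rw [← hrank, ← hspan, finrank_span_eq_card hli]
  let f : R ≃ μ := Fintype.equivOfCardEq hcard.symm
  refine ⟨⟨fun j => (a (f j)).1, fun x y h => f.injective (ha (Subtype.ext h))⟩,
    fun j => (a (f j)).2, inferInstance, inferInstance, ?_⟩
  have hli' : LinearIndependent ℚ (Matrix.row
      (Matrix.of fun i j => (A (a (f i)).1 j : ℚ) : Matrix R R ℚ)) :=
    hli.comp f f.injective
  rw [Matrix.linearIndependent_rows_iff_isUnit, Matrix.isUnit_iff_isUnit_det] at hli'
  intro h0
  apply hli'.ne_zero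
  have : ((A.submatrix (fun j => (a (f j)).1) (Subtype.val : R → κ)).det : ℚ) = 0 := by
    exact_mod_cast h0
  rw [Int.cast_det] at this
  exact this

theorem natAbs_det_le_maxSubdet {ι κ μ : Type*} [Finite ι] [Finite κ] [Fintype μ] [DecidableEq μ]
    (A : Matrix ι κ ℤ) (r : μ ↪ ι) (c : μ ↪ κ) :
    (A.submatrix r c).det.natAbs ≤ maxSubdet A := by
  refine (isGreatest_maxSubdet A).2 ⟨Fintype.card μ, (Fintype.equivFin μ).symm.toEmbedding.trans r,
    (Fintype.equivFin μ).symm.toEmbedding.trans c, ?_⟩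
  have := Matrix.det_submatrix_equiv_self (Fintype.equivFin μ).symm (A.submatrix r c)
  rw [← this]
  rfl

/-- Keeping only the equations of a nonsingular square submatrix enlarges the solution set, and then
it has as many elements as that minor says. -/
theorem card_minorSol_le {ι κ : Type*} [Finite ι] [Fintype κ] (A : Matrix ι κ ℤ)
    (R : Set κ) (C : Set ι) : Nat.card (minorSol A R C) ≤ maxSubdet A := by
  by_cases hfin : (minorSol A R C).Finite
  · obtain ⟨r, hr, _, _, hdet⟩ := exists_minor_of_minorSol_finite A R C hfin
    have h1 := card_minorSol_range A r (Function.Embedding.subtype (· ∈ R))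
    have h2 := card_circleKer _ hdet
    have h3 : (minorSol A R (Set.range r)).Finite := by
      refine Set.finite_coe_iff.1 (Nat.finite_of_card_ne_zero ?_)
      have h4 : Set.range (Function.Embedding.subtype (· ∈ R)) = R := Subtype.range_coe
      rw [h4] at h1
      rw [h1]
      exact h2.trans_ne (Int.natAbs_ne_zero.2 hdet)
    calc Nat.card (minorSol A R C) ≤ Nat.card (minorSol A R (Set.range r)) :=
          Nat.card_mono h3 (minorSol_anti A R (by rintro _ ⟨i, rfl⟩; exact hr i))
      _ = _ := by
          have h4 : Set.range (Function.Embedding.subtype (· ∈ R)) = R := Subtype.range_coe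
          rw [h4] at h1
          exact h1.trans h2
      _ ≤ _ := natAbs_det_le_maxSubdet A r (Function.Embedding.subtype (· ∈ R))
  -- `Nat.card` of an infinite type is zero, so here the bound is trivial.
  · have : Infinite (minorSol A R C) := Set.infinite_coe_iff.2 hfin
    simp

theorem one_le_maxSubdet {ι κ : Type*} [Finite ι] [Finite κ] (A : Matrix ι κ ℤ) :
    1 ≤ maxSubdet A :=
  (isGreatest_maxSubdet A).2
    ⟨0, Function.Embedding.ofIsEmpty, Function.Embedding.ofIsEmpty, by simp⟩

/-- A maximal minor is nonzero, since the empty minor is already 1; hence it counts solutions. -/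
theorem exists_card_minorSol_eq {ι κ : Type*} [Finite ι] [Fintype κ] (A : Matrix ι κ ℤ) :
    ∃ R C, Nat.card (minorSol A R C) = maxSubdet A := by
  obtain ⟨k, r, c, h⟩ := (isGreatest_maxSubdet A).1
  refine ⟨Set.range c, Set.range r, ?_⟩
  rw [card_minorSol_range, card_circleKer, ← h]
  intro h0
  have := one_le_maxSubdet A
  rw [h, h0] at this
  simp at this

/-! ### Paths and the relations that they impose on their ends -/

/-- The circle-valued sequences `z 0, …, z (k + 1)` along a path with `k` inner vertices
(continued by zeros) for which inner vertex `t + 1` carries the value zero if `¬ r t`, and the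
equation of its closed neighbourhood holds if `c t`. -/
def pathSol (k : ℕ) (r c : ℕ → Prop) : AddSubgroup (ℕ → UnitAddCircle) where
  carrier := {z | (∀ t < k, (¬ r t → z (t + 1) = 0) ∧ (c t → z t + z (t + 1) + z (t + 2) = 0)) ∧
    ∀ t, k + 1 < t → z t = 0}
  zero_mem' := by simp
  add_mem' := by
    rintro x y ⟨hx, hx'⟩ ⟨hy, hy'⟩
    refine ⟨fun t ht => ⟨fun h => ?_, fun h => ?_⟩, fun t ht => ?_⟩
    · simp [(hx t ht).1 h, (hy t ht).1 h]
    · have := congrArg₂ (· + ·) ((hx t ht).2 h) ((hy t ht).2 h)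
      simp only [add_zero] at this
      rw [← this]
      simp only [Pi.add_apply]
      abel
    · simp [hx' t ht, hy' t ht]
  neg_mem' := by
    rintro x ⟨hx, hx'⟩
    refine ⟨fun t ht => ⟨fun h => ?_, fun h => ?_⟩, fun t ht => ?_⟩
    · simp [(hx t ht).1 h]
    · have := congrArg (- ·) ((hx t ht).2 h)
      simp only [neg_zero] at this
      rw [← this]
      simp only [Pi.neg_apply]
      abel
    · simp [hx' t ht]

theorem mem_pathSol {k : ℕ} {r c : ℕ → Prop} {z : ℕ → UnitAddCircle} :
    z ∈ pathSol k r c ↔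
      (∀ t < k, (¬ r t → z (t + 1) = 0) ∧ (c t → z t + z (t + 1) + z (t + 2) = 0)) ∧
      ∀ t, k + 1 < t → z t = 0 := Iff.rfl

/-- A path solution is determined by its two first and its two last values. -/
def PathRigid (k : ℕ) (r c : ℕ → Prop) : Prop :=
  ∀ z ∈ pathSol k r c, z 0 = 0 → z 1 = 0 → z k = 0 → z (k + 1) = 0 → z = 0

/-- The type of relations between the two first and the two last values of a path. -/
abbrev EndRel := UnitAddCircle → UnitAddCircle → UnitAddCircle → UnitAddCircle → Prop

/-- The relation between the two first and the two last values of the solutions along a path. -/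
def pathRel (k : ℕ) (r c : ℕ → Prop) : EndRel :=
  fun p s t q => ∃ z ∈ pathSol k r c, z 0 = p ∧ z 1 = s ∧ z k = t ∧ z (k + 1) = q

/-- The relations of the rigid paths with `k` inner vertices. -/
def pathTypes (k : ℕ) : Set EndRel := {ρ | ∃ r c, PathRigid k r c ∧ ρ = pathRel k r c}

/-- A sum of consecutive values vanishes exactly if two partial sums agree. Applying an arbitrary
function to the partial sums of `z` preserves all such agreements, in particular all conditions of
`pathSol`. -/
theorem exists_family_of_ne_zero {k : ℕ} {r c : ℕ → Prop} {z : ℕ → UnitAddCircle}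
    (hz : z ∈ pathSol k r c) (h0 : z ≠ 0) :
    ∃ F : UnitAddCircle → ℕ → UnitAddCircle, Function.Injective F ∧ ∀ u, F u ∈ pathSol k r c ∧
      ∀ a b, a ≤ b → b ≤ k + 2 → ∑ i ∈ Finset.Ico a b, z i = 0 →
        ∑ i ∈ Finset.Ico a b, F u i = 0 := by
  classical
  set x : ℕ → UnitAddCircle := fun j => ∑ i ∈ Finset.range j, z i with hx
  have hxz : ∀ j, x (j + 1) - x j = z j := by
    intro j
    simp [hx, Finset.sum_range_succ]
  obtain ⟨j, hjk, hj⟩ : ∃ j ≤ k + 2, x j ≠ 0 := by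
    by_contra! hcon
    apply h0
    ext t
    by_cases ht : t ≤ k + 1
    · rw [← hxz, hcon _ (by omega), hcon _ (by omega), sub_zero]; rfl
    · exact hz.2 t (by omega)
  -- The value at the partial sum `x j ≠ 0` is replaced by the parameter `u`, all other values by
  -- zero. Since `x 0 = 0` is different from `x j`, the parameter can be recovered as a block sum.
  let φ : UnitAddCircle → UnitAddCircle → UnitAddCircle := fun u t => if t = x j then u else 0
  let F : UnitAddCircle → ℕ → UnitAddCircle := fun u t =>
    if t ≤ k + 1 then φ u (x (t + 1)) - φ u (x t) else 0
  have hsum : ∀ u a b, a ≤ b → b ≤ k + 2 →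
      ∑ i ∈ Finset.Ico a b, F u i = φ u (x b) - φ u (x a) := by
    intro u a b hab hb
    rw [← Finset.sum_Ico_sub (fun t => φ u (x t)) hab]
    refine Finset.sum_congr rfl fun i hi => ?_
    rw [Finset.mem_Ico] at hi
    simp only [F, if_pos (show i ≤ k + 1 by omega)]
  have hsum' : ∀ a b, a ≤ b → ∑ i ∈ Finset.Ico a b, z i = x b - x a := by
    intro a b hab
    rw [← Finset.sum_Ico_sub _ hab]
    exact Finset.sum_congr rfl fun i hi => (hxz i).symm
  have htrans : ∀ u a b, a ≤ b → b ≤ k + 2 → ∑ i ∈ Finset.Ico a b, z i = 0 →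
        ∑ i ∈ Finset.Ico a b, F u i = 0 := by
    intro u a b hab hb h
    rw [hsum' a b hab, sub_eq_zero] at h
    rw [hsum u a b hab hb, h, sub_self]
  refine ⟨F, ?_, fun u => ⟨⟨fun t ht => ⟨fun h => ?_, fun h => ?_⟩, ?_⟩, htrans u⟩⟩
  · intro u v huv
    have h1 := hsum u 0 j (by omega) hjk
    have h2 := hsum v 0 j (by omega) hjk
    rw [huv, h2] at h1
    have hx0 : x 0 = 0 := by simp [hx]
    simpa [φ, hx0, Ne.symm hj] using h1.symm
  · have := htrans u (t + 1) (t + 2) (by omega) (by omega)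
    simp only [show Finset.Ico (t + 1) (t + 2) = {t + 1} from Nat.Ico_succ_singleton (t + 1),
      Finset.sum_singleton] at this
    exact this ((hz.1 t ht).1 h)
  · have := htrans u t (t + 3) (by omega) (by omega)
    simp only [Finset.sum_Ico_succ_top (show t ≤ t + 2 by omega),
      Finset.sum_Ico_succ_top (show t ≤ t + 1 by omega),
      Finset.sum_Ico_succ_top (le_refl t), Finset.Ico_self, Finset.sum_empty, zero_add] at this
    exact this ((hz.1 t ht).2 h)
  · intro t ht
    simp only [F, if_neg (show ¬ t ≤ k + 1 by omega)]

/-- The relation between the differences of the values of a function on six points that is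
constant on the classes of a given equivalence relation. -/
def setoidRel (σ : Setoid (Fin 6)) : EndRel := fun p s t q =>
  ∃ X : Fin 6 → UnitAddCircle, (∀ i j, σ i j → X i = X j) ∧
    X 1 - X 0 = p ∧ X 2 - X 1 = s ∧ X 4 - X 3 = t ∧ X 5 - X 4 = q

/-- In terms of potentials, the solutions are the functions that are constant on the classes of the
equivalence relation generated by the conditions. The four end values are differences of the
potentials at `0, 1, 2, k, k + 1, k + 2`, so only the relation induced on these six positions
matters. For small `k` some of the six coincide; pulling the relation back along `node` takes care
of this. -/
theorem exists_setoidRel_eq (k : ℕ) (r c : ℕ → Prop) :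
    ∃ σ, pathRel k r c = setoidRel σ := by
  classical
  let S : ℕ → ℕ → Prop := fun a b =>
    ∃ t < k, (¬ r t ∧ a = t + 1 ∧ b = t + 2) ∨ (c t ∧ a = t ∧ b = t + 3)
  let g : Setoid ℕ := Relation.EqvGen.setoid S
  let node : Fin 6 → ℕ := ![0, 1, 2, k, k + 1, k + 2]
  have hnode : ∀ x : ℕ → UnitAddCircle, (∀ a b, S a b → x a = x b) →
      ∀ a b, g a b → x a = x b := by
    intro x hx a b hab
    induction hab with
    | rel a b h => exact hx a b h
    | refl a => rfl
    | symm a b _ ih => exact ih.symm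
    | trans a b c _ _ ih ih' => exact ih.trans ih'
  refine ⟨g.comap node, ?_⟩
  funext p s t q
  refine propext ⟨?_, ?_⟩
  · rintro ⟨z, hz, rfl, rfl, rfl, rfl⟩
    set x : ℕ → UnitAddCircle := fun j => ∑ i ∈ Finset.range j, z i with hx
    have hxz : ∀ j, x (j + 1) - x j = z j := by
      intro j
      simp [hx, Finset.sum_range_succ]
    refine ⟨fun i => x (node i), fun i j hij => hnode x ?_ _ _ hij, hxz 0, hxz 1, hxz k,
      hxz (k + 1)⟩
    rintro a b ⟨t, ht, ⟨h, rfl, rfl⟩ | ⟨h, rfl, rfl⟩⟩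
    · have := hxz (t + 1)
      rw [(hz.1 t ht).1 h, sub_eq_zero] at this
      exact this.symm
    · have := (hz.1 a ht).2 h
      rw [← hxz, ← hxz, ← hxz] at this
      rw [← sub_eq_zero, ← neg_eq_zero, ← this]
      abel
  · rintro ⟨X, hX, rfl, rfl, rfl, rfl⟩
    -- Potentials are prescribed on the classes that meet one of the six nodes; all other classes
    -- are free and get zero.
    let x : ℕ → UnitAddCircle := fun n => if h : ∃ i, g n (node i) then X h.choose else 0
    have hxg : ∀ a b, g a b → x a = x b := by
      intro a b hab
      by_cases h : ∃ i, g a (node i)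
      · have h' : ∃ i, g b (node i) := ⟨h.choose, g.trans (g.symm hab) h.choose_spec⟩
        simp only [x, dif_pos h, dif_pos h']
        apply hX
        change g _ _
        exact g.trans (g.symm h.choose_spec) (g.trans hab h'.choose_spec)
      · have h' : ¬ ∃ i, g b (node i) := fun ⟨i, hi⟩ => h ⟨i, g.trans hab hi⟩
        simp only [x, dif_neg h, dif_neg h']
    have hxn : ∀ i, x (node i) = X i := by
      intro i
      have h : ∃ j, g (node i) (node j) := ⟨i, g.refl _⟩
      simp only [x, dif_pos h]
      apply hX
      exact g.symm h.choose_spec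
    have hS : ∀ a b, S a b → x a = x b := fun a b h => hxg a b (Relation.EqvGen.rel _ _ h)
    have e0 := hxn 0; have e1 := hxn 1; have e2 := hxn 2
    have e3 := hxn 3; have e4 := hxn 4; have e5 := hxn 5
    simp only [node] at e0 e1 e2 e3 e4 e5
    refine ⟨fun t => if t ≤ k + 1 then x (t + 1) - x t else 0,
      ⟨fun t ht => ⟨fun h => ?_, fun h => ?_⟩,
      ?_⟩, ?_, ?_, ?_, ?_⟩
    · simp only [if_pos (show t + 1 ≤ k + 1 by omega)]
      rw [hS (t + 1) (t + 1 + 1) ⟨t, ht, Or.inl ⟨h, rfl, rfl⟩⟩, sub_self]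
    · simp only [if_pos (show t + 1 ≤ k + 1 by omega), if_pos (show t + 2 ≤ k + 1 by omega),
        if_pos (show t ≤ k + 1 by omega)]
      have := hS t (t + 3) ⟨t, ht, Or.inr ⟨h, rfl, rfl⟩⟩
      rw [show t + 2 + 1 = t + 3 from rfl, ← this]
      abel
    · intro t ht
      simp only [if_neg (show ¬ t ≤ k + 1 by omega)]
    · simp only [if_pos (Nat.zero_le _)]
      rw [← e0, ← e1]; rfl
    · simp only [if_pos (show 1 ≤ k + 1 by omega)]
      rw [← e1, ← e2]; rfl
    · simp only [if_pos (show k ≤ k + 1 by omega)]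
      rw [← e3, ← e4]; rfl
    · simp only [if_pos (le_refl _)]
      rw [← e4, ← e5]; rfl

/-! ### Finiteness and eventual periodicity of the path types -/

theorem finite_range_setoidRel : (Set.range setoidRel).Finite := by
  have : Finite (Setoid (Fin 6)) :=
    Finite.of_injective (fun σ : Setoid (Fin 6) => (fun i j => σ i j : Fin 6 → Fin 6 → Prop))
      (fun σ τ h => Setoid.ext fun a b => iff_of_eq (congrFun (congrFun h a) b))
  exact Set.finite_range _

theorem pathTypes_subset_range (k : ℕ) : pathTypes k ⊆ Set.range setoidRel := by
  rintro _ ⟨r, c, -, rfl⟩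
  obtain ⟨σ, h⟩ := exists_setoidRel_eq k r c
  exact ⟨σ, h.symm⟩

/-- Append three inner vertices with free values and active equations. The equations make the
sequence periodic with period three there, so positions `k + 3`, `k + 4` repeat the values at `k`,
`k + 1`, and the end relation as well as rigidity are unchanged. -/
theorem pathTypes_subset_add_three (k : ℕ) : pathTypes k ⊆ pathTypes (k + 3) := by
  rintro _ ⟨r, c, hrig, rfl⟩
  let r' : ℕ → Prop := fun t => t < k → r t
  let c' : ℕ → Prop := fun t => t < k → c t
  have htrunc : ∀ z ∈ pathSol (k + 3) r' c',
      (fun t => if t ≤ k + 1 then z t else 0) ∈ pathSol k r c ∧ z (k + 3) = z k ∧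
        z (k + 4) = z (k + 1) ∧ z (k + 2) = - (z k + z (k + 1)) := by
    intro z hz
    refine ⟨⟨fun t ht => ⟨fun h => ?_, fun h => ?_⟩, fun t ht => ?_⟩, ?_⟩
    · simp only [if_pos (show t + 1 ≤ k + 1 by omega)]
      exact (hz.1 t (by omega)).1 (fun h' => h (h' ht))
    · simp only [if_pos (show t + 1 ≤ k + 1 by omega), if_pos (show t + 2 ≤ k + 1 by omega),
        if_pos (show t ≤ k + 1 by omega)]
      exact (hz.1 t (by omega)).2 (fun _ => h)
    · simp only [if_neg (show ¬ t ≤ k + 1 by omega)]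
    · have h1 := (hz.1 k (by omega)).2 (fun h => absurd h (by omega))
      have h2 := (hz.1 (k + 1) (by omega)).2 (fun h => absurd h (by omega))
      have h3 := (hz.1 (k + 2) (by omega)).2 (fun h => absurd h (by omega))
      have e2 : z (k + 2) = - (z k + z (k + 1)) := eq_neg_of_add_eq_zero_right h1
      have e3 : z (k + 3) = - (z (k + 1) + z (k + 2)) := eq_neg_of_add_eq_zero_right h2
      have e4 : z (k + 4) = - (z (k + 2) + z (k + 3)) := eq_neg_of_add_eq_zero_right h3
      refine ⟨?_, ?_, e2⟩
      · rw [e3, e2]; abel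
      · rw [e4, e3, e2]; abel
  refine ⟨r', c', ?_, ?_⟩
  · intro z hz h0 h1 hk hk1
    obtain ⟨ht, e3, e4, e2⟩ := htrunc z hz
    have hk' : z k = 0 := by rw [← e3]; exact hk
    have hk1' : z (k + 1) = 0 := by rw [← e4]; exact hk1
    have := hrig _ ht (by simpa using h0) (by simpa using h1) (by simpa using hk')
      (by simpa using hk1')
    ext t
    rcases le_or_gt t (k + 1) with h | h
    · simpa [h] using congrFun this t
    · rcases (show t = k + 2 ∨ t = k + 3 ∨ t = k + 4 ∨ k + 3 + 1 < t by omega) with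
        rfl | rfl | rfl | h'
      · rw [e2, hk', hk1']; simp
      · exact hk
      · exact hk1
      · exact hz.2 t h'
  · funext p s t q
    refine propext ⟨?_, ?_⟩
    · rintro ⟨z, hz, rfl, rfl, rfl, rfl⟩
      let z' : ℕ → UnitAddCircle := fun t => if t ≤ k + 1 then z t else if t = k + 2 then
        - (z k + z (k + 1)) else if t = k + 3 then z k else if t = k + 4 then z (k + 1) else 0
      have hz' : ∀ t ≤ k + 1, z' t = z t := fun t ht => by simp only [z', if_pos ht]
      have e2 : z' (k + 2) = - (z k + z (k + 1)) := by simp [z']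
      have e3 : z' (k + 3) = z k := by simp [z']
      have e4 : z' (k + 4) = z (k + 1) := by simp [z']
      refine ⟨z', ⟨fun t ht => ⟨fun h => ?_, fun h => ?_⟩, fun t ht => ?_⟩, ?_, ?_, e3, e4⟩
      · have htk : t < k := by
          by_contra h'
          exact h (fun h'' => absurd h'' h')
        rw [hz' _ (by omega)]
        exact (hz.1 t htk).1 (fun h' => h (fun _ => h'))
      · rcases (show t < k ∨ t = k ∨ t = k + 1 ∨ t = k + 2 by omega) with h' | rfl | rfl | rfl
        · rw [hz' _ (by omega), hz' _ (by omega), hz' _ (by omega)]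
          exact (hz.1 t h').2 (h h')
        · rw [hz' _ (by omega), hz' _ (by omega), e2]; abel
        · rw [hz' _ (by omega), e2, e3]; abel
        · rw [e2, e3, e4]; abel
      · have h1 : ¬ t ≤ k + 1 := by omega
        have h2 : t ≠ k + 2 := by omega
        have h3 : t ≠ k + 3 := by omega
        have h4 : t ≠ k + 4 := by omega
        simp only [z', if_neg h1, if_neg h2, if_neg h3, if_neg h4]
      · exact hz' 0 (by omega)
      · exact hz' 1 (by omega)
    · rintro ⟨z, hz, rfl, rfl, rfl, rfl⟩
      obtain ⟨ht, e3, e4, e2⟩ := htrunc z hz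
      exact ⟨_, ht, by simp, by simp, by simp [e3], by simpa using e4.symm⟩

/-- In each residue class modulo three the types form an increasing chain of subsets of a finite
set, which becomes stationary. -/
theorem exists_pathTypes_periodic : ∃ q, ∀ k, q ≤ k → pathTypes k = pathTypes (k + 3) := by
  have hfin : Finite (Set.range setoidRel) := finite_range_setoidRel.to_subtype
  have key : ∀ i : ℕ, ∃ n, ∀ m, n ≤ m → pathTypes (3 * m + i) = pathTypes (3 * n + i) := by
    intro i
    let f : ℕ →o Set (Set.range setoidRel) :=
      ⟨fun n => {ρ | ρ.1 ∈ pathTypes (3 * n + i)}, monotone_nat_of_le_succ fun n ρ hρ => by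
        have := pathTypes_subset_add_three _ hρ
        rw [show 3 * n + i + 3 = 3 * (n + 1) + i by ring] at this
        exact this⟩
    obtain ⟨n, hn⟩ := WellFoundedGT.monotone_chain_condition f
    refine ⟨n, fun m hm => ?_⟩
    have h := hn m hm
    ext ρ
    constructor
    · intro hρ
      have : (⟨ρ, pathTypes_subset_range _ hρ⟩ : Set.range setoidRel) ∈ f m := hρ
      rw [← h] at this
      exact this
    · intro hρ
      have : (⟨ρ, pathTypes_subset_range _ hρ⟩ : Set.range setoidRel) ∈ f n := hρ
      rw [h] at this
      exact this
  choose n hn using key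
  -- A common threshold beyond which each of the three chains is stationary, whatever the residue of
  -- `k`.
  refine ⟨3 * (n 0 + n 1 + n 2) + 3, fun k hk => ?_⟩
  obtain ⟨m, i, hi, rfl⟩ : ∃ m i, i < 3 ∧ k = 3 * m + i :=
    ⟨k / 3, k % 3, Nat.mod_lt _ (by norm_num), (Nat.div_add_mod k 3).symm⟩
  have hni : n i ≤ m := by interval_cases i <;> omega
  rw [hn i m hni, show 3 * m + i + 3 = 3 * (m + 1) + i by ring, hn i (m + 1) (by omega)]

/-! ### Graphs with edges subdivided into paths -/

/-- A finite multigraph on the natural numbers with edges `e ∈ L` from `a e` to `b e`, where the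
edge `e` stands for a path with `len e` inner vertices. -/
structure PathGraph where
  /-- the edges -/
  L : Finset ℕ
  /-- first endpoint -/
  a : ℕ → ℕ
  /-- second endpoint -/
  b : ℕ → ℕ
  /-- number of inner vertices -/
  len : ℕ → ℕ

namespace PathGraph

/-- The sum at the vertex `v` of the values at the ends of edges. -/
def endSum (W : PathGraph) (d d' : ℕ → UnitAddCircle) (v : ℕ) : UnitAddCircle :=
  ∑ e ∈ W.L, ((if W.a e = v then d e else 0) + (if W.b e = v then d' e else 0))

/-- The vertex `v` is an endpoint of an edge. -/
def Touched (W : PathGraph) (v : ℕ) : Prop := ∃ e ∈ W.L, W.a e = v ∨ W.b e = v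

/-- Circle-valued functions on the vertices and on the ends of the edges that satisfy the given
relations along the edges, vanish at the vertices without `r`, and satisfy the equation of the
closed neighbourhood at the vertices with `c`. -/
def sol (W : PathGraph) (r c : ℕ → Prop) (ρ : ℕ → EndRel) :
    Set ((ℕ → UnitAddCircle) × (ℕ → UnitAddCircle) × (ℕ → UnitAddCircle)) :=
  {x | (∀ e ∈ W.L, ρ e (x.1 (W.a e)) (x.2.1 e) (x.2.2 e) (x.1 (W.b e))) ∧
    (∀ e ∉ W.L, x.2.1 e = 0 ∧ x.2.2 e = 0) ∧ (∀ v, ¬ r v → x.1 v = 0) ∧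
    ∀ v, c v → x.1 v + W.endSum x.2.1 x.2.2 v = 0}

/-- The finite numbers of solutions of the systems on `W`. -/
def counts (W : PathGraph) : Set ℕ :=
  {n | 0 < n ∧ ∃ r c ρ, (∀ v, r v → W.Touched v) ∧ (∀ e ∈ W.L, ρ e ∈ pathTypes (W.len e)) ∧
    n = Nat.card (W.sol r c ρ)}

theorem endSum_congr {W W' : PathGraph} {d d' : ℕ → UnitAddCircle} {v : ℕ} (hL : W.L = W'.L)
    (ha : ∀ e ∈ W.L, W.a e = W'.a e) (hb : ∀ e ∈ W.L, W.b e = W'.b e) :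
    W.endSum d d' v = W'.endSum d d' v := by
  unfold endSum
  rw [← hL]
  exact Finset.sum_congr rfl fun e he => by rw [ha e he, hb e he]

theorem sol_congr {W W' : PathGraph} {r c : ℕ → Prop} {ρ : ℕ → EndRel} (hL : W.L = W'.L)
    (ha : ∀ e ∈ W.L, W.a e = W'.a e) (hb : ∀ e ∈ W.L, W.b e = W'.b e) :
    W.sol r c ρ = W'.sol r c ρ := by
  ext x
  unfold sol
  simp only [Set.mem_ofPred_eq, endSum_congr hL ha hb, hL]
  refine and_congr_left fun _ => forall₂_congr fun e he => ?_
  rw [← hL] at he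
  rw [ha e he, hb e he]

theorem counts_subset_of_congr {W W' : PathGraph} (hL : W.L = W'.L)
    (ha : ∀ e ∈ W.L, W.a e = W'.a e) (hb : ∀ e ∈ W.L, W.b e = W'.b e)
    (hT : ∀ e ∈ W.L, pathTypes (W.len e) = pathTypes (W'.len e)) : W.counts ⊆ W'.counts := by
  rintro n ⟨hn, r, c, ρ, hr, hρ, rfl⟩
  refine ⟨hn, r, c, ρ, fun v hv => ?_, fun e he => ?_, by rw [sol_congr hL ha hb]⟩
  · obtain ⟨e, he, h⟩ := hr v hv
    exact ⟨e, hL ▸ he, by rwa [← ha e he, ← hb e he]⟩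
  · rw [← hL] at he
    rw [← hT e he]
    exact hρ e he

/-- A length enters only through its set of path types. This is what allows long paths to be
shortened by multiples of three. -/
theorem counts_congr {W W' : PathGraph} (hL : W.L = W'.L)
    (ha : ∀ e ∈ W.L, W.a e = W'.a e) (hb : ∀ e ∈ W.L, W.b e = W'.b e)
    (hT : ∀ e ∈ W.L, pathTypes (W.len e) = pathTypes (W'.len e)) : W.counts = W'.counts := by
  refine (counts_subset_of_congr hL ha hb hT).antisymm (counts_subset_of_congr hL.symm ?_ ?_ ?_)
  all_goals rw [← hL]
  exacts [fun e he => (ha e he).symm, fun e he => (hb e he).symm, fun e he => (hT e he).symm]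

end PathGraph

/-! #### Reversing a path -/

theorem rev_mem_pathSol {k : ℕ} {r c : ℕ → Prop} {z : ℕ → UnitAddCircle} (hz : z ∈ pathSol k r c) :
    (fun t => if t ≤ k + 1 then z (k + 1 - t) else 0) ∈
      pathSol k (fun t => r (k - 1 - t)) (fun t => c (k - 1 - t)) := by
  refine ⟨fun t ht => ⟨fun h => ?_, fun h => ?_⟩, fun t ht => ?_⟩
  · simp only [if_pos (show t + 1 ≤ k + 1 by omega)]
    have := (hz.1 (k - 1 - t) (by omega)).1 h
    rwa [show k - 1 - t + 1 = k + 1 - (t + 1) by omega] at this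
  · simp only [if_pos (show t + 1 ≤ k + 1 by omega), if_pos (show t ≤ k + 1 by omega),
      if_pos (show t + 2 ≤ k + 1 by omega)]
    have := (hz.1 (k - 1 - t) (by omega)).2 h
    rw [show k - 1 - t + 1 = k + 1 - (t + 1) by omega, show k - 1 - t = k + 1 - (t + 2) by omega,
      show k + 1 - (t + 2) + 2 = k + 1 - t by omega] at this
    rw [← this]
    abel
  · simp only [if_neg (show ¬ t ≤ k + 1 by omega)]

theorem pathRel_rev {k : ℕ} {r c : ℕ → Prop} {p s t q : UnitAddCircle}
    (h : pathRel k r c p s t q) :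
    pathRel k (fun t => r (k - 1 - t)) (fun t => c (k - 1 - t)) q t s p := by
  obtain ⟨z, hz, rfl, rfl, rfl, rfl⟩ := h
  exact ⟨_, rev_mem_pathSol hz, by simp, by simp, by simp, by simp⟩

theorem pathSol_congr {k : ℕ} {r c r' c' : ℕ → Prop} (hr : ∀ t < k, (r t ↔ r' t))
    (hc : ∀ t < k, (c t ↔ c' t)) : pathSol k r c = pathSol k r' c' := by
  ext z
  simp only [mem_pathSol]
  refine and_congr_left fun _ => forall₂_congr fun t ht => ?_
  rw [hr t ht, hc t ht]

theorem pathTypes_rev {k : ℕ} {ρ : EndRel} (h : ρ ∈ pathTypes k) :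
    (fun p s t q => ρ q t s p) ∈ pathTypes k := by
  obtain ⟨r, c, hrig, rfl⟩ := h
  have hrr : pathSol k (fun t => r (k - 1 - (k - 1 - t))) (fun t => c (k - 1 - (k - 1 - t))) =
      pathSol k r c :=
    pathSol_congr (fun t ht => by rw [show k - 1 - (k - 1 - t) = t by omega])
      (fun t ht => by rw [show k - 1 - (k - 1 - t) = t by omega])
  refine ⟨fun t => r (k - 1 - t), fun t => c (k - 1 - t), ?_, ?_⟩
  · intro z hz h0 h1 hk hk1
    have h2 := rev_mem_pathSol hz
    rw [hrr] at h2
    have := hrig _ h2 (by simpa using hk1) (by simpa using hk) (by simpa using h1)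
      (by simpa using h0)
    ext t
    rcases le_or_gt t (k + 1) with h | h
    · have h3 := congrFun this (k + 1 - t)
      simpa [show k + 1 - (k + 1 - t) = t by omega] using h3
    · exact hz.2 t h
  · funext p s t q
    refine propext ⟨pathRel_rev, fun h => ?_⟩
    have h1 := pathRel_rev h
    unfold pathRel at h1 ⊢
    rwa [hrr] at h1

namespace PathGraph

/-- The edge `i` is reversed. -/
def flip (W : PathGraph) (i : ℕ) : PathGraph where
  L := W.L
  a := Function.update W.a i (W.b i)
  b := Function.update W.b i (W.a i)
  len := W.len

theorem endSum_flip (W : PathGraph) (i : ℕ) (d d' : ℕ → UnitAddCircle) (v : ℕ) :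
    (W.flip i).endSum (Function.update d i (d' i)) (Function.update d' i (d i)) v
      = W.endSum d d' v := by
  unfold endSum flip
  refine Finset.sum_congr rfl fun e _ => ?_
  by_cases h : e = i
  · subst h
    simp [add_comm]
  · simp [Function.update_of_ne h]

theorem counts_subset_flip (W : PathGraph) (i : ℕ) : W.counts ⊆ (W.flip i).counts := by
  classical
  rintro n ⟨hn, r, c, ρ, hr, hρ, rfl⟩
  refine ⟨hn, r, c, Function.update ρ i (fun p s t q => ρ i q t s p), fun v hv => ?_,
    fun e he => ?_, ?_⟩
  · obtain ⟨e, he, h⟩ := hr v hv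
    refine ⟨e, he, ?_⟩
    by_cases hei : e = i
    · subst hei
      simpa [flip, or_comm] using h
    · simpa [flip, Function.update_of_ne hei] using h
  · by_cases hei : e = i
    · subst hei
      simpa [flip] using pathTypes_rev (hρ e he)
    · simpa [flip, Function.update_of_ne hei] using hρ e he
  · let f : (ℕ → UnitAddCircle) × (ℕ → UnitAddCircle) × (ℕ → UnitAddCircle) →
        (ℕ → UnitAddCircle) × (ℕ → UnitAddCircle) × (ℕ → UnitAddCircle) := fun x =>
      (x.1, Function.update x.2.1 i (x.2.2 i), Function.update x.2.2 i (x.2.1 i))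
    have hf : Function.Involutive f := by
      rintro ⟨y, d, d'⟩
      simp [f]
    have hmem : ∀ x, f x ∈ (W.flip i).sol r c (Function.update ρ i (fun p s t q => ρ i q t s p)) ↔
        x ∈ W.sol r c ρ := by
      rintro ⟨y, d, d'⟩
      unfold sol
      simp only [Set.mem_ofPred_eq, f, endSum_flip]
      refine and_congr (forall₂_congr fun e he => ?_) (and_congr_left fun _ =>
        forall₂_congr fun e he => ?_)
      · by_cases hei : e = i
        · subst hei
          simp [flip]
        · simp [flip, Function.update_of_ne hei]
      · by_cases hei : e = i
        · subst hei
          simp [and_comm]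
        · simp [Function.update_of_ne hei]
    refine Nat.card_congr (Equiv.subtypeEquiv hf.toPerm fun x => ?_)
    exact (hmem x).symm

/-- Orientations are bookkeeping: path types are closed under reversal, and the two end values of
the edge are exchanged. -/
theorem counts_flip (W : PathGraph) (i : ℕ) : (W.flip i).counts = W.counts := by
  refine Set.Subset.antisymm ?_ (W.counts_subset_flip i)
  have h := (W.flip i).counts_subset_flip i
  have h' : (W.flip i).flip i = W := by
    unfold flip
    simp
  rwa [h'] at h

end PathGraph

/-! #### Concatenating paths -/

/-- Blocks of length one and two are singled out because these are the conditions at the end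
vertices of a path: a forced zero, and an equation involving the end and its only neighbour. -/
theorem exists_family_of_ne_zero' {k : ℕ} {r c : ℕ → Prop} {z : ℕ → UnitAddCircle}
    (hz : z ∈ pathSol k r c) (h0 : z ≠ 0) :
    ∃ F : UnitAddCircle → ℕ → UnitAddCircle, Function.Injective F ∧ ∀ u, F u ∈ pathSol k r c ∧
      (∀ t ≤ k + 1, z t = 0 → F u t = 0) ∧
      ∀ t ≤ k, z t + z (t + 1) = 0 → F u t + F u (t + 1) = 0 := by
  obtain ⟨F, hF, h⟩ := exists_family_of_ne_zero hz h0
  refine ⟨F, hF, fun u => ⟨(h u).1, fun t ht h1 => ?_, fun t ht h1 => ?_⟩⟩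
  · have := (h u).2 t (t + 1) (by omega) (by omega)
    simpa [h1] using this
  · have := (h u).2 t (t + 2) (by omega) (by omega)
    simp only [Finset.sum_Ico_succ_top (show t ≤ t + 1 by omega),
      Finset.sum_Ico_succ_top (le_refl t), Finset.Ico_self, Finset.sum_empty, zero_add] at this
    exact this h1

theorem trunc_mem_pathSol {k k' : ℕ} {r c : ℕ → Prop} {z : ℕ → UnitAddCircle}
    (hk : k ≤ k') (hz : z ∈ pathSol k' r c) :
    (fun t => if t ≤ k + 1 then z t else 0) ∈ pathSol k r c := by
  refine ⟨fun t ht => ⟨fun h => ?_, fun h => ?_⟩, fun t ht => ?_⟩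
  · simp only [if_pos (show t + 1 ≤ k + 1 by omega)]
    exact (hz.1 t (by omega)).1 h
  · simp only [if_pos (show t + 1 ≤ k + 1 by omega), if_pos (show t + 2 ≤ k + 1 by omega),
      if_pos (show t ≤ k + 1 by omega)]
    exact (hz.1 t (by omega)).2 h
  · simp only [if_neg (show ¬ t ≤ k + 1 by omega)]

theorem shift_mem_pathSol {k l : ℕ} {r c : ℕ → Prop} {z : ℕ → UnitAddCircle}
    (hz : z ∈ pathSol (k + l + 1) r c) :
    (fun t => z (k + 1 + t)) ∈ pathSol l (fun t => r (k + 1 + t)) (fun t => c (k + 1 + t)) :=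
  ⟨fun t ht => hz.1 (k + 1 + t) (by omega), fun t ht => hz.2 (k + 1 + t) (by omega)⟩

/-- The two paths overlap in the middle vertex, at position `k + 1` of the first and position `0` of
the second. It is the inner vertex with index `k`, and `hr` and `hc` are its conditions. -/
theorem glue_mem_pathSol {k l : ℕ} {r c : ℕ → Prop} {z w : ℕ → UnitAddCircle}
    (hz : z ∈ pathSol k r c)
    (hw : w ∈ pathSol l (fun t => r (k + 1 + t)) (fun t => c (k + 1 + t)))
    (hzw : z (k + 1) = w 0) (hr : ¬ r k → w 0 = 0) (hc : c k → z k + w 0 + w 1 = 0) :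
    (fun t => if t ≤ k + 1 then z t else w (t - (k + 1))) ∈ pathSol (k + l + 1) r c := by
  have hz' : ∀ t ≤ k + 1, (fun t => if t ≤ k + 1 then z t else w (t - (k + 1))) t = z t :=
    fun t ht => by simp only [if_pos ht]
  have hw' : ∀ t, (fun t => if t ≤ k + 1 then z t else w (t - (k + 1))) (k + 1 + t) = w t := by
    intro t
    rcases Nat.eq_zero_or_pos t with rfl | h
    · simpa using hzw
    · simp only [if_neg (show ¬ k + 1 + t ≤ k + 1 by omega)]
      rw [show k + 1 + t - (k + 1) = t by omega]
  refine ⟨fun t ht => ?_, fun t ht => ?_⟩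
  · rcases lt_trichotomy t k with h | rfl | h
    · rw [hz' _ (by omega), hz' _ (by omega), hz' _ (by omega)]
      exact hz.1 t h
    · rw [hz' _ (by omega), hz' _ (by omega), hzw, hw' 1]
      exact ⟨hr, hc⟩
    · obtain ⟨m, rfl⟩ := Nat.exists_eq_add_of_lt h
      rw [show k + m + 1 + 1 = k + 1 + (m + 1) by ring,
        show k + m + 1 + 2 = k + 1 + (m + 2) by ring,
        show k + m + 1 = k + 1 + m by ring, hw', hw', hw']
      exact hw.1 m (by omega)
  · simp only [if_neg (show ¬ t ≤ k + 1 by omega)]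
    exact hw.2 _ (by omega)

/-- `m`, `x`, `n` are the values around the middle vertex for two relations in series. -/
def IsMid (ρ σ : EndRel) (r c : Prop) (p s t q m x n : UnitAddCircle) : Prop :=
  ρ p s m x ∧ σ x n t q ∧ (¬ r → x = 0) ∧ (c → m + x + n = 0)

/-- Two relations in series, with a middle vertex. -/
def compRel (ρ σ : EndRel) (r c : Prop) : EndRel := fun p s t q =>
  ∃ m x n, IsMid ρ σ r c p s t q m x n

/-- The values around the middle vertex are determined by those at the ends. -/
def CompUnique (ρ σ : EndRel) (r c : Prop) : Prop := ∀ p s t q m x n m' x' n',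
  IsMid ρ σ r c p s t q m x n → IsMid ρ σ r c p s t q m' x' n' → m = m' ∧ x = x' ∧ n = n'

/-- Cut the path at the inner vertex with index `k`, or glue two pieces there. -/
theorem pathRel_concat (k l : ℕ) (r c : ℕ → Prop) :
    pathRel (k + l + 1) r c = compRel (pathRel k r c)
      (pathRel l (fun t => r (k + 1 + t)) (fun t => c (k + 1 + t))) (r k) (c k) := by
  funext p s t q
  refine propext ⟨?_, ?_⟩
  · rintro ⟨z, hz, rfl, rfl, rfl, rfl⟩
    refine ⟨z k, z (k + 1), z (k + 2), ⟨_, trunc_mem_pathSol (by omega) hz, ?_⟩,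
      ⟨_, shift_mem_pathSol hz, ?_⟩, (hz.1 k (by omega)).1, (hz.1 k (by omega)).2⟩
    · simp
    · refine ⟨rfl, rfl, ?_, ?_⟩
      · simp only [show k + 1 + l = k + l + 1 by ring]
      · simp only [show k + 1 + (l + 1) = k + l + 1 + 1 by ring]
  · rintro ⟨m, x, n, ⟨z, hz, rfl, rfl, rfl, h1⟩, ⟨w, hw, rfl, rfl, rfl, rfl⟩, hr, hc⟩
    refine ⟨_, glue_mem_pathSol hz hw h1 hr hc, ?_⟩
    refine ⟨by simp, by simp, ?_, ?_⟩
    -- For `l = 0` the last but one position is the middle vertex itself, which the glued sequence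
    -- takes from the first piece.
    · rcases Nat.eq_zero_or_pos l with rfl | h
      · simpa using h1
      · simp only [if_neg (show ¬ k + l + 1 ≤ k + 1 by omega),
          show k + l + 1 - (k + 1) = l by omega]
    · simp only [if_neg (show ¬ k + l + 1 + 1 ≤ k + 1 by omega),
        show k + l + 1 + 1 - (k + 1) = l + 1 by omega]

theorem eq_of_pathRigid {k : ℕ} {r c : ℕ → Prop} (h : PathRigid k r c) {z w : ℕ → UnitAddCircle}
    (hz : z ∈ pathSol k r c) (hw : w ∈ pathSol k r c) (h0 : z 0 = w 0) (h1 : z 1 = w 1)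
    (hk : z k = w k) (hk1 : z (k + 1) = w (k + 1)) : z = w := by
  rw [← sub_eq_zero]
  exact h _ (sub_mem hz hw) (by simp [h0]) (by simp [h1]) (by simp [hk]) (by simp [hk1])

/-- A solution on the left piece that vanishes at all four end positions extends by zero to the
whole path. -/
theorem PathRigid.left {k l : ℕ} {r c : ℕ → Prop} (h : PathRigid (k + l + 1) r c) :
    PathRigid k r c := by
  intro z hz h0 h1 hk hk1
  have h2 := h _ (glue_mem_pathSol (w := 0) hz (zero_mem _) (by simpa using hk1) (fun _ => rfl)
    (fun _ => by simp [hk])) (by simp [h0]) (by simp [h1])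
    (by
      rcases Nat.eq_zero_or_pos l with rfl | h
      · simp [hk1]
      · simp [show ¬ k + l ≤ k by omega])
    (by simp [show ¬ k + l + 1 ≤ k by omega])
  ext t
  rcases le_or_gt t (k + 1) with ht | ht
  · simpa [ht] using congrFun h2 t
  · exact hz.2 t ht

theorem PathRigid.right {k l : ℕ} {r c : ℕ → Prop} (h : PathRigid (k + l + 1) r c) :
    PathRigid l (fun t => r (k + 1 + t)) (fun t => c (k + 1 + t)) := by
  intro z hz h0 h1 hk hk1
  have h2 := h _ (glue_mem_pathSol (z := 0) (zero_mem _) hz h0.symm (fun _ => h0)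
    (fun _ => by simp [h0, h1])) (by simp) (by simp)
    (by
      rcases Nat.eq_zero_or_pos l with rfl | h
      · simp
      · simp only [if_neg (show ¬ k + l + 1 ≤ k + 1 by omega),
          show k + l + 1 - (k + 1) = l by omega, hk])
    (by
      simp only [if_neg (show ¬ k + l + 1 + 1 ≤ k + 1 by omega),
        show k + l + 1 + 1 - (k + 1) = l + 1 by omega, hk1])
  ext t
  rcases Nat.eq_zero_or_pos t with rfl | ht
  · exact h0
  · have := congrFun h2 (k + 1 + t)
    simpa [show ¬ k + 1 + t ≤ k + 1 by omega, show t ≠ 0 by omega] using this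

/-- Two choices of middle values glue to two solutions on the whole path with the same end values,
which rigidity identifies. -/
theorem PathRigid.compUnique {k l : ℕ} {r c : ℕ → Prop} (h : PathRigid (k + l + 1) r c) :
    CompUnique (pathRel k r c) (pathRel l (fun t => r (k + 1 + t)) (fun t => c (k + 1 + t)))
      (r k) (c k) := by
  rintro p s t q m x n m' x' n' ⟨⟨z, hz, rfl, rfl, rfl, h1⟩, ⟨w, hw, rfl, rfl, rfl, rfl⟩, hr, hc⟩
    ⟨⟨z', hz', e0, e1, rfl, h1'⟩, ⟨w', hw', rfl, rfl, e2, e3⟩, hr', hc'⟩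
  have hzw := eq_of_pathRigid h (glue_mem_pathSol hz hw h1 hr hc)
    (glue_mem_pathSol hz' hw' h1' hr' hc') (by simp [e0]) (by simp [e1])
    (by
      rcases Nat.eq_zero_or_pos l with rfl | h
      · simpa [h1, h1'] using e2.symm
      · simp only [if_neg (show ¬ k + l + 1 ≤ k + 1 by omega),
          show k + l + 1 - (k + 1) = l by omega, e2])
    (by
      simp only [if_neg (show ¬ k + l + 1 + 1 ≤ k + 1 by omega),
        show k + l + 1 + 1 - (k + 1) = l + 1 by omega, e3])
  have a1 := congrFun hzw k
  have a2 := congrFun hzw (k + 1)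
  have a3 := congrFun hzw (k + 2)
  simp only [if_pos (show k ≤ k + 1 by omega), if_pos (le_refl (k + 1)),
    if_neg (show ¬ k + 2 ≤ k + 1 by omega), show k + 2 - (k + 1) = 1 by omega] at a1 a2 a3
  exact ⟨a1, by rw [← h1, ← h1', a2], a3⟩

/-- Without rigidity there is a nonzero solution with vanishing ends, and hence a whole family. As
both pieces are rigid, a member of the family is determined by its three middle values, so these
already form an infinite family. -/
theorem exists_mid_family {k l : ℕ} {r c : ℕ → Prop} (hk : PathRigid k r c)
    (hl : PathRigid l (fun t => r (k + 1 + t)) (fun t => c (k + 1 + t)))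
    (h : ¬ PathRigid (k + l + 1) r c) :
    ∃ F : UnitAddCircle → UnitAddCircle × UnitAddCircle × UnitAddCircle, Function.Injective F ∧
      ∀ u, IsMid (pathRel k r c) (pathRel l (fun t => r (k + 1 + t)) (fun t => c (k + 1 + t)))
        (r k) (c k) 0 0 0 0 (F u).1 (F u).2.1 (F u).2.2 := by
  unfold PathRigid at h
  push Not at h
  obtain ⟨z, hz, h0, h1, h2, h3, hne⟩ := h
  obtain ⟨F, hF, hFz⟩ := exists_family_of_ne_zero' hz hne
  have hF0 := fun u => (hFz u).2.1 0 (by omega) h0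
  have hF1 := fun u => (hFz u).2.1 1 (by omega) h1
  have hF2 := fun u => (hFz u).2.1 (k + l + 1) (by omega) h2
  have hF3 := fun u => (hFz u).2.1 (k + l + 1 + 1) (by omega) h3
  refine ⟨fun u => (F u k, F u (k + 1), F u (k + 2)), ?_, fun u => ?_⟩
  · intro u v huv
    simp only [Prod.mk.injEq] at huv
    apply hF
    have e1 := eq_of_pathRigid hk (trunc_mem_pathSol (by omega) (hFz u).1)
      (trunc_mem_pathSol (by omega) (hFz v).1) (by simp [hF0]) (by simp [hF1])
      (by simp [huv.1]) (by simp [huv.2.1])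
    have e2 := eq_of_pathRigid hl (shift_mem_pathSol (hFz u).1) (shift_mem_pathSol (hFz v).1)
      huv.2.1 huv.2.2 (by simp only [show k + 1 + l = k + l + 1 by ring, hF2])
      (by simp only [show k + 1 + (l + 1) = k + l + 1 + 1 by ring, hF3])
    ext t
    rcases le_or_gt t (k + 1) with ht | ht
    · simpa [ht] using congrFun e1 t
    · obtain ⟨j, rfl⟩ := Nat.exists_eq_add_of_le ht.le
      exact congrFun e2 j
  · have hu := (hFz u).1
    refine ⟨⟨_, trunc_mem_pathSol (by omega) hu, ?_⟩,
      ⟨_, shift_mem_pathSol hu, ?_⟩, (hu.1 k (by omega)).1, (hu.1 k (by omega)).2⟩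
    · simp [hF0, hF1]
    · refine ⟨rfl, rfl, ?_, ?_⟩
      · simp only [show k + 1 + l = k + l + 1 by ring, hF2]
      · simp only [show k + 1 + (l + 1) = k + l + 1 + 1 by ring, hF3]

theorem zero_of_mem_pathTypes {k : ℕ} {ρ : EndRel} (h : ρ ∈ pathTypes k) : ρ 0 0 0 0 := by
  obtain ⟨r, c, -, rfl⟩ := h
  exact ⟨0, zero_mem _, rfl, rfl, rfl, rfl⟩

/-- Two paths in series either form a path, or have infinitely many inner solutions. -/
theorem compRel_mem_pathTypes {k l : ℕ} {ρ σ : EndRel} (hρ : ρ ∈ pathTypes k)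
    (hσ : σ ∈ pathTypes l) (r c : Prop) :
    (compRel ρ σ r c ∈ pathTypes (k + l + 1) ∧ CompUnique ρ σ r c) ∨
    ∃ F : UnitAddCircle → UnitAddCircle × UnitAddCircle × UnitAddCircle, Function.Injective F ∧
      ∀ u, IsMid ρ σ r c 0 0 0 0 (F u).1 (F u).2.1 (F u).2.2 := by
  obtain ⟨r₁, c₁, h₁, rfl⟩ := hρ
  obtain ⟨r₂, c₂, h₂, rfl⟩ := hσ
  let R : ℕ → Prop := fun t => if t < k then r₁ t else if t = k then r else r₂ (t - (k + 1))
  let C : ℕ → Prop := fun t => if t < k then c₁ t else if t = k then c else c₂ (t - (k + 1))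
  have e1 : pathSol k r₁ c₁ = pathSol k R C :=
    pathSol_congr (fun t ht => by simp [R, ht]) (fun t ht => by simp [C, ht])
  have hsub : ∀ t, k + 1 + t - (k + 1) = t := fun t => by omega
  have e2 : pathSol l r₂ c₂ = pathSol l (fun t => R (k + 1 + t)) (fun t => C (k + 1 + t)) :=
    pathSol_congr
      (fun t _ => by
        simp only [R, if_neg (show ¬ k + 1 + t < k by omega),
          if_neg (show k + 1 + t ≠ k by omega), hsub])
      (fun t _ => by
        simp only [C, if_neg (show ¬ k + 1 + t < k by omega),
          if_neg (show k + 1 + t ≠ k by omega), hsub])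
  have hR : R k = r := by simp [R]
  have hC : C k = c := by simp [C]
  unfold PathRigid at h₁ h₂
  unfold pathRel
  rw [e1] at h₁ ⊢
  rw [e2] at h₂ ⊢
  by_cases h : PathRigid (k + l + 1) R C
  · left
    rw [← hR, ← hC]
    exact ⟨⟨R, C, h, (pathRel_concat k l R C).symm⟩, h.compUnique⟩
  · right
    rw [← hR, ← hC]
    exact exists_mid_family h₁ h₂ h

/-- The converse of `compRel_mem_pathTypes`: every type of the long path splits, so contraction
creates no new solution numbers. -/
theorem exists_compRel_of_mem_pathTypes {k l : ℕ} {ρ : EndRel} (hρ : ρ ∈ pathTypes (k + l + 1)) :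
    ∃ σ ∈ pathTypes k, ∃ τ ∈ pathTypes l, ∃ r c, ρ = compRel σ τ r c ∧ CompUnique σ τ r c := by
  obtain ⟨r, c, h, rfl⟩ := hρ
  exact ⟨_, ⟨r, c, h.left, rfl⟩, _, ⟨_, _, h.right, rfl⟩, r k, c k, pathRel_concat k l r c,
    h.compUnique⟩

/-! #### Contracting a vertex of degree two -/

namespace PathGraph

/-- The edge `j` is appended to the edge `i`. -/
def merge (W : PathGraph) (i j : ℕ) : PathGraph where
  L := W.L.erase j
  a := W.a
  b := Function.update W.b i (W.b j)
  len := Function.update W.len i (W.len i + W.len j + 1)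

/-- The edge `i` ends and the edge `j` begins at the vertex `v`, at which no other end of an
edge lies. -/
structure IsJoint (W : PathGraph) (i j v : ℕ) : Prop where
  hi : i ∈ W.L
  hj : j ∈ W.L
  hij : i ≠ j
  hbi : W.b i = v
  haj : W.a j = v
  hai : W.a i ≠ v
  hbj : W.b j ≠ v
  other : ∀ e ∈ W.L, e ≠ i → e ≠ j → W.a e ≠ v ∧ W.b e ≠ v

variable {W : PathGraph} {i j v : ℕ}

theorem IsJoint.sum_eq (h : W.IsJoint i j v) (f : ℕ → UnitAddCircle) :
    ∑ e ∈ W.L, f e = f i + (f j + ∑ e ∈ (W.L.erase i).erase j, f e) := by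
  rw [Finset.add_sum_erase _ _ (Finset.mem_erase.2 ⟨h.hij.symm, h.hj⟩),
    Finset.add_sum_erase _ _ h.hi]

theorem IsJoint.endSum_self (h : W.IsJoint i j v) (d d' : ℕ → UnitAddCircle) :
    W.endSum d d' v = d' i + d j := by
  unfold endSum
  rw [h.sum_eq, Finset.sum_eq_zero]
  · simp [h.hbi, h.haj, h.hai, h.hbj]
  · intro e he
    simp only [Finset.mem_erase] at he
    have := h.other e he.2.2 he.2.1 he.1
    simp [this.1, this.2]

theorem IsJoint.endSum_merge (h : W.IsJoint i j v) (d d' : ℕ → UnitAddCircle) {u : ℕ}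
    (hu : u ≠ v) : (W.merge i j).endSum d (Function.update d' i (d' j)) u = W.endSum d d' u := by
  have hmem : i ∈ W.L.erase j := Finset.mem_erase.2 ⟨h.hij, h.hi⟩
  unfold endSum
  rw [h.sum_eq]
  simp only [merge]
  rw [← Finset.add_sum_erase _ _ hmem, Finset.erase_right_comm]
  simp only [Function.update_self, h.hbi, h.haj, Ne.symm hu, if_false, add_zero, zero_add]
  rw [add_assoc]
  congr 2
  refine Finset.sum_congr rfl fun e he => ?_
  simp only [Finset.mem_erase] at he
  simp only [Function.update_of_ne he.2.1]
  congr

theorem IsJoint.endSum_merge_self (h : W.IsJoint i j v) (d d' : ℕ → UnitAddCircle) :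
    (W.merge i j).endSum d d' v = 0 := by
  unfold endSum
  refine Finset.sum_eq_zero fun e he => ?_
  simp only [merge, Finset.mem_erase] at he ⊢
  by_cases hei : e = i
  · subst hei
    simp [h.hai, h.hbj]
  · have := h.other e he.2 hei he.1
    simp [this.1, this.2, Function.update_of_ne hei]

theorem endSum_congr' {d d' δ δ' : ℕ → UnitAddCircle} {u : ℕ} (hd : ∀ e ∈ W.L, d e = δ e)
    (hd' : ∀ e ∈ W.L, d' e = δ' e) : W.endSum d d' u = W.endSum δ δ' u :=
  Finset.sum_congr rfl fun e he => by rw [hd e he, hd' e he]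

/-- Forgetting the three values around `v` is a bijection: the composed relation provides the middle
values, and `huniq` says that there is only one choice. The equation at `v` may stay in `c`, since
`v` carries zero and no edge of the merged graph ends there. -/
theorem IsJoint.card_sol_merge (h : W.IsJoint i j v) {r c : ℕ → Prop} {ρ : ℕ → EndRel}
    (huniq : CompUnique (ρ i) (ρ j) (r v) (c v)) :
    Nat.card (W.sol r c ρ) = Nat.card ((W.merge i j).sol (fun u => r u ∧ u ≠ v) c
      (Function.update ρ i (compRel (ρ i) (ρ j) (r v) (c v)))) := by
  classical
  have hij := h.hij
  have hv : ∀ e ∈ W.L, e ≠ i → e ≠ j → W.a e ≠ v ∧ W.b e ≠ v := h.other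
  -- The merged edge keeps the name `i` and its first end value, and inherits the second end value
  -- of `j`; what belonged to `v` and `j` is set to zero, as required off the edge set.
  let f : (ℕ → UnitAddCircle) × (ℕ → UnitAddCircle) × (ℕ → UnitAddCircle) →
      (ℕ → UnitAddCircle) × (ℕ → UnitAddCircle) × (ℕ → UnitAddCircle) := fun x =>
    (Function.update x.1 v 0, Function.update x.2.1 j 0,
      Function.update (Function.update x.2.2 i (x.2.2 j)) j 0)
  have hmid : ∀ x ∈ W.sol r c ρ, IsMid (ρ i) (ρ j) (r v) (c v) (x.1 (W.a i)) (x.2.1 i) (x.2.2 j)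
      (x.1 (W.b j)) (x.2.2 i) (x.1 v) (x.2.1 j) := by
    rintro x ⟨h1, h2, h3, h4⟩
    have hi := h1 i h.hi
    have hj := h1 j h.hj
    rw [h.hbi] at hi
    rw [h.haj] at hj
    refine ⟨hi, hj, h3 v, fun hc => ?_⟩
    have := h4 v hc
    rw [h.endSum_self] at this
    rw [← this]
    abel
  have hmaps : ∀ x ∈ W.sol r c ρ, f x ∈ (W.merge i j).sol (fun u => r u ∧ u ≠ v) c
      (Function.update ρ i (compRel (ρ i) (ρ j) (r v) (c v))) := by
    intro x hx
    have hx' := hx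
    obtain ⟨h1, h2, h3, h4⟩ := hx'
    refine ⟨fun e he => ?_, fun e he => ?_, fun u hu => ?_, fun u hu => ?_⟩
    · simp only [merge, Finset.mem_erase] at he ⊢
      by_cases hei : e = i
      · subst hei
        simp only [f, Function.update_self, Function.update_of_ne h.hai,
          Function.update_of_ne h.hbj, Function.update_of_ne he.1]
        exact ⟨_, _, _, hmid x hx⟩
      · have hve := hv e he.2 hei he.1
        simp only [f, Function.update_of_ne hei, Function.update_of_ne hve.1,
          Function.update_of_ne hve.2, Function.update_of_ne he.1]
        exact h1 e he.2
    · simp only [merge, Finset.mem_erase, not_and_or, not_not] at he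
      by_cases hej : e = j
      · simp [f, hej]
      · have he' := he.resolve_left hej
        have hei : e ≠ i := fun h' => he' (h' ▸ h.hi)
        simpa [f, Function.update_of_ne hej, Function.update_of_ne hei] using h2 e he'
    · by_cases huv : u = v
      · simp [f, huv]
      · simp only [f, Function.update_of_ne huv]
        exact h3 u fun h' => hu ⟨h', huv⟩
    · by_cases huv : u = v
      · subst huv
        simp [f, h.endSum_merge_self]
      · simp only [f, Function.update_of_ne huv]
        rw [← h4 u hu, ← h.endSum_merge _ _ huv]
        congr 1
        refine endSum_congr' (fun e he => ?_) (fun e he => ?_)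
        · exact Function.update_of_ne (Finset.ne_of_mem_erase he) _ _
        · exact Function.update_of_ne (Finset.ne_of_mem_erase he) _ _
  refine Nat.card_congr (Equiv.ofBijective (fun x => (⟨f x.1, hmaps x.1 x.2⟩ :
    (W.merge i j).sol _ _ _)) ⟨?_, ?_⟩)
  · rintro ⟨⟨y, d, d'⟩, hx⟩ ⟨⟨y₁, d₁, d₁'⟩, hx₁⟩ hf
    have hf' : f (y, d, d') = f (y₁, d₁, d₁') := congrArg Subtype.val hf
    simp only [f, Prod.mk.injEq] at hf'
    obtain ⟨hy, hd, hd'⟩ := hf'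
    have hy' : ∀ u ≠ v, y u = y₁ u := fun u hu => by
      simpa [Function.update_of_ne hu] using congrFun hy u
    have hd1 : ∀ e ≠ j, d e = d₁ e := fun e he => by
      simpa [Function.update_of_ne he] using congrFun hd e
    have hd2 : ∀ e ≠ j, e ≠ i → d' e = d₁' e := fun e he hei => by
      simpa [Function.update_of_ne he, Function.update_of_ne hei] using congrFun hd' e
    have hd3 : d' j = d₁' j := by
      simpa [Function.update_of_ne hij] using congrFun hd' i
    have m1 := hmid _ hx
    have m2 := hmid _ hx₁
    simp only at m1 m2
    rw [hy' _ h.hai, hy' _ h.hbj, hd1 i hij, hd3] at m1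
    obtain ⟨g1, g2, g3⟩ := huniq _ _ _ _ _ _ _ _ _ _ m1 m2
    ext e
    · by_cases he : e = v
      · subst he; exact g2
      · exact hy' e he
    · by_cases he : e = j
      · subst he; exact g3
      · exact hd1 e he
    · by_cases he : e = j
      · subst he; exact hd3
      · by_cases hei : e = i
        · subst hei; exact g1
        · exact hd2 e he hei
  · rintro ⟨⟨y, d, d'⟩, hx⟩
    obtain ⟨h1, h2, h3, h4⟩ := id hx
    simp only at h1 h2 h3 h4
    have hi' : i ∈ (W.merge i j).L := Finset.mem_erase.2 ⟨hij, h.hi⟩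
    have hj' : j ∉ (W.merge i j).L := Finset.notMem_erase _ _
    have hyv : y v = 0 := h3 v fun h' => h'.2 rfl
    have hij' : j ≠ i := hij.symm
    have hcomp := h1 i hi'
    simp only [Function.update_self, merge] at hcomp
    obtain ⟨m, x, n, hρi, hρj, hr, hc⟩ := hcomp
    have hw : (Function.update y v x, Function.update d j n,
        Function.update (Function.update d' j (d' i)) i m) ∈ W.sol r c ρ := by
      refine ⟨fun e he => ?_, fun e he => ?_, fun u hu => ?_, fun u hu => ?_⟩
      · by_cases hei : e = i
        · subst hei
          simp only [h.hbi, Function.update_self, Function.update_of_ne h.hai,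
            Function.update_of_ne hij]
          exact hρi
        · by_cases hej : e = j
          · subst hej
            simp only [h.haj, Function.update_self, Function.update_of_ne h.hbj,
              Function.update_of_ne hij']
            exact hρj
          · have hve := hv e he hei hej
            simp only [Function.update_of_ne hei, Function.update_of_ne hve.1,
              Function.update_of_ne hve.2, Function.update_of_ne hej]
            have := h1 e (Finset.mem_erase.2 ⟨hej, he⟩)
            simpa [merge, Function.update_of_ne hei] using this
      · have hei : e ≠ i := fun h' => he (h' ▸ h.hi)
        have hej : e ≠ j := fun h' => he (h' ▸ h.hj)
        simp only [Function.update_of_ne hei, Function.update_of_ne hej]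
        exact h2 e fun h' => he (Finset.mem_of_mem_erase h')
      · by_cases huv : u = v
        · subst huv
          simpa using hr hu
        · simp only [Function.update_of_ne huv]
          exact h3 u fun h' => hu h'.1
      · by_cases huv : u = v
        · subst huv
          rw [h.endSum_self]
          simp only [Function.update_self]
          rw [← hc hu]
          abel
        · simp only [Function.update_of_ne huv]
          rw [← h4 u hu, ← h.endSum_merge _ _ huv]
          congr 1
          refine endSum_congr' (fun e he => ?_) (fun e he => ?_)
          · exact Function.update_of_ne (Finset.ne_of_mem_erase he) _ _
          · have hej : e ≠ j := Finset.ne_of_mem_erase he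
            by_cases hei : e = i
            · subst hei
              simp [Function.update_of_ne hij']
            · simp [Function.update_of_ne hei, Function.update_of_ne hej]
    refine ⟨⟨_, hw⟩, Subtype.ext ?_⟩
    simp only [f, Prod.mk.injEq]
    refine ⟨?_, ?_, ?_⟩
    · rw [Function.update_idem, Function.update_eq_self_iff, hyv]
    · rw [Function.update_idem, Function.update_eq_self_iff, (h2 j hj').1]
    · ext e
      by_cases hej : e = j
      · subst hej
        simp [(h2 e hj').2]
      · by_cases hei : e = i
        · subst hei
          simp [Function.update_of_ne hij, Function.update_of_ne hij']
        · simp [Function.update_of_ne hei, Function.update_of_ne hej]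

/-- Types of the merged edge split into types of the two pieces. Conversely, two types in series
either compose to a type, or have infinitely many solutions around `v`, and then the system
contributes nothing to `counts`. -/
theorem IsJoint.counts_merge (h : W.IsJoint i j v) : (W.merge i j).counts = W.counts := by
  classical
  have hij := h.hij
  have hi' : i ∈ (W.merge i j).L := Finset.mem_erase.2 ⟨hij, h.hi⟩
  apply Set.Subset.antisymm
  · rintro n ⟨hn, r, c, ρ, hr, hρ, rfl⟩
    have hρi := hρ i hi'
    simp only [merge, Function.update_self] at hρi
    obtain ⟨σ, hσ, τ, hτ, r₀, c₀, hcomp, huniq⟩ := exists_compRel_of_mem_pathTypes hρi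
    -- No edge of the merged graph touches `v`, so its value was forced to zero there; this leaves
    -- room to reinstall the conditions `r₀` and `c₀`.
    have hrv : ¬ r v := by
      intro hv
      obtain ⟨e, he, hev⟩ := hr v hv
      simp only [merge, Finset.mem_erase] at he hev
      by_cases hei : e = i
      · subst hei
        simp [h.hai, h.hbj] at hev
      · have := h.other e he.2 hei he.1
        simp [this.1, this.2, Function.update_of_ne hei] at hev
    let r' := fun u => if u = v then r₀ else r u
    let c' := fun u => if u = v then c₀ else c u
    let ρ' := Function.update (Function.update ρ i σ) j τ
    have e1 : ρ' i = σ := by simp [ρ', Function.update_of_ne hij]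
    have e2 : ρ' j = τ := by simp [ρ']
    have e3 : r' v = r₀ := by simp [r']
    have e4 : c' v = c₀ := by simp [c']
    refine ⟨hn, r', c', ρ', ?_, ?_, ?_⟩
    · intro u hu
      by_cases huv : u = v
      · subst huv
        exact ⟨i, h.hi, Or.inr h.hbi⟩
      · simp only [r', if_neg huv] at hu
        obtain ⟨e, he, hev⟩ := hr u hu
        simp only [merge, Finset.mem_erase] at he hev
        by_cases hei : e = i
        · subst hei
          simp only [Function.update_self] at hev
          rcases hev with hev | hev
          · exact ⟨e, h.hi, Or.inl hev⟩
          · exact ⟨j, h.hj, Or.inr hev⟩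
        · rw [Function.update_of_ne hei] at hev
          exact ⟨e, he.2, hev⟩
    · intro e he
      by_cases hej : e = j
      · subst hej; rw [e2]; exact hτ
      · by_cases hei : e = i
        · subst hei; rw [e1]; exact hσ
        · have := hρ e (Finset.mem_erase.2 ⟨hej, he⟩)
          simpa [ρ', merge, Function.update_of_ne hei, Function.update_of_ne hej] using this
    · rw [h.card_sol_merge (by rw [e1, e2, e3, e4]; exact huniq), e1, e2, e3, e4, ← hcomp]
      congr 2
      ext x
      unfold sol
      have hrr : (∀ u, ¬ r u → x.1 u = 0) ↔ ∀ u, ¬ (r' u ∧ u ≠ v) → x.1 u = 0 := by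
        refine forall_congr' fun u => ?_
        by_cases huv : u = v
        · subst huv
          simp [hrv]
        · simp [r', huv]
      refine and_congr (forall₂_congr fun e he => ?_) (and_congr_right fun _ =>
        (and_congr_left' hrr).trans (and_congr_right fun h3 => forall_congr' fun u => ?_))
      · by_cases hei : e = i
        · subst hei
          simp
        · have hej : e ≠ j := Finset.ne_of_mem_erase he
          simp [ρ', Function.update_of_ne hei, Function.update_of_ne hej]
      · by_cases huv : u = v
        · subst huv
          rw [h.endSum_merge_self, add_zero, h3 u (by simp)]
          simp
        · simp [c', huv]
  · rintro n ⟨hn, r, c, ρ, hr, hρ, rfl⟩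
    rcases compRel_mem_pathTypes (hρ i h.hi) (hρ j h.hj) (r v) (c v) with
      ⟨hmem, huniq⟩ | ⟨F, hF, hFm⟩
    · refine ⟨hn, _, c, _, ?_, ?_, h.card_sol_merge huniq⟩
      · rintro u ⟨hu, huv⟩
        obtain ⟨e, he, hev⟩ := hr u hu
        by_cases hej : e = j
        · subst hej
          refine ⟨i, hi', Or.inr ?_⟩
          have : W.a e ≠ u := by rw [h.haj]; exact huv.symm
          simpa [merge] using hev.resolve_left this
        · by_cases hei : e = i
          · subst hei
            have : W.b e ≠ u := by rw [h.hbi]; exact huv.symm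
            exact ⟨e, hi', Or.inl (hev.resolve_right this)⟩
          · exact ⟨e, Finset.mem_erase.2 ⟨hej, he⟩, by
              simpa [merge, Function.update_of_ne hei] using hev⟩
      · intro e he
        simp only [merge, Finset.mem_erase] at he ⊢
        by_cases hei : e = i
        · subst hei
          simpa using hmem
        · simpa [Function.update_of_ne hei] using hρ e he.2
    -- The infinite family of middle values, extended by zero, consists of solutions on all of `W`;
    -- but the count is positive, hence finite.
    · exfalso
      let g : UnitAddCircle →
          (ℕ → UnitAddCircle) × (ℕ → UnitAddCircle) × (ℕ → UnitAddCircle) := fun u =>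
        (Pi.single v (F u).2.1, Pi.single j (F u).2.2, Pi.single i (F u).1)
      have hg : ∀ u, g u ∈ W.sol r c ρ := by
        intro u
        obtain ⟨m1, m2, m3, m4⟩ := hFm u
        refine ⟨fun e he => ?_, fun e he => ?_, fun w hw => ?_, fun w hw => ?_⟩
        · by_cases hei : e = i
          · subst hei
            simp only [g, h.hbi, Pi.single_eq_same, Pi.single_eq_of_ne h.hai,
              Pi.single_eq_of_ne hij]
            exact m1
          · by_cases hej : e = j
            · subst hej
              simp only [g, h.haj, Pi.single_eq_same, Pi.single_eq_of_ne h.hbj,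
                Pi.single_eq_of_ne hij.symm]
              exact m2
            · have hve := h.other e he hei hej
              simp only [g, Pi.single_eq_of_ne hei, Pi.single_eq_of_ne hej,
                Pi.single_eq_of_ne hve.1, Pi.single_eq_of_ne hve.2]
              exact zero_of_mem_pathTypes (hρ e he)
        · have hei : e ≠ i := fun h' => he (h' ▸ h.hi)
          have hej : e ≠ j := fun h' => he (h' ▸ h.hj)
          simp [g, Pi.single_eq_of_ne hei, Pi.single_eq_of_ne hej]
        · by_cases hwv : w = v
          · subst hwv
            simpa [g] using m3 hw
          · simp [g, Pi.single_eq_of_ne hwv]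
        · by_cases hwv : w = v
          · subst hwv
            rw [h.endSum_self]
            simp only [g, Pi.single_eq_same]
            rw [← m4 hw]
            abel
          · simp only [g, Pi.single_eq_of_ne hwv, zero_add]
            refine Finset.sum_eq_zero fun e he => ?_
            by_cases hei : e = i
            · subst hei
              simp [h.hbi, Ne.symm hwv, Pi.single_eq_of_ne hij]
            · by_cases hej : e = j
              · subst hej
                simp [h.haj, Ne.symm hwv, Pi.single_eq_of_ne hij.symm]
              · simp [Pi.single_eq_of_ne hei, Pi.single_eq_of_ne hej]
      have : Infinite (W.sol r c ρ) := by
        refine Infinite.of_injective (fun u => (⟨g u, hg u⟩ : W.sol r c ρ)) fun u w huw => ?_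
        have h1 : g u = g w := congrArg Subtype.val huw
        simp only [g, Prod.mk.injEq, Pi.single_inj] at h1
        exact hF (Prod.ext h1.2.2 (Prod.ext h1.1 h1.2.1))
      simp at hn

end PathGraph

/-! #### Components that consist of a single edge -/

namespace PathGraph

/-- The edge `e` is deleted. -/
def delEdge (W : PathGraph) (e : ℕ) : PathGraph := { W with L := W.L.erase e }

/-- Only the edge `e` is kept. -/
def onlyEdge (W : PathGraph) (e : ℕ) : PathGraph := { W with L := {e} }

/-- No other edge has an endpoint in common with the edge `e`. -/
structure IsolatedEdge (W : PathGraph) (e : ℕ) : Prop where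
  mem : e ∈ W.L
  other : ∀ f ∈ W.L, f ≠ e → (W.a f ≠ W.a e ∧ W.a f ≠ W.b e) ∧ W.b f ≠ W.a e ∧ W.b f ≠ W.b e

variable {W : PathGraph} {e : ℕ}

theorem endSum_eq_delEdge_add (he : e ∈ W.L) (d d' : ℕ → UnitAddCircle) (v : ℕ) :
    W.endSum d d' v = (W.delEdge e).endSum d d' v + (W.onlyEdge e).endSum d d' v := by
  have h := Finset.sum_erase_add W.L
    (fun f => (if W.a f = v then d f else 0) + (if W.b f = v then d' f else 0)) he
  rw [← Finset.sum_singleton (fun f => (if W.a f = v then d f else 0) +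
    (if W.b f = v then d' f else 0)) e] at h
  exact h.symm

theorem endSum_onlyEdge_of_ne {d d' : ℕ → UnitAddCircle} {v : ℕ}
    (hv : ¬ (v = W.a e ∨ v = W.b e)) : (W.onlyEdge e).endSum d d' v = 0 := by
  rw [not_or] at hv
  simp [endSum, onlyEdge, Ne.symm hv.1, Ne.symm hv.2]

theorem IsolatedEdge.endSum_delEdge (h : W.IsolatedEdge e) {d d' : ℕ → UnitAddCircle} {v : ℕ}
    (hv : v = W.a e ∨ v = W.b e) : (W.delEdge e).endSum d d' v = 0 := by
  refine Finset.sum_eq_zero fun f hf => ?_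
  simp only [delEdge, Finset.mem_erase] at hf ⊢
  have := h.other f hf.2 hf.1
  rcases hv with rfl | rfl
  · simp [this.1.1, this.2.1]
  · simp [this.1.2, this.2.2]

/-- No condition links the isolated edge with the rest, so the system decouples and a solution is
the sum of two solutions with disjoint supports. -/
theorem IsolatedEdge.card_sol (h : W.IsolatedEdge e) (r c : ℕ → Prop) (ρ : ℕ → EndRel) :
    Nat.card (W.sol r c ρ) =
      Nat.card ((W.delEdge e).sol (fun v => r v ∧ ¬ (v = W.a e ∨ v = W.b e)) c ρ) *
      Nat.card ((W.onlyEdge e).sol (fun v => r v ∧ (v = W.a e ∨ v = W.b e)) c ρ) := by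
  classical
  let S : ℕ → Prop := fun v => v = W.a e ∨ v = W.b e
  have hSa : S (W.a e) := Or.inl rfl
  have hSb : S (W.b e) := Or.inr rfl
  have hother : ∀ f ∈ W.L, f ≠ e → ¬ S (W.a f) ∧ ¬ S (W.b f) := fun f hf hfe => by
    have := h.other f hf hfe
    simp only [S, not_or]
    exact this
  rw [← Nat.card_prod]
  refine Nat.card_congr
    { toFun := fun x => (⟨(fun v => if S v then 0 else x.1.1 v, fun f => if f = e then 0 else
          x.1.2.1 f, fun f => if f = e then 0 else x.1.2.2 f), ?_⟩,
        ⟨(fun v => if S v then x.1.1 v else 0, fun f => if f = e then x.1.2.1 f else 0,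
          fun f => if f = e then x.1.2.2 f else 0), ?_⟩)
      invFun := fun x => ⟨x.1.1 + x.2.1, ?_⟩
      left_inv := ?_
      right_inv := ?_ }
  · obtain ⟨⟨y, d, d'⟩, h1, h2, h3, h4⟩ := x
    refine ⟨fun f hf => ?_, fun f hf => ?_, fun v hv => ?_, fun v hv => ?_⟩
    · have hf' := Finset.mem_erase.1 hf
      have := hother f hf'.2 hf'.1
      simp only [if_neg hf'.1, if_neg (show ¬ S ((W.delEdge e).a f) from this.1),
        if_neg (show ¬ S ((W.delEdge e).b f) from this.2)]
      exact h1 f hf'.2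
    · by_cases hfe : f = e
      · simp [hfe]
      · simp only [if_neg hfe]
        exact h2 f fun h' => hf (Finset.mem_erase.2 ⟨hfe, h'⟩)
    · by_cases hS : S v
      · simp [hS]
      · simp only [if_neg hS]
        exact h3 v fun h' => hv ⟨h', hS⟩
    · by_cases hS : S v
      · simp only [if_pos hS, zero_add]
        exact h.endSum_delEdge hS
      · simp only [if_neg hS]
        have := h4 v hv
        simp only [endSum_eq_delEdge_add h.mem, endSum_onlyEdge_of_ne hS, add_zero] at this
        rw [← this]
        congr 1
        exact endSum_congr' (fun f hf => if_neg (Finset.ne_of_mem_erase hf))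
          (fun f hf => if_neg (Finset.ne_of_mem_erase hf))
  · obtain ⟨⟨y, d, d'⟩, h1, h2, h3, h4⟩ := x
    refine ⟨fun f hf => ?_, fun f hf => ?_, fun v hv => ?_, fun v hv => ?_⟩
    · obtain rfl := Finset.mem_singleton.1 hf
      simp only [if_pos (show S ((W.onlyEdge f).a f) from hSa),
        if_pos (show S ((W.onlyEdge f).b f) from hSb), if_true]
      exact h1 f h.mem
    · have hfe : f ≠ e := fun h' => hf (Finset.mem_singleton.2 h')
      simp [hfe]
    · by_cases hS : S v
      · simp only [if_pos hS]
        exact h3 v fun h' => hv ⟨h', hS⟩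
      · simp [hS]
    · by_cases hS : S v
      · simp only [if_pos hS]
        have := h4 v hv
        simp only [endSum_eq_delEdge_add h.mem, h.endSum_delEdge hS, zero_add] at this
        rw [← this]
        congr 1
        exact endSum_congr' (fun f hf => if_pos (Finset.mem_singleton.1 hf))
          (fun f hf => if_pos (Finset.mem_singleton.1 hf))
      · simp only [if_neg hS, zero_add]
        exact endSum_onlyEdge_of_ne hS
  · obtain ⟨⟨⟨y, d, d'⟩, h1, h2, h3, h4⟩, ⟨⟨y₁, d₁, d₁'⟩, k1, k2, k3, k4⟩⟩ := x
    have hy : ∀ v, S v → y v = 0 := fun v hv => h3 v fun h' => h'.2 hv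
    have hy₁ : ∀ v, ¬ S v → y₁ v = 0 := fun v hv => k3 v fun h' => hv h'.2
    have hd := h2 e (Finset.notMem_erase _ _)
    have hd₁ : ∀ f, f ≠ e → d₁ f = 0 ∧ d₁' f = 0 :=
      fun f hf => k2 f fun h' => hf (Finset.mem_singleton.1 h')
    simp only at hd
    have e1 : ∀ v, W.endSum (d + d₁) (d' + d₁') v = (W.delEdge e).endSum d d' v +
        (W.onlyEdge e).endSum d₁ d₁' v := by
      intro v
      rw [endSum_eq_delEdge_add h.mem]
      congr 1
      · exact endSum_congr' (fun f hf => by simp [(hd₁ f (Finset.ne_of_mem_erase hf)).1])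
          (fun f hf => by simp [(hd₁ f (Finset.ne_of_mem_erase hf)).2])
      · exact endSum_congr' (fun f hf => by
          obtain rfl := Finset.mem_singleton.1 hf
          simp [hd.1]) (fun f hf => by
          obtain rfl := Finset.mem_singleton.1 hf
          simp [hd.2])
    refine ⟨fun f hf => ?_, fun f hf => ?_, fun v hv => ?_, fun v hv => ?_⟩
    · by_cases hfe : f = e
      · subst hfe
        have := k1 f (Finset.mem_singleton_self _)
        simpa [hy _ hSa, hy _ hSb, hd, onlyEdge] using this
      · have hf' := hother f hf hfe
        have := h1 f (Finset.mem_erase.2 ⟨hfe, hf⟩)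
        simpa [hy₁ _ hf'.1, hy₁ _ hf'.2, hd₁ f hfe, delEdge] using this
    · have hfe : f ≠ e := fun h' => hf (h' ▸ h.mem)
      have := h2 f fun h' => hf (Finset.mem_of_mem_erase h')
      simp only at this
      simp [this, hd₁ f hfe]
    · have a1 := h3 v fun h' => hv h'.1
      have a2 := k3 v fun h' => hv h'.1
      simp only at a1 a2
      simp [a1, a2]
    · have a1 := h4 v hv
      have a2 := k4 v hv
      simp only at a1 a2
      simp only [Prod.mk_add_mk, Pi.add_apply, e1]
      rw [← add_zero (0 : UnitAddCircle)]
      nth_rw 1 [← a1]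
      rw [← a2]
      abel
  · rintro ⟨⟨y, d, d'⟩, hx⟩
    ext v
    · by_cases hS : S v <;> simp [hS]
    · by_cases hS : v = e <;> simp [hS]
    · by_cases hS : v = e <;> simp [hS]
  · rintro ⟨⟨⟨y, d, d'⟩, h1, h2, h3, h4⟩, ⟨⟨y₁, d₁, d₁'⟩, k1, k2, k3, k4⟩⟩
    have hy : ∀ v, S v → y v = 0 := fun v hv => h3 v fun h' => h'.2 hv
    have hy₁ : ∀ v, ¬ S v → y₁ v = 0 := fun v hv => k3 v fun h' => hv h'.2
    have hd := h2 e (Finset.notMem_erase _ _)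
    have hd₁ : ∀ f, f ≠ e → d₁ f = 0 ∧ d₁' f = 0 :=
      fun f hf => k2 f fun h' => hf (Finset.mem_singleton.1 h')
    simp only at hd
    ext v
    · by_cases hS : S v
      · simp [hS, hy]
      · simp [hS, hy₁]
    · by_cases hS : v = e
      · simp [hS, hd]
      · simp [hS, hd₁]
    · by_cases hS : v = e
      · simp [hS, hd]
      · simp [hS, hd₁]
    · by_cases hS : S v
      · simp [hS, hy]
      · simp [hS, hy₁]
    · by_cases hS : v = e
      · simp [hS, hd]
      · simp [hS, hd₁]
    · by_cases hS : v = e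
      · simp [hS, hd]
      · simp [hS, hd₁]

theorem IsolatedEdge.mul_mem_counts (h : W.IsolatedEdge e) {m n : ℕ}
    (hm : m ∈ (W.delEdge e).counts) (hn : n ∈ (W.onlyEdge e).counts) : m * n ∈ W.counts := by
  classical
  obtain ⟨hm0, r, c, ρ, hr, hρ, rfl⟩ := hm
  obtain ⟨hn0, r₁, c₁, ρ₁, hr₁, hρ₁, rfl⟩ := hn
  let S : ℕ → Prop := fun v => v = W.a e ∨ v = W.b e
  have hrS : ∀ v, r v → ¬ S v := by
    intro v hv hS
    obtain ⟨f, hf, hfv⟩ := hr v hv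
    have := h.other f (Finset.mem_of_mem_erase hf) (Finset.ne_of_mem_erase hf)
    simp only [delEdge] at hfv
    rcases hS with rfl | rfl <;> tauto
  have hrS₁ : ∀ v, r₁ v → S v := by
    intro v hv
    obtain ⟨f, hf, hfv⟩ := hr₁ v hv
    obtain rfl := Finset.mem_singleton.1 hf
    simp only [onlyEdge] at hfv
    simp only [S]
    tauto
  refine ⟨Nat.mul_pos hm0 hn0, fun v => r v ∨ r₁ v, fun v => if S v then c₁ v else c v,
    Function.update ρ e (ρ₁ e), ?_, ?_, ?_⟩
  · rintro v (hv | hv)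
    · obtain ⟨f, hf, hfv⟩ := hr v hv
      exact ⟨f, Finset.mem_of_mem_erase hf, hfv⟩
    · rcases hrS₁ v hv with rfl | rfl
      · exact ⟨e, h.mem, Or.inl rfl⟩
      · exact ⟨e, h.mem, Or.inr rfl⟩
  · intro f hf
    by_cases hfe : f = e
    · subst hfe
      simpa [onlyEdge] using hρ₁ f (Finset.mem_singleton_self _)
    · simpa [delEdge, Function.update_of_ne hfe] using hρ f (Finset.mem_erase.2 ⟨hfe, hf⟩)
  · rw [h.card_sol]
    congr 2
    · congr 1
      ext x
      have hrr : (∀ v, ¬ r v → x.1 v = 0) ↔ ∀ v, ¬ ((r v ∨ r₁ v) ∧ ¬ S v) → x.1 v = 0 := by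
        refine forall_congr' fun v => ?_
        have := hrS v
        have := hrS₁ v
        rw [show ((r v ∨ r₁ v) ∧ ¬ S v) ↔ r v by tauto]
      refine and_congr (forall₂_congr fun f hf => ?_) (and_congr_right fun _ =>
        (and_congr_left' hrr).trans (and_congr_right fun h3 => forall_congr' fun v => ?_))
      · rw [Function.update_of_ne (Finset.ne_of_mem_erase hf)]
      · by_cases hS : S v
        · rw [h.endSum_delEdge hS, h3 v fun h' => h'.2 hS]
          simp
        · simp [hS]
    · congr 1
      ext x
      have hrr : (∀ v, ¬ r₁ v → x.1 v = 0) ↔ ∀ v, ¬ ((r v ∨ r₁ v) ∧ S v) → x.1 v = 0 := by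
        refine forall_congr' fun v => ?_
        have := hrS v
        have := hrS₁ v
        rw [show ((r v ∨ r₁ v) ∧ S v) ↔ r₁ v by tauto]
      refine and_congr (forall₂_congr fun f hf => ?_) (and_congr_right fun _ =>
        (and_congr_left' hrr).trans (and_congr_right fun h3 => forall_congr' fun v => ?_))
      · obtain rfl := Finset.mem_singleton.1 hf
        rw [Function.update_self]
      · by_cases hS : S v
        · simp [hS]
        · rw [endSum_onlyEdge_of_ne hS, h3 v fun h' => hS h'.2]
          simp

theorem IsolatedEdge.exists_mul_eq (h : W.IsolatedEdge e) {k : ℕ} (hk : k ∈ W.counts) :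
    ∃ m ∈ (W.delEdge e).counts, ∃ n ∈ (W.onlyEdge e).counts, k = m * n := by
  obtain ⟨hk0, r, c, ρ, hr, hρ, rfl⟩ := hk
  rw [h.card_sol] at hk0 ⊢
  refine ⟨_, ⟨Nat.pos_of_mul_pos_right hk0, _, c, ρ, ?_, fun f hf => ?_, rfl⟩,
    _, ⟨Nat.pos_of_mul_pos_left hk0, _, c, ρ, ?_, fun f hf => ?_, rfl⟩, rfl⟩
  · rintro v ⟨hv, hS⟩
    obtain ⟨f, hf, hfv⟩ := hr v hv
    refine ⟨f, Finset.mem_erase.2 ⟨?_, hf⟩, hfv⟩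
    rintro rfl
    tauto
  · exact hρ f (Finset.mem_of_mem_erase hf)
  · rintro v ⟨hv, hS⟩
    refine ⟨e, Finset.mem_singleton_self _, ?_⟩
    simp only [onlyEdge]
    tauto
  · obtain rfl := Finset.mem_singleton.1 hf
    exact hρ f h.mem

/-! ### The trivial system, and components that are paths -/

theorem pathRigid_false (k : ℕ) : PathRigid k (fun _ => False) (fun _ => False) := by
  intro z hz h0 h1 hk hk1
  ext t
  rcases (show t = 0 ∨ t = k + 1 ∨ k + 1 < t ∨ ∃ s < k, t = s + 1 by
    rcases Nat.eq_zero_or_pos t with h | h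
    · exact Or.inl h
    · rcases lt_trichotomy t (k + 1) with h' | h' | h'
      · exact Or.inr (Or.inr (Or.inr ⟨t - 1, by omega, by omega⟩))
      · exact Or.inr (Or.inl h')
      · exact Or.inr (Or.inr (Or.inl h'))) with rfl | rfl | h | ⟨s, hs, rfl⟩
  · exact h0
  · exact hk1
  · exact hz.2 t h
  · exact (hz.1 s hs).1 not_false

theorem eq_zero_of_pathRel_false {k : ℕ} {s t : UnitAddCircle}
    (h : pathRel k (fun _ => False) (fun _ => False) 0 s t 0) : s = 0 ∧ t = 0 := by
  obtain ⟨z, hz, h0, rfl, rfl, hk1⟩ := h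
  rcases Nat.eq_zero_or_pos k with rfl | h
  · exact ⟨hk1, h0⟩
  · have h1 := (hz.1 0 h).1 not_false
    have h2 := (hz.1 (k - 1) (by omega)).1 not_false
    rw [Nat.sub_add_cancel h] at h2
    exact ⟨h1, h2⟩

/-- Forcing every value to zero leaves one solution; this is the empty minor. -/
theorem one_mem_counts (W : PathGraph) : 1 ∈ W.counts := by
  refine ⟨one_pos, fun _ => False, fun _ => False,
    fun e => pathRel (W.len e) (fun _ => False) (fun _ => False), fun _ h => h.elim,
    fun e _ => ⟨_, _, pathRigid_false _, rfl⟩, ?_⟩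
  symm
  rw [Nat.card_eq_one_iff_unique]
  constructor
  · constructor
    have key : ∀ x ∈ W.sol (fun _ => False) (fun _ => False)
        (fun e => pathRel (W.len e) (fun _ => False) (fun _ => False)), x = 0 := by
      rintro ⟨y, d, d'⟩ ⟨h1, h2, h3, -⟩
      have hy : ∀ v, y v = 0 := fun v => h3 v not_false
      have hd : ∀ e, d e = 0 ∧ d' e = 0 := by
        intro e
        by_cases he : e ∈ W.L
        · have := h1 e he
          simp only [hy] at this
          exact eq_zero_of_pathRel_false this
        · exact h2 e he
      ext v
      · exact hy v
      · exact (hd v).1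
      · exact (hd v).2
    rintro ⟨x, hx⟩ ⟨x', hx'⟩
    exact Subtype.ext ((key x hx).trans (key x' hx').symm)
  · exact ⟨⟨0, fun e _ => zero_of_mem_pathTypes ⟨_, _, pathRigid_false _, rfl⟩,
      fun _ _ => ⟨rfl, rfl⟩, fun _ _ => rfl, fun _ h => h.elim⟩⟩

/-- On a path every equation, also those at the two ends, is a sum of consecutive values, and such
interval matrices are totally unimodular. Concretely, a nonzero solution would generate the infinite
family of `exists_family_of_ne_zero'`, so a finite solution set contains zero only. -/
theorem eq_one_of_mem_counts_onlyEdge (hab : W.a e ≠ W.b e) {n : ℕ}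
    (hn : n ∈ (W.onlyEdge e).counts) : n = 1 := by
  classical
  obtain ⟨hn0, r, c, ρ, hr, hρ, rfl⟩ := hn
  have hfin : Finite ((W.onlyEdge e).sol r c ρ) := Nat.finite_of_card_ne_zero hn0.ne'
  have hne : Nonempty ((W.onlyEdge e).sol r c ρ) := (Nat.card_pos_iff.1 hn0).1
  rw [Nat.card_eq_one_iff_unique]
  refine ⟨?_, hne⟩
  obtain ⟨R, C, hrig, hρe⟩ := hρ e (Finset.mem_singleton_self _)
  simp only [onlyEdge] at hrig hρe
  set k := W.len e
  have hsuma : ∀ d d', (W.onlyEdge e).endSum d d' (W.a e) = d e := by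
    intro d d'
    simp [endSum, onlyEdge, hab.symm]
  have hsumb : ∀ d d', (W.onlyEdge e).endSum d d' (W.b e) = d' e := by
    intro d d'
    simp [endSum, onlyEdge, hab]
  have hr' : ∀ v, v ≠ W.a e → v ≠ W.b e → ¬ r v := by
    intro v hva hvb hv
    obtain ⟨f, hf, hfv⟩ := hr v hv
    obtain rfl := Finset.mem_singleton.1 hf
    simp only [onlyEdge] at hfv
    tauto
  have key : ∀ x ∈ (W.onlyEdge e).sol r c ρ, x = 0 := by
    rintro ⟨y, d, d'⟩ ⟨h1, h2, h3, h4⟩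
    have hrel := h1 e (Finset.mem_singleton_self _)
    rw [hρe] at hrel
    obtain ⟨z, hz, z0, z1, zk, zk1⟩ := hrel
    simp only [onlyEdge] at z0 z1 zk zk1 h3 h4
    by_cases hz0 : z = 0
    · subst hz0
      ext v
      · by_cases hva : v = W.a e
        · subst hva; exact z0.symm
        · by_cases hvb : v = W.b e
          · subst hvb; exact zk1.symm
          · exact h3 v (hr' v hva hvb)
      · by_cases hv : v = e
        · subst hv; exact z1.symm
        · exact (h2 v fun h => hv (Finset.mem_singleton.1 h)).1
      · by_cases hv : v = e
        · subst hv; exact zk.symm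
        · exact (h2 v fun h => hv (Finset.mem_singleton.1 h)).2
    · exfalso
      obtain ⟨F, hF, hFz⟩ := exists_family_of_ne_zero' hz hz0
      let g : UnitAddCircle →
          (ℕ → UnitAddCircle) × (ℕ → UnitAddCircle) × (ℕ → UnitAddCircle) := fun u =>
        -- The family survives the passage to the four end values because the type of the edge is
        -- rigid.
        (Function.update (Pi.single (W.a e) (F u 0)) (W.b e) (F u (k + 1)),
          Pi.single e (F u 1), Pi.single e (F u k))
      have hga : ∀ u, (g u).1 (W.a e) = F u 0 := fun u => by simp [g, Function.update_of_ne hab]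
      have hgb : ∀ u, (g u).1 (W.b e) = F u (k + 1) := fun u => by simp [g]
      have hgo : ∀ u v, v ≠ W.a e → v ≠ W.b e → (g u).1 v = 0 := fun u v hva hvb => by
        simp [g, Function.update_of_ne hvb, Pi.single_eq_of_ne hva]
      have hg : ∀ u, g u ∈ (W.onlyEdge e).sol r c ρ := by
        intro u
        obtain ⟨hu, hu1, hu2⟩ := hFz u
        refine ⟨fun f hf => ?_, fun f hf => ?_, fun v hv => ?_, fun v hv => ?_⟩
        · obtain rfl := Finset.mem_singleton.1 hf
          rw [hρe]
          refine ⟨F u, hu, ?_, ?_, ?_, ?_⟩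
          · exact (hga u).symm
          · simp [g]
          · simp [g]
          · exact (hgb u).symm
        · have : f ≠ e := fun h => hf (Finset.mem_singleton.2 h)
          simp [g, Pi.single_eq_of_ne this]
        · by_cases hva : v = W.a e
          · subst hva
            rw [hga]
            exact hu1 0 (by omega) (z0.trans (h3 _ hv))
          · by_cases hvb : v = W.b e
            · subst hvb
              rw [hgb]
              exact hu1 (k + 1) le_rfl (zk1.trans (h3 _ hv))
            · exact hgo u v hva hvb
        · by_cases hva : v = W.a e
          · subst hva
            have h5 := h4 _ hv
            have h6 := hsuma d d'
            simp only [onlyEdge] at h6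
            rw [h6, ← z0, ← z1] at h5
            rw [hga, hsuma]
            simpa [g] using hu2 0 (by omega) h5
          · by_cases hvb : v = W.b e
            · subst hvb
              have h5 := h4 _ hv
              have h6 := hsumb d d'
              simp only [onlyEdge] at h6
              rw [h6, ← zk, ← zk1, add_comm] at h5
              rw [hgb, hsumb, add_comm]
              simpa [g] using hu2 k le_rfl h5
            · rw [hgo u v hva hvb, zero_add]
              exact endSum_onlyEdge_of_ne (by tauto)
      have : Infinite ((W.onlyEdge e).sol r c ρ) := by
        refine Infinite.of_injective (fun u => (⟨g u, hg u⟩ : (W.onlyEdge e).sol r c ρ))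
          fun u w huw => hF ?_
        have h5 : g u = g w := congrArg Subtype.val huw
        refine eq_of_pathRigid hrig (hFz u).1 (hFz w).1 ?_ ?_ ?_ ?_
        · rw [← hga, ← hga, h5]
        · have := congrArg (fun x => x.2.1 e) h5
          simpa [g] using this
        · have := congrArg (fun x => x.2.2 e) h5
          simpa [g] using this
        · rw [← hgb, ← hgb, h5]
      exact not_finite ((W.onlyEdge e).sol r c ρ)
  exact ⟨fun ⟨x, hx⟩ ⟨x', hx'⟩ => Subtype.ext ((key x hx).trans (key x' hx').symm)⟩

/-- A component that is a path does not matter. -/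
theorem IsolatedEdge.counts_delEdge (h : W.IsolatedEdge e) (hab : W.a e ≠ W.b e) :
    (W.delEdge e).counts = W.counts := by
  apply Set.Subset.antisymm
  · intro m hm
    simpa using h.mul_mem_counts hm (one_mem_counts _)
  · intro k hk
    obtain ⟨m, hm, n, hn, rfl⟩ := h.exists_mul_eq hk
    rw [eq_one_of_mem_counts_onlyEdge hab hn, mul_one]
    exact hm

end PathGraph

/-! #### Components that are cycles -/

theorem UnitAddCircle.exists_ne_zero_of_two_le {n : ℕ} (hn : 2 ≤ n) :
    ∃ u : UnitAddCircle, u ≠ 0 ∧ n • u = 0 := by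
  have hn0 : (n : ℝ) ≠ 0 := by positivity
  refine ⟨((1 / n : ℝ) : UnitAddCircle), ?_, ?_⟩
  · rw [Ne, UnitAddCircle.coe_eq_zero_iff_int]
    rintro ⟨m, hm⟩
    rw [eq_div_iff hn0] at hm
    have h1 : m * (n : ℤ) = 1 := by exact_mod_cast hm
    have := Int.eq_one_or_neg_one_of_mul_eq_one' h1
    omega
  · rw [← QuotientAddGroup.mk_nsmul, nsmul_eq_mul, mul_one_div_cancel hn0]
    exact (UnitAddCircle.coe_eq_zero_iff_int 1).2 ⟨1, by simp⟩

theorem UnitAddCircle.finite_torsion {n : ℕ} (hn : 0 < n) :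
    {u : UnitAddCircle | n • u = 0}.Finite :=
  AddCircle.finite_torsion 1 hn

/-- From `s` on each equation determines the next value from the two before it; past the end of the
path all values are zero anyway. -/
theorem eq_zero_of_full_path {k : ℕ} {r c : ℕ → Prop} {z : ℕ → UnitAddCircle}
    (hz : z ∈ pathSol k r c) {s : ℕ} (h0 : z s = 0) (h1 : z (s + 1) = 0)
    (hc : ∀ t, s ≤ t → c t) : ∀ t, s ≤ t → z t = 0 ∧ z (t + 1) = 0 := by
  intro t ht
  induction t, ht using Nat.le_induction with
  | base => exact ⟨h0, h1⟩
  | succ t ht ih =>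
    refine ⟨ih.2, ?_⟩
    by_cases htk : t < k
    · have := (hz.1 t htk).2 (hc t ht)
      rwa [ih.1, ih.2, zero_add, zero_add] at this
    · exact hz.2 _ (by omega)

/-- The difference of two consecutive equations is `z (t + 3) - z t = 0`. -/
theorem full_path_periodic {k : ℕ} {r c : ℕ → Prop} {z : ℕ → UnitAddCircle}
    (hz : z ∈ pathSol k r c) {s : ℕ} (hc : ∀ t, s ≤ t → c t) (m i : ℕ)
    (h : s + (3 * m + i) ≤ k + 1) : z (s + (3 * m + i)) = z (s + i) := by
  induction m with
  | zero => simp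
  | succ m ih =>
    rw [← ih (by omega)]
    have h1 := (hz.1 (s + (3 * m + i)) (by omega)).2 (hc _ (by omega))
    have h2 := (hz.1 (s + (3 * m + i) + 1) (by omega)).2 (hc _ (by omega))
    rw [show s + (3 * (m + 1) + i) = s + (3 * m + i) + 1 + 2 by ring]
    rw [show s + (3 * m + i) + 1 + 1 = s + (3 * m + i) + 2 by ring] at h2
    rw [← sub_eq_zero, ← sub_self (0 : UnitAddCircle)]
    nth_rw 2 [← h1]
    rw [← h2]
    abel

namespace PathGraph

variable {W : PathGraph} {e : ℕ}

/-- A criterion for a cycle: if every cyclic solution is determined by the value at its base vertex,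
and that value is torsion of bounded order, then the solution set is finite; one nonzero solution
then gives a count of at least two. Here `r₀` and `c₀` are the conditions at the base vertex. -/
theorem exists_two_le_of_loop_aux (hab : W.a e = W.b e) {R C : ℕ → Prop}
    (hrig : PathRigid (W.len e) R C) (r₀ c₀ : Prop) (N : ℕ) (hN : 0 < N)
    (f : UnitAddCircle → UnitAddCircle)
    (h : ∀ z ∈ pathSol (W.len e) R C, z (W.len e + 1) = z 0 → (¬ r₀ → z 0 = 0) →
      (c₀ → z 0 + (z 1 + z (W.len e)) = 0) →
      N • z 0 = 0 ∧ z 1 = f (z 0) ∧ z (W.len e) = f (z 0))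
    (hex : ∃ z ∈ pathSol (W.len e) R C, z (W.len e + 1) = z 0 ∧ (¬ r₀ → z 0 = 0) ∧
      (c₀ → z 0 + (z 1 + z (W.len e)) = 0) ∧ z 0 ≠ 0) :
    ∃ n ∈ (W.onlyEdge e).counts, 2 ≤ n := by
  classical
  set k := W.len e
  set v := W.a e with hv
  let G := W.onlyEdge e
  let r : ℕ → Prop := fun u => u = v ∧ r₀
  let c : ℕ → Prop := fun u => u = v ∧ c₀
  let ρ : ℕ → EndRel := fun _ => pathRel k R C
  have hsum : ∀ d d', G.endSum d d' v = d e + d' e := by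
    intro d d'
    simp [endSum, G, onlyEdge, ← hab, ← hv]
  have hz : ∀ x ∈ G.sol r c ρ, N • x.1 v = 0 ∧ x.2.1 e = f (x.1 v) ∧ x.2.2 e = f (x.1 v) := by
    rintro ⟨y, d, d'⟩ ⟨h1, h2, h3, h4⟩
    obtain ⟨z, hz, z0, z1, zk, zk1⟩ := h1 e (Finset.mem_singleton_self _)
    simp only [onlyEdge, G, ← hab, ← hv] at z0 z1 zk zk1
    simp only
    rw [← z1, ← zk, ← z0]
    refine h z hz (zk1.trans z0.symm) (fun hr => ?_) (fun hc => ?_)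
    · rw [z0]; exact h3 v fun h' => hr h'.2
    · have := h4 v ⟨rfl, hc⟩
      rw [hsum] at this
      rw [z0, z1, zk]
      exact this
  have hy : ∀ x ∈ G.sol r c ρ, ∀ u ≠ v, x.1 u = 0 := fun x hx u hu =>
    hx.2.2.1 u fun h' => hu h'.1
  have hinj : Function.Injective
      (fun x : G.sol r c ρ => (⟨x.1.1 v, (hz x.1 x.2).1⟩ : {u : UnitAddCircle | N • u = 0})) := by
    rintro ⟨x, hx⟩ ⟨x', hx'⟩ hxx
    have hv : x.1 v = x'.1 v := congrArg Subtype.val hxx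
    ext u
    · by_cases hu : u = v
      · subst hu; exact hv
      · simp [hy x hx u hu, hy x' hx' u hu]
    · by_cases hu : u = e
      · subst hu; simp only [(hz x hx).2.1, (hz x' hx').2.1, hv]
      · have hu' : u ∉ G.L := fun h' => hu (Finset.mem_singleton.1 h')
        simp only [(hx.2.1 u hu').1, (hx'.2.1 u hu').1]
    · by_cases hu : u = e
      · subst hu; simp only [(hz x hx).2.2, (hz x' hx').2.2, hv]
      · have hu' : u ∉ G.L := fun h' => hu (Finset.mem_singleton.1 h')
        simp only [(hx.2.1 u hu').2, (hx'.2.1 u hu').2]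
  have hfin' := (UnitAddCircle.finite_torsion hN).to_subtype
  have hfin : Finite (G.sol r c ρ) := Finite.of_injective _ hinj
  have hρ : pathRel k R C ∈ pathTypes k := ⟨R, C, hrig, rfl⟩
  obtain ⟨z, hzm, hz1, hz2, hz3, hz4⟩ := hex
  let x₁ : (ℕ → UnitAddCircle) × (ℕ → UnitAddCircle) × (ℕ → UnitAddCircle) :=
    (Pi.single v (z 0), Pi.single e (z 1), Pi.single e (z k))
  have hx₁ : x₁ ∈ G.sol r c ρ := by
    refine ⟨fun f hf => ?_, fun f hf => ?_, fun u hu => ?_, fun u hu => ?_⟩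
    · obtain rfl := Finset.mem_singleton.1 hf
      refine ⟨z, hzm, ?_⟩
      simp [x₁, G, onlyEdge, ← hab, ← hv, hz1]
    · have : f ≠ e := fun h' => hf (Finset.mem_singleton.2 h')
      simp [x₁, Pi.single_eq_of_ne this]
    · by_cases huv : u = v
      · subst huv
        simpa [x₁] using hz2 fun h' => hu ⟨rfl, h'⟩
      · simp [x₁, Pi.single_eq_of_ne huv]
    · obtain ⟨rfl, hc⟩ := hu
      rw [hsum]
      simpa [x₁] using hz3 hc
  have hx₀ : (0 : (ℕ → UnitAddCircle) × (ℕ → UnitAddCircle) × (ℕ → UnitAddCircle)) ∈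
      G.sol r c ρ := by
    refine ⟨fun f hf => zero_of_mem_pathTypes hρ, fun _ _ => ⟨rfl, rfl⟩, fun _ _ => rfl,
      fun u _ => ?_⟩
    simp [endSum]
  have hnt : Nontrivial (G.sol r c ρ) := by
    refine ⟨⟨⟨0, hx₀⟩, ⟨x₁, hx₁⟩, fun h' => hz4 ?_⟩⟩
    have := congrArg (fun x => x.1.1 v) h'
    simpa [x₁] using this.symm
  have hcard : 1 < Nat.card (G.sol r c ρ) := Finite.one_lt_card_iff_nontrivial.2 hnt
  refine ⟨_, ⟨zero_lt_one.trans hcard, r, c, ρ, ?_, ?_, rfl⟩, hcard⟩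
  · rintro u ⟨rfl, -⟩
    exact ⟨e, Finset.mem_singleton_self _, Or.inl rfl⟩
  · intro f hf
    obtain rfl := Finset.mem_singleton.1 hf
    exact hρ

/-- A component that is a cycle contributes a factor of at least two. -/
theorem exists_two_le_of_loop (hab : W.a e = W.b e) (hlen : 3 ≤ W.len e) :
    ∃ n ∈ (W.onlyEdge e).counts, 2 ≤ n := by
  set k := W.len e with hk
  -- The cycle has `k + 1` vertices. If three does not divide this number, the full system works:
  -- its solutions are the constants `u` with `3 u = 0`. Otherwise the full system has infinitely
  -- many solutions, and one uses another minor: three vertices are forced to zero and three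
  -- equations are dropped, which leaves the solutions with `2 u = 0`.
  by_cases h3 : (k + 1) % 3 = 0
  -- The values at positions 1, 3, 5 are zero and the equations at 2, 4 and at the base vertex are
  -- missing. Hence the signs alternate at positions 0, 2, 4, 6, and periodicity carries `z 6 = - z
  -- 0` on to position `k + 1`, which is the base vertex again.
  · obtain ⟨m, hm⟩ : ∃ m, k = 3 * m + 5 := ⟨(k - 5) / 3, by omega⟩
    have hcpos : ∀ t, 5 ≤ t → t ≠ 1 ∧ t ≠ 3 := fun t ht => by omega
    have hstart : ∀ z ∈ pathSol k (fun t => t ≠ 0 ∧ t ≠ 2 ∧ t ≠ 4) (fun t => t ≠ 1 ∧ t ≠ 3),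
        z 1 = 0 ∧ z 3 = 0 ∧ z 5 = 0 ∧ z 2 = - z 0 ∧ z 4 = z 0 ∧ z 6 = - z 0 := by
      intro z hz
      have h1 := (hz.1 0 (by omega)).1 (by simp)
      have h3 := (hz.1 2 (by omega)).1 (by simp)
      have h5 := (hz.1 4 (by omega)).1 (by simp)
      have e0 := (hz.1 0 (by omega)).2 (by simp)
      have e2 := (hz.1 2 (by omega)).2 (by simp)
      have e4 := (hz.1 4 (by omega)).2 (by simp)
      simp only [zero_add, Nat.reduceAdd] at h1 h3 h5 e0 e2 e4
      rw [h1, add_zero] at e0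
      rw [h3, add_zero] at e2
      rw [h5, add_zero] at e4
      have a2 : z 2 = - z 0 := eq_neg_of_add_eq_zero_right e0
      have a4 : z 4 = z 0 := by rw [eq_neg_of_add_eq_zero_right e2, a2, neg_neg]
      exact ⟨h1, h3, h5, a2, a4, by rw [eq_neg_of_add_eq_zero_right e4, a4]⟩
    refine exists_two_le_of_loop_aux hab (R := fun t => t ≠ 0 ∧ t ≠ 2 ∧ t ≠ 4)
      (C := fun t => t ≠ 1 ∧ t ≠ 3) ?_ True False 2 (by norm_num) (fun _ => 0) ?_ ?_
    · intro z hz h0 _ _ _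
      obtain ⟨a1, a3, a5, a2, a4, a6⟩ := hstart z hz
      rw [h0, neg_zero] at a2 a6
      rw [h0] at a4
      have := eq_zero_of_full_path hz a5 a6 hcpos
      ext t
      rcases le_or_gt 5 t with h | h
      · exact (this t h).1
      · interval_cases t <;> assumption
    · intro z hz hcyc _ _
      rw [← hk] at hz hcyc ⊢
      obtain ⟨a1, a3, a5, a2, a4, a6⟩ := hstart z hz
      have b1 := full_path_periodic hz hcpos m 1 (by omega)
      have b2 := full_path_periodic hz hcpos m 0 (by omega)
      rw [show 5 + (3 * m + 1) = k + 1 by omega, hcyc] at b1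
      rw [show 5 + (3 * m + 0) = k by omega] at b2
      simp only [Nat.reduceAdd, add_zero] at b1 b2
      refine ⟨?_, a1, b2.trans a5⟩
      rw [a6] at b1
      rw [two_nsmul]
      nth_rw 1 [b1]
      simp
    · obtain ⟨u, hu0, hu⟩ := UnitAddCircle.exists_ne_zero_of_two_le (le_refl 2)
      rw [two_nsmul] at hu
      rw [← hk]
      -- The positions at which the nonzero solution vanishes; all others carry the element `u` of
      -- order two, so each active equation contains `u` exactly twice.
      let P : ℕ → Prop := fun p => p = 1 ∨ p = 3 ∨ (5 ≤ p ∧ p % 3 = 2) ∨ k + 1 < p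
      let z : ℕ → UnitAddCircle := fun p => open Classical in if P p then 0 else u
      have z0 : ∀ p, P p → z p = 0 := fun p hp => if_pos hp
      have z1 : ∀ p, ¬ P p → z p = u := fun p hp => if_neg hp
      refine ⟨z, ⟨fun t ht => ⟨fun h => ?_, fun h => ?_⟩, fun t ht => ?_⟩, ?_, ?_, ?_, ?_⟩
      · exact z0 _ (by simp only [P]; omega)
      · by_cases ht0 : t = 0
        · subst ht0
          rw [z1 0 (by simp only [P]; omega), z0 (0 + 1) (Or.inl rfl),
            z1 (0 + 2) (by simp only [P]; omega), add_zero, hu]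
        · by_cases ht4 : t % 3 = 2
          · rcases (show t = 2 ∨ 5 ≤ t by omega) with ht2 | ht5
            · rw [z1 _ (by simp only [P]; omega), z0 _ (by simp only [P]; omega),
                z1 _ (by simp only [P]; omega), add_zero, hu]
            · rw [z0 _ (by simp only [P]; omega), z1 _ (by simp only [P]; omega),
                z1 _ (by simp only [P]; omega), zero_add, hu]
          · by_cases ht5 : t % 3 = 1
            · rw [z1 _ (by simp only [P]; omega), z0 _ (by simp only [P]; omega),
                z1 _ (by simp only [P]; omega), add_zero, hu]
            · rw [z1 _ (by simp only [P]; omega), z1 _ (by simp only [P]; omega),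
                z0 _ (by simp only [P]; omega), add_zero, hu]
      · exact z0 _ (by simp only [P]; omega)
      · rw [z1 _ (by simp only [P]; omega), z1 _ (by simp only [P]; omega)]
      · simp
      · simp
      · rw [z1 _ (by simp only [P]; omega)]
        exact hu0
  · refine exists_two_le_of_loop_aux hab (R := fun _ => True)
      (C := fun _ => True) ?_ True True 3 (by norm_num) id ?_ ?_
    · intro z hz h0 h1 _ _
      ext t
      exact (eq_zero_of_full_path hz h0 h1 (fun _ _ => trivial) t (Nat.zero_le _)).1
    · intro z hz hcyc _ hsum
      rw [← hk] at hz hcyc hsum ⊢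
      have hsum := hsum trivial
      have hper := fun m i => full_path_periodic hz (s := 0) (fun _ _ => trivial) m i
      simp only [zero_add] at hper
      rcases (show k % 3 = 0 ∨ k % 3 = 1 by omega) with hmod | hmod
      · obtain ⟨m, hm⟩ : ∃ m, k = 3 * m := ⟨k / 3, by omega⟩
        have b1 := hper m 0 (by omega)
        have b2 := hper m 1 (by omega)
        rw [← hm, add_zero] at b1
        rw [← hm, hcyc] at b2
        refine ⟨?_, b2.symm, b1⟩
        rw [b1, ← b2] at hsum
        rw [← hsum]
        abel
      · obtain ⟨m, hm⟩ : ∃ m, k = 3 * m + 1 := ⟨k / 3, by omega⟩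
        have b1 := hper m 1 (by omega)
        have b2 := hper m 2 (by omega)
        rw [← hm] at b1
        rw [show 3 * m + 2 = k + 1 by omega, hcyc] at b2
        have b3 := (hz.1 0 (by omega)).2 trivial
        simp only [zero_add] at b3
        rw [← b2] at b3
        rw [b1] at hsum ⊢
        have b4 : z 1 = z 0 := by
          rw [← sub_eq_zero, ← sub_self (0 : UnitAddCircle)]
          nth_rw 2 [← b3]
          rw [← hsum]
          abel
        refine ⟨?_, b4, b4⟩
        rw [b4] at hsum
        rw [← hsum]
        abel
    · obtain ⟨u, hu0, hu⟩ := UnitAddCircle.exists_ne_zero_of_two_le (n := 3) (by norm_num)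
      have hu' : u + u + u = 0 := by
        rw [← hu]; abel
      rw [← hk]
      refine ⟨fun t => if t ≤ k + 1 then u else 0, ⟨fun t ht => ⟨fun h => absurd trivial h,
        fun _ => ?_⟩, fun t ht => ?_⟩, ?_, ?_, ?_, ?_⟩
      · simp only [if_pos (show t + 1 ≤ k + 1 by omega), if_pos (show t + 2 ≤ k + 1 by omega),
          if_pos (show t ≤ k + 1 by omega), hu']
      · simp only [if_neg (show ¬ t ≤ k + 1 by omega)]
      · simp
      · simp
      · intro _
        simp only [if_pos (show k ≤ k + 1 by omega), if_pos (show 0 ≤ k + 1 by omega),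
          if_pos (show 1 ≤ k + 1 by omega)]
        rw [← add_assoc, hu']
      · simpa using hu0

/-- The number of loops that are components is small. -/
theorem exists_two_pow_le_of_loops (W : PathGraph) (S : Finset ℕ)
    (hS : ∀ e ∈ S, W.IsolatedEdge e ∧ W.a e = W.b e ∧ 3 ≤ W.len e) :
    ∃ n ∈ W.counts, 2 ^ S.card ≤ n := by
  classical
  induction S using Finset.induction_on generalizing W with
  | empty => exact ⟨1, one_mem_counts W, by simp⟩
  | insert e S heS ih =>
    obtain ⟨he, hab, hlen⟩ := hS e (Finset.mem_insert_self _ _)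
    obtain ⟨m, hm, hm'⟩ := ih (W.delEdge e) (fun f hf => by
      have hf' := hS f (Finset.mem_insert_of_mem hf)
      have hfe : f ≠ e := fun h' => heS (h' ▸ hf)
      refine ⟨⟨Finset.mem_erase.2 ⟨hfe, hf'.1.mem⟩, fun g hg hgf => ?_⟩, hf'.2⟩
      exact hf'.1.other g (Finset.mem_of_mem_erase hg) hgf)
    obtain ⟨n, hn, hn'⟩ := exists_two_le_of_loop hab hlen
    refine ⟨m * n, he.mul_mem_counts hm hn, ?_⟩
    rw [Finset.card_insert_of_notMem heS, pow_succ]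
    exact Nat.mul_le_mul hm' hn'

end PathGraph

/-! #### Disjoint stars, and a bound for the degrees -/

theorem UnitAddCircle.card_torsion {n : ℕ} (hn : 0 < n) :
    Nat.card {u : UnitAddCircle // n • u = 0} = n := by
  have h := card_circleKer (Matrix.of fun (_ _ : Unit) => (n : ℤ)) (by simp [hn.ne'])
  simp only [Matrix.det_unique, Matrix.of_apply, Int.natAbs_natCast] at h
  refine Eq.trans ?_ h
  refine Nat.card_congr (Equiv.subtypeEquiv (Equiv.funUnique Unit UnitAddCircle).symm fun u => ?_)
  simp [mem_circleKer]

/-! ### Paths with one inner vertex -/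

theorem pathRel_one_true {p s t q : UnitAddCircle} :
    pathRel 1 (fun _ => True) (fun _ => True) p s t q ↔ s = t ∧ p + s + q = 0 := by
  constructor
  · rintro ⟨z, hz, rfl, rfl, rfl, rfl⟩
    exact ⟨rfl, (hz.1 0 one_pos).2 trivial⟩
  · rintro ⟨rfl, h⟩
    refine ⟨fun i => if i = 0 then p else if i = 1 then s else if i = 2 then q else 0,
      ⟨fun i hi => ?_, fun i hi => ?_⟩, by simp, by simp, by simp, by simp⟩
    · obtain rfl : i = 0 := by omega
      simpa using h
    · simp [show i ≠ 0 by omega, show i ≠ 1 by omega, show i ≠ 2 by omega]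

theorem pathRel_one_false {p s t q : UnitAddCircle} :
    pathRel 1 (fun _ => False) (fun _ => False) p s t q ↔ s = 0 ∧ t = 0 := by
  constructor
  · rintro ⟨z, hz, rfl, rfl, rfl, rfl⟩
    exact ⟨(hz.1 0 one_pos).1 not_false, (hz.1 0 one_pos).1 not_false⟩
  · rintro ⟨rfl, rfl⟩
    refine ⟨fun i => if i = 0 then p else if i = 2 then q else 0,
      ⟨fun i hi => ?_, fun i hi => ?_⟩, by simp, by simp, by simp, by simp⟩
    · obtain rfl : i = 0 := by omega
      simp
    · simp [show i ≠ 0 by omega, show i ≠ 2 by omega]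

theorem pathRigid_one (r c : ℕ → Prop) : PathRigid 1 r c := by
  intro z hz h0 h1 _ h2
  ext t
  rcases (show t = 0 ∨ t = 1 ∨ t = 2 ∨ 2 < t by omega) with rfl | rfl | rfl | h
  exacts [h0, h1, h2, hz.2 t h]

namespace PathGraph

/-- The edges from `v` to a vertex outside of `S`. -/
def crossEdges (W : PathGraph) (S : Finset ℕ) (v : ℕ) : Finset ℕ :=
  W.L.filter fun e => (W.a e = v ∧ W.b e ∉ S) ∨ (W.b e = v ∧ W.a e ∉ S)

/-- Activate the vertices in `S` and the edges that leave `S`, and switch off the other edges. An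
active edge carries minus the value of its endpoint in `S`, so the equation at `v` reads `(1 - d) y
= 0` with `d` the number of active edges at `v`. The active part consists of disjoint stars, each
contributing the factor `d - 1`. -/
theorem prod_mem_counts (W : PathGraph) (hlen : ∀ e ∈ W.L, W.len e = 1)
    (hab : ∀ e ∈ W.L, W.a e ≠ W.b e) (S : Finset ℕ)
    (h2 : ∀ v ∈ S, 2 ≤ (W.crossEdges S v).card) :
    ∏ v ∈ S, ((W.crossEdges S v).card - 1) ∈ W.counts := by
  classical
  let X : ℕ → Prop := fun e => ¬ (W.a e ∈ S ↔ W.b e ∈ S)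
  let ρ : ℕ → EndRel := fun e => if X e then pathRel 1 (fun _ => True) (fun _ => True)
    else pathRel 1 (fun _ => False) (fun _ => False)
  let val : (ℕ → UnitAddCircle) → ℕ → UnitAddCircle := fun y e =>
    if e ∈ W.L ∧ X e then - (y (W.a e) + y (W.b e)) else 0
  have hρ : ∀ e ∈ W.L, ∀ (y d d' : ℕ → UnitAddCircle),
      (ρ e (y (W.a e)) (d e) (d' e) (y (W.b e)) ↔ d e = val y e ∧ d' e = val y e) := by
    intro e he y d d'
    by_cases hX : X e
    · simp only [ρ, if_pos hX, pathRel_one_true, val, if_pos (And.intro he hX)]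
      constructor
      · rintro ⟨h, h'⟩
        have : d e = - (y (W.a e) + y (W.b e)) := by
          rw [eq_neg_iff_add_eq_zero, ← h']; abel
        exact ⟨this, h ▸ this⟩
      · rintro ⟨h, h'⟩
        exact ⟨h.trans h'.symm, by rw [h]; abel⟩
    · have hX' : ¬ (e ∈ W.L ∧ X e) := fun h => hX h.2
      simp only [ρ, if_neg hX, pathRel_one_false, val, if_neg hX']
  have hsum : ∀ y : ℕ → UnitAddCircle, (∀ v ∉ S, y v = 0) → ∀ v ∈ S,
      W.endSum (val y) (val y) v = - ((W.crossEdges S v).card • y v) := by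
    intro y hy v hv
    have hterm : ∀ e ∈ W.L, ((if W.a e = v then val y e else 0) +
        (if W.b e = v then val y e else 0)) =
        if (W.a e = v ∧ W.b e ∉ S) ∨ (W.b e = v ∧ W.a e ∉ S) then - y v else 0 := by
      intro e he
      have hne := hab e he
      by_cases h1 : W.a e = v
      · have h1' : W.b e ≠ v := fun h => hne (h1.trans h.symm)
        by_cases h2 : W.b e ∈ S
        · have hX : ¬ X e := by simp [X, h1, hv, h2]
          simp [h1, h1', h2, val, hX]
        · have hX : X e := by simp [X, h1, hv, h2]
          simp [h1, h1', h2, val, hX, he, hy _ h2]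
      · by_cases h1' : W.b e = v
        · by_cases h2 : W.a e ∈ S
          · have hX : ¬ X e := by simp [X, h1', hv, h2]
            simp [h1, h1', h2, val, hX]
          · have hX : X e := by simp [X, h1', hv, h2]
            simp [h1, h1', h2, val, hX, he, hy _ h2]
        · simp [h1, h1']
    unfold endSum
    rw [Finset.sum_congr rfl hterm, ← Finset.sum_filter, Finset.sum_const, smul_neg]
    rfl
  have hpos : 0 < ∏ v ∈ S, ((W.crossEdges S v).card - 1) :=
    Finset.prod_pos fun v hv => by have := h2 v hv; omega
  refine ⟨hpos, fun v => v ∈ S, fun v => v ∈ S, ρ, fun v hv => ?_, fun e he => ?_, ?_⟩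
  · obtain ⟨e, he⟩ := Finset.card_pos.1 (lt_of_lt_of_le two_pos (h2 v hv))
    rw [crossEdges, Finset.mem_filter] at he
    exact ⟨e, he.1, by tauto⟩
  · rw [hlen e he]
    by_cases hX : X e
    · simp only [ρ, if_pos hX]
      exact ⟨_, _, pathRigid_one _ _, rfl⟩
    · simp only [ρ, if_neg hX]
      exact ⟨_, _, pathRigid_one _ _, rfl⟩
  · have h1 : ∏ v ∈ S, ((W.crossEdges S v).card - 1) =
        Nat.card (∀ v : S, {u : UnitAddCircle // ((W.crossEdges S v).card - 1) • u = 0}) := by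
      rw [Nat.card_pi, ← Finset.prod_coe_sort]
      refine Finset.prod_congr rfl fun v _ => ?_
      rw [UnitAddCircle.card_torsion]
      have := h2 v v.2
      omega
    rw [h1]
    have heq : ∀ v ∈ S, ∀ u : UnitAddCircle, u + - ((W.crossEdges S v).card • u) = 0 ↔
        ((W.crossEdges S v).card - 1) • u = 0 := by
      intro v hv u
      have := h2 v hv
      conv_lhs => rw [show (W.crossEdges S v).card = (W.crossEdges S v).card - 1 + 1 by omega]
      rw [succ_nsmul, neg_add, ← add_assoc, add_comm u, add_assoc, add_neg_cancel, add_zero,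
        neg_eq_zero]
    let ext : (∀ v : S, {u : UnitAddCircle // ((W.crossEdges S v).card - 1) • u = 0}) →
        ℕ → UnitAddCircle := fun w v => if hv : v ∈ S then (w ⟨v, hv⟩).1 else 0
    have hextS : ∀ w v, v ∉ S → ext w v = 0 := fun w v hv => dif_neg hv
    refine Nat.card_congr
      { toFun := fun w => ⟨(ext w, val (ext w), val (ext w)), ?_⟩
        invFun := fun x => fun v => ⟨x.1.1 v, ?_⟩
        left_inv := ?_
        right_inv := ?_ }
    · refine ⟨fun e he => (hρ e he _ _ _).2 ⟨rfl, rfl⟩, fun e he => ?_, hextS w, fun v hv => ?_⟩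
      · simp [val, he]
      · rw [hsum _ (hextS w) v hv, heq v hv]
        simp only [ext, dif_pos hv]
        exact (w ⟨v, hv⟩).2
    · obtain ⟨⟨y, d, d'⟩, g1, g2, g3, g4⟩ := x
      rw [← heq v v.2]
      have := g4 v v.2
      rw [← hsum y g3 v v.2]
      refine Eq.trans ?_ this
      refine congrArg (y v + ·) ?_
      exact endSum_congr' (fun e he => ((hρ e he y d d').1 (g1 e he)).1.symm)
        (fun e he => ((hρ e he y d d').1 (g1 e he)).2.symm)
    · intro w
      funext v
      refine Subtype.ext ?_
      simp [ext]
    · rintro ⟨⟨y, d, d'⟩, g1, g2, g3, g4⟩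
      refine Subtype.ext ?_
      have hval : ∀ e ∉ W.L, val y e = 0 := fun e he => by simp [val, he]
      have hd : val y = d := by
        ext e
        by_cases he : e ∈ W.L
        · exact ((hρ e he y d d').1 (g1 e he)).1.symm
        · rw [hval e he]; exact (g2 e he).1.symm
      have hd' : val y = d' := by
        ext e
        by_cases he : e ∈ W.L
        · exact ((hρ e he y d d').1 (g1 e he)).2.symm
        · rw [hval e he]; exact (g2 e he).2.symm
      have hy : ∀ w : (∀ v : S, {u : UnitAddCircle // ((W.crossEdges S v).card - 1) • u = 0}),
          (∀ v, (w v).1 = y v) → (ext w, val (ext w), val (ext w)) = (y, d, d') := by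
        intro w hw
        have hwy : ext w = y := by
          ext v
          by_cases hv : v ∈ S
          · simp only [ext, dif_pos hv, hw]
          · rw [hextS w v hv]
            exact (g3 v hv).symm
        rw [hwy]
        nth_rw 1 [hd]
        rw [hd']
      have hmem : ∀ v : S, ((W.crossEdges S v).card - 1) • y v = 0 := by
        intro v
        rw [← heq v v.2, ← hsum y g3 v v.2, hd]
        nth_rw 2 [← hd]
        rw [hd']
        exact g4 v v.2
      exact hy (fun v => ⟨y v, hmem v⟩) fun v => rfl

/-- The number of edges at the vertex `v`. -/
def edgeDeg (W : PathGraph) (v : ℕ) : ℕ := (W.L.filter fun e => W.a e = v ∨ W.b e = v).card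

/-- The number of edges from the vertex `v` to vertices of colour `j`. -/
def colourDeg (W : PathGraph) (f : ℕ → Fin 4) (v : ℕ) (j : Fin 4) : ℕ :=
  (W.L.filter fun e => (W.a e = v ∧ f (W.b e) = j) ∨ (W.b e = v ∧ f (W.a e) = j)).card

/-- A colouring with four colours exists for which at most a quarter of the edges at each vertex
joins it to a vertex of the same colour. -/
theorem exists_colouring (W : PathGraph) (hab : ∀ e ∈ W.L, W.a e ≠ W.b e) :
    ∃ f : ℕ → Fin 4, ∀ v, 4 * W.colourDeg f v (f v) ≤ W.edgeDeg v := by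
  classical
  -- A colouring with the largest number of bichromatic edges will do.
  let B : (ℕ → Fin 4) → ℕ := fun f => (W.L.filter fun e => f (W.a e) ≠ f (W.b e)).card
  have hbdd : BddAbove (Set.range B) :=
    ⟨W.L.card, by rintro _ ⟨f, rfl⟩; exact Finset.card_filter_le _ _⟩
  obtain ⟨f, hf⟩ := Nat.sSup_mem (Set.range_nonempty B) hbdd
  have hmax : ∀ g, B g ≤ B f := fun g => by
    rw [hf]; exact le_csSup hbdd ⟨g, rfl⟩
  refine ⟨f, fun v => ?_⟩
  -- The right-hand side does not depend on the colour of `v`; recolouring only trades bichromatic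
  -- edges for monochromatic ones at `v`. By maximality the own colour is the rarest among the
  -- neighbours, hence accounts for at most a quarter of them.
  have hB : ∀ g : ℕ → Fin 4, B g + W.colourDeg g v (g v) =
      (W.L.filter fun e => g (W.a e) ≠ g (W.b e) ∨ W.a e = v ∨ W.b e = v).card := by
    intro g
    unfold colourDeg
    rw [← Finset.card_union_of_disjoint]
    · congr 1
      ext e
      simp only [Finset.mem_union, Finset.mem_filter]
      constructor
      · rintro (⟨he, h⟩ | ⟨he, h | h⟩)
        · exact ⟨he, Or.inl h⟩
        · exact ⟨he, Or.inr (Or.inl h.1)⟩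
        · exact ⟨he, Or.inr (Or.inr h.1)⟩
      · rintro ⟨he, h⟩
        by_cases hg : g (W.a e) = g (W.b e)
        · rcases h with h | h | h
          · exact absurd hg h
          · exact Or.inr ⟨he, Or.inl ⟨h, by rw [← hg, h]⟩⟩
          · exact Or.inr ⟨he, Or.inr ⟨h, by rw [hg, h]⟩⟩
        · exact Or.inl ⟨he, hg⟩
    · rw [Finset.disjoint_filter]
      rintro e he hne (⟨rfl, h⟩ | ⟨rfl, h⟩)
      · exact hne h.symm
      · exact hne h
  have hle : ∀ j, W.colourDeg f v (f v) ≤ W.colourDeg f v j := by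
    intro j
    have h1 := hB f
    have h2 := hB (Function.update f v j)
    have h3 := hmax (Function.update f v j)
    have h4 : W.colourDeg (Function.update f v j) v (Function.update f v j v) =
        W.colourDeg f v j := by
      unfold colourDeg
      congr 1
      refine Finset.filter_congr fun e he => ?_
      have hne := hab e he
      rw [Function.update_self]
      refine or_congr (and_congr_right fun h => ?_) (and_congr_right fun h => ?_)
      · rw [Function.update_of_ne (fun h' => hne (h.trans h'.symm))]
      · rw [Function.update_of_ne (fun h' => hne (h'.trans h.symm))]
    have h5 : (W.L.filter fun e => Function.update f v j (W.a e) ≠ Function.update f v j (W.b e) ∨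
        W.a e = v ∨ W.b e = v) = W.L.filter fun e => f (W.a e) ≠ f (W.b e) ∨
        W.a e = v ∨ W.b e = v := by
      refine Finset.filter_congr fun e he => ?_
      by_cases ha : W.a e = v
      · simp [ha]
      · by_cases hb : W.b e = v
        · simp [hb]
        · simp [ha, hb]
    rw [h4, h5] at h2
    omega
  have hsum : ∑ j, W.colourDeg f v j = W.edgeDeg v := by
    unfold colourDeg edgeDeg
    let g : ℕ → Fin 4 := fun e => if W.a e = v then f (W.b e) else f (W.a e)
    rw [Finset.card_eq_sum_card_fiberwise (f := g) (t := Finset.univ) (by simp)]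
    refine Finset.sum_congr rfl fun j _ => ?_
    congr 1
    ext e
    simp only [Finset.mem_filter]
    constructor
    · rintro ⟨he, ⟨h, h'⟩ | ⟨h, h'⟩⟩
      · exact ⟨⟨he, Or.inl h⟩, by simp only [g, if_pos h, h']⟩
      · have : W.a e ≠ v := fun h'' => hab e he (h''.trans h.symm)
        exact ⟨⟨he, Or.inr h⟩, by simp only [g, if_neg this, h']⟩
    · rintro ⟨⟨he, h⟩, h'⟩
      by_cases ha : W.a e = v
      · simp only [g, if_pos ha] at h'
        exact ⟨he, Or.inl ⟨ha, h'⟩⟩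
      · simp only [g, if_neg ha] at h'
        exact ⟨he, Or.inr ⟨h.resolve_left ha, h'⟩⟩
  rw [Fin.sum_univ_four] at hsum
  have := hle 0; have := hle 1; have := hle 2; have := hle 3
  omega

theorem one_add_sum_le_prod_one_add (S : Finset ℕ) (y : ℕ → ℕ) :
    1 + ∑ v ∈ S, y v ≤ ∏ v ∈ S, (1 + y v) := by
  classical
  induction S using Finset.induction_on with
  | empty => simp
  | insert v S hv ih =>
    rw [Finset.sum_insert hv, Finset.prod_insert hv]
    have : 1 ≤ ∏ v ∈ S, (1 + y v) := le_trans (by omega) ih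
    nlinarith [Nat.zero_le (y v)]

/-- The degrees that are at least three have a small sum. -/
theorem sum_edgeDeg_le (W : PathGraph) (hlen : ∀ e ∈ W.L, W.len e = 1)
    (hab : ∀ e ∈ W.L, W.a e ≠ W.b e) {M : ℕ} (hM : ∀ n ∈ W.counts, n ≤ M) (X : Finset ℕ)
    (hX : ∀ v ∈ X, 3 ≤ W.edgeDeg v) : ∑ v ∈ X, W.edgeDeg v ≤ 16 * M := by
  classical
  obtain ⟨f, hf⟩ := W.exists_colouring hab
  -- Each colour class is treated as the set of centres of disjoint stars; the four classes together
  -- give the factor 16.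
  have key : ∀ j, ∑ v ∈ X with f v = j, W.edgeDeg v ≤ 4 * M := by
    intro j
    set S := X.filter fun v => f v = j with hS
    have hcross : ∀ v ∈ S, W.edgeDeg v ≤ (W.crossEdges S v).card + W.colourDeg f v (f v) := by
      intro v hv
      have hvj : f v = j := (Finset.mem_filter.1 hv).2
      unfold edgeDeg crossEdges colourDeg
      refine le_trans (Finset.card_le_card ?_) (Finset.card_union_le _ _)
      intro e he
      simp only [Finset.mem_union, Finset.mem_filter] at he ⊢
      have hSj : ∀ u, u ∈ S → f u = f v := fun u hu => by
        rw [hvj]; exact (Finset.mem_filter.1 hu).2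
      rcases he with ⟨he, h | h⟩
      · by_cases hb : W.b e ∈ S
        · exact Or.inr ⟨he, Or.inl ⟨h, hSj _ hb⟩⟩
        · exact Or.inl ⟨he, Or.inl ⟨h, hb⟩⟩
      · by_cases ha : W.a e ∈ S
        · exact Or.inr ⟨he, Or.inr ⟨h, hSj _ ha⟩⟩
        · exact Or.inl ⟨he, Or.inr ⟨h, ha⟩⟩
    -- At most a quarter of the edges at `v` stay inside `S`. For degree at least three this leaves
    -- three or more crossing edges, and enough that four times their number less two is at least
    -- the degree.
    have hbound : ∀ v ∈ S, 3 ≤ (W.crossEdges S v).card ∧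
        W.edgeDeg v ≤ 4 * ((W.crossEdges S v).card - 2) := by
      intro v hv
      have h1 := hcross v hv
      have h2 := hf v
      have h3 := hX v (Finset.mem_filter.1 hv).1
      omega
    have hprod := hM _ (W.prod_mem_counts hlen hab S fun v hv => by
      have := (hbound v hv).1; omega)
    have hprod' : ∏ v ∈ S, ((W.crossEdges S v).card - 1) =
        ∏ v ∈ S, (1 + ((W.crossEdges S v).card - 2)) :=
      Finset.prod_congr rfl fun v hv => by have := (hbound v hv).1; omega
    rw [hprod'] at hprod
    have h4 := one_add_sum_le_prod_one_add S fun v => (W.crossEdges S v).card - 2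
    calc ∑ v ∈ S, W.edgeDeg v ≤ ∑ v ∈ S, 4 * ((W.crossEdges S v).card - 2) :=
          Finset.sum_le_sum fun v hv => (hbound v hv).2
      _ = 4 * ∑ v ∈ S, ((W.crossEdges S v).card - 2) := by rw [Finset.mul_sum]
      _ ≤ 4 * M := by omega
  rw [← Finset.sum_fiberwise X f]
  have h0 := key 0; have h1 := key 1; have h2 := key 2; have h3 := key 3
  rw [Fin.sum_univ_four]
  omega

end PathGraph

/-! #### Graphs without subdivisions and matrices -/

/-- Without inner vertices the positions `0` and `1` are the two ends, so the value next to either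
end is the value at the other end. -/
theorem mem_pathTypes_zero {ρ : EndRel} :
    ρ ∈ pathTypes 0 ↔ ρ = fun p s t q => s = q ∧ t = p := by
  have h : ∀ r c, PathRigid 0 r c ∧ pathRel 0 r c = fun p s t q => s = q ∧ t = p := by
    intro r c
    refine ⟨fun z hz h0 h1 _ _ => ?_, ?_⟩
    · ext t
      rcases (show t = 0 ∨ t = 1 ∨ 1 < t by omega) with rfl | rfl | h
      exacts [h0, h1, hz.2 t h]
    · funext p s t q
      refine propext ⟨?_, ?_⟩
      · rintro ⟨z, hz, rfl, rfl, rfl, rfl⟩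
        exact ⟨rfl, rfl⟩
      · rintro ⟨rfl, rfl⟩
        refine ⟨fun i => if i = 0 then t else if i = 1 then s else 0, ⟨fun i hi => absurd hi
          (Nat.not_lt_zero i), fun i hi => ?_⟩, by simp, by simp, by simp, by simp⟩
        simp [show i ≠ 0 by omega, show i ≠ 1 by omega]
  constructor
  · rintro ⟨r, c, -, rfl⟩
    exact (h r c).2
  · rintro rfl
    exact ⟨fun _ => True, fun _ => True, (h _ _).1, (h _ _).2.symm⟩

namespace PathGraph

/-- If no edge has inner vertices, the end values are copies of vertex values, and the system on `W`
is the one that `minorSol` attaches to the identity plus the adjacency matrix, loops and multiple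
edges included. -/
theorem isGreatest_counts {ι : Type*} [Fintype ι] [DecidableEq ι] (W : PathGraph)
    (hlen : ∀ e ∈ W.L, W.len e = 0) (f : ι ↪ ℕ)
    (hf : ∀ e ∈ W.L, W.a e ∈ Set.range f ∧ W.b e ∈ Set.range f) (A : Matrix ι ι ℤ)
    (hA : ∀ i j, A i j = (if i = j then 1 else 0) + ∑ e ∈ W.L,
      ((if W.a e = f i ∧ W.b e = f j then 1 else 0) +
        (if W.b e = f i ∧ W.a e = f j then 1 else 0))) :
    IsGreatest W.counts (maxSubdet A) := by
  classical
  let ρ₀ : EndRel := fun p s t q => s = q ∧ t = p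
  have hsum : ∀ (y : ℕ → UnitAddCircle) (i : ι), ∑ j, A i j • y (f j) = y (f i) +
      ∑ e ∈ W.L, ((if W.a e = f i then y (W.b e) else 0) +
        (if W.b e = f i then y (W.a e) else 0)) := by
    intro y i
    have hone : ∀ (u v : ℕ), v ∈ Set.range f → ∑ j, (if u = f i ∧ v = f j then (1 : ℤ) else 0) •
        y (f j) = if u = f i then y v else 0 := by
      rintro u _ ⟨k, rfl⟩
      by_cases hu : u = f i
      · simp [hu, f.injective.eq_iff, ite_smul]
      · simp [hu]
    simp only [hA, add_smul, Finset.sum_add_distrib, Finset.sum_smul]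
    congr 1
    · simp [ite_smul]
    · congr 1
      · rw [Finset.sum_comm]
        exact Finset.sum_congr rfl fun e he => hone _ _ (hf e he).2
      · rw [Finset.sum_comm]
        exact Finset.sum_congr rfl fun e he => hone _ _ (hf e he).1
  have htouch : ∀ v, W.Touched v → v ∈ Set.range f := by
    rintro v ⟨e, he, rfl | rfl⟩
    exacts [(hf e he).1, (hf e he).2]
  have hcard : ∀ (r c : ℕ → Prop) (ρ : ℕ → EndRel), (∀ v, r v → W.Touched v) →
      (∀ e ∈ W.L, ρ e = ρ₀) →
      Nat.card (W.sol r c ρ) = Nat.card (minorSol A {i | r (f i)} {i | c (f i)}) := by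
    intro r c ρ hr hρ
    have hends : ∀ x ∈ W.sol r c ρ, ∀ e ∈ W.L, x.2.1 e = x.1 (W.b e) ∧ x.2.2 e = x.1 (W.a e) := by
      intro x hx e he
      have := hx.1 e he
      rw [hρ e he] at this
      exact this
    have hsumx : ∀ (y d d' : ℕ → UnitAddCircle), (∀ e ∈ W.L, d e = y (W.b e) ∧ d' e = y (W.a e)) →
        ∀ i, ∑ j, A i j • y (f j) = y (f i) + W.endSum d d' (f i) := by
      intro y d d' hd i
      rw [hsum]
      congr 1
      exact Finset.sum_congr rfl fun e he => by rw [(hd e he).1, (hd e he).2]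
    let ext : (ι → UnitAddCircle) → ℕ → UnitAddCircle := fun y => Function.extend f y 0
    have hext : ∀ y i, ext y (f i) = y i := fun y i => f.injective.extend_apply _ _ _
    have hext' : ∀ y v, v ∉ Set.range f → ext y v = 0 := fun y v hv =>
      Function.extend_apply' _ _ _ (by simpa using hv)
    refine Nat.card_congr
      { toFun := fun x => ⟨fun i => x.1.1 (f i), fun i hi => x.2.2.2.1 _ hi, fun i hi => ?_⟩
        invFun := fun y => ⟨(ext y.1, fun e => if e ∈ W.L then ext y.1 (W.b e) else 0,
          fun e => if e ∈ W.L then ext y.1 (W.a e) else 0), fun e he => ?_, fun e he => ?_,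
          fun v hv => ?_, fun v hv => ?_⟩
        left_inv := ?_
        right_inv := ?_ }
    · rw [hsumx _ _ _ (hends x.1 x.2)]
      exact x.2.2.2.2 _ hi
    · rw [hρ e he]
      simp only [if_pos he]
      exact ⟨rfl, rfl⟩
    · simp [he]
    · by_cases hvf : v ∈ Set.range f
      · obtain ⟨i, rfl⟩ := hvf
        simp only [hext]
        exact y.2.1 i hv
      · exact hext' _ _ hvf
    · by_cases hvf : v ∈ Set.range f
      · obtain ⟨i, rfl⟩ := hvf
        rw [← hsumx _ _ _ (fun e he => ⟨if_pos he, if_pos he⟩)]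
        simp only [hext]
        exact y.2.2 i hv
      · simp only [hext' _ _ hvf, zero_add]
        refine Finset.sum_eq_zero fun e he => ?_
        have ha : W.a e ≠ v := fun h => hvf (h ▸ (hf e he).1)
        have hb : W.b e ≠ v := fun h => hvf (h ▸ (hf e he).2)
        simp [ha, hb]
    · rintro ⟨⟨y, d, d'⟩, hx⟩
      have hy : ext (fun i => y (f i)) = y := by
        ext v
        by_cases hvf : v ∈ Set.range f
        · obtain ⟨i, rfl⟩ := hvf
          exact hext _ _
        · rw [hext' _ _ hvf]
          exact (hx.2.2.1 v fun h => hvf (htouch v (hr v h))).symm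
      refine Subtype.ext ?_
      simp only [hy, Prod.mk.injEq, true_and]
      constructor
      · ext e
        by_cases he : e ∈ W.L
        · simp only [if_pos he]
          exact ((hends _ hx e he).1).symm
        · simp only [if_neg he]
          exact (hx.2.1 e he).1.symm
      · ext e
        by_cases he : e ∈ W.L
        · simp only [if_pos he]
          exact ((hends _ hx e he).2).symm
        · simp only [if_neg he]
          exact (hx.2.1 e he).2.symm
    · rintro ⟨y, hy⟩
      refine Subtype.ext ?_
      ext i
      exact hext _ _
  constructor
  · obtain ⟨R, C, hRC⟩ := exists_card_minorSol_eq A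
    have hpos : 0 < Nat.card (minorSol A R C) := by rw [hRC]; exact one_le_maxSubdet A
    let r : ℕ → Prop := fun v => W.Touched v ∧ ∃ i ∈ R, f i = v
    let c : ℕ → Prop := fun v => ∃ i ∈ C, f i = v
    refine ⟨one_le_maxSubdet A, r, c, fun _ => ρ₀, fun v hv => hv.1, fun e he => ?_, ?_⟩
    · rw [hlen e he, mem_pathTypes_zero]
    · rw [hcard r c _ (fun v hv => hv.1) (fun _ _ => rfl), ← hRC]
      congr 2
      have hC : {i | c (f i)} = C := by
        ext i
        simp [c, f.injective.eq_iff]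
      rw [hC]
      have hR : ∀ i, r (f i) ↔ W.Touched (f i) ∧ i ∈ R := by
        intro i
        simp [r, f.injective.eq_iff]
      ext y
      refine and_congr_left fun hy => forall_congr' fun i => ?_
      simp only [Set.mem_ofPred_eq, hR]
      by_cases ht : W.Touched (f i)
      · simp [ht]
      · have hdiag : ∀ j, A i j = if i = j then 1 else 0 := by
          intro j
          rw [hA, Finset.sum_eq_zero, add_zero]
          intro e he
          have ha : W.a e ≠ f i := fun h => ht ⟨e, he, Or.inl h⟩
          have hb : W.b e ≠ f i := fun h => ht ⟨e, he, Or.inr h⟩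
          simp [ha, hb]
        have hdiag' : ∀ j, A j i = if j = i then 1 else 0 := by
          intro j
          rw [hA, Finset.sum_eq_zero, add_zero]
          intro e he
          have ha : W.a e ≠ f i := fun h => ht ⟨e, he, Or.inl h⟩
          have hb : W.b e ≠ f i := fun h => ht ⟨e, he, Or.inr h⟩
          simp [ha, hb]
        -- Vertices on no edge are excluded from `r`. Nothing is lost: row and column of such a
        -- vertex are those of the unit matrix, so its equation forces zero, and if only the column
        -- were selected there would be infinitely many solutions.
        simp only [ht, false_and, not_false_eq_true, true_implies]
        by_cases hiC : i ∈ C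
        · have h0 : y i = 0 := by simpa [hdiag, ite_smul] using hy i hiC
          simp [h0]
        · by_cases hiR : i ∈ R
          · exfalso
            have hinf := minorSol_infinite A R C (Pi.single i 1) (by simp)
              (fun j hj => Pi.single_eq_of_ne (by rintro rfl; exact hj hiR) _)
              (fun j hj => by
                have hji : j ≠ i := fun h => hiC (h ▸ hj)
                simp [Pi.single_apply, hdiag', hji])
            have := hinf.to_subtype
            simp at hpos
          · simp [hiR]
  · rintro n ⟨hn, r, c, ρ, hr, hρ, rfl⟩
    rw [hcard r c ρ hr fun e he => by
      have := hρ e he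
      rwa [hlen e he, mem_pathTypes_zero] at this]
    exact card_minorSol_le A _ _

end PathGraph

/-! #### Contracting and expanding regardless of orientation -/

namespace PathGraph

theorem exists_oriented (W : PathGraph) {i p v : ℕ}
    (h : (W.a i = p ∧ W.b i = v) ∨ (W.a i = v ∧ W.b i = p)) :
    ∃ W' : PathGraph, W'.counts = W.counts ∧ W'.L = W.L ∧ W'.len = W.len ∧
      (W'.a i = p ∧ W'.b i = v) ∧ ∀ e ≠ i, W'.a e = W.a e ∧ W'.b e = W.b e := by
  rcases h with h | h
  · exact ⟨W, rfl, rfl, rfl, h, fun _ _ => ⟨rfl, rfl⟩⟩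
  · refine ⟨W.flip i, W.counts_flip i, rfl, rfl, ?_, fun e he => ?_⟩
    · simp [flip, h.1, h.2]
    · simp [flip, Function.update_of_ne he]

/-- The contraction of a vertex of degree two. -/
theorem counts_contract (W : PathGraph) {i j v p q l : ℕ} (hi : i ∈ W.L) (hj : j ∈ W.L)
    (hij : i ≠ j) (hei : (W.a i = p ∧ W.b i = v) ∨ (W.a i = v ∧ W.b i = p)) (hp : p ≠ v)
    (hej : (W.a j = q ∧ W.b j = v) ∨ (W.a j = v ∧ W.b j = q)) (hq : q ≠ v)
    (hother : ∀ e ∈ W.L, e ≠ i → e ≠ j → W.a e ≠ v ∧ W.b e ≠ v)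
    (hl : pathTypes l = pathTypes (W.len i + W.len j + 1)) :
    (PathGraph.mk (W.L.erase j) (Function.update W.a i p) (Function.update W.b i q)
      (Function.update W.len i l)).counts = W.counts := by
  obtain ⟨W₁, h1, h1L, h1l, h1i, h1o⟩ := W.exists_oriented hei
  have hej' : (W₁.a j = v ∧ W₁.b j = q) ∨ (W₁.a j = q ∧ W₁.b j = v) := by
    rw [(h1o j hij.symm).1, (h1o j hij.symm).2]
    exact hej.symm
  obtain ⟨W₂, h2, h2L, h2l, h2j, h2o⟩ := W₁.exists_oriented hej'
  have hL : W₂.L = W.L := h2L.trans h1L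
  have hlen : W₂.len = W.len := h2l.trans h1l
  have hi2 : W₂.a i = p ∧ W₂.b i = v := by
    rw [(h2o i hij).1, (h2o i hij).2]
    exact h1i
  have ho2 : ∀ e, e ≠ i → e ≠ j → W₂.a e = W.a e ∧ W₂.b e = W.b e := fun e hei hej => by
    rw [(h2o e hej).1, (h2o e hej).2, (h1o e hei).1, (h1o e hei).2]
    exact ⟨rfl, rfl⟩
  have hJ : W₂.IsJoint i j v :=
    { hi := hL ▸ hi
      hj := hL ▸ hj
      hij := hij
      hbi := hi2.2
      haj := h2j.1
      hai := by rw [hi2.1]; exact hp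
      hbj := by rw [h2j.2]; exact hq
      other := fun e he h h' => by
        rw [(ho2 e h h').1, (ho2 e h h').2]
        exact hother e (hL ▸ he) h h' }
  rw [← h1, ← h2, ← hJ.counts_merge]
  refine counts_congr ?_ (fun e he => ?_) (fun e he => ?_) (fun e he => ?_)
  · simp only [merge, hL]
  all_goals
    simp only [Finset.mem_erase] at he
    simp only [merge]
    by_cases hei : e = i
    · subst hei
      simp [hi2.1, h2j.2, hl, hlen]
    · simp [Function.update_of_ne hei, (ho2 e hei he.1).1, (ho2 e hei he.1).2, hlen]

/-- The reverse operation: an inner vertex next to the first end of the edge `i` becomes the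
vertex `s`, and `j` the edge that leads to it. -/
theorem counts_expand (W : PathGraph) {i j s l : ℕ} (hi : i ∈ W.L) (hj : j ∉ W.L)
    (hs : ¬ W.Touched s) (hl : W.len i = l + 1) :
    (PathGraph.mk (insert j W.L) (Function.update (Function.update W.a j (W.a i)) i s)
      (Function.update W.b j s) (Function.update (Function.update W.len j 0) i l)).counts =
      W.counts := by
  have hij : i ≠ j := fun h => hj (h ▸ hi)
  have hsa : ∀ e ∈ W.L, W.a e ≠ s ∧ W.b e ≠ s := fun e he =>
    ⟨fun h => hs ⟨e, he, Or.inl h⟩, fun h => hs ⟨e, he, Or.inr h⟩⟩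
  -- Expansion is contraction of the new vertex read backwards, up to the orientation of the edge
  -- `i`.
  have h := counts_contract (PathGraph.mk (insert j W.L)
    (Function.update (Function.update W.a j (W.a i)) i s)
    (Function.update W.b j s) (Function.update (Function.update W.len j 0) i l))
    (i := i) (j := j) (v := s) (p := W.b i) (q := W.a i) (l := l + 1)
    (Finset.mem_insert_of_mem hi) (Finset.mem_insert_self _ _) hij
    (Or.inr (by simp [Function.update_of_ne hij])) (hsa i hi).2
    (Or.inl (by simp [Function.update_of_ne hij.symm])) (hsa i hi).1 ?_ ?_
  · rw [← h, ← W.counts_flip i]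
    refine counts_congr ?_ (fun e he => ?_) (fun e he => ?_) (fun e he => ?_)
    · simp [flip, Finset.erase_insert hj]
    all_goals
      simp only [Finset.erase_insert hj] at he
      have hej : e ≠ j := fun h => hj (h ▸ he)
      simp only [flip]
      by_cases hei : e = i
      · subst hei
        simp [hl]
      · simp [Function.update_of_ne hei, Function.update_of_ne hej]
  · intro e he hei hej
    have he' : e ∈ W.L := (Finset.mem_insert.1 he).resolve_left hej
    simpa [Function.update_of_ne hei, Function.update_of_ne hej] using hsa e he'
  · simp [Function.update_of_ne hij.symm]

end PathGraph

/-! #### The graph of an edge list -/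

namespace EdgeList

variable {V : Type*} {G : SimpleGraph V} (e : EdgeList G)

/-- The number of the first endpoint of the edge with a given number. -/
noncomputable def fstNum (i : ℕ) : ℕ :=
  if h : i < Nat.card G.edgeSet then (e.num (e.fst ⟨i, h⟩) : ℕ) else 0

/-- The number of the second endpoint of the edge with a given number. -/
noncomputable def sndNum (i : ℕ) : ℕ :=
  if h : i < Nat.card G.edgeSet then (e.num (e.snd ⟨i, h⟩) : ℕ) else 0

theorem fst_ne_snd (i : Fin (Nat.card G.edgeSet)) : e.fst i ≠ e.snd i := by
  intro h
  have h1 := (e.edge i).2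
  rw [e.edge_eq i, h] at h1
  exact G.loopless.irrefl _ h1

theorem fstNum_ne_sndNum {i : ℕ} (hi : i < Nat.card G.edgeSet) : e.fstNum i ≠ e.sndNum i := by
  simp only [fstNum, sndNum, dif_pos hi]
  intro h
  exact e.fst_ne_snd _ (e.num.injective (Fin.ext h))

theorem fstNum_lt {i : ℕ} (hi : i < Nat.card G.edgeSet) : e.fstNum i < Nat.card V := by
  simp only [fstNum, dif_pos hi]
  exact Fin.is_lt _

theorem sndNum_lt {i : ℕ} (hi : i < Nat.card G.edgeSet) : e.sndNum i < Nat.card V := by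
  simp only [sndNum, dif_pos hi]
  exact Fin.is_lt _

/-- The graph of the edge list, in which every edge has one inner vertex. -/
noncomputable def pathGraph : PathGraph where
  L := Finset.range (Nat.card G.edgeSet)
  a := e.fstNum
  b := e.sndNum
  len := fun _ => 1

/-- The graph of the edge list in which the first `k` edges have been subdivided. -/
noncomputable def subdivided (k : ℕ) : PathGraph where
  L := Finset.range (Nat.card G.edgeSet + k)
  a := fun i => if i < Nat.card G.edgeSet then if i < k then Nat.card V + i else e.fstNum i
    else e.fstNum (i - Nat.card G.edgeSet)
  b := fun i => if i < Nat.card G.edgeSet then e.sndNum i else Nat.card V +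
    (i - Nat.card G.edgeSet)
  len := fun i => if i < Nat.card G.edgeSet ∧ k ≤ i then 1 else 0

/-- The edges are subdivided one by one with `PathGraph.counts_expand`. The new vertex on edge `i`
is `|V| + i`; the name `i` stays with the half at the second endpoint, and `|E| + i` is the half at
the first. -/
theorem counts_subdivided {k : ℕ} (hk : k ≤ Nat.card G.edgeSet) :
    (e.subdivided k).counts = e.pathGraph.counts := by
  induction k with
  | zero =>
    refine PathGraph.counts_congr (by simp [-Nat.card_coe_set_eq, -Nat.card_eq_fintype_card,
      subdivided, pathGraph]) ?_ ?_ ?_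
    all_goals
      intro i hi
      have hi' : i < Nat.card G.edgeSet := by
        simpa [-Nat.card_coe_set_eq, -Nat.card_eq_fintype_card, subdivided] using hi
      simp [-Nat.card_coe_set_eq, -Nat.card_eq_fintype_card, subdivided, pathGraph, hi']
  | succ k ih =>
    rw [← ih (by omega)]
    set m := Nat.card G.edgeSet with hm
    have hkm : k < m := hk
    have h := PathGraph.counts_expand (e.subdivided k) (i := k) (j := m + k)
      (s := Nat.card V + k) (l := 0)
      (by simp only [subdivided, ← hm, Finset.mem_range]; omega)
      (by simp only [subdivided, ← hm, Finset.mem_range]; omega)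
      ?_ (by simp [-Nat.card_coe_set_eq, -Nat.card_eq_fintype_card, subdivided, ← hm, hkm])
    · rw [← h]
      refine PathGraph.counts_congr ?_ ?_ ?_ ?_
      · simp only [subdivided, ← hm]
        ext i
        simp only [Finset.mem_range, Finset.mem_insert]
        omega
      all_goals
        intro i hi
        have hi' : i < m + (k + 1) := by
          simpa [-Nat.card_coe_set_eq, -Nat.card_eq_fintype_card, subdivided, ← hm] using hi
        simp only [subdivided, ← hm]
        by_cases h1 : i = k
        · subst h1
          simp [hkm, Function.update_of_ne (show i ≠ m + i by omega)]
        · by_cases h2 : i = m + k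
          · subst h2
            simp [hkm, show ¬ (m + k < m) by omega,
              Function.update_of_ne (show m + k ≠ k by omega)]
          · by_cases h3 : i < m
            · rcases lt_or_gt_of_ne h1 with h4 | h4
              · simp [Function.update_of_ne h1, Function.update_of_ne h2, h3, h4,
                  show i < k + 1 by omega, show ¬ k ≤ i by omega, show ¬ k + 1 ≤ i by omega]
              · simp [Function.update_of_ne h1, Function.update_of_ne h2, h3,
                  show ¬ i < k by omega, show ¬ i < k + 1 by omega, show k + 1 ≤ i by omega,
                  show k ≤ i by omega]
            · simp [Function.update_of_ne h1, Function.update_of_ne h2, h3]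
    · rintro ⟨i, hi, h | h⟩
      all_goals
        simp only [subdivided, ← hm, Finset.mem_range] at hi h
        split_ifs at h
        all_goals first
          | omega
          | (have := e.fstNum_lt (i := i) (by omega); omega)
          | (have := e.sndNum_lt (i := i) (by omega); omega)
          | (have := e.fstNum_lt (i := i - m) (by omega); omega)

/-- Once all edges are subdivided, the vertices are those of `V ⊕ G.edgeSet`, adjacency is
incidence, and the identity plus the adjacency matrix is M(G). -/
theorem isGreatest_counts_pathGraph [Finite V] :
    IsGreatest e.pathGraph.counts G.subdetDelta := by
  classical
  have : Fintype V := Fintype.ofFinite V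
  have : Fintype G.edgeSet := Fintype.ofFinite _
  rw [← e.counts_subdivided le_rfl]
  set n := Nat.card V with hn
  set m := Nat.card G.edgeSet with hm
  let f : V ⊕ G.edgeSet ↪ ℕ :=
    ⟨Sum.elim (fun v => (e.num v : ℕ)) (fun x => n + (e.edge.symm x : ℕ)), by
      rintro (v | x) (w | y) h
      · exact congrArg Sum.inl (e.num.injective (Fin.ext h))
      · simp only [Sum.elim_inl, Sum.elim_inr] at h
        have := (e.num v).2
        omega
      · simp only [Sum.elim_inl, Sum.elim_inr] at h
        have := (e.num w).2
        omega
      · simp only [Sum.elim_inr, Nat.add_left_cancel_iff] at h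
        exact congrArg Sum.inr (e.edge.symm.injective (Fin.ext h))⟩
  have hfV : ∀ k < n, k ∈ Set.range f := fun k hk =>
    ⟨Sum.inl (e.num.symm ⟨k, hk⟩), by simp [f]⟩
  have hfE : ∀ k < m, n + k ∈ Set.range f := fun k hk =>
    ⟨Sum.inr (e.edge ⟨k, hk⟩), congrArg (fun i : Fin _ => n + (i : ℕ)) (e.edge.symm_apply_apply _)⟩
  refine PathGraph.isGreatest_counts (ι := V ⊕ G.edgeSet) _ ?_ f ?_ _ ?_
  · intro i hi
    simp only [subdivided, ← hm, ite_eq_right_iff]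
    omega
  · intro i hi
    simp only [subdivided, ← hm, ← hn, Finset.mem_range] at hi ⊢
    by_cases h : i < m
    · simp only [if_pos h]
      exact ⟨hfE i h, hfV _ (e.sndNum_lt h)⟩
    · simp only [if_neg h]
      exact ⟨hfV _ (e.fstNum_lt (by omega)), hfE _ (by omega)⟩
  · intro x y
    have hs : ∀ F : ℕ → ℤ, ∑ i ∈ (e.subdivided m).L, F i =
        ∑ i : Fin m, (F i + F (m + i)) := by
      intro F
      simp only [subdivided, ← hm]
      rw [Finset.sum_range_add, Finset.sum_range, Finset.sum_range, Finset.sum_add_distrib]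
    rw [hs]
    have h1 : ∀ i : Fin m, (e.subdivided m).a i = n + i ∧ (e.subdivided m).b i = e.num (e.snd i) ∧
        (e.subdivided m).a (m + i) = e.num (e.fst i) ∧ (e.subdivided m).b (m + i) = n + i := by
      intro i
      have hi := i.2
      simp only [subdivided, ← hm, ← hn, fstNum, sndNum, if_pos hi, dif_pos hi,
        if_neg (show ¬ m + (i : ℕ) < m by omega), Nat.add_sub_cancel_left, Fin.eta, and_self]
    simp only [fun i => (h1 i).1, fun i => (h1 i).2.1, fun i => (h1 i).2.2.1,
      fun i => (h1 i).2.2.2]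
    have hfl : ∀ v, f (Sum.inl v) = (e.num v : ℕ) := fun v => rfl
    have hfr : ∀ x, f (Sum.inr x) = n + (e.edge.symm x : ℕ) := fun x => rfl
    have hnl : ∀ (k : ℕ) v, ¬ (n + k = (e.num v : ℕ)) := fun k v h => by
      have := (e.num v).2
      omega
    have hnr : ∀ v (k : ℕ), ¬ ((e.num v : ℕ) = n + k) := fun v k h => hnl k v h.symm
    have hnum : ∀ v w, ((e.num v : ℕ) = (e.num w : ℕ)) ↔ v = w := fun v w => by
      rw [Fin.val_inj, e.num.injective.eq_iff]
    have hmem : ∀ (v : V) (x : G.edgeSet), ((G.incMatrix ℤ) v x.1) =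
        (if e.snd (e.edge.symm x) = v then 1 else 0) +
        (if e.fst (e.edge.symm x) = v then 1 else 0) := by
      intro v x
      rw [SimpleGraph.incMatrix_apply', ← e.edge.apply_symm_apply x]
      have hmem' : (e.edge (e.edge.symm x)).1 ∈ G.incidenceSet v ↔
          e.snd (e.edge.symm x) = v ∨ e.fst (e.edge.symm x) = v := by
        rw [SimpleGraph.incidenceSet, Set.mem_sep_iff]
        rw [and_iff_right (e.edge (e.edge.symm x)).2, e.edge_eq, Sym2.mem_iff]
        tauto
      have hne := e.fst_ne_snd (e.edge.symm x)
      simp only [Equiv.symm_apply_apply]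
      by_cases ha : e.snd (e.edge.symm x) = v
      · have hb : e.fst (e.edge.symm x) ≠ v := fun h => hne (h.trans ha.symm)
        rw [if_pos (hmem'.2 (Or.inl ha)), if_pos ha, if_neg hb, add_zero]
      · by_cases hb : e.fst (e.edge.symm x) = v
        · rw [if_pos (hmem'.2 (Or.inr hb)), if_neg ha, if_pos hb, zero_add]
        · rw [if_neg (fun h => (hmem'.1 h).elim ha hb), if_neg ha, if_neg hb, zero_add]
    have hdelta : ∀ (x : G.edgeSet) (P : Fin m → Prop),
        ∑ i : Fin m, (if P i ∧ i = e.edge.symm x then (1 : ℤ) else 0) =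
          if P (e.edge.symm x) then 1 else 0 := by
      intro x P
      rw [Finset.sum_eq_single (e.edge.symm x)]
      · simp only [and_true]
      · intro i _ hi
        simp only [hi, and_false, if_false]
      · exact fun h => absurd (Finset.mem_univ _) h
    rcases x with v | x <;> rcases y with w | y
    · simp [SimpleGraph.totalMatchingMatrix, hfl, hnl, Matrix.one_apply]
    · simp only [SimpleGraph.totalMatchingMatrix, Matrix.fromBlocks_apply₁₂, hfl, hfr, hnl, hnr,
        Matrix.submatrix_apply, id, reduceCtorEq, if_false, and_false, zero_add,
        add_zero, hnum, Nat.add_left_cancel_iff, Fin.val_inj]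
      rw [Finset.sum_add_distrib, hdelta, hdelta]
      convert hmem v y using 1
    · simp only [SimpleGraph.totalMatchingMatrix, Matrix.fromBlocks_apply₂₁, hfl, hfr, hnl, hnr,
        Matrix.transpose_apply, Matrix.submatrix_apply, id, reduceCtorEq, if_false,
        and_false, zero_add, add_zero, hnum, Nat.add_left_cancel_iff, Fin.val_inj]
      simp only [and_comm (a := (_ : Fin m) = _)]
      rw [Finset.sum_add_distrib, hdelta, hdelta]
      convert hmem w x using 1
    · simp [SimpleGraph.totalMatchingMatrix, hfr, hnr, Matrix.one_apply]

end EdgeList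

/-! ### A table of all minors -/

open Finset in
/-- The determinant of the submatrix with the given list of rows and set of columns (`0` if it is
not square), computed by expansion along the first row of the list. -/
def rowExpand (A : ℕ → ℕ → ℤ) : List ℕ → Finset ℕ → ℤ
  | [], S => if S = ∅ then 1 else 0
  | i :: R, S => ∑ j ∈ S, (-1) ^ #{j' ∈ S | j < j'} * A i j * rowExpand A R (S.erase j)

open Finset in
theorem rowExpand_cons (A : ℕ → ℕ → ℤ) (i : ℕ) (R : List ℕ) (S : Finset ℕ) :
    rowExpand A (i :: R) S =
      ∑ j ∈ S, (-1) ^ #{j' ∈ S | j < j'} * A i j * rowExpand A R (S.erase j) := rfl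

theorem rowExpand_eq_zero (A : ℕ → ℕ → ℤ) {R : List ℕ} {S : Finset ℕ} (h : R.length ≠ S.card) :
    rowExpand A R S = 0 := by
  induction R generalizing S with
  | nil =>
    have : S ≠ ∅ := by
      rintro rfl
      exact h rfl
    simp [rowExpand, this]
  | cons i R ih =>
    rw [rowExpand_cons]
    refine Finset.sum_eq_zero fun j hj => ?_
    rw [ih, mul_zero]
    rw [Finset.card_erase_of_mem hj]
    simp only [List.length_cons] at h
    have := Finset.card_pos.2 ⟨j, hj⟩
    omega

/-- With the rows listed backwards this is Laplace expansion along the last row; the number of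
larger columns has the parity of the usual exponent `k + j`. -/
theorem rowExpand_ofFn (A : ℕ → ℕ → ℤ) {k : ℕ} (r s : Fin k → ℕ) (hs : StrictMono s) :
    rowExpand A (List.ofFn (r ∘ Fin.rev)) (Finset.univ.image s) =
      (Matrix.of fun i j => A (r i) (s j)).det := by
  induction k with
  | zero => simp [rowExpand]
  | succ k ih =>
    rw [List.ofFn_succ, rowExpand_cons, Matrix.det_succ_row _ (Fin.last k),
      Finset.sum_image hs.injective.injOn]
    refine Finset.sum_congr rfl fun j _ => ?_
    have h1 : (fun i : Fin k => (r ∘ Fin.rev) i.succ) = (r ∘ Fin.castSucc) ∘ Fin.rev := by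
      funext i
      simp [Fin.rev_succ]
    have h2 : (Finset.univ.image s).erase (s j) = Finset.univ.image (s ∘ j.succAbove) := by
      ext x
      simp only [Finset.mem_erase, Finset.mem_image, Finset.mem_univ, true_and,
        Function.comp_apply]
      constructor
      · rintro ⟨hx, i, rfl⟩
        obtain ⟨i', h⟩ := Fin.exists_succAbove_eq (x := i) (y := j) (by rintro rfl; exact hx rfl)
        exact ⟨i', congrArg s h⟩
      · rintro ⟨i, rfl⟩
        exact ⟨fun h => Fin.succAbove_ne j i (hs.injective h), _, rfl⟩
    have h3 : (Finset.filter (fun x => s j < x) (Finset.univ.image s)).card = k - j := by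
      rw [Finset.filter_image, Finset.card_image_of_injective _ hs.injective]
      simp only [hs.lt_iff_lt]
      have : Finset.filter (fun x => j < x) Finset.univ = Finset.Ioi j := by
        ext
        simp
      rw [this, Fin.card_Ioi]
      omega
    rw [h1, h2, ih _ _ (hs.comp (Fin.strictMono_succAbove j)), h3]
    have h4 : ((-1 : ℤ)) ^ (k - (j : ℕ)) = (-1) ^ ((Fin.last k : ℕ) + (j : ℕ)) := by
      have hj : (j : ℕ) ≤ k := Nat.lt_succ_iff.1 j.2
      rw [Fin.val_last, show k + (j : ℕ) = (k - j) + 2 * j by omega, pow_add, pow_mul]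
      simp
    rw [h4]
    congr 2
    ext a b
    simp

theorem abs_rowExpand_le (A : ℕ → ℕ → ℤ) {N B : ℕ} (hA : ∀ i j, |A i j| ≤ B)
    (R : List ℕ) {S : Finset ℕ} (hS : S.card ≤ N) :
    |rowExpand A R S| ≤ ((N * B) ^ R.length : ℕ) := by
  induction R generalizing S with
  | nil =>
    simp only [rowExpand]
    split_ifs <;> simp
  | cons i R ih =>
    rw [rowExpand_cons]
    refine (Finset.abs_sum_le_sum_abs _ _).trans ?_
    have h : ∀ j ∈ S, |(-1) ^ (Finset.filter (fun j' => j < j') S).card * A i j *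
        rowExpand A R (S.erase j)| ≤ (B * (N * B) ^ R.length : ℕ) := by
      intro j _
      rw [abs_mul, abs_mul, abs_pow, abs_neg, abs_one, one_pow, one_mul]
      push_cast
      have := ih (S := S.erase j) ((Finset.card_erase_le).trans hS)
      push_cast at this
      exact mul_le_mul (hA i j) this (abs_nonneg _) (by positivity)
    refine (Finset.sum_le_card_nsmul _ _ _ h).trans ?_
    rw [List.length_cons, pow_succ, nsmul_eq_mul]
    norm_cast
    calc S.card * (B * (N * B) ^ R.length) ≤ N * (B * (N * B) ^ R.length) := by gcongr
      _ = _ := by ring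

/-- The positions of the ones in the binary expansion. -/
def bitSet (x : ℕ) : Finset ℕ := x.bitIndices.toFinset

theorem sum_bitSet (x : ℕ) : ∑ i ∈ bitSet x, 2 ^ i = x := Finset.sum_toFinset_bitIndices_two_pow x

theorem bitSet_sum (S : Finset ℕ) : bitSet (∑ i ∈ S, 2 ^ i) = S :=
  Finset.toFinset_bitIndices_sum_two_pow S

theorem bitSet_lt {x k : ℕ} (hx : x < 2 ^ k) {i : ℕ} (hi : i ∈ bitSet x) : i < k := by
  have h1 : 2 ^ i ≤ x := by
    conv_rhs => rw [← sum_bitSet x]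
    exact Finset.single_le_sum (f := fun i => 2 ^ i) (fun _ _ => Nat.zero_le _) hi
  exact (Nat.pow_lt_pow_iff_right (by norm_num)).1 (h1.trans_lt hx)

theorem sum_two_pow_lt {S : Finset ℕ} {k : ℕ} (h : ∀ i ∈ S, i < k) : ∑ i ∈ S, 2 ^ i < 2 ^ k :=
  Nat.geomSum_lt le_rfl h

theorem bitSet_two_pow_add {i y : ℕ} (hy : y < 2 ^ i) :
    bitSet (2 ^ i + y) = insert i (bitSet y) := by
  rw [← bitSet_sum (insert i (bitSet y)), Finset.sum_insert, sum_bitSet]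
  exact fun h => lt_irrefl _ (bitSet_lt hy h)

theorem bitSet_sub {j y : ℕ} (hj : j ∈ bitSet y) : bitSet (y - 2 ^ j) = (bitSet y).erase j := by
  rw [← bitSet_sum ((bitSet y).erase j)]
  have := Finset.add_sum_erase (bitSet y) (fun i => 2 ^ i) hj
  rw [sum_bitSet] at this
  congr 1
  omega

theorem two_pow_le_of_mem_bitSet {j y : ℕ} (hj : j ∈ bitSet y) : 2 ^ j ≤ y := by
  conv_rhs => rw [← sum_bitSet y]
  exact Finset.single_le_sum (f := fun i => 2 ^ i) (fun _ _ => Nat.zero_le _) hj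

/-- The minor whose rows are given by the digits of `x` above the `N`-th, and whose columns are
given by the lower `N` digits. -/
def minorAt (A : ℕ → ℕ → ℤ) (N x : ℕ) : ℤ :=
  rowExpand A ((bitSet (x / 2 ^ N)).sort (· ≥ ·)) (bitSet (x % 2 ^ N))

theorem minorAt_low (A : ℕ → ℕ → ℤ) {N x : ℕ} (hx : x < 2 ^ N) :
    minorAt A N x = if x = 0 then 1 else 0 := by
  rw [minorAt, Nat.div_eq_of_lt hx, Nat.mod_eq_of_lt hx]
  have h0 : bitSet 0 = ∅ := by simp [bitSet]
  rw [h0, Finset.sort_empty]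
  simp only [rowExpand]
  congr 1
  rw [eq_iff_iff]
  constructor
  · intro h
    rw [← sum_bitSet x, h, Finset.sum_empty]
  · rintro rfl
    exact h0

-- This is the recursion of the table. The leading digit `i` of the index is the largest row;
-- expanding along it removes this digit, and removing the column `j` subtracts `2 ^ j`. Every minor
-- needed thus sits at an index below `2 ^ (i + N)`, filled earlier.
open Finset in
theorem minorAt_high (A : ℕ → ℕ → ℤ) {N i y : ℕ} (hy : y < 2 ^ (i + N)) :
    minorAt A N (2 ^ (i + N) + y) = ∑ j ∈ bitSet (y % 2 ^ N),
      (-1) ^ #{j' ∈ bitSet (y % 2 ^ N) | j < j'} * A i j * minorAt A N (y - 2 ^ j) := by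
  have hp : 0 < 2 ^ N := by positivity
  have h1 : (2 ^ (i + N) + y) / 2 ^ N = 2 ^ i + y / 2 ^ N := by
    rw [pow_add, add_comm, Nat.add_mul_div_right _ _ hp, add_comm]
  have h2 : (2 ^ (i + N) + y) % 2 ^ N = y % 2 ^ N := by
    rw [pow_add, Nat.mul_comm, Nat.mul_add_mod]
  have h3 : y / 2 ^ N < 2 ^ i := by
    rw [Nat.div_lt_iff_lt_mul hp, ← pow_add]
    exact hy
  rw [minorAt, h1, h2, bitSet_two_pow_add h3, Finset.sort_insert, rowExpand_cons]
  · refine Finset.sum_congr rfl fun j hj => ?_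
    have h4 := two_pow_le_of_mem_bitSet hj
    have h5 := Nat.div_add_mod y (2 ^ N)
    have h6 := Nat.mod_lt y hp
    have h7 : y - 2 ^ j = 2 ^ N * (y / 2 ^ N) + (y % 2 ^ N - 2 ^ j) := by
      generalize 2 ^ N * (y / 2 ^ N) = z at h5
      generalize 2 ^ j = w at h4 ⊢
      generalize y % 2 ^ N = x at h4 h5 ⊢
      omega
    rw [minorAt, h7, Nat.mul_add_mod, Nat.mod_eq_of_lt ((Nat.sub_le _ _).trans_lt h6),
      bitSet_sub hj,
      Nat.mul_add_div hp, Nat.div_eq_of_lt ((Nat.sub_le _ _).trans_lt h6), add_zero]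
  · intro b hb
    exact (bitSet_lt h3 hb).le
  · exact fun h => lt_irrefl _ (bitSet_lt h3 h)

theorem abs_minorAt_le (A : ℕ → ℕ → ℤ) {N B : ℕ} (hA : ∀ i j, |A i j| ≤ B) {i x : ℕ}
    (hx : x < 2 ^ (i + N)) (h1 : 1 ≤ N * B) : |minorAt A N x| ≤ ((N * B) ^ i : ℕ) := by
  have hp : 0 < 2 ^ N := by positivity
  have hc : ∀ {y k}, y < 2 ^ k → (bitSet y).card ≤ k := fun {y k} hy =>
    (Finset.card_le_card (fun i hi => Finset.mem_range.2 (bitSet_lt hy hi))).trans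
      (Finset.card_range k).le
  refine (abs_rowExpand_le A hA _ (hc (Nat.mod_lt x hp))).trans ?_
  rw [Finset.length_sort]
  norm_cast
  refine Nat.pow_le_pow_right h1 (hc ?_)
  rw [Nat.div_lt_iff_lt_mul hp, ← pow_add]
  exact hx

theorem rowExpand_sort (A : ℕ → ℕ → ℤ) {R S : Finset ℕ} {k : ℕ} (hR : R.card = k)
    (hS : S.card = k) : ∃ r s : Fin k → ℕ, Function.Injective r ∧ Function.Injective s ∧
      Set.range r = R ∧ Set.range s = S ∧
      rowExpand A (R.sort (· ≥ ·)) S = (Matrix.of fun i j => A (r i) (s j)).det := by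
  have hl : (R.sort (· ≥ ·)).length = k := by rw [Finset.length_sort, hR]
  obtain ⟨l, hl'⟩ : ∃ l, l = R.sort (· ≥ ·) := ⟨_, rfl⟩
  have hnd : l.Nodup := hl' ▸ Finset.sort_nodup _ _
  have hmem : ∀ x, x ∈ l ↔ x ∈ R := fun x => by rw [hl', Finset.mem_sort]
  rw [← hl'] at hl ⊢
  subst hl
  refine ⟨l.get ∘ Fin.rev, S.orderEmbOfFin hS,
    (List.nodup_iff_injective_get.1 hnd).comp Fin.rev_injective,
    (S.orderEmbOfFin hS).injective, ?_, Finset.range_orderEmbOfFin _ _, ?_⟩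
  · rw [Fin.rev_surjective.range_comp, Set.range_list_get]
    ext x
    exact hmem x
  · rw [← rowExpand_ofFn A _ _ (S.orderEmbOfFin hS).strictMono, Finset.image_orderEmbOfFin_univ]
    congr 1
    have : (l.get ∘ Fin.rev) ∘ Fin.rev = l.get := by
      funext i
      simp
    rw [this, List.ofFn_get]

theorem exists_equiv_comp_eq {α β γ : Type*} {f : α → γ} {g : β → γ} (hf : Function.Injective f)
    (hg : Function.Injective g) (h : Set.range f = Set.range g) : ∃ e : α ≃ β, g ∘ e = f := by
  refine ⟨(Equiv.ofInjective f hf).trans ((Equiv.setCongr h).trans (Equiv.ofInjective g hg).symm),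
    ?_⟩
  funext x
  simp only [Function.comp_apply, Equiv.trans_apply]
  rw [Equiv.apply_ofInjective_symm hg]
  rfl

/-- The largest minor is the largest entry of the table. -/
theorem maxSubdet_eq_of_table (A : ℕ → ℕ → ℤ) {N b : ℕ}
    (h1 : ∀ x < 2 ^ (N + N), (minorAt A N x).natAbs ≤ b)
    (h2 : ∃ x < 2 ^ (N + N), (minorAt A N x).natAbs = b) :
    maxSubdet (Matrix.of fun i j : Fin N => A i j) = b := by
  have hp : 0 < 2 ^ N := by positivity
  refine le_antisymm ?_ ?_
  · obtain ⟨k, r, c, h⟩ := (isGreatest_maxSubdet (Matrix.of fun i j : Fin N => A i j)).1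
    rw [h]
    have hr : Function.Injective fun i => (r i : ℕ) := fun i j h => r.injective (Fin.ext h)
    have hc : Function.Injective fun i => (c i : ℕ) := fun i j h => c.injective (Fin.ext h)
    obtain ⟨r', c', hr', hc', hrr, hcr, hd⟩ := rowExpand_sort A
      (R := Finset.univ.image fun i => (r i : ℕ)) (S := Finset.univ.image fun i => (c i : ℕ))
      (k := k) (by rw [Finset.card_image_of_injective _ hr, Finset.card_fin])
      (by rw [Finset.card_image_of_injective _ hc, Finset.card_fin])
    obtain ⟨e₁, he₁⟩ := exists_equiv_comp_eq hr hr' (by rw [hrr]; simp)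
    obtain ⟨e₂, he₂⟩ := exists_equiv_comp_eq hc hc' (by rw [hcr]; simp)
    have hx1 := sum_two_pow_lt (S := Finset.univ.image fun i => (r i : ℕ)) (k := N) (by simp)
    have hx2 := sum_two_pow_lt (S := Finset.univ.image fun i => (c i : ℕ)) (k := N) (by simp)
    set x1 := ∑ i ∈ Finset.univ.image fun i => (r i : ℕ), 2 ^ i with hx1'
    set x2 := ∑ i ∈ Finset.univ.image fun i => (c i : ℕ), 2 ^ i with hx2'
    -- The table cell of the chosen row and column sets. Sorting them only permutes rows and
    -- columns, which preserves the absolute value of the determinant.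
    have h3 := h1 (2 ^ N * x1 + x2) (by
      rw [pow_add]
      nlinarith)
    rw [minorAt, Nat.mul_add_mod, Nat.mod_eq_of_lt hx2, Nat.mul_add_div hp, Nat.div_eq_of_lt hx2,
      add_zero, hx1', hx2', bitSet_sum, bitSet_sum, hd] at h3
    refine le_trans (le_of_eq ?_) h3
    have h4 : (Matrix.of fun i j : Fin N => A i j).submatrix r c =
        (Matrix.of fun i j => A (r' i) (c' j)).submatrix e₁ e₂ := by
      ext i j
      have hi := congrFun he₁ i
      have hj := congrFun he₂ j
      simp only [Function.comp_apply] at hi hj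
      simp [hi, hj]
    rw [h4, ← Int.natAbs_abs, Matrix.abs_det_submatrix_equiv_equiv, Int.natAbs_abs]
  · obtain ⟨x, hx, rfl⟩ := h2
    have hdiv : x / 2 ^ N < 2 ^ N := by
      rw [Nat.div_lt_iff_lt_mul hp, ← pow_add]
      exact hx
    rw [minorAt]
    by_cases hk : (bitSet (x / 2 ^ N)).card = (bitSet (x % 2 ^ N)).card
    · obtain ⟨r, c, hr, hc, hrr, hcr, hd⟩ := rowExpand_sort A hk rfl
      have hrN : ∀ i, r i < N := fun i => bitSet_lt hdiv
        (Finset.mem_coe.1 (hrr ▸ Set.mem_range_self i))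
      have hcN : ∀ i, c i < N := fun i => bitSet_lt (Nat.mod_lt x hp)
        (Finset.mem_coe.1 (hcr ▸ Set.mem_range_self i))
      rw [hd]
      exact natAbs_det_le_maxSubdet (Matrix.of fun i j : Fin N => A i j)
        ⟨fun i => ⟨r i, hrN i⟩, fun i j h => hr (congrArg Fin.val h)⟩
        ⟨fun i => ⟨c i, hcN i⟩, fun i j h => hc (congrArg Fin.val h)⟩
    -- Cells whose row and column sets differ in size hold zero and cannot spoil the maximum.
    · rw [rowExpand_eq_zero A (by rwa [Finset.length_sort])]
      exact Nat.zero_le _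

/-! ### Reasoning about programs -/

namespace RAM

/-- The program halts from `s`, in a number of steps and a state that satisfy `Q`. -/
def Halts (W : ℕ) (p : Program) (s : State) (Q : ℕ → State → Prop) : Prop :=
  ∃ t s', Exec W p s t s' ∧ Q t s'

variable {W : ℕ} {s : State} {Q Q' : ℕ → State → Prop} {p q : Program}

theorem Halts.mono (h : Halts W p s Q) (hQ : ∀ t s', Q t s' → Q' t s') : Halts W p s Q' := by
  obtain ⟨t, s', h1, h2⟩ := h
  exact ⟨t, s', h1, hQ t s' h2⟩

theorem halts_skip : Halts W .skip s Q ↔ Q 1 s :=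
  ⟨fun ⟨_, _, h, hQ⟩ => by cases h; exact hQ, fun h => ⟨_, _, .skip s, h⟩⟩

theorem halts_const {x : ℕ} {k : ℤ} :
    Halts W (.const x k) s Q ↔ |k| ≤ W ∧ Q 1 (s.setReg x k) :=
  ⟨fun ⟨_, _, h, hQ⟩ => by cases h; exact ⟨‹_›, hQ⟩, fun h => ⟨_, _, .const s x k h.1, h.2⟩⟩

theorem halts_add {x y z : ℕ} :
    Halts W (.add x y z) s Q ↔
      |s.reg y + s.reg z| ≤ W ∧ Q 1 (s.setReg x (s.reg y + s.reg z)) :=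
  ⟨fun ⟨_, _, h, hQ⟩ => by cases h; exact ⟨‹_›, hQ⟩, fun h => ⟨_, _, .add s x y z h.1, h.2⟩⟩

theorem halts_sub {x y z : ℕ} :
    Halts W (.sub x y z) s Q ↔
      |s.reg y - s.reg z| ≤ W ∧ Q 1 (s.setReg x (s.reg y - s.reg z)) :=
  ⟨fun ⟨_, _, h, hQ⟩ => by cases h; exact ⟨‹_›, hQ⟩, fun h => ⟨_, _, .sub s x y z h.1, h.2⟩⟩

theorem halts_load {x a y : ℕ} :
    Halts W (.load x a y) s Q ↔ Q 1 (s.setReg x (s.arr a (s.reg y))) :=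
  ⟨fun ⟨_, _, h, hQ⟩ => by cases h; exact hQ, fun h => ⟨_, _, .load s x a y, h⟩⟩

theorem halts_store {a y x : ℕ} :
    Halts W (.store a y x) s Q ↔ Q 1 (s.setArr a (s.reg y) (s.reg x)) :=
  ⟨fun ⟨_, _, h, hQ⟩ => by cases h; exact hQ, fun h => ⟨_, _, .store s a y x, h⟩⟩

theorem halts_seq :
    Halts W (.seq p q) s Q ↔ Halts W p s fun t s' => Halts W q s' fun t' => Q (t + t') :=
  ⟨fun ⟨_, _, h, hQ⟩ => by
    cases h with
    | seq h1 h2 => exact ⟨_, _, h1, _, _, h2, hQ⟩,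
   fun ⟨_, _, h1, _, _, h2, hQ⟩ => ⟨_, _, .seq h1 h2, hQ⟩⟩

theorem halts_ite {y z : ℕ} :
    Halts W (.ite y z p q) s Q ↔ if s.reg y < s.reg z then Halts W p s fun t => Q (t + 1)
      else Halts W q s fun t => Q (t + 1) := by
  split_ifs with h
  · exact ⟨fun ⟨_, _, h1, hQ⟩ => by
      cases h1 with
      | ite_true _ h1 => exact ⟨_, _, h1, hQ⟩
      | ite_false h' _ => exact absurd h h',
     fun ⟨_, _, h1, hQ⟩ => ⟨_, _, .ite_true h h1, hQ⟩⟩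
  · exact ⟨fun ⟨_, _, h1, hQ⟩ => by
      cases h1 with
      | ite_true h' _ => exact absurd h' h
      | ite_false _ h1 => exact ⟨_, _, h1, hQ⟩,
     fun ⟨_, _, h1, hQ⟩ => ⟨_, _, .ite_false h h1, hQ⟩⟩

/-- A loop with an invariant that counts the remaining iterations. -/
theorem halts_while {y z N T : ℕ} (I : ℕ → State → Prop) (h0 : I N s)
    (hI : ∀ k s, I k s → s.reg y < s.reg z →
      ∃ k', k = k' + 1 ∧ Halts W p s fun t s' => t ≤ T ∧ I k' s')
    (hQ : ∀ t k s, t ≤ N * (T + 1) + 1 → I k s → ¬ s.reg y < s.reg z → Q t s) :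
    Halts W (.while y z p) s Q := by
  have key : ∀ N s, I N s → ∃ t k s', Exec W (.while y z p) s t s' ∧ t ≤ N * (T + 1) + 1 ∧
      I k s' ∧ ¬ s'.reg y < s'.reg z := by
    intro N
    induction N with
    | zero =>
      intro s hs
      by_cases h : s.reg y < s.reg z
      · obtain ⟨k', hk, -⟩ := hI 0 s hs h
        omega
      · exact ⟨1, 0, s, .while_false h, by omega, hs, h⟩
    | succ N ih =>
      intro s hs
      by_cases h : s.reg y < s.reg z
      · obtain ⟨k', hk, t, s', h1, h2, h3⟩ := hI _ s hs h
        obtain rfl : k' = N := by omega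
        obtain ⟨t', k, s'', h4, h5, h6, h7⟩ := ih s' h3
        exact ⟨_, k, s'', .while_true h h1 h4, by rw [Nat.succ_mul]; omega, h6, h7⟩
      · exact ⟨1, _, s, .while_false h, by omega, hs, h⟩
  obtain ⟨t, k, s', h1, h2, h3, h4⟩ := key N s h0
  exact ⟨t, s', h1, hQ t k s' h2 h3 h4⟩

/-- A loop in which the register `y` counts up to the value of the register `z`. -/
theorem halts_for {y z N T : ℕ} (I : ℕ → State → Prop) (h0 : I 0 s)
    (hyz : ∀ k s, I k s → s.reg y = k ∧ s.reg z = N)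
    (hI : ∀ k s, k < N → I k s → Halts W p s fun t s' => t ≤ T ∧ I (k + 1) s')
    (hQ : ∀ t s, t ≤ N * (T + 1) + 1 → I N s → Q t s) :
    Halts W (.while y z p) s Q := by
  refine halts_while (N := N) (T := T) (fun k s => k ≤ N ∧ I (N - k) s) ⟨le_rfl, by simpa using h0⟩
    (fun k s h h' => ?_) (fun t k s ht h h' => ?_)
  · obtain ⟨h1, h2⟩ := hyz _ _ h.2
    rw [h1, h2] at h'
    have h'' : N - k < N := by exact_mod_cast h'
    refine ⟨k - 1, by omega, (hI _ s h'' h.2).mono fun t s' ht => ⟨ht.1, by omega, ?_⟩⟩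
    rw [show N - (k - 1) = N - k + 1 by omega]
    exact ht.2
  · obtain ⟨h1, h2⟩ := hyz _ _ h.2
    rw [h1, h2] at h'
    have h'' : ¬ N - k < N := by exact_mod_cast h'
    refine hQ t s ht ?_
    rw [show N = N - k by omega]
    exact h.2

/-- Execute the programs one after the other. -/
def seqs : List Program → Program
  | [] => .skip
  | p :: l => .seq p (seqs l)

theorem halts_seqs_nil : Halts W (seqs []) s Q ↔ Q 1 s := halts_skip

theorem halts_seqs_cons {l : List Program} :
    Halts W (seqs (p :: l)) s Q ↔
      Halts W p s fun t s' => Halts W (seqs l) s' fun t' => Q (t + t') := halts_seq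

/-- If the registers are equal then `p` else `q`. -/
def ifEq (y z : ℕ) (p q : Program) : Program := .ite y z q (.ite z y q p)

/-- Equality takes two tests to confirm, but inequality may be found by the first or only by the
second, hence two postconditions for `q`. -/
theorem halts_ifEq {y z : ℕ} (h1 : s.reg y = s.reg z → Halts W p s fun t => Q (t + 2))
    (h2 : s.reg y ≠ s.reg z → Halts W q s fun t s' => Q (t + 1) s' ∧ Q (t + 2) s') :
    Halts W (ifEq y z p q) s Q := by
  rw [ifEq, halts_ite]
  split_ifs with h
  · exact (h2 h.ne).mono fun t s' h => h.1
  · rw [halts_ite]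
    split_ifs with h'
    · exact (h2 h'.ne').mono fun t s' h => h.2
    · exact h1 (le_antisymm (not_lt.1 h') (not_lt.1 h))

/-! ### Effect of updates on registers and array cells -/

@[simp] theorem reg_setReg (s : State) (x : ℕ) (v : ℤ) (y : ℕ) :
    (s.setReg x v).reg y = if y = x then v else s.reg y := by
  simp only [State.setReg, Function.update_apply]

@[simp] theorem arr_setReg (s : State) (x : ℕ) (v : ℤ) : (s.setReg x v).arr = s.arr := rfl

@[simp] theorem reg_setArr (s : State) (a : ℕ) (i v : ℤ) : (s.setArr a i v).reg = s.reg := rfl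

@[simp] theorem arr_setArr (s : State) (a : ℕ) (i v : ℤ) (b : ℕ) :
    (s.setArr a i v).arr b = if b = a then Function.update (s.arr a) i v else s.arr b := by
  simp only [State.setArr, Function.update_apply]

attribute [simp] halts_skip halts_const halts_add halts_sub halts_load halts_store
  halts_seqs_nil halts_seqs_cons

/-- The contents of an array whose cells `0, 1, …` hold the values of `g`. -/
def cells (g : ℕ → ℤ) (i : ℤ) : ℤ := if 0 ≤ i then g i.toNat else 0

@[simp] theorem cells_natCast (g : ℕ → ℤ) (k : ℕ) : cells g k = g k := by simp [cells]

theorem update_cells (g : ℕ → ℤ) (k : ℕ) (v : ℤ) :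
    Function.update (cells g) k v = cells (Function.update g k v) := by
  funext i
  by_cases h : i = k
  · subst h
    simp
  · rw [Function.update_of_ne h]
    simp only [cells]
    split_ifs with h0
    · rw [Function.update_of_ne]
      omega
    · rfl

/-- The contents of an array whose cells `0, 1, …` hold the values of `g`. -/
def natCells (g : ℕ → ℕ) : ℤ → ℤ := cells fun k => (g k : ℤ)

@[simp] theorem natCells_natCast (g : ℕ → ℕ) (k : ℕ) : natCells g k = g k := cells_natCast _ _

@[simp] theorem update_natCells (g : ℕ → ℕ) (k v : ℕ) :
    Function.update (natCells g) k v = natCells (Function.update g k v) := by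
  rw [natCells, update_cells, natCells]
  congr 1
  funext i
  simp only [Function.update_apply]
  split_ifs <;> rfl

@[simp] theorem update_natCells_add_one (g : ℕ → ℕ) (k v : ℕ) :
    Function.update (natCells g) k ((v : ℤ) + 1) = natCells (Function.update g k (v + 1)) := by
  rw [← update_natCells, Nat.cast_add_one]

@[simp] theorem update_natCells_one (g : ℕ → ℕ) (k : ℕ) :
    Function.update (natCells g) k 1 = natCells (Function.update g k 1) := by
  rw [← update_natCells, Nat.cast_one]

@[simp] theorem update_natCells_zero (g : ℕ → ℕ) (k : ℕ) :
    Function.update (natCells g) k 0 = natCells (Function.update g k 0) := by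
  rw [← update_natCells, Nat.cast_zero]

/-- The first `16` registers hold the values of `r`. -/
def Agree (r : ℕ → ℤ) (s : State) : Prop := ∀ x < 16, s.reg x = r x

@[simp] theorem agree_setReg {r : ℕ → ℤ} {s : State} {x : ℕ} {v : ℤ} (hx : 16 ≤ x) :
    Agree r (s.setReg x v) ↔ Agree r s := by
  refine forall₂_congr fun y hy => ?_
  rw [reg_setReg, if_neg (by omega)]

@[simp] theorem agree_setArr {r : ℕ → ℤ} {s : State} {a : ℕ} {i v : ℤ} :
    Agree r (s.setArr a i v) ↔ Agree r s := Iff.rfl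

/-- The arrays from the `k`-th on are empty. -/
def ZeroFrom (k : ℕ) (s : State) : Prop := ∀ a, k ≤ a → s.arr a = natCells fun _ => 0

@[simp] theorem zeroFrom_setReg {k : ℕ} {s : State} {x : ℕ} {v : ℤ} :
    ZeroFrom k (s.setReg x v) ↔ ZeroFrom k s := Iff.rfl

@[simp] theorem zeroFrom_setArr {k : ℕ} {s : State} {a : ℕ} {i v : ℤ} (ha : a < k) :
    ZeroFrom k (s.setArr a i v) ↔ ZeroFrom k s := by
  refine forall₂_congr fun b hb => ?_
  rw [arr_setArr, if_neg (by omega)]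

end RAM

/-! ### Reading the graph -/

/-- `I e v` counts how often the edge `e ∈ L` ends in `v`. The table `deg` holds the degrees, and
for the vertices of degree at most two `P` and `Q` hold the edges. -/
structure Slots (L : Finset ℕ) (I : ℕ → ℕ → ℕ) (deg P Q : ℕ → ℕ) : Prop where
  mem : ∀ e v, I e v ≠ 0 → e ∈ L
  sum : ∀ v, ∑ e ∈ L, I e v = deg v
  one : ∀ v, deg v = 1 → ∀ e, I e v = if P v = e then 1 else 0
  two : ∀ v, deg v = 2 → ∀ e, I e v = (if P v = e then 1 else 0) + if Q v = e then 1 else 0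

/-- Each vertex has a stack of depth two, with the latest edge in `P` and the one before in `Q`.
Overflow is harmless because the slots are only meaningful up to degree two. A loop is recorded
twice. -/
theorem Slots.add {L : Finset ℕ} {I : ℕ → ℕ → ℕ} {deg P Q : ℕ → ℕ} (h : Slots L I deg P Q)
    {e v : ℕ} (he : e ∈ L) :
    Slots L (fun e' v' => I e' v' + if e' = e ∧ v' = v then 1 else 0)
      (Function.update deg v (deg v + 1)) (Function.update P v e) (Function.update Q v (P v)) where
  mem e' v' h' := by
    by_cases h1 : e' = e ∧ v' = v
    · exact h1.1 ▸ he
    · exact h.mem e' v' (by simpa [h1] using h')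
  sum v' := by
    rw [Finset.sum_add_distrib, h.sum]
    by_cases h1 : v' = v
    · subst h1
      simp [he]
    · simp [h1]
  one v' hv' e' := by
    by_cases h1 : v' = v
    · subst h1
      simp only [Function.update_self, Nat.add_eq_right, and_true] at hv' ⊢
      have h2 := h.sum v'
      rw [hv', Finset.sum_eq_zero_iff] at h2
      have h3 : I e' v' = 0 := by
        by_contra h3
        exact h3 (h2 e' (h.mem _ _ h3))
      rw [h3, zero_add]
      simp only [eq_comm]
    · rw [Function.update_of_ne h1] at hv' ⊢
      simpa [h1] using h.one v' hv' e'
  two v' hv' e' := by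
    by_cases h1 : v' = v
    · subst h1
      simp only [Function.update_self, and_true] at hv' ⊢
      rw [h.one v' (by omega), add_comm]
      simp only [eq_comm]
    · rw [Function.update_of_ne h1] at hv' ⊢
      rw [Function.update_of_ne h1]
      simpa [h1] using h.two v' hv' e'

namespace RAM

/-- Record the degrees of the vertices, and up to two edges at every vertex. -/
def scanEdges : Program :=
  seqs [.const 20 0, .while 20 2 (seqs [.load 21 0 20, .load 22 1 20,
    .load 23 2 21, .add 23 23 3, .store 2 21 23, .load 23 3 21, .store 4 21 23, .store 3 21 20,
    .load 23 2 22, .add 23 23 3, .store 2 22 23, .load 23 3 22, .store 4 22 23, .store 3 22 20,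
    .store 5 20 3, .add 20 20 3])]

theorem halts_scanEdges {W : ℕ} {s : State} {Q : ℕ → State → Prop} {r : ℕ → ℤ} {m : ℕ}
    {a b : ℕ → ℕ} (hr : Agree r s) (hr2 : r 2 = m) (hr3 : r 3 = 1) (ha : s.arr 0 = natCells a)
    (hb : s.arr 1 = natCells b) (hz : ZeroFrom 2 s) (hW : 2 * m + 2 ≤ W)
    (hQ : ∀ t s' deg P Q', t ≤ 20 * (m + 1) → Agree r s' → s'.arr 0 = natCells a →
      s'.arr 1 = natCells b → s'.arr 2 = natCells deg → s'.arr 3 = natCells P →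
      s'.arr 4 = natCells Q' → s'.arr 5 = natCells (fun e => if e < m then 1 else 0) →
      ZeroFrom 6 s' → Slots (Finset.range m) (fun e v => if e < m then
        (if a e = v then 1 else 0) + (if b e = v then 1 else 0) else 0) deg P Q' → Q t s') :
    Halts W scanEdges s Q := by
  simp only [scanEdges, halts_seqs_cons, halts_const]
  refine ⟨by simp, ?_⟩
  refine halts_for (N := m) (T := 17) (fun k s => Agree r s ∧ s.reg 20 = k ∧ s.arr 0 = natCells a ∧
    s.arr 1 = natCells b ∧ s.arr 5 = natCells (fun e => if e < k then 1 else 0) ∧ ZeroFrom 6 s ∧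
    ∃ deg P Q', s.arr 2 = natCells deg ∧ s.arr 3 = natCells P ∧ s.arr 4 = natCells Q' ∧
    (∀ v, deg v ≤ 2 * k) ∧
    Slots (Finset.range m) (fun e v => if e < k then
      (if a e = v then 1 else 0) + (if b e = v then 1 else 0) else 0) deg P Q') ?_ ?_ ?_ ?_
  · refine ⟨by simpa using hr, by simp, by simpa using ha, by simpa using hb,
      by simpa using hz 5 (by norm_num), fun a ha => hz a (by omega), 0, 0, 0,
      hz 2 (by norm_num), hz 3 (by norm_num), hz 4 (by norm_num), by simp,
      ⟨by simp, by simp, by simp, by simp⟩⟩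
  · rintro k s ⟨h1, h2, -⟩
    exact ⟨h2, (h1 2 (by norm_num)).trans hr2⟩
  · rintro k s hk ⟨h1, h2, h3, h4, h5, h6, deg, P, Q', h7, h8, h9, h10, h11⟩
    have h12 : s.reg 3 = 1 := (h1 3 (by norm_num)).trans hr3
    simp [h1, h2, h3, h4, h5, h6, h7, h8, h9, h12]
    have ha' := h10 (a k)
    have hb' := h10 (b k)
    -- One round of the loop pushes the edge `k` at its first and then at its second end.
    have hfun : (fun e v => (if e < k then
        (if a e = v then 1 else 0) + (if b e = v then 1 else 0) else 0) +
        (if e = k ∧ v = a k then 1 else 0) + (if e = k ∧ v = b k then 1 else 0)) =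
        fun e v => if e ≤ k then (if a e = v then 1 else 0) + (if b e = v then 1 else 0) else 0 := by
      funext e v
      rcases lt_trichotomy e k with h | rfl | h
      · simp [h, h.le, h.ne]
      · simp [eq_comm]
      · simp [h.not_gt, h.not_ge, h.ne']
    have hslot := (h11.add (v := a k) (Finset.mem_range.2 hk)).add (v := b k) (Finset.mem_range.2 hk)
    rw [hfun] at hslot
    have hupd : ∀ v, Function.update deg (a k) (deg (a k) + 1) v ≤ 2 * k + 1 := by
      intro v
      rw [Function.update_apply]
      split_ifs
      · omega
      · exact (h10 v).trans (by omega)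
    refine ⟨?_, ?_, ?_, ?_, _, rfl, _, rfl, _, rfl, fun v => ?_, hslot⟩
    · rw [abs_le]
      omega
    · have := hupd (b k)
      rw [abs_le]
      omega
    · rw [abs_le]
      omega
    · congr 1
      funext e
      rw [Function.update_apply]
      split_ifs <;> omega
    · rw [Function.update_apply]
      split_ifs
      · have := hupd (b k)
        omega
      · exact (hupd v).trans (by omega)
  · rintro t s ht ⟨h1, h2, h3, h4, h5, h6, deg, P, Q', h7, h8, h9, h10, h11⟩
    simp only [halts_seqs_nil]
    exact hQ _ _ deg P Q' (by omega) h1 h3 h4 h7 h8 h9 h5 h6 h11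

end RAM

/-! ### Contracting the vertices of degree two -/

/-- How often the edge `e` of `W` ends in `v`. -/
def PathGraph.incidence (W : PathGraph) (e v : ℕ) : ℕ :=
  if e ∈ W.L then (if W.a e = v then 1 else 0) + (if W.b e = v then 1 else 0) else 0

/-- The invariant of the contraction: the tables describe the graph `W`. -/
structure Tables (n m cap : ℕ) (deg₀ : ℕ → ℕ) (W : PathGraph) (deg P Q : ℕ → ℕ) : Prop where
  mem : ∀ e, e ∈ W.L ↔ e < m ∧ W.len e ≠ 0
  len_lt : ∀ e, W.len e < cap
  loop : ∀ e ∈ W.L, W.a e = W.b e → 3 ≤ W.len e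
  lt : ∀ e ∈ W.L, W.a e < n ∧ W.b e < n
  slots : Slots W.L W.incidence deg P Q
  deg : ∀ v, deg v = 0 ∨ deg v = deg₀ v

namespace Tables

variable {n m cap : ℕ} {deg₀ deg P Q : ℕ → ℕ} {W : PathGraph}

/-- An edge that meets `v` once is not a loop, and its other end is the sum of its ends minus `v`.
This is how the machine finds it without knowing the orientation. -/
theorem other_end (h : Tables n m cap deg₀ W deg P Q) {e v : ℕ} (he : W.incidence e v = 1) :
    e ∈ W.L ∧ ∃ p, p < n ∧ p ≠ v ∧ W.a e + W.b e = p + v ∧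
      ((W.a e = p ∧ W.b e = v) ∨ (W.a e = v ∧ W.b e = p)) := by
  have heL : e ∈ W.L := by
    by_contra h'
    simp [PathGraph.incidence, h'] at he
  have hlt := h.lt e heL
  simp only [PathGraph.incidence, if_pos heL] at he
  refine ⟨heL, ?_⟩
  split_ifs at he with h1 h2 h2
  · simp at he
  · exact ⟨W.b e, hlt.2, h2, by omega, Or.inr ⟨h1, rfl⟩⟩
  · exact ⟨W.a e, hlt.1, h1, by omega, Or.inl ⟨rfl, h2⟩⟩
  · simp at he

/-- The edge `i` now runs from `p` to `q`, so the slots change only at `q`, where `i` takes the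
place of `j`; `deg v = 0` marks `v` as gone. The ends `p` and `q` may coincide, and then a loop
arises, which is why `3 ≤ l` is kept. The last clause says that no vertex newly acquires degree two
and that loops at vertices of degree two stay loops, so a single pass over the vertices is enough.
-/
theorem contract (h : Tables n m cap deg₀ W deg P Q) {i j v p q l : ℕ} (hv : deg v = 2)
    (hi : P v = i) (hj : Q v = j) (hij : i ≠ j)
    (hei : (W.a i = p ∧ W.b i = v) ∨ (W.a i = v ∧ W.b i = p)) (hp : p ≠ v) (hpn : p < n)
    (hej : (W.a j = q ∧ W.b j = v) ∨ (W.a j = v ∧ W.b j = q)) (hq : q ≠ v) (hqn : q < n)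
    (hl : pathTypes l = pathTypes (W.len i + W.len j + 1)) (hl3 : 3 ≤ l) (hlc : l < cap)
    {W' : PathGraph} (hW' : W' = PathGraph.mk (W.L.erase j) (Function.update W.a i p)
      (Function.update W.b i q) (Function.update (Function.update W.len i l) j 0))
    {deg' P' Q' : ℕ → ℕ} (hdeg' : deg' = Function.update deg v 0)
    (hPQ : (P q = j ∧ P' = Function.update P q i ∧ Q' = Q) ∨
      (P q ≠ j ∧ P' = P ∧ Q' = Function.update Q q i)) :
    Tables n m cap deg₀ W' deg' P' Q' ∧ W'.counts = W.counts ∧ deg' v = 0 ∧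
      ∀ u, deg' u = 2 → deg u = 2 ∧ (P u = Q u → P' u = Q' u) := by
  have hI := h.slots.two v hv
  have hIi : W.incidence i v = 1 := by
    rw [hI, hi, hj]
    simp [hij.symm]
  have hIj : W.incidence j v = 1 := by
    rw [hI, hi, hj]
    simp [hij]
  have hiL := (h.other_end hIi).1
  have hjL := (h.other_end hIj).1
  have hiv : ∀ x, W.incidence i x = (if p = x then 1 else 0) + if v = x then 1 else 0 := by
    intro x
    simp only [PathGraph.incidence, if_pos hiL]
    rcases hei with ⟨h1, h2⟩ | ⟨h1, h2⟩ <;> rw [h1, h2]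
    rw [add_comm]
  have hjv : ∀ x, W.incidence j x = (if q = x then 1 else 0) + if v = x then 1 else 0 := by
    intro x
    simp only [PathGraph.incidence, if_pos hjL]
    rcases hej with ⟨h1, h2⟩ | ⟨h1, h2⟩ <;> rw [h1, h2]
    rw [add_comm]
  have hL' : W'.L = W.L.erase j := by rw [hW']
  have hIj' : ∀ x, W'.incidence j x = 0 := fun x => by
    simp [PathGraph.incidence, hL']
  have hIi' : ∀ x, W'.incidence i x = (if p = x then 1 else 0) + if q = x then 1 else 0 := by
    intro x
    have : i ∈ W'.L := hL' ▸ Finset.mem_erase.2 ⟨hij, hiL⟩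
    simp only [PathGraph.incidence, if_pos this]
    simp [hW']
  have hIo : ∀ e x, e ≠ i → e ≠ j → W'.incidence e x = W.incidence e x := by
    intro e x h1 h2
    simp only [PathGraph.incidence, hL', Finset.mem_erase, h2, ne_eq, not_false_eq_true, true_and]
    simp [hW', h1]
  have hov : ∀ e ∈ W.L, e ≠ i → e ≠ j → W.a e ≠ v ∧ W.b e ≠ v := by
    intro e he h1 h2
    have h3 := hI e
    rw [hi, hj, if_neg h1.symm, if_neg h2.symm] at h3
    simp only [PathGraph.incidence, if_pos he] at h3
    constructor <;> intro h4 <;> simp [h4] at h3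
  have hcounts : W'.counts = W.counts := by
    rw [← W.counts_contract hiL hjL hij hei hp hej hq hov hl, hW']
    refine PathGraph.counts_congr rfl (fun _ _ => rfl) (fun _ _ => rfl) (fun e he => ?_)
    have : e ≠ j := (Finset.mem_erase.1 he).1
    simp [this]
  have hdv : deg' v = 0 := by simp [hdeg']
  have hdo : ∀ u, u ≠ v → deg' u = deg u := fun u hu => by simp [hdeg', hu]
  have huv : ∀ u, deg' u ≠ 0 → u ≠ v := fun u hu hu' => hu (hu' ▸ hdv)
  have hPo : ∀ u, u ≠ q → P' u = P u ∧ Q' u = Q u := by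
    intro u hu
    rcases hPQ with ⟨-, h1, h2⟩ | ⟨-, h1, h2⟩ <;> simp [h1, h2, hu]
  refine ⟨⟨?_, ?_, ?_, ?_, ⟨?_, ?_, ?_, ?_⟩, ?_⟩, hcounts, hdv, ?_⟩
  · intro e
    rw [hL', Finset.mem_erase, h.mem, hW']
    simp only [Function.update_apply]
    split_ifs with h1 h2
    · simp [h1]
    · subst h2
      exact iff_of_true ⟨h1, (h.mem e).1 hiL⟩ ⟨((h.mem e).1 hiL).1, by omega⟩
    · simp [h1]
  · intro e
    rw [hW']
    simp only [Function.update_apply]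
    split_ifs
    · omega
    · exact hlc
    · exact h.len_lt e
  · intro e he
    rw [hL', Finset.mem_erase] at he
    rw [hW']
    by_cases hei : e = i
    · subst hei
      simpa [hij] using fun _ => hl3
    · simpa [hei, he.1] using h.loop e he.2
  · intro e he
    rw [hL', Finset.mem_erase] at he
    rw [hW']
    by_cases hei : e = i
    · subst hei
      simpa using ⟨hpn, hqn⟩
    · simpa [hei] using h.lt e he.2
  · intro e x hex
    by_contra h1
    simp [PathGraph.incidence, h1] at hex
  · intro x
    -- Before, `i` and `j` end at `p, v` and `q, v`; afterwards `i` ends at `p, q`. So only the two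
    -- incidences at `v` disappear.
    have h1 := h.slots.sum x
    rw [← Finset.add_sum_erase _ _ hjL, ← Finset.add_sum_erase _ _ (Finset.mem_erase.2 ⟨hij, hiL⟩),
      hiv, hjv] at h1
    rw [hL', ← Finset.add_sum_erase _ _ (Finset.mem_erase.2 ⟨hij, hiL⟩), hIi']
    rw [Finset.sum_congr rfl fun e he => hIo e x (Finset.mem_erase.1 he).1
      (Finset.mem_erase.1 (Finset.mem_erase.1 he).2).1]
    by_cases hx : x = v
    · subst hx
      rw [hdv]
      rw [hv] at h1
      simp only [if_neg hp, if_neg hq, if_true] at h1 ⊢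
      omega
    · rw [hdo x hx, ← h1, if_neg (Ne.symm hx)]
      omega
  · intro x hx e
    have hxv : x ≠ v := huv x (by omega)
    have h1 := h.slots.one x (by rw [← hdo x hxv, hx])
    by_cases hxq : x = q
    · subst hxq
      have h2 := h1 j
      have h4 := h1 i
      rw [hjv, if_pos rfl, if_neg (Ne.symm hxv)] at h2
      rw [hiv, if_neg (Ne.symm hxv)] at h4
      have hPj : P x = j := by
        by_contra h3
        simp [h3] at h2
      rw [hPj, if_neg hij.symm] at h4
      rcases hPQ with ⟨-, h3, -⟩ | ⟨h3, -⟩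
      · rw [h3, Function.update_self]
        by_cases hei : e = i
        · subst hei
          rw [hIi']
          simp at h4 ⊢
          exact h4
        · rw [if_neg (Ne.symm hei)]
          by_cases hej : e = j
          · rw [hej, hIj']
          · rw [hIo e x hei hej, h1, hPj, if_neg (Ne.symm hej)]
      · exact absurd hPj h3
    · rw [(hPo x hxq).1]
      by_cases hej : e = j
      · rw [hej, hIj', ← h1 j, hjv, if_neg (Ne.symm hxq), if_neg (Ne.symm hxv)]
      · rw [← h1 e]
        by_cases hei : e = i
        · rw [hei, hIi', hiv, if_neg (Ne.symm hxq), if_neg (Ne.symm hxv)]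
        · exact hIo e x hei hej
  · intro x hx e
    have hxv : x ≠ v := huv x (by omega)
    have h1 := h.slots.two x (by rw [← hdo x hxv, hx])
    by_cases hxq : x = q
    · subst hxq
      have h2 := h1 j
      have h4 := h1 i
      rw [hjv, if_pos rfl, if_neg (Ne.symm hxv)] at h2
      rw [hiv, if_neg (Ne.symm hxv)] at h4
      -- At `q` one slot holds `j`; `k` is the edge in the other slot, which may be `i` if `p = q`.
      have key : ∀ k, ((P x = j ∧ Q x = k) ∨ (P x = k ∧ Q x = j)) → k ≠ j →
          W'.incidence e x = (if i = e then 1 else 0) + if k = e then 1 else 0 := by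
        intro k hk hkj
        have h1' : ∀ e, W.incidence e x = (if j = e then 1 else 0) + if k = e then 1 else 0 := by
          intro e
          rw [h1]
          rcases hk with ⟨h5, h6⟩ | ⟨h5, h6⟩ <;> rw [h5, h6]
          rw [add_comm]
        by_cases hej : e = j
        · rw [hej, hIj', if_neg hij, if_neg hkj]
        · by_cases hei : e = i
          · subst hei
            have h7 := h1' e
            rw [if_neg (Ne.symm hej), hiv, if_neg (Ne.symm hxv)] at h7
            rw [hIi', if_pos rfl, if_pos rfl]
            omega
          · rw [hIo e x hei hej, h1', if_neg (Ne.symm hei), if_neg (Ne.symm hej)]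
      rcases hPQ with ⟨h3, h5, h6⟩ | ⟨h3, h5, h6⟩
      · rw [h5, h6, Function.update_self]
        refine key _ (Or.inl ⟨h3, rfl⟩) fun h7 => ?_
        rw [h3, h7] at h2
        simp at h2
      · rw [h5, h6, Function.update_self, add_comm]
        refine key _ (Or.inr ⟨rfl, ?_⟩) h3
        by_contra h7
        simp [h3, h7] at h2
    · rw [(hPo x hxq).1, (hPo x hxq).2]
      by_cases hej : e = j
      · rw [hej, hIj', ← h1 j, hjv, if_neg (Ne.symm hxq), if_neg (Ne.symm hxv)]
      · rw [← h1 e]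
        by_cases hei : e = i
        · rw [hei, hIi', hiv, if_neg (Ne.symm hxq), if_neg (Ne.symm hxv)]
        · exact hIo e x hei hej
  · intro x
    by_cases hx : x = v
    · exact Or.inl (hx ▸ hdv)
    · rw [hdo x hx]
      exact h.deg x
  · intro x hx
    have hxv : x ≠ v := huv x (by omega)
    rw [hdo x hxv] at hx
    refine ⟨hx, fun hPQx => ?_⟩
    by_cases hxq : x = q
    -- At `q` the two slots cannot agree: then `j` would meet `q` twice or not at all, but it meets
    -- `q` once.
    · have h1 := h.slots.two x hx j
      rw [hjv, if_pos hxq.symm, if_neg (Ne.symm hxv), hPQx] at h1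
      split_ifs at h1 <;> omega
    · rw [(hPo x hxq).1, (hPo x hxq).2, hPQx]

end Tables

namespace RAM

theorem setReg_setReg (s : State) (x : ℕ) (v w : ℤ) : (s.setReg x v).setReg x w = s.setReg x w := by
  simp [State.setReg]

theorem setReg_self (s : State) (x : ℕ) : s.setReg x (s.reg x) = s := by
  simp [State.setReg]

/-- Three is subtracted as long as the length is at least `cap = q + 3`; the result is then still at
least `q`, in the range where the types are periodic. -/
theorem halts_reduce {W cap q l₀ : ℕ} {s : State} {Q : ℕ → State → Prop}
    (hq : ∀ k, q ≤ k → pathTypes k = pathTypes (k + 3)) (hq3 : 3 ≤ q) (hcap : cap = q + 3)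
    (h4 : s.reg 4 = (cap : ℤ) - 1) (h7 : s.reg 7 = 3) (hl : s.reg 25 = l₀) (hl3 : 3 ≤ l₀)
    (hW : l₀ ≤ W)
    (hQ : ∀ t l, t ≤ 2 * l₀ + 1 → l < cap → 3 ≤ l → pathTypes l = pathTypes l₀ →
      Q t (s.setReg 25 l)) :
    Halts W (.while 4 25 (.sub 25 25 7)) s Q := by
  refine halts_while (N := l₀) (T := 1) (fun k s' => ∃ l : ℕ, l ≤ k ∧ l ≤ l₀ ∧ 3 ≤ l ∧
    pathTypes l = pathTypes l₀ ∧ s' = s.setReg 25 l)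
    ⟨l₀, le_rfl, le_rfl, hl3, rfl, by rw [← hl, setReg_self]⟩ ?_ ?_
  · rintro k s' ⟨l, h1, h2, h3, h5, rfl⟩ hlt
    simp only [reg_setReg, show (4 : ℕ) ≠ 25 by norm_num, if_false, if_true, h4] at hlt
    refine ⟨k - 1, by omega, ?_⟩
    rw [halts_sub]
    simp only [reg_setReg, show (7 : ℕ) ≠ 25 by norm_num, if_false, if_true, h7, setReg_setReg]
    refine ⟨by rw [abs_le]; omega, le_rfl, l - 3, by omega, by omega, by omega, ?_, ?_⟩
    · rw [hq (l - 3) (by omega), show l - 3 + 3 = l by omega, h5]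
    · rw [Nat.cast_sub h3]
      rfl
  · rintro t k s' ht ⟨l, h1, h2, h3, h5, rfl⟩ hlt
    simp only [reg_setReg, show (4 : ℕ) ≠ 25 by norm_num, if_false, if_true, h4] at hlt
    exact hQ t l (by omega) (by omega) h3 h5

/-- Replace the edges `i` and `j` at the vertex `v` of degree two by one edge: compute its ends and
its length. -/
def mergeEnds : Program :=
  seqs [.load 23 0 21, .load 24 1 21, .add 23 23 24, .sub 23 23 20,
    .load 24 0 22, .load 25 1 22, .add 24 24 25, .sub 24 24 20,
    .store 0 21 23, .store 1 21 24,
    .load 25 5 21, .load 26 5 22, .add 25 25 26, .add 25 25 3]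

/-- Replace the edges `i` and `j` at the vertex `v` of degree two by one edge: update the tables. -/
def mergeSlots : Program :=
  seqs [.store 5 21 25, .store 5 22 5, .store 2 20 5, .load 26 3 24,
    ifEq 26 22 (.store 3 24 21) (.store 4 24 21)]

/-- Replace the edges `i` and `j` at the vertex `v` of degree two by one edge. -/
def mergeAt : Program :=
  seqs [mergeEnds, .while 4 25 (.sub 25 25 7), mergeSlots]

theorem halts_mergeAt {W q n m cap v : ℕ} {s : State} {Q : ℕ → State → Prop} {r : ℕ → ℤ}
    {deg₀ deg P Q' : ℕ → ℕ} {G : PathGraph}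
    (hq : ∀ k, q ≤ k → pathTypes k = pathTypes (k + 3)) (hq3 : 3 ≤ q) (hcap : cap = q + 3)
    (hr : Agree r s) (hr3 : r 3 = 1) (hr4 : r 4 = (cap : ℤ) - 1) (hr5 : r 5 = 0) (hr7 : r 7 = 3)
    (hv : s.reg 20 = v) (hi : s.reg 21 = P v) (hj : s.reg 22 = Q' v) (hij : P v ≠ Q' v)
    (h0 : s.arr 0 = natCells G.a) (h1 : s.arr 1 = natCells G.b) (h2 : s.arr 2 = natCells deg)
    (h3 : s.arr 3 = natCells P) (h4 : s.arr 4 = natCells Q') (h5 : s.arr 5 = natCells G.len)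
    (hz : ZeroFrom 6 s) (hT : Tables n m cap deg₀ G deg P Q') (hdv : deg v = 2)
    (hW : 2 * n + 2 * cap ≤ W)
    (hQ : ∀ t s' G' deg' P' Q'', t ≤ 4 * cap + 30 → Agree r s' → s'.reg 20 = v →
      s'.arr 0 = natCells G'.a → s'.arr 1 = natCells G'.b → s'.arr 2 = natCells deg' →
      s'.arr 3 = natCells P' → s'.arr 4 = natCells Q'' → s'.arr 5 = natCells G'.len →
      ZeroFrom 6 s' → Tables n m cap deg₀ G' deg' P' Q'' → G'.counts = G.counts → deg' v = 0 →
      (∀ u, deg' u = 2 → deg u = 2 ∧ (P u = Q' u → P' u = Q'' u)) → Q t s') :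
    Halts W mergeAt s Q := by
  have hI := hT.slots.two v hdv
  have hIi : G.incidence (P v) v = 1 := by
    rw [hI]
    simp [hij.symm]
  have hIj : G.incidence (Q' v) v = 1 := by
    rw [hI]
    simp [hij]
  obtain ⟨hiL, p, hpn, hpv, hpe, hei⟩ := hT.other_end hIi
  obtain ⟨hjL, p', hpn', hpv', hpe', hej⟩ := hT.other_end hIj
  have hli := hT.len_lt (P v)
  have hlj := hT.len_lt (Q' v)
  have hli' := ((hT.mem _).1 hiL).2
  have hlj' := ((hT.mem _).1 hjL).2
  have hai := hT.lt _ hiL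
  have haj := hT.lt _ hjL
  have hp : (G.a (P v) : ℤ) + G.b (P v) - v = p := by omega
  have hp' : (G.a (Q' v) : ℤ) + G.b (Q' v) - v = p' := by omega
  have c3 : s.reg 3 = 1 := (hr 3 (by norm_num)).trans hr3
  have c4 : s.reg 4 = (cap : ℤ) - 1 := (hr 4 (by norm_num)).trans hr4
  have c5 : s.reg 5 = 0 := (hr 5 (by norm_num)).trans hr5
  have c7 : s.reg 7 = 3 := (hr 7 (by norm_num)).trans hr7
  simp only [mergeAt, halts_seqs_cons]
  simp [mergeEnds, h0, h1, h5, hv, hi, hj, hp, hp', c3]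
  refine ⟨by rw [abs_le]; omega, by omega, by rw [abs_le]; omega, by omega, by rw [abs_le]; omega,
    by rw [abs_le]; omega, ?_⟩
  refine halts_reduce (l₀ := G.len (P v) + G.len (Q' v) + 1) hq hq3 hcap (by simp [c4])
    (by simp [c7]) (by simp) (by omega) (by omega) fun t l ht hlc hl3 hl => ?_
  have key := fun P' Q'' => hT.contract (P' := P') (Q' := Q'') hdv rfl rfl hij hei hpv hpn hej hpv'
    hpn' hl hl3 hlc rfl rfl
  simp [mergeSlots, h3, hv, hi, hj, c5]
  refine halts_ifEq (fun h => ?_) (fun h => ?_)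
  · have h : P p' = Q' v := by simpa [hj] using h
    obtain ⟨k1, k2, k3, k4⟩ := key _ _ (Or.inl ⟨h, rfl, rfl⟩)
    simp [hi]
    exact hQ _ _ _ _ _ _ (by omega) (by simpa using hr) (by simpa using hv) (by simp [h0])
      (by simp [h1]) (by simp [h2]) (by simp [h3]) (by simp [h4]) (by simp [h5])
      (by simpa using hz) k1 k2 k3 k4
  · have h : P p' ≠ Q' v := by simpa [hj] using h
    obtain ⟨k1, k2, k3, k4⟩ := key _ _ (Or.inr ⟨h, rfl, rfl⟩)
    simp [hi]
    constructor
    all_goals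
      exact hQ _ _ _ _ _ _ (by omega) (by simpa using hr) (by simpa using hv)
        (by simp [h0]) (by simp [h1]) (by simp [h2]) (by simp [h3]) (by simp [h4]) (by simp [h5])
        (by simpa using hz) k1 k2 k3 k4

/-- Contract all vertices of degree two. -/
def contractAll : Program :=
  seqs [.const 20 0, .while 20 1 (seqs [.load 21 2 20,
    ifEq 21 6 (seqs [.load 21 3 20, .load 22 4 20, ifEq 21 22 .skip mergeAt]) .skip,
    .add 20 20 3])]

/-- A vertex of degree two is skipped exactly if its two slots agree, that is, if it carries a loop.
The invariant that all vertices visited so far are of this kind, or not of degree two, survives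
later contractions by `Tables.contract`. -/
theorem halts_contractAll {W q n m cap : ℕ} {s : State} {Q : ℕ → State → Prop} {r : ℕ → ℤ}
    {deg₀ P Q' : ℕ → ℕ} {G : PathGraph}
    (hq : ∀ k, q ≤ k → pathTypes k = pathTypes (k + 3)) (hq3 : 3 ≤ q) (hcap : cap = q + 3)
    (hr : Agree r s) (hr1 : r 1 = n) (hr3 : r 3 = 1) (hr4 : r 4 = (cap : ℤ) - 1) (hr5 : r 5 = 0)
    (hr6 : r 6 = 2) (hr7 : r 7 = 3)
    (h0 : s.arr 0 = natCells G.a) (h1 : s.arr 1 = natCells G.b) (h2 : s.arr 2 = natCells deg₀)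
    (h3 : s.arr 3 = natCells P) (h4 : s.arr 4 = natCells Q') (h5 : s.arr 5 = natCells G.len)
    (hz : ZeroFrom 6 s) (hT : Tables n m cap deg₀ G deg₀ P Q') (hW : 2 * n + 2 * cap ≤ W)
    (hQ : ∀ t s' G' deg' P' Q'', t ≤ (4 * cap + 50) * (n + 1) → Agree r s' →
      s'.arr 0 = natCells G'.a → s'.arr 1 = natCells G'.b → s'.arr 2 = natCells deg' →
      s'.arr 5 = natCells G'.len →
      ZeroFrom 6 s' → Tables n m cap deg₀ G' deg' P' Q'' → G'.counts = G.counts →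
      (∀ v < n, deg' v = 2 → P' v = Q'' v) → Q t s') :
    Halts W contractAll s Q := by
  simp only [contractAll, halts_seqs_cons, halts_const]
  refine ⟨by simp, ?_⟩
  obtain ⟨J, hJ⟩ : ∃ J : ℕ → (ℕ → ℤ → ℤ) → Prop, ∀ k f, J k f ↔ ∃ G' deg' P' Q'',
      f 0 = natCells G'.a ∧ f 1 = natCells G'.b ∧
      f 2 = natCells deg' ∧ f 3 = natCells P' ∧ f 4 = natCells Q'' ∧
      f 5 = natCells G'.len ∧ Tables n m cap deg₀ G' deg' P' Q'' ∧ G'.counts = G.counts ∧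
      (∀ v < k, deg' v = 2 → P' v = Q'' v) := ⟨_, fun _ _ => Iff.rfl⟩
  refine halts_for (N := n) (T := 4 * cap + 45) (fun k s => Agree r s ∧ s.reg 20 = k ∧
    ZeroFrom 6 s ∧ J k s.arr) ?_ ?_ ?_ ?_
  · exact ⟨by simpa using hr, by simp, by simpa using hz, (hJ _ _).2 ⟨G, deg₀, P, Q', h0, h1, h2,
      h3, h4, h5, hT, rfl, by simp⟩⟩
  · rintro k s ⟨h1, h2, -⟩
    exact ⟨h2, (h1 1 (by norm_num)).trans hr1⟩
  · rintro k s hk ⟨hr, hk0, hz, hJ'⟩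
    obtain ⟨G', deg', P', Q'', h0, h1, h2, h3, h4, h5, hT, hc, hd⟩ := (hJ _ _).1 hJ'
    have c3 : s.reg 3 = 1 := (hr 3 (by norm_num)).trans hr3
    have c6 : s.reg 6 = 2 := (hr 6 (by norm_num)).trans hr6
    have hkW : |(k : ℤ) + 1| ≤ W := by
      rw [abs_le]
      omega
    simp only [halts_seqs_cons, halts_load]
    have hskip : (deg' k = 2 → P' k = Q'' k) → ∀ v < k + 1, deg' v = 2 → P' v = Q'' v := by
      intro h v hv
      rcases Nat.lt_succ_iff_lt_or_eq.1 hv with hv | rfl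
      · exact hd v hv
      · exact h
    refine halts_ifEq (fun h => ?_) (fun h => ?_)
    · have h : deg' k = 2 := by
        have h' : (deg' k : ℤ) = 2 := by simpa [hk0, h2, c6] using h
        exact_mod_cast h'
      simp only [halts_seqs_cons, halts_load]
      refine halts_ifEq (fun h' => ?_) (fun h' => ?_)
      · have h' : P' k = Q'' k := by simpa [hk0, h3, h4] using h'
        simp [hk0, c3]
        exact ⟨hkW, hr, hz, (hJ _ _).2 ⟨G', deg', P', Q'', h0, h1, h2, h3, h4, h5, hT, hc,
          hskip fun _ => h'⟩⟩
      · have h' : P' k ≠ Q'' k := by simpa [hk0, h3, h4] using h'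
        refine halts_mergeAt hq hq3 hcap (by simpa using hr) hr3 hr4 hr5 hr7 (v := k)
          (by simpa using hk0) (by simp [hk0, h3]) (by simp [hk0, h4]) h' (by simpa using h0)
          (by simpa using h1) (by simpa using h2) (by simpa using h3) (by simpa using h4)
          (by simpa using h5) (by simpa using hz) hT h hW ?_
        intro t s' G₂ deg₂ P₂ Q₂ ht hr hk0 h0 h1 h2 h3 h4 h5 hz hT hc' hd0 hd2
        have c3 : s'.reg 3 = 1 := (hr 3 (by norm_num)).trans hr3
        have hfin : ∀ v < k + 1, deg₂ v = 2 → P₂ v = Q₂ v := by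
          intro v hv hv2
          rcases Nat.lt_succ_iff_lt_or_eq.1 hv with hv | rfl
          · exact (hd2 v hv2).2 (hd v hv (hd2 v hv2).1)
          · omega
        simp [hk0, c3]
        constructor
        all_goals exact ⟨hkW, by omega, hr, hz, (hJ _ _).2 ⟨G₂, deg₂, P₂, Q₂, h0, h1,
          h2, h3, h4, h5, hT, hc'.trans hc, hfin⟩⟩
    · have h : deg' k ≠ 2 := by
        intro h'
        exact h (by simp [hk0, h2, c6, h'])
      simp [hk0, c3]
      exact ⟨hkW, hr, hz, (hJ _ _).2 ⟨G', deg', P', Q'', h0, h1, h2, h3,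
        h4, h5, hT, hc, hskip fun h' => absurd h' h⟩⟩
  · rintro t s ht ⟨hr, hk0, hz, hJ'⟩
    obtain ⟨G', deg', P', Q'', h0, h1, h2, h3, h4, h5, hT, hc, hd⟩ := (hJ _ _).1 hJ'
    simp only [halts_seqs_nil]
    refine hQ _ _ G' deg' P' Q'' ?_ hr h0 h1 h2 h5 hz hT hc hd
    nlinarith

end RAM

/-! ### The edges that matter -/

/-- The graph with fewer edges. -/
def PathGraph.restrict (W : PathGraph) (L : Finset ℕ) : PathGraph := { W with L := L }

theorem PathGraph.counts_restrict_sdiff (W : PathGraph) {S : Finset ℕ} (hSL : S ⊆ W.L)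
    (hS : ∀ e ∈ S, W.IsolatedEdge e ∧ W.a e ≠ W.b e) :
    (W.restrict (W.L \ S)).counts = W.counts := by
  induction S using Finset.induction_on with
  | empty =>
    rw [Finset.sdiff_empty]
    rfl
  | insert e S he ih =>
    rw [← ih (fun f hf => hSL (Finset.mem_insert_of_mem hf))
      (fun f hf => hS f (Finset.mem_insert_of_mem hf))]
    have h := hS e (Finset.mem_insert_self _ _)
    have h' : (W.restrict (W.L \ S)).IsolatedEdge e :=
      ⟨Finset.mem_sdiff.2 ⟨hSL (Finset.mem_insert_self _ _), he⟩,
        fun f hf hfe => h.1.other f (Finset.mem_sdiff.1 hf).1 hfe⟩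
    rw [← h'.counts_delEdge h.2]
    refine counts_congr ?_ (fun _ _ => rfl) (fun _ _ => rfl) (fun _ _ => rfl)
    simp only [restrict, delEdge, Finset.sdiff_insert]

/-- The edges that are not components without a cycle. -/
def PathGraph.keep (W : PathGraph) (deg : ℕ → ℕ) : Finset ℕ :=
  W.L.filter fun e => 2 < deg (W.a e) + deg (W.b e)

namespace Tables

variable {n m cap : ℕ} {deg₀ deg P Q : ℕ → ℕ} {W : PathGraph}

theorem one_le_deg (h : Tables n m cap deg₀ W deg P Q) {e v : ℕ} (he : e ∈ W.L)
    (hv : W.a e = v ∨ W.b e = v) : W.incidence e v ≤ deg v ∧ 1 ≤ W.incidence e v := by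
  constructor
  · rw [← h.slots.sum v]
    exact Finset.single_le_sum (f := fun e => W.incidence e v) (fun _ _ => Nat.zero_le _) he
  · rw [PathGraph.incidence, if_pos he]
    rcases hv with hv | hv <;> rw [if_pos hv] <;> omega

/-- The edge `e` already exhausts the degree of `v`. -/
theorem eq_of_incidence_eq (h : Tables n m cap deg₀ W deg P Q) {e v : ℕ} (he : e ∈ W.L)
    (hv : W.incidence e v = deg v) {f : ℕ} (hf : f ∈ W.L) (hfe : f ≠ e) :
    W.a f ≠ v ∧ W.b f ≠ v := by
  have h1 := h.slots.sum v
  rw [← Finset.add_sum_erase _ _ he, hv, Nat.add_eq_left, Finset.sum_eq_zero_iff] at h1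
  have h2 := h1 f (Finset.mem_erase.2 ⟨hfe, hf⟩)
  simp only [PathGraph.incidence, if_pos hf] at h2
  constructor <;> intro h3 <;> simp [h3] at h2

theorem isolatedEdge (h : Tables n m cap deg₀ W deg P Q) {e : ℕ} (he : e ∈ W.L)
    (ha : W.incidence e (W.a e) = deg (W.a e)) (hb : W.incidence e (W.b e) = deg (W.b e)) :
    W.IsolatedEdge e := by
  refine ⟨he, fun f hf hfe => ?_⟩
  have h1 := h.eq_of_incidence_eq he ha hf hfe
  have h2 := h.eq_of_incidence_eq he hb hf hfe
  exact ⟨⟨h1.1, h2.1⟩, ⟨h1.2, h2.2⟩⟩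

theorem incidence_of_ne {e : ℕ} (he : e ∈ W.L) (hab : W.a e ≠ W.b e) :
    W.incidence e (W.a e) = 1 ∧ W.incidence e (W.b e) = 1 := by
  simp [PathGraph.incidence, he, hab, hab.symm]

theorem incidence_of_eq {e : ℕ} (he : e ∈ W.L) (hab : W.a e = W.b e) :
    W.incidence e (W.a e) = 2 := by
  simp [PathGraph.incidence, he, hab]

/-- A dropped edge has degree sum at most two at its ends, hence both ends have degree one and it is
not a loop, since a loop counts twice at its vertex. So it is a component that is a path. -/
theorem counts_keep (h : Tables n m cap deg₀ W deg P Q) :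
    (W.restrict (W.keep deg)).counts = W.counts := by
  have h1 := W.counts_restrict_sdiff (S := W.L \ W.keep deg) Finset.sdiff_subset fun e he => by
    obtain ⟨heL, hk⟩ := Finset.mem_sdiff.1 he
    have hk' : deg (W.a e) + deg (W.b e) ≤ 2 := by
      by_contra hc
      exact hk (Finset.mem_filter.2 ⟨heL, by omega⟩)
    have ha := h.one_le_deg heL (Or.inl rfl)
    have hb := h.one_le_deg heL (Or.inr rfl)
    have hab : W.a e ≠ W.b e := by
      intro hab
      have h2 := incidence_of_eq heL hab
      rw [← hab] at hk'
      omega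
    have h2 := incidence_of_ne heL hab
    exact ⟨h.isolatedEdge heL (by omega) (by omega), hab⟩
  have h2 : W.keep deg ⊆ W.L := Finset.filter_subset _ _
  rwa [Finset.sdiff_sdiff_eq_self h2] at h1

/-- After the contraction a vertex of degree two carries just a loop. So a kept edge is either such
a loop, and these are cycle components, or it has an end of degree at least three. Degrees that are
not zero are the original ones, so the bound `hB` for the input graph applies. -/
theorem card_keep_le (h : Tables n m cap deg₀ W deg P Q)
    (hPQ : ∀ v < n, deg v = 2 → P v = Q v) {M B : ℕ} (hM : ∀ c ∈ W.counts, c ≤ M)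
    (hB : ∀ X : Finset ℕ, (∀ v ∈ X, 3 ≤ deg₀ v) → ∑ v ∈ X, deg₀ v ≤ B) :
    (W.keep deg).card ≤ M + B := by
  set S := W.L.filter fun e => W.a e = W.b e ∧ deg (W.a e) = 2 with hS
  set X := (Finset.range n).filter fun v => 3 ≤ deg v with hX
  have hSM : S.card ≤ M := by
    obtain ⟨c, hc, hc'⟩ := W.exists_two_pow_le_of_loops S fun e he => by
      obtain ⟨heL, hab, hd⟩ := Finset.mem_filter.1 he
      have h2 := incidence_of_eq heL hab
      refine ⟨h.isolatedEdge heL (by omega) ?_, hab, h.loop e heL hab⟩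
      rw [← hab]
      omega
    -- In fact the number of loops is at most logarithmic in `M`; the linear bound is enough.
    exact (Nat.lt_two_pow_self.le.trans hc').trans (hM c hc)
  have hsub : W.keep deg ⊆ S ∪ X.biUnion fun v => W.L.filter fun e => W.incidence e v ≠ 0 := by
    intro e he
    obtain ⟨heL, hk⟩ := Finset.mem_filter.1 he
    have ha := h.one_le_deg heL (Or.inl rfl)
    have hb := h.one_le_deg heL (Or.inr rfl)
    have hlt := h.lt e heL
    have hfin : (3 ≤ deg (W.a e) ∨ 3 ≤ deg (W.b e)) →
        e ∈ S ∪ X.biUnion fun v => W.L.filter fun e => W.incidence e v ≠ 0 := by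
      rintro (h3 | h3)
      · exact Finset.mem_union_right _ (Finset.mem_biUnion.2 ⟨W.a e,
          Finset.mem_filter.2 ⟨Finset.mem_range.2 hlt.1, h3⟩,
          Finset.mem_filter.2 ⟨heL, by omega⟩⟩)
      · exact Finset.mem_union_right _ (Finset.mem_biUnion.2 ⟨W.b e,
          Finset.mem_filter.2 ⟨Finset.mem_range.2 hlt.2, h3⟩,
          Finset.mem_filter.2 ⟨heL, by omega⟩⟩)
    by_cases hab : W.a e = W.b e
    · have h2 := incidence_of_eq heL hab
      by_cases h3 : deg (W.a e) = 2
      · exact Finset.mem_union_left _ (Finset.mem_filter.2 ⟨heL, hab, h3⟩)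
      · exact hfin (Or.inl (by omega))
    · have h2 := incidence_of_ne heL hab
      have hne : ∀ v < n, W.incidence e v = 1 → deg v ≠ 2 := by
        intro v hv h3 h4
        have h5 := h.slots.two v h4 e
        rw [h3, hPQ v hv h4] at h5
        split_ifs at h5 <;> omega
      have h3 := hne _ hlt.1 h2.1
      have h4 := hne _ hlt.2 h2.2
      exact hfin (by omega)
  refine (Finset.card_le_card hsub).trans ((Finset.card_union_le _ _).trans
    (add_le_add hSM (Finset.card_biUnion_le.trans ?_)))
  have hdeg : ∀ v ∈ X, deg v = deg₀ v := fun v hv => by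
    have := (Finset.mem_filter.1 hv).2
    exact (h.deg v).resolve_left (by omega)
  refine le_trans (Finset.sum_le_sum fun v hv => ?_) (hB X fun v hv => ?_)
  · rw [← hdeg v hv, ← h.slots.sum v, Finset.card_filter]
    refine Finset.sum_le_sum fun e _ => ?_
    split_ifs <;> omega
  · rw [← hdeg v hv]
    exact (Finset.mem_filter.1 hv).2

end Tables

/-- The vertices below `n` with a non-zero entry are numbered `1, …, cnt`. -/
structure VertexNumbering (n : ℕ) (new : ℕ → ℕ) (cnt : ℕ) : Prop where
  le : ∀ v, new v ≤ cnt
  inj : ∀ v w, new v ≠ 0 → new v = new w → v = w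
  lt : ∀ v, new v ≠ 0 → v < n

theorem VertexNumbering.update {n cnt v : ℕ} {new : ℕ → ℕ} (h : VertexNumbering n new cnt)
    (hv : v < n) :
    VertexNumbering n (Function.update new v (cnt + 1)) (cnt + 1) where
  le u := by
    have := h.le u
    rw [Function.update_apply]
    split_ifs <;> omega
  inj u w hu := by
    have h1 := h.le u
    have h2 := h.le w
    have h3 := h.inj u w
    rw [Function.update_apply] at hu
    simp only [Function.update_apply]
    split_ifs at hu ⊢ with h4 h5 <;> intro h6 <;> omega
  lt u hu := by
    rw [Function.update_apply] at hu
    split_ifs at hu with h1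
    · omega
    · exact h.lt u hu

namespace RAM

/-- Number the vertex in the register `x` if it has no number yet. -/
def assign (x : ℕ) : Program :=
  seqs [.load 25 6 x, ifEq 25 5 (seqs [.add 31 31 3, .store 6 x 31]) .skip]

theorem halts_assign {W n x v cnt : ℕ} {new : ℕ → ℕ} {s : State} {Q : ℕ → State → Prop}
    (hx25 : x ≠ 25) (hx31 : x ≠ 31) (h3 : s.reg 3 = 1)
    (h5 : s.reg 5 = 0) (hx : s.reg x = v) (h31 : s.reg 31 = cnt) (h6 : s.arr 6 = natCells new)
    (hN : VertexNumbering n new cnt) (hv : v < n) (hW : cnt + 1 ≤ W)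
    (hQ : ∀ t s' new' cnt', t ≤ 10 → (∀ y, y ≠ 25 → y ≠ 31 → s'.reg y = s.reg y) →
      (∀ a, a ≠ 6 → s'.arr a = s.arr a) → s'.reg 31 = ((cnt' : ℕ) : ℤ) → s'.arr 6 = natCells new' →
      VertexNumbering n new' cnt' → cnt' ≤ cnt + 1 → new' v ≠ 0 → (∀ u, new u ≠ 0 → new' u ≠ 0) →
      Q t s') : Halts W (assign x) s Q := by
  simp only [assign, halts_seqs_cons, halts_load]
  refine halts_ifEq (fun h => ?_) (fun h => ?_)
  · have h : new v = 0 := by simpa [hx, h6, h5] using h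
    simp [hx31, hx25, hx, h31, h6, h3]
    refine ⟨by rw [abs_le]; omega, hQ _ _ (Function.update new v (cnt + 1)) (cnt + 1) (by omega)
      (fun y h1 h2 => by simp [h1, h2]) (fun a ha => by simp [ha]) (by simp) (by simp [h6])
      (hN.update hv) le_rfl (by simp) fun u hu => ?_⟩
    rw [Function.update_apply]
    split_ifs
    · omega
    · exact hu
  · have h : new v ≠ 0 := by simpa [hx, h6, h5] using h
    simp only [halts_skip, halts_seqs_nil]
    constructor
    all_goals
      exact hQ _ _ new cnt (by omega) (fun y h1 h2 => by simp [h1]) (fun a ha => by simp)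
        (by simpa using h31) (by simpa using h6) hN (by omega) h fun _ hu => hu

/-- Delete the components without a cycle, and count and number what is left. -/
def selectEdges : Program :=
  seqs [.const 20 0, .const 30 0, .const 31 0, .while 20 2 (seqs [.load 21 5 20,
    .ite 5 21 (seqs [.load 22 0 20, .load 23 1 20, .load 24 2 22, .load 25 2 23, .add 24 24 25,
      .ite 6 24 (seqs [.add 30 30 3, assign 22, assign 23]) (.store 5 20 5)]) .skip,
    .add 20 20 3])]

/-- Edges are deleted by writing the length zero. Every kept edge numbers at most two new vertices,
whence the bound on `cnt`. -/
theorem halts_selectEdges {W n m cap : ℕ} {s : State} {Q : ℕ → State → Prop} {r : ℕ → ℤ}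
    {deg₀ deg P Q' : ℕ → ℕ} {G : PathGraph}
    (hr : Agree r s) (hr2 : r 2 = m) (hr3 : r 3 = 1) (hr5 : r 5 = 0) (hr6 : r 6 = 2)
    (h0 : s.arr 0 = natCells G.a) (h1 : s.arr 1 = natCells G.b) (h2 : s.arr 2 = natCells deg)
    (h5 : s.arr 5 = natCells G.len)
    (hz : ZeroFrom 6 s) (hT : Tables n m cap deg₀ G deg P Q') (hdeg : ∀ v, deg v ≤ 2 * m)
    (hW : 4 * m + 4 ≤ W)
    (hQ : ∀ t s' cnt new, t ≤ 50 * (m + 1) → Agree r s' →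
      s'.reg 30 = (G.keep deg).card → s'.reg 31 = ((cnt : ℕ) : ℤ) → cnt ≤ 2 * (G.keep deg).card →
      s'.arr 0 = natCells G.a → s'.arr 1 = natCells G.b →
      s'.arr 5 = natCells (fun e => if e < m ∧ e ∉ G.keep deg then 0 else G.len e) →
      s'.arr 6 = natCells new → ZeroFrom 7 s' → VertexNumbering n new cnt →
      (∀ e ∈ G.keep deg, new (G.a e) ≠ 0 ∧ new (G.b e) ≠ 0) → Q t s') :
    Halts W selectEdges s Q := by
  have hkm : ∀ e ∈ G.keep deg, e < m := fun e he =>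
    ((hT.mem e).1 (Finset.mem_filter.1 he).1).1
  simp only [selectEdges, halts_seqs_cons, halts_const]
  refine ⟨by simp, by simp, by simp, ?_⟩
  obtain ⟨J, hJ⟩ : ∃ J : ℕ → ℤ → ℤ → (ℤ → ℤ) → (ℤ → ℤ) → Prop, ∀ k x y f g, J k x y f g ↔
      ∃ cnt new, x = ((G.keep deg).filter (· < k)).card ∧ y = (cnt : ℕ) ∧
      f = natCells (fun e => if e < k ∧ e ∉ G.keep deg then 0 else G.len e) ∧
      g = natCells new ∧ VertexNumbering n new cnt ∧
      cnt ≤ 2 * ((G.keep deg).filter (· < k)).card ∧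
      ∀ e ∈ G.keep deg, e < k → new (G.a e) ≠ 0 ∧ new (G.b e) ≠ 0 := ⟨_, fun _ _ _ _ _ => Iff.rfl⟩
  refine halts_for (N := m) (T := 46) (fun k s => Agree r s ∧ s.reg 20 = k ∧ ZeroFrom 7 s ∧
    s.arr 0 = natCells G.a ∧ s.arr 1 = natCells G.b ∧ s.arr 2 = natCells deg ∧
    J k (s.reg 30) (s.reg 31) (s.arr 5) (s.arr 6)) ?_ ?_ ?_ ?_
  · refine ⟨by simpa using hr, by simp, fun a ha => hz a (by omega), h0, h1, h2,
      (hJ _ _ _ _ _).2 ⟨0, fun _ => 0, by simp, by simp, by simpa using h5, hz 6 (by omega),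
      ⟨by simp, by simp, by simp⟩, by simp, by simp⟩⟩
  · rintro k s ⟨h1, h2, -⟩
    exact ⟨h2, (h1 2 (by norm_num)).trans hr2⟩
  · rintro k s hk ⟨hr, hk0, hz, h0, h1, h2, hJ'⟩
    obtain ⟨cnt, new, h30, h31, h5, h6, hN, hcnt, hnew⟩ := (hJ _ _ _ _ _).1 hJ'
    have c3 : s.reg 3 = 1 := (hr 3 (by norm_num)).trans hr3
    have c5 : s.reg 5 = 0 := (hr 5 (by norm_num)).trans hr5
    have c6 : s.reg 6 = 2 := (hr 6 (by norm_num)).trans hr6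
    have hkW : |(k : ℤ) + 1| ≤ W := by
      rw [abs_le]
      omega
    have hc : ((G.keep deg).filter (· < k)).card ≤ k := by
      calc _ ≤ (Finset.range k).card := Finset.card_le_card fun e he =>
            Finset.mem_range.2 (Finset.mem_filter.1 he).2
        _ = k := Finset.card_range k
    have hsucc : (G.keep deg).filter (· < k + 1) =
        if k ∈ G.keep deg then insert k ((G.keep deg).filter (· < k)) else
          (G.keep deg).filter (· < k) := by
      ext e
      split_ifs with h <;> simp only [Finset.mem_filter, Finset.mem_insert] <;> constructor
      · rintro ⟨h1, h2⟩
        by_cases h3 : e = k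
        · exact Or.inl h3
        · exact Or.inr ⟨h1, by omega⟩
      · rintro (rfl | h3)
        · exact ⟨h, by omega⟩
        · exact ⟨h3.1, by omega⟩
      · rintro ⟨h1, h2⟩
        have : e ≠ k := fun h3 => h (h3 ▸ h1)
        exact ⟨h1, by omega⟩
      · rintro ⟨h1, h2⟩
        exact ⟨h1, by omega⟩
    have hnot : k ∉ G.keep deg → ((G.keep deg).filter (· < k + 1)) =
        ((G.keep deg).filter (· < k)) := fun h => by rw [hsucc, if_neg h]
    have hin : k ∈ G.keep deg → ((G.keep deg).filter (· < k + 1)).card =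
        ((G.keep deg).filter (· < k)).card + 1 := fun h => by
      rw [hsucc, if_pos h, Finset.card_insert_of_notMem (by simp)]
    have hda := hdeg (G.a k)
    have hdb := hdeg (G.b k)
    have h5k : (if k < k ∧ k ∉ G.keep deg then 0 else G.len k) = G.len k := by simp
    simp only [halts_seqs_cons, halts_load, halts_ite, arr_setReg, reg_setReg, hk0, h5,
      natCells_natCast, h5k, show (5 : ℕ) ≠ 21 by norm_num, if_false, if_true, c5]
    by_cases hl : G.len k = 0
    · have hkn : k ∉ G.keep deg := fun h => ((hT.mem k).1 (Finset.mem_filter.1 h).1).2 hl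
      simp [hl, hk0, c3]
      refine ⟨hkW, hr, hz, h0, h1, h2, (hJ _ _ _ _ _).2 ⟨cnt, new, by rw [hnot hkn]; exact h30,
        h31, ?_, h6, hN, by rw [hnot hkn]; exact hcnt, fun e he hek => hnew e he ?_⟩⟩
      · rw [h5]
        congr 1
        funext e
        by_cases he : e = k
        · subst he
          simp [hl]
        · have : (e < k + 1) ↔ e < k := by omega
          simp only [this]
      · have : e ≠ k := fun h => hkn (h ▸ he)
        omega
    · have hkL : k ∈ G.L := (hT.mem k).2 ⟨hk, hl⟩
      have hlt := hT.lt k hkL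
      rw [if_pos (by omega)]
      by_cases hkeep : 2 < deg (G.a k) + deg (G.b k)
      · have hkk : k ∈ G.keep deg := Finset.mem_filter.2 ⟨hkL, hkeep⟩
        simp [hk0, h0, h1, h2, c6]
        refine ⟨by rw [abs_le]; omega, ?_⟩
        rw [if_pos (by omega)]
        simp [c3, h30]
        refine ⟨by rw [abs_le]; omega, ?_⟩
        refine halts_assign (v := G.a k) (cnt := cnt) (new := new) (by norm_num) (by norm_num)
          (by simpa using c3) (by simpa using c5) (by simp) (by simpa using h31)
          (by simpa using h6) hN hlt.1 (by omega) ?_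
        intro t s₁ new₁ cnt₁ ht hreg harr h31 h6 hN hcnt₁ hv hu
        refine halts_assign (v := G.b k) (cnt := cnt₁) (new := new₁) (by norm_num) (by norm_num)
          (by rw [hreg 3 (by norm_num) (by norm_num)]; simpa using c3)
          (by rw [hreg 5 (by norm_num) (by norm_num)]; simpa using c5)
          (by rw [hreg 23 (by norm_num) (by norm_num)]; simp) h31
          h6 hN hlt.2 (by omega) ?_
        intro t₂ s₂ new₂ cnt₂ ht₂ hreg₂ harr₂ h31 h6 hN hcnt₂ hv₂ hu₂
        have hreg' : ∀ y, y < 25 ∨ y = 30 → s₂.reg y = _ := fun y hy =>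
          (hreg₂ y (by omega) (by omega)).trans (hreg y (by omega) (by omega))
        have harr' : ∀ a, a ≠ 6 → s₂.arr a = _ := fun a ha => (harr₂ a ha).trans (harr a ha)
        have e3 : s₂.reg 3 = 1 := by
          rw [hreg' 3 (by norm_num)]
          simpa using c3
        have e20 : s₂.reg 20 = k := by
          rw [hreg' 20 (by norm_num)]
          simpa using hk0
        have e30 : s₂.reg 30 = ((G.keep deg).filter (· < k + 1)).card := by
          rw [hreg' 30 (by norm_num), hin hkk]
          simp
        have eA : Agree r s₂ := fun y hy => by
          rw [hreg' y (by omega)]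
          simp only [reg_setReg]
          rw [if_neg (by omega), if_neg (by omega), if_neg (by omega), if_neg (by omega),
            if_neg (by omega), if_neg (by omega), if_neg (by omega)]
          exact hr y hy
        have eZ : ZeroFrom 7 s₂ := fun a ha => by
          rw [harr' a (by omega)]
          exact hz a ha
        simp [e3, e20]
        refine ⟨hkW, by omega, eA, eZ, (harr' 0 (by norm_num)).trans h0,
          (harr' 1 (by norm_num)).trans h1, (harr' 2 (by norm_num)).trans h2,
          (hJ _ _ _ _ _).2 ⟨cnt₂, new₂, e30, h31, ?_, h6, hN, by rw [hin hkk]; omega, ?_⟩⟩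
        · rw [(harr' 5 (by norm_num)).trans h5]
          congr 1
          funext e
          by_cases he : e = k
          · subst he
            simp [hkk]
          · have : (e < k + 1) ↔ e < k := by omega
            simp only [this]
        · intro e he hek
          by_cases he' : e = k
          · subst he'
            exact ⟨hu₂ _ hv, hv₂⟩
          · have := hnew e he (by omega)
            exact ⟨hu₂ _ (hu _ this.1), hu₂ _ (hu _ this.2)⟩
      · have hkn : k ∉ G.keep deg := fun h => hkeep (Finset.mem_filter.1 h).2
        simp [hk0, h0, h1, h2, c6]
        refine ⟨by rw [abs_le]; omega, ?_⟩
        rw [if_neg (by omega)]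
        simp [c3, c5, h5]
        refine ⟨hkW, hr, hz, (hJ _ _ _ _ _).2 ⟨cnt, new, by rw [hnot hkn]; exact h30,
          h31, ?_, h6, hN, by rw [hnot hkn]; exact hcnt, fun e he hek => hnew e he ?_⟩⟩
        · congr 1
          funext e
          by_cases he : e = k
          · subst he
            simp [hkn]
          · have : (e < k + 1) ↔ e < k := by omega
            simp [this, he]
        · have : e ≠ k := fun h => hkn (h ▸ he)
          omega
  · rintro t s ht ⟨hr, hk0, hz, h0, h1, h2, hJ'⟩
    obtain ⟨cnt, new, h30, h31, h5, h6, hN, hcnt, hnew⟩ := (hJ _ _ _ _ _).1 hJ'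
    have hall : (G.keep deg).filter (· < m) = G.keep deg := Finset.filter_true_of_mem hkm
    rw [hall] at h30 hcnt
    simp only [halts_seqs_nil]
    exact hQ _ _ cnt new (by omega) hr h30 h31 hcnt h0 h1 h5 h6 hz hN
      fun e he => hnew e he (hkm e he)

end RAM

/-! ### The matrix of what is left -/

/-- The vertex with the number `x`; the numbers that are not used stand for new vertices. -/
noncomputable def vertexName (n : ℕ) (new : ℕ → ℕ) (x : ℕ) : ℕ :=
  open Classical in if h : x ≠ 0 ∧ ∃ v, new v = x then h.2.choose else n + x

theorem VertexNumbering.vertexName_new {n cnt v : ℕ} {new : ℕ → ℕ} (h : VertexNumbering n new cnt)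
    (hv : new v ≠ 0) : vertexName n new (new v) = v := by
  have h1 : new v ≠ 0 ∧ ∃ w, new w = new v := ⟨hv, v, rfl⟩
  rw [vertexName, dif_pos h1]
  exact (h.inj _ _ hv h1.2.choose_spec.symm).symm

theorem VertexNumbering.vertexName_of_lt {n cnt x : ℕ} {new : ℕ → ℕ}
    (h : VertexNumbering n new cnt) (hx : cnt < x) : vertexName n new x = n + x := by
  rw [vertexName, dif_neg]
  rintro ⟨-, v, hv⟩
  have := h.le v
  omega

/-- Numbers in use name vertices below `n`, where `new` is injective; all other numbers `x` name `n
+ x`. Number zero is never in use and names `n` itself. -/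
theorem VertexNumbering.vertexName_injective {n cnt : ℕ} {new : ℕ → ℕ}
    (h : VertexNumbering n new cnt) : Function.Injective (vertexName n new) := by
  have key : ∀ x, (∃ v, v < n ∧ new v = x ∧ vertexName n new x = v) ∨
      vertexName n new x = n + x := by
    intro x
    by_cases hx : x ≠ 0 ∧ ∃ v, new v = x
    · obtain ⟨hx0, v, rfl⟩ := hx
      exact Or.inl ⟨v, h.lt v hx0, rfl, h.vertexName_new hx0⟩
    · right
      rw [vertexName, dif_neg hx]
  intro x y hxy
  rcases key x with ⟨v, hv, hv', hx⟩ | hx <;> rcases key y with ⟨w, hw, hw', hy⟩ | hy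
  · have : v = w := by rw [← hx, ← hy, hxy]
    rw [← hv', ← hw', this]
  · omega
  · omega
  · omega

/-- The matrix entry of an edge from `u` to `v` at the position of the vertices `p` and `q`. -/
def edgeEntry (u v p q : ℕ) : ℕ :=
  (if u = p ∧ v = q then 1 else 0) + (if v = p ∧ u = q then 1 else 0)

/-- The state of the construction: all edges of `W` in `L` below `k` have been replaced by edges
without inner vertices, the edges from `k'` on are untouched, the numbers up to `cnt` have been
used, and the table `M` is the matrix of the edges without inner vertices. -/
structure Expansion (n m N S K : ℕ) (f : ℕ → ℕ) (W : PathGraph) (L : Finset ℕ) (k k' : ℕ)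
    (X : PathGraph) (cnt : ℕ) (M : ℕ → ℕ) : Prop where
  counts : X.counts = W.counts
  low : ∀ e < m, e ∈ X.L ↔ e ∈ L
  todo : ∀ e ∈ L, k' ≤ e → X.a e = W.a e ∧ X.len e = W.len e
  todo_b : ∀ e ∈ L, k ≤ e → X.b e = W.b e
  le : ∀ e ∈ X.L, e ≤ m + cnt
  vert : ∀ e ∈ X.L, X.a e ≤ n + cnt ∧ X.b e ≤ n + cnt
  done : ∀ e ∈ X.L, e < k ∨ m ≤ e →
    X.len e = 0 ∧ ∃ x y, x ≤ cnt ∧ y ≤ cnt ∧ X.a e = f x ∧ X.b e = f y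
  pot : cnt + ∑ e ∈ X.L, X.len e ≤ S
  card : X.L.card ≤ K + cnt
  mat : ∀ x < N, ∀ y < N, M (x * N + y) = (if x = y then 1 else 0) +
    ∑ e ∈ X.L with e < k ∨ m ≤ e, edgeEntry (X.a e) (X.b e) (f x) (f y)

namespace Expansion

variable {n m N S K k cnt : ℕ} {f : ℕ → ℕ} {W X : PathGraph} {L : Finset ℕ} {M M' : ℕ → ℕ}

/-- One inner vertex of the edge `k` becomes the vertex numbered `cnt + 1`, joined to the old first
end by the new edge `m + (cnt + 1)`. The sum of `cnt` and all remaining lengths stays the same,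
which bounds the numbers that will ever be used. -/
theorem expand (h : Expansion n m N S K f W L k (k + 1) X cnt M) (hm : ∀ e ∈ L, e < m)
    (hf : Function.Injective f) {x l : ℕ} (hk : k ∈ L) (hl : X.len k = l + 1)
    (hx : X.a k = f x) (hxc : x ≤ cnt) (hfc : f (cnt + 1) = n + (cnt + 1))
    (hM : ∀ x' < N, ∀ y' < N, M' (x' * N + y') = M (x' * N + y') +
      edgeEntry x (cnt + 1) x' y') :
    ∃ X', Expansion n m N S K f W L k (k + 1) X' (cnt + 1) M' ∧ X'.len k = l ∧
      X'.a k = f (cnt + 1) := by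
  have hkm := hm k hk
  have hkX : k ∈ X.L := (h.low k hkm).2 hk
  have hj : m + (cnt + 1) ∉ X.L := fun hj => by
    have := h.le _ hj
    omega
  have hkj : k ≠ m + (cnt + 1) := by omega
  have hs : ¬ X.Touched (n + (cnt + 1)) := by
    rintro ⟨e, he, h1⟩
    have := h.vert e he
    omega
  have hne : ∀ e ∈ X.L, e ≠ m + (cnt + 1) := fun e he h1 => hj (h1 ▸ he)
  refine ⟨_, ⟨(X.counts_expand hkX hj hs hl).trans h.counts, ?_, ?_, ?_, ?_, ?_, ?_, ?_, ?_, ?_⟩,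
    ?_, ?_⟩
  · intro e he
    rw [Finset.mem_insert, ← h.low e he]
    constructor
    · rintro (h1 | h1)
      · omega
      · exact h1
    · exact Or.inr
  · intro e he hke
    have h1 : e ≠ k := by omega
    have h2 : e ≠ m + (cnt + 1) := by
      have := hm e he
      omega
    simpa [h1, h2] using h.todo e he hke
  · intro e he hke
    have h2 : e ≠ m + (cnt + 1) := by
      have := hm e he
      omega
    simpa [h2] using h.todo_b e he hke
  · intro e he
    rcases Finset.mem_insert.1 he with h1 | h1
    · omega
    · have := h.le e h1
      omega
  · intro e he
    simp only [Function.update_apply]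
    have h2 := h.vert k hkX
    rcases Finset.mem_insert.1 he with h1 | h1
    · rw [if_neg (by omega), if_pos h1, if_pos h1]
      omega
    · have h3 := h.vert e h1
      rw [if_neg (hne e h1), if_neg (hne e h1)]
      split_ifs <;> omega
  · intro e he hd
    have h1 : e ≠ k := by omega
    rcases Finset.mem_insert.1 he with h2 | h2
    · subst h2
      simp only [Function.update_of_ne h1, Function.update_self]
      exact ⟨trivial, x, cnt + 1, by omega, le_rfl, hx, hfc.symm⟩
    · obtain ⟨h3, x', y', h4, h5, h6, h7⟩ := h.done e h2 hd
      simp only [Function.update_of_ne h1, Function.update_of_ne (hne e h2)]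
      exact ⟨h3, x', y', by omega, by omega, h6, h7⟩
  · have h1 := h.pot
    rw [← Finset.add_sum_erase _ _ hkX, hl] at h1
    rw [Finset.sum_insert hj, ← Finset.add_sum_erase _ _ hkX]
    simp only [Function.update_self, Function.update_of_ne hkj.symm]
    have h2 : ∑ e ∈ X.L.erase k, Function.update (Function.update X.len (m + (cnt + 1)) 0) k l e =
        ∑ e ∈ X.L.erase k, X.len e := by
      refine Finset.sum_congr rfl fun e he => ?_
      obtain ⟨h3, h4⟩ := Finset.mem_erase.1 he
      rw [Function.update_of_ne h3, Function.update_of_ne (hne e h4)]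
    rw [h2]
    omega
  · rw [Finset.card_insert_of_notMem hj]
    have := h.card
    omega
  · intro x' hx' y' hy'
    rw [hM x' hx' y' hy', h.mat x' hx' y' hy', Finset.filter_insert,
      if_pos (Or.inr (Nat.le_add_right m (cnt + 1))),
      Finset.sum_insert (fun h1 => hj (Finset.mem_filter.1 h1).1)]
    simp only [Function.update_self, Function.update_of_ne hkj.symm]
    have h2 : ∀ e ∈ X.L.filter (fun e => e < k ∨ m ≤ e),
        edgeEntry (Function.update (Function.update X.a (m + (cnt + 1)) (X.a k)) k (n + (cnt + 1)) e)
        (Function.update X.b (m + (cnt + 1)) (n + (cnt + 1)) e) (f x') (f y') =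
        edgeEntry (X.a e) (X.b e) (f x') (f y') := by
      intro e he
      obtain ⟨h3, h4⟩ := Finset.mem_filter.1 he
      rw [Function.update_of_ne (by omega), Function.update_of_ne (hne e h3),
        Function.update_of_ne (hne e h3)]
    rw [Finset.sum_congr rfl h2, hx, ← hfc]
    have h3 : edgeEntry (f x) (f (cnt + 1)) (f x') (f y') = edgeEntry x (cnt + 1) x' y' := by
      simp only [edgeEntry, hf.eq_iff]
    rw [h3]
    ring
  · simp
  · simp [hfc]

/-- When no inner vertex is left, the edge `k` itself enters the matrix. -/
theorem finish (h : Expansion n m N S K f W L k (k + 1) X cnt M) (hm : ∀ e ∈ L, e < m)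
    (hf : Function.Injective f) {x y : ℕ} (hk : k ∈ L) (hl : X.len k = 0)
    (hx : X.a k = f x) (hxc : x ≤ cnt) (hy : W.b k = f y) (hyc : y ≤ cnt)
    (hM : ∀ x' < N, ∀ y' < N, M' (x' * N + y') = M (x' * N + y') + edgeEntry x y x' y') :
    Expansion n m N S K f W L (k + 1) (k + 1) X cnt M' := by
  have hkm := hm k hk
  have hkX : k ∈ X.L := (h.low k hkm).2 hk
  have hb : X.b k = f y := (h.todo_b k hk le_rfl).trans hy
  refine ⟨h.counts, h.low, h.todo, fun e he hke => h.todo_b e he (by omega), h.le, h.vert, ?_,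
    h.pot, h.card, ?_⟩
  · intro e he hd
    by_cases h1 : e = k
    · subst h1
      exact ⟨hl, x, y, hxc, hyc, hx, hb⟩
    · exact h.done e he (by omega)
  · intro x' hx' y' hy'
    have h1 : X.L.filter (fun e => e < k + 1 ∨ m ≤ e) =
        insert k (X.L.filter fun e => e < k ∨ m ≤ e) := by
      ext e
      simp only [Finset.mem_insert, Finset.mem_filter]
      constructor
      · rintro ⟨h1, h2⟩
        by_cases h3 : e = k
        · exact Or.inl h3
        · exact Or.inr ⟨h1, by omega⟩
      · rintro (rfl | h1)
        · exact ⟨hkX, by omega⟩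
        · exact ⟨h1.1, by omega⟩
    rw [h1, Finset.sum_insert (fun h2 => by
      have := (Finset.mem_filter.1 h2).2
      omega), hM x' hx' y' hy', h.mat x' hx' y' hy', hx, hb]
    have h3 : edgeEntry (f x) (f y) (f x') (f y') = edgeEntry x y x' y' := by
      simp only [edgeEntry, hf.eq_iff]
    rw [h3]
    ring

theorem skip (h : Expansion n m N S K f W L k k X cnt M) (hk : k ∉ L) (hkm : k < m) :
    Expansion n m N S K f W L (k + 1) (k + 1) X cnt M := by
  have hne : ∀ e ∈ X.L, e ≠ k := fun e he h1 => hk ((h.low k hkm).1 (h1 ▸ he))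
  refine ⟨h.counts, h.low, fun e he hke => h.todo e he (by omega),
    fun e he hke => h.todo_b e he (by omega), h.le, h.vert, fun e he hd =>
    h.done e he (by have := hne e he; omega), h.pot, h.card, fun x hx y hy => ?_⟩
  rw [h.mat x hx y hy]
  congr 1
  refine Finset.sum_congr (Finset.filter_congr fun e he => ?_) fun _ _ => rfl
  have := hne e he
  omega

end Expansion

/-! ### Addresses of matrix entries stored row by row -/

theorem mul_add_inj {N x y x' y' : ℕ} (hy : y < N) (hy' : y' < N) :
    x * N + y = x' * N + y' ↔ x = x' ∧ y = y' := by
  refine ⟨fun h => ?_, fun h => by rw [h.1, h.2]⟩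
  have hN : 0 < N := by omega
  have h1 : (x * N + y) / N = x := by
    rw [mul_comm, Nat.mul_add_div hN, Nat.div_eq_of_lt hy, add_zero]
  have h2 : (x' * N + y') / N = x' := by
    rw [mul_comm, Nat.mul_add_div hN, Nat.div_eq_of_lt hy', add_zero]
  have h3 : x = x' := by rw [← h1, ← h2, h]
  subst h3
  exact ⟨rfl, by omega⟩

theorem mul_add_lt {N x y : ℕ} (hx : x < N) (hy : y < N) : x * N + y < N * N := by
  have : (x + 1) * N ≤ N * N := Nat.mul_le_mul_right N hx
  rw [Nat.succ_mul] at this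
  omega

theorem Expansion.mat_le {n m N S K k k' cnt : ℕ} {f : ℕ → ℕ} {W X : PathGraph} {L : Finset ℕ}
    {M : ℕ → ℕ} (h : Expansion n m N S K f W L k k' X cnt M) {x y : ℕ} (hx : x < N) (hy : y < N) :
    M (x * N + y) ≤ 1 + 2 * (K + cnt) := by
  rw [h.mat x hx y hy]
  have h1 : ∑ e ∈ X.L with e < k ∨ m ≤ e, edgeEntry (X.a e) (X.b e) (f x) (f y) ≤
      (K + cnt) * 2 := by
    refine (Finset.sum_le_card_nsmul _ _ 2 fun e _ => ?_).trans ?_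
    · simp only [edgeEntry]
      split_ifs <;> omega
    · rw [smul_eq_mul]
      exact Nat.mul_le_mul_right 2 ((Finset.card_filter_le _ _).trans h.card)
  split_ifs <;> omega

namespace RAM

/-- Write the unit matrix, and the addresses of its rows. -/
def unitMatrix : Program :=
  seqs [.const 20 0, .const 21 0, .while 20 9 (seqs [.store 8 20 21, .add 22 21 20,
    .store 7 22 3, .add 21 21 9, .add 20 20 3])]

theorem halts_unitMatrix {W N : ℕ} {s : State} {Q : ℕ → State → Prop} {r : ℕ → ℤ}
    (hr : Agree r s) (hr3 : r 3 = 1) (hr9 : r 9 = N) (hz : ZeroFrom 7 s) (hW : N * N + N ≤ W)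
    (hQ : ∀ t s' M R, t ≤ 8 * (N + 1) → Agree r s' → (∀ a < 7, s'.arr a = s.arr a) →
      (∀ y, 26 ≤ y → s'.reg y = s.reg y) → s'.arr 7 = natCells M → s'.arr 8 = natCells R →
      ZeroFrom 9 s' → (∀ x < N, R x = x * N) →
      (∀ x < N, ∀ y < N, M (x * N + y) = if x = y then 1 else 0) → Q t s') :
    Halts W unitMatrix s Q := by
  simp only [unitMatrix, halts_seqs_cons, halts_const]
  refine ⟨by simp, by simp, ?_⟩
  obtain ⟨J, hJ⟩ : ∃ J : ℕ → (ℤ → ℤ) → (ℤ → ℤ) → Prop, ∀ k f g, J k f g ↔ ∃ M R,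
      f = natCells M ∧ g = natCells R ∧ (∀ x < k, R x = x * N) ∧
      (∀ x < N, ∀ y < N, M (x * N + y) = if x = y ∧ x < k then 1 else 0) :=
    ⟨_, fun _ _ _ => Iff.rfl⟩
  refine halts_for (N := N) (T := 6) (fun k s' => Agree r s' ∧ s'.reg 20 = k ∧
    s'.reg 21 = ((k * N : ℕ) : ℤ) ∧ ZeroFrom 9 s' ∧ (∀ a < 7, s'.arr a = s.arr a) ∧
    (∀ y, 26 ≤ y → s'.reg y = s.reg y) ∧ J k (s'.arr 7) (s'.arr 8)) ?_ ?_ ?_ ?_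
  · exact ⟨by simpa using hr, by simp, by simp, fun a ha => hz a (by omega), fun a ha => rfl,
      fun y hy => by simp [show y ≠ 20 by omega, show y ≠ 21 by omega],
      (hJ _ _ _).2 ⟨fun _ => 0, fun _ => 0, hz 7 (by omega), hz 8 (by omega), by simp, by simp⟩⟩
  · rintro k s ⟨h1, h2, -⟩
    exact ⟨h2, (h1 9 (by norm_num)).trans hr9⟩
  · rintro k s' hk ⟨hr, h20, h21, hz, ha, hy, hJ'⟩
    obtain ⟨M, R, h7, h8, hR, hM⟩ := (hJ _ _ _).1 hJ'
    have c3 : s'.reg 3 = 1 := (hr 3 (by norm_num)).trans hr3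
    have c9 : s'.reg 9 = N := (hr 9 (by norm_num)).trans hr9
    have hb := mul_add_lt hk hk
    have hb' : k * N + N ≤ N * N := by
      rw [← Nat.succ_mul]
      exact Nat.mul_le_mul_right N hk
    have e1 : ((k * N : ℕ) : ℤ) + k = ((k * N + k : ℕ) : ℤ) := by push_cast; rfl
    have e2 : ((k * N : ℕ) : ℤ) + N = (((k + 1) * N : ℕ) : ℤ) := by push_cast; ring
    simp only [halts_seqs_cons, halts_store, halts_add, halts_seqs_nil, reg_setReg, reg_setArr,
      arr_setReg, arr_setArr, h20, h21, h7, h8, c3, c9, e1, e2, update_natCells,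
      update_natCells_one, if_true, if_false, Nat.reduceEqDiff]
    refine ⟨by rw [abs_le]; omega, by rw [abs_le, Nat.succ_mul]; omega, by rw [abs_le]; omega,
      by omega, by simpa using hr, by push_cast; rfl, trivial, by simpa using hz, fun a ha' => ?_,
      fun y hy' => ?_, (hJ _ _ _).2 ⟨_, _, rfl, rfl, fun x hx => ?_, fun x hx y hy => ?_⟩⟩
    · rw [if_neg (by omega), if_neg (by omega)]
      exact ha a ha'
    · rw [if_neg (by omega), if_neg (by omega), if_neg (by omega)]
      exact hy y hy'
    · rw [Function.update_apply]
      split_ifs with h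
      · rw [h]
      · exact hR x (by omega)
    · rw [Function.update_apply, hM x hx y hy]
      simp only [mul_add_inj hy hk]
      split_ifs <;> omega
  · rintro t s' ht ⟨hr, h20, h21, hz, ha, hy, hJ'⟩
    obtain ⟨M, R, h7, h8, hR, hM⟩ := (hJ _ _ _).1 hJ'
    simp only [halts_seqs_nil]
    refine hQ _ _ M R (by omega) hr ha hy h7 h8 hz hR fun x hx y hy => ?_
    rw [hM x hx y hy]
    simp [hx]

/-- Record an edge in the matrix. -/
def link : Program :=
  seqs [.load 24 8 22, .add 24 24 23, .load 25 7 24, .add 25 25 3, .store 7 24 25,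
    .load 24 8 23, .add 24 24 22, .load 25 7 24, .add 25 25 3, .store 7 24 25]

/-- The two symmetric entries are incremented one after the other; for a loop they coincide, and the
diagonal entry grows by two. -/
theorem halts_link {W N x y : ℕ} {s : State} {Q : ℕ → State → Prop} {M R : ℕ → ℕ}
    (h3 : s.reg 3 = 1) (h22 : s.reg 22 = x) (h23 : s.reg 23 = y) (h7 : s.arr 7 = natCells M)
    (h8 : s.arr 8 = natCells R) (hR : ∀ x < N, R x = x * N) (hx : x < N) (hy : y < N)
    (hW : N * N ≤ W) (hM : ∀ x < N, ∀ y < N, M (x * N + y) + 2 ≤ W)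
    (hQ : ∀ s' M', (∀ y, y ≠ 24 → y ≠ 25 → s'.reg y = s.reg y) →
      (∀ a, a ≠ 7 → s'.arr a = s.arr a) → s'.arr 7 = natCells M' →
      (∀ x' < N, ∀ y' < N, M' (x' * N + y') = M (x' * N + y') + edgeEntry x y x' y') → Q 11 s') :
    Halts W link s Q := by
  have e1 : ((x * N : ℕ) : ℤ) + y = ((x * N + y : ℕ) : ℤ) := by push_cast; rfl
  have e2 : ((y * N : ℕ) : ℤ) + x = ((y * N + x : ℕ) : ℤ) := by push_cast; rfl
  have hb1 := mul_add_lt hx hy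
  have hb2 := mul_add_lt hy hx
  have hM1 := hM x hx y hy
  have hM2 := hM y hy x hx
  simp only [link, halts_seqs_cons, halts_store, halts_add, halts_seqs_nil, reg_setReg, reg_setArr,
    arr_setReg, arr_setArr, h22, h23, h7, h8, h3, e1, e2, natCells_natCast,
    update_natCells_add_one, if_true, if_false, Nat.reduceEqDiff, hR x hx,
    hR y hy, halts_load]
  have hu : Function.update M (x * N + y) (M (x * N + y) + 1) (y * N + x) + 1 ≤ W := by
    rw [Function.update_apply]
    split_ifs <;> omega
  refine ⟨by rw [abs_le]; omega, by rw [abs_le]; omega, by rw [abs_le]; omega,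
    by rw [abs_le]; omega, ?_⟩
  refine hQ _ (Function.update (Function.update M (x * N + y) (M (x * N + y) + 1)) (y * N + x)
    (Function.update M (x * N + y) (M (x * N + y) + 1) (y * N + x) + 1))
    (fun y h1 h2 => by simp [h1, h2]) (fun a ha => by simp [ha]) (by
      simp only [arr_setArr, arr_setReg, if_true, h7, update_natCells_add_one])
    fun x' hx' y' hy' => ?_
  simp only [Function.update_apply, mul_add_inj hy' hy, mul_add_inj hy' hx, mul_add_inj hx hy,
    edgeEntry]
  by_cases h1 : x' = y ∧ y' = x
  · obtain ⟨rfl, rfl⟩ := h1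
    by_cases h2 : x' = y'
    · subst h2
      simp
    · simp [h2, Ne.symm h2]
  · by_cases h2 : x' = x ∧ y' = y
    · obtain ⟨rfl, rfl⟩ := h2
      simp [h1, show ¬ (y' = x' ∧ x' = y') by omega]
    · simp [h1, h2, show ¬ (x = x' ∧ y = y') by omega, show ¬ (y = x' ∧ x = y') by omega]

/-- Replace every remaining edge by a path without inner vertices, and record its edges in the
matrix. -/
def expandEdges : Program :=
  seqs [.const 20 0, .while 20 2 (seqs [.load 21 5 20,
    .ite 5 21 (seqs [.load 22 0 20, .load 22 6 22,
      .while 5 21 (seqs [.add 31 31 3, .add 23 31 5, link, .add 22 23 5, .sub 21 21 3]),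
      .load 23 1 20, .load 23 6 23, link]) .skip,
    .add 20 20 3])]

/-- At the start the numbers used and the remaining lengths add up to at most `cnt₀ + K * cap < N`.
This sum is never exceeded, so all vertex numbers fit into a matrix of order `N`. -/
theorem halts_expandEdges {W n m N K cap cnt₀ : ℕ} {s : State} {Q : ℕ → State → Prop} {r : ℕ → ℤ}
    {G : PathGraph} {L : Finset ℕ} {new M₀ R len : ℕ → ℕ}
    (hr : Agree r s) (hr2 : r 2 = m) (hr3 : r 3 = 1) (hr5 : r 5 = 0)
    (h0 : s.arr 0 = natCells G.a) (h1 : s.arr 1 = natCells G.b)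
    (h5 : s.arr 5 = natCells len) (h6 : s.arr 6 = natCells new) (h7 : s.arr 7 = natCells M₀)
    (h8 : s.arr 8 = natCells R) (h31 : s.reg 31 = cnt₀) (hz : ZeroFrom 9 s)
    (hN : VertexNumbering n new cnt₀) (hR : ∀ x < N, R x = x * N)
    (hL : G.L = L) (hLm : ∀ e ∈ L, e < m)
    (hlen : ∀ e < m, len e = if e ∈ L then G.len e else 0)
    (hpos : ∀ e ∈ L, G.len e ≠ 0) (hcap : ∀ e ∈ L, G.len e < cap) (hcard : L.card = K)
    (hvert : ∀ e ∈ L, G.a e < n ∧ G.b e < n)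
    (hnew : ∀ e ∈ L, new (G.a e) ≠ 0 ∧ new (G.b e) ≠ 0)
    (hM₀ : ∀ x < N, ∀ y < N, M₀ (x * N + y) = if x = y then 1 else 0)
    (hcnt : cnt₀ + K * cap < N)
    (hW : N * N + 10 * N + 10 + m + cap ≤ W) (hKN : K ≤ N)
    (hQ : ∀ t s' X cnt M, t ≤ (30 * cap + 50) * (m + 1) → Agree r s' → cnt < N →
      s'.arr 7 = natCells M → ZeroFrom 9 s' →
      Expansion n m N (N - 1) K (vertexName n new) G L m m X cnt M → Q t s') :
    Halts W expandEdges s Q := by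
  set f := vertexName n new with hf
  have hfinj : Function.Injective f := hN.vertexName_injective
  simp only [expandEdges, halts_seqs_cons, halts_const]
  refine ⟨by simp, ?_⟩
  obtain ⟨J, hJ⟩ : ∃ J : ℕ → ℕ → ℤ → (ℤ → ℤ) → PathGraph → ℕ → Prop, ∀ k k' y g X cnt,
      J k k' y g X cnt ↔ ∃ M, y = (cnt : ℕ) ∧ cnt₀ ≤ cnt ∧ g = natCells M ∧
        Expansion n m N (N - 1) K f G L k k' X cnt M := ⟨_, fun _ _ _ _ _ _ => Iff.rfl⟩
  obtain ⟨F, hF⟩ : ∃ F : (ℕ → ℤ → ℤ) → Prop, ∀ g, F g ↔ g 0 = natCells G.a ∧ g 1 = natCells G.b ∧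
      g 5 = natCells len ∧ g 6 = natCells new ∧ g 8 = natCells R ∧
      ∀ a, 9 ≤ a → g a = natCells fun _ => 0 := ⟨_, fun _ => Iff.rfl⟩
  have hFc : ∀ g g' : ℕ → ℤ → ℤ, (∀ a, a ≠ 7 → g' a = g a) → F g → F g' := by
    intro g g' h hg
    rw [hF] at hg ⊢
    rw [h 0 (by norm_num), h 1 (by norm_num), h 5 (by norm_num), h 6 (by norm_num),
      h 8 (by norm_num)]
    exact ⟨hg.1, hg.2.1, hg.2.2.1, hg.2.2.2.1, hg.2.2.2.2.1, fun a ha => by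
      rw [h a (by omega), hg.2.2.2.2.2 a ha]⟩
  refine halts_for (N := m) (T := 30 * cap + 40) (fun k s => Agree r s ∧ s.reg 20 = k ∧ F s.arr ∧
    ∃ X cnt, J k k (s.reg 31) (s.arr 7) X cnt) ?_ ?_ ?_ ?_
  · refine ⟨by simpa using hr, by simp, (hF _).2 ⟨h0, h1, h5, h6, h8, hz⟩, G, cnt₀,
      (hJ _ _ _ _ _ _).2 ⟨M₀, by simpa using h31, le_rfl, h7, ⟨rfl, fun e _ => by rw [hL],
      fun e _ _ => ⟨rfl, rfl⟩, fun e _ _ => rfl, fun e he => ?_, fun e he => ?_, fun e he h => ?_,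
      ?_, ?_, fun x hx y hy => ?_⟩⟩⟩
    · have := hLm e (hL ▸ he)
      omega
    · have := hvert e (hL ▸ he)
      omega
    · have := hLm e (hL ▸ he)
      omega
    · have h2 : ∑ e ∈ G.L, G.len e ≤ K * cap := by
        rw [hL, ← hcard]
        exact Finset.sum_le_card_nsmul _ _ _ fun e he => (hcap e he).le
      omega
    · rw [hL, hcard]
      omega
    · rw [hM₀ x hx y hy, Finset.filter_false_of_mem, Finset.sum_empty, add_zero]
      intro e he
      have := hLm e (hL ▸ he)
      omega
  · rintro k s ⟨h1, h2, -⟩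
    exact ⟨h2, (h1 2 (by norm_num)).trans hr2⟩
  · rintro k s hk ⟨hr, h20, hFs, X, cnt, hJs⟩
    have c3 : s.reg 3 = 1 := (hr 3 (by norm_num)).trans hr3
    have c5 : s.reg 5 = 0 := (hr 5 (by norm_num)).trans hr5
    obtain ⟨a0, a1, a5, a6, a8, a9⟩ := (hF _).1 hFs
    obtain ⟨M, h31, hc0, h7, hE⟩ := (hJ _ _ _ _ _ _).1 hJs
    have hkW : |(k : ℤ) + 1| ≤ W := by
      rw [abs_le]
      omega
    simp only [halts_seqs_cons, halts_load, halts_ite, arr_setReg, reg_setReg, h20, a5,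
      natCells_natCast, if_false, if_true, c5, Nat.reduceEqDiff]
    by_cases hkL : k ∈ L
    · have hlk := hlen k hk
      rw [if_pos hkL] at hlk
      have hlp := hpos k hkL
      have hlc := hcap k hkL
      rw [hlk, if_pos (by omega)]
      -- `l` is the number of inner vertices still to be split off; register 22 holds the number `x`
      -- of the current first end of the edge `k`.
      refine halts_while (N := G.len k) (T := 16) (fun l s => Agree r s ∧ s.reg 20 = k ∧
        s.reg 21 = (l : ℕ) ∧ F s.arr ∧ ∃ X cnt x, J k (k + 1) (s.reg 31) (s.arr 7) X cnt ∧
        X.len k = l ∧ x ≤ cnt ∧ X.a k = f x ∧ s.reg 22 = (x : ℕ)) ?_ ?_ ?_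
      · have h2 := hE.todo k hkL le_rfl
        refine ⟨by simpa using hr, by simpa using h20, by simp, hFs, X, cnt, new (G.a k),
          (hJ _ _ _ _ _ _).2 ⟨M, by simpa using h31, hc0, h7, hE.counts, hE.low,
          fun e he hke => hE.todo e he (by omega), hE.todo_b, hE.le, hE.vert, hE.done, hE.pot,
          hE.card, hE.mat⟩, h2.2, (hN.le _).trans hc0, ?_, ?_⟩
        · rw [h2.1, hf, hN.vertexName_new (hnew k hkL).1]
        · simp [a0, a6]
      · rintro l s ⟨hr, h20, h21, hFs, X, cnt, x, hJs, hXl, hxc, hXa, h22⟩ hlt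
        obtain ⟨a0, a1, a5, a6, a8, a9⟩ := (hF _).1 hFs
        obtain ⟨M, h31, hc0, h7, hE⟩ := (hJ _ _ _ _ _ _).1 hJs
        have c3 : s.reg 3 = 1 := (hr 3 (by norm_num)).trans hr3
        have c5 : s.reg 5 = 0 := (hr 5 (by norm_num)).trans hr5
        obtain ⟨l', rfl⟩ : ∃ l', l = l' + 1 := ⟨l - 1, by omega⟩
        refine ⟨l', rfl, ?_⟩
        have hpot := hE.pot
        have hkX : k ∈ X.L := (hE.low k hk).2 hkL
        have hsum : l' + 1 ≤ ∑ e ∈ X.L, X.len e := by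
          rw [← hXl]
          exact Finset.single_le_sum (f := fun e => X.len e) (fun _ _ => Nat.zero_le _) hkX
        have e1 : (cnt : ℤ) + 1 = ((cnt + 1 : ℕ) : ℤ) := by push_cast; rfl
        simp only [halts_seqs_cons, halts_add, reg_setReg, h31, c3, c5, e1, if_true, if_false,
          Nat.reduceEqDiff, add_zero]
        refine ⟨by rw [abs_le]; omega, by rw [abs_le]; omega, ?_⟩
        refine halts_link (x := x) (y := cnt + 1) (N := N) (M := M) (R := R) (by simpa using c3)
          (by simpa using h22) (by simp) (by simpa using h7) (by simpa using a8) hR (by omega)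
          (by omega) (by omega) (fun x hx y hy => ?_) ?_
        · have := hE.mat_le hx hy
          omega
        · intro s₁ M' hreg harr h7 hM'
          obtain ⟨X', hE', hXl', hXa'⟩ := hE.expand hLm hfinj hkL hXl hXa hxc
            (hN.vertexName_of_lt (by omega)) hM'
          have b3 : s₁.reg 3 = 1 := by
            rw [hreg 3 (by norm_num) (by norm_num)]
            simpa using c3
          have b5 : s₁.reg 5 = 0 := by
            rw [hreg 5 (by norm_num) (by norm_num)]
            simpa using c5
          have b21 : s₁.reg 21 = ((l' + 1 : ℕ) : ℤ) := by
            rw [hreg 21 (by norm_num) (by norm_num)]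
            simpa using h21
          have b23 : s₁.reg 23 = ((cnt + 1 : ℕ) : ℤ) := by
            rw [hreg 23 (by norm_num) (by norm_num)]
            simp
          have b31 : s₁.reg 31 = ((cnt + 1 : ℕ) : ℤ) := by
            rw [hreg 31 (by norm_num) (by norm_num)]
            simp
          have b20 : s₁.reg 20 = k := by
            rw [hreg 20 (by norm_num) (by norm_num)]
            simpa using h20
          have bA : Agree r s₁ := fun y hy => by
            rw [hreg y (by omega) (by omega)]
            simp only [reg_setReg]
            rw [if_neg (by omega), if_neg (by omega)]
            exact hr y hy
          have e2 : ((l' + 1 : ℕ) : ℤ) - 1 = (l' : ℤ) := by push_cast; ring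
          simp only [halts_sub, halts_seqs_nil, reg_setReg, b21, b23,
            b3, b5, e2, if_false, Nat.reduceEqDiff, add_zero]
          refine ⟨by rw [abs_le]; omega, by rw [abs_le]; omega, by omega, by simpa using bA,
            by simpa using b20, by simp, hFc _ _ harr hFs, X', cnt + 1, cnt + 1,
            (hJ _ _ _ _ _ _).2 ⟨M', by simpa using b31, by omega, by simpa using h7, hE'⟩, hXl',
            le_rfl, hXa', by simp⟩
      · rintro t l s ht ⟨hr, h20, h21, hFs, X, cnt, x, hJs, hXl, hxc, hXa, h22⟩ hlt
        obtain ⟨a0, a1, a5, a6, a8, a9⟩ := (hF _).1 hFs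
        obtain ⟨M, h31, hc0, h7, hE⟩ := (hJ _ _ _ _ _ _).1 hJs
        have c3 : s.reg 3 = 1 := (hr 3 (by norm_num)).trans hr3
        have c5 : s.reg 5 = 0 := (hr 5 (by norm_num)).trans hr5
        obtain rfl : l = 0 := by
          rw [c5, h21] at hlt
          omega
        have hpot := hE.pot
        have hb := hN.le (G.b k)
        simp only [h20, a1, a6,
          natCells_natCast]
        refine halts_link (x := x) (y := new (G.b k)) (N := N) (M := M) (R := R)
          (by simpa using c3)
          (by simpa using h22) (by simp) (by simpa using h7) (by simpa using a8) hR (by omega)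
          (by omega) (by omega) (fun x hx y hy => ?_) ?_
        · have := hE.mat_le hx hy
          omega
        · intro s₁ M' hreg harr h7 hM'
          have hE' := hE.finish hLm hfinj hkL hXl hXa hxc
            (hN.vertexName_new (hnew k hkL).2).symm (hb.trans hc0) hM'
          have b3 : s₁.reg 3 = 1 := by
            rw [hreg 3 (by norm_num) (by norm_num)]
            simpa using c3
          have b31 : s₁.reg 31 = (cnt : ℤ) := by
            rw [hreg 31 (by norm_num) (by norm_num)]
            simpa using h31
          have b20 : s₁.reg 20 = k := by
            rw [hreg 20 (by norm_num) (by norm_num)]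
            simpa using h20
          have bA : Agree r s₁ := fun y hy => by
            rw [hreg y (by omega) (by omega)]
            simp only [reg_setReg]
            rw [if_neg (by omega), if_neg (by omega)]
            exact hr y hy
          simp only [halts_seqs_nil, halts_add, b20, b3]
          refine ⟨hkW, by omega, by simpa using bA, by simp, hFc _ _ harr hFs, X, cnt,
            (hJ _ _ _ _ _ _).2 ⟨M', by simpa using b31, hc0, by simpa using h7, hE'⟩⟩
    · have hlk := hlen k hk
      rw [if_neg hkL] at hlk
      rw [hlk, if_neg (by norm_num)]
      simp only [halts_skip, halts_add, halts_seqs_nil, reg_setReg, h20, c3, if_false,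
        Nat.reduceEqDiff]
      refine ⟨hkW, by omega, by simpa using hr, by simp, hFs, X, cnt,
        (hJ _ _ _ _ _ _).2 ⟨M, by simpa using h31, hc0, h7, hE.skip hkL hk⟩⟩
  · rintro t s ht ⟨hr, h20, hFs, X, cnt, hJs⟩
    obtain ⟨a0, a1, a5, a6, a8, a9⟩ := (hF _).1 hFs
    obtain ⟨M, h31, hc0, h7, hE⟩ := (hJ _ _ _ _ _ _).1 hJs
    have hpot := hE.pot
    simp only [halts_seqs_nil]
    refine hQ _ _ X cnt M ?_ hr (by omega) h7 a9 hE
    nlinarith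

end RAM

/-! ### Filling the table of minors -/

/-! ### Sums over the indices above or below a moving bound -/

theorem sum_filter_le_succ {α : Type*} [AddCommMonoid α] (S : Finset ℕ) (F : ℕ → α) (j : ℕ) :
    ∑ x ∈ S with j ≤ x, F x = (if j ∈ S then F j else 0) + ∑ x ∈ S with j < x, F x := by
  have h : (S.filter fun x => j ≤ x) =
      if j ∈ S then insert j (S.filter fun x => j < x) else S.filter fun x => j < x := by
    ext x
    split_ifs with h <;> simp only [Finset.mem_insert, Finset.mem_filter] <;> constructor
    · rintro ⟨h1, h2⟩
      by_cases h3 : x = j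
      · exact Or.inl h3
      · exact Or.inr ⟨h1, by omega⟩
    · rintro (rfl | h3)
      · exact ⟨h, le_rfl⟩
      · exact ⟨h3.1, by omega⟩
    · rintro ⟨h1, h2⟩
      have : x ≠ j := fun h3 => h (h3 ▸ h1)
      exact ⟨h1, by omega⟩
    · rintro ⟨h1, h2⟩
      exact ⟨h1, by omega⟩
  rw [h]
  split_ifs with h'
  · rw [Finset.sum_insert (by simp)]
  · rw [zero_add]

theorem sum_filter_lt_succ (S : Finset ℕ) (F : ℕ → ℕ) (j : ℕ) :
    ∑ x ∈ S with x < j + 1, F x = (if j ∈ S then F j else 0) + ∑ x ∈ S with x < j, F x := by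
  have h1 := Finset.sum_filter_add_sum_filter_not S (fun x => x < j + 1) F
  have h2 := Finset.sum_filter_add_sum_filter_not S (fun x => x < j) F
  have h3 := sum_filter_le_succ S F j
  simp only [not_lt, Nat.succ_le_iff] at h1 h2
  omega

namespace RAM

/-- Multiplication by a matrix entry is repeated addition, as the machine has no product.
Intermediate sums lie between the extremes, so one bound on `|acc| + c * |t|` covers them. -/
theorem halts_mulAdd {W c : ℕ} {acc t : ℤ} {s : State} {Q : ℕ → State → Prop}
    (h3 : s.reg 3 = 1) (h28 : s.reg 28 = acc) (h29 : s.reg 29 = t) (h36 : s.reg 36 = c)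
    (h37 : s.reg 37 = 0) (hW : |acc| + c * |t| ≤ W) (hc : c ≤ W)
    (hQ : ∀ τ s', τ ≤ 4 * c + 1 → s'.reg 28 = acc + c * t →
      (∀ x, x ≠ 28 → x ≠ 37 → s'.reg x = s.reg x) → s'.arr = s.arr → Q τ s') :
    Halts W (.while 37 36 (seqs [.add 28 28 29, .add 37 37 3])) s Q := by
  refine halts_for (N := c) (T := 3) (fun k s' => s'.reg 37 = k ∧ s'.reg 28 = acc + k * t ∧
    (∀ x, x ≠ 28 → x ≠ 37 → s'.reg x = s.reg x) ∧ s'.arr = s.arr) ?_ ?_ ?_ ?_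
  · exact ⟨by simpa using h37, by simpa using h28, fun _ _ _ => rfl, rfl⟩
  · rintro k s' ⟨h1, h2, h4, -⟩
    exact ⟨h1, (h4 36 (by norm_num) (by norm_num)).trans h36⟩
  · rintro k s' hk ⟨h1, h2, h4, h5⟩
    have c3 : s'.reg 3 = 1 := (h4 3 (by norm_num) (by norm_num)).trans h3
    have c29 : s'.reg 29 = t := (h4 29 (by norm_num) (by norm_num)).trans h29
    simp only [halts_seqs_cons, halts_add, halts_seqs_nil, reg_setReg, h1, h2, c3, c29, if_false,
      if_true, Nat.reduceEqDiff]
    have hb : |acc + k * t + t| ≤ W := by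
      have e : acc + k * t + t = acc + (k + 1) * t := by ring
      rw [e]
      refine (abs_add_le _ _).trans (le_trans ?_ hW)
      rw [abs_mul]
      have h6 : |(k : ℤ) + 1| ≤ c := by
        rw [abs_le]
        omega
      have := mul_le_mul_of_nonneg_right h6 (abs_nonneg t)
      omega
    refine ⟨hb, by rw [abs_le]; omega, by omega, by push_cast; rfl, by push_cast; ring,
      fun x hx hx' => ?_, h5⟩
    rw [if_neg hx', if_neg hx]
    exact h4 x hx hx'
  · rintro τ s' hτ ⟨h1, h2, h4, h5⟩
    exact hQ _ _ (by omega) h2 h4 h5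

/-- Add an entry of the current row times the number in register `29`. -/
def addMultiple : Program :=
  seqs [.add 36 35 24, .load 36 7 36, .const 37 0,
    .while 37 36 (seqs [.add 28 28 29, .add 37 37 3])]

/-- Compute a minor by expansion along its last row. -/
def expandRow : Program :=
  seqs [.add 24 9 5, .add 25 23 5, .const 26 0, .const 28 0,
    .while 5 24 (seqs [.sub 24 24 3, .load 27 9 24,
      .ite 25 27 .skip (seqs [.sub 25 25 27, .sub 29 22 27, .load 29 10 29,
        .ite 5 26 (seqs [.sub 29 5 29, .const 26 0]) (.const 26 1),
        addMultiple])])]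

/-- The columns are scanned downwards. Register 25 holds the part of the column mask below the
current position, so bit `k` is set exactly if this rest is at least `2 ^ k`. Register 26 holds the
parity of the number of columns already met, which is the sign in the expansion. Smaller minors are
read from array 10. -/
theorem halts_expandRow {W N B U i y : ℕ} {s : State} {Q : ℕ → State → Prop} {A : ℕ → ℕ → ℤ}
    {g : ℕ → ℤ} {M P : ℕ → ℕ}
    (h3 : s.reg 3 = 1) (h5 : s.reg 5 = 0) (h9 : s.reg 9 = N) (h22 : s.reg 22 = y)
    (h23 : s.reg 23 = ((y % 2 ^ N : ℕ) : ℤ)) (h35 : s.reg 35 = ((i * N : ℕ) : ℤ))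
    (a7 : s.arr 7 = natCells M) (a9 : s.arr 9 = natCells P) (a10 : s.arr 10 = cells g)
    (hP : ∀ j < N, P j = 2 ^ j) (hA : ∀ j < N, A i j = M (i * N + j))
    (hB : ∀ j < N, M (i * N + j) ≤ B)
    (hg : ∀ x < y, g x = minorAt A N x ∧ |minorAt A N x| ≤ U) (hy : y < 2 ^ (i + N))
    (hW1 : N * (B * U) ≤ W) (hW2 : 2 ^ (i + N) ≤ W) (hW3 : i * N + N + B + U + 2 ≤ W)
    (hQ : ∀ t s', t ≤ N * (4 * B + 30) + 10 → s'.reg 28 = minorAt A N (2 ^ (i + N) + y) →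
      (∀ x, (x < 24 ∨ 30 ≤ x) → x ≠ 36 → x ≠ 37 → s'.reg x = s.reg x) → s'.arr = s.arr → Q t s') :
    Halts W expandRow s Q := by
  have hp : 0 < 2 ^ N := by positivity
  have hC : y % 2 ^ N < 2 ^ N := Nat.mod_lt y hp
  have hCy : y % 2 ^ N ≤ y := Nat.mod_le y _
  set S := bitSet (y % 2 ^ N) with hS
  have hSN : ∀ j ∈ S, j < N := fun j hj => bitSet_lt hC hj
  set T : ℕ → ℤ := fun j => (-1) ^ (S.filter fun j' => j < j').card * A i j *
    minorAt A N (y - 2 ^ j) with hT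
  have hgy : ∀ j ∈ S, g (y - 2 ^ j) = minorAt A N (y - 2 ^ j) ∧
      |minorAt A N (y - 2 ^ j)| ≤ U ∧ 2 ^ j ≤ y := by
    intro j hj
    have h1 := two_pow_le_of_mem_bitSet hj
    have h2 : 0 < 2 ^ j := by positivity
    obtain ⟨h3, h4⟩ := hg (y - 2 ^ j) (by omega)
    exact ⟨h3, h4, by omega⟩
  have hTb : ∀ j ∈ S, |T j| ≤ ((B * U : ℕ) : ℤ) := by
    intro j hj
    simp only [hT, abs_mul, abs_pow, abs_neg, abs_one, one_pow, one_mul]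
    rw [hA j (hSN j hj), Nat.abs_cast]
    push_cast
    have h1 := hB j (hSN j hj)
    exact mul_le_mul (by exact_mod_cast h1) (hgy j hj).2.1 (abs_nonneg _) (by positivity)
  have hsumb : ∀ S' ⊆ S, |∑ j ∈ S', T j| ≤ ((S'.card * (B * U) : ℕ) : ℤ) := by
    intro S' hS'
    refine (Finset.abs_sum_le_sum_abs _ _).trans ?_
    refine (Finset.sum_le_card_nsmul _ _ _ fun j hj => hTb j (hS' hj)).trans ?_
    rw [nsmul_eq_mul]
    push_cast
    rfl
  have hSc : S.card ≤ N := (Finset.card_le_card (fun j hj => Finset.mem_range.2 (hSN j hj))).trans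
    (Finset.card_range N).le
  simp only [expandRow, halts_seqs_cons, halts_add, halts_const, reg_setReg, h9, h5, h23, if_false,
    Nat.reduceEqDiff, add_zero]
  have hCW : y % 2 ^ N ≤ W := hCy.trans (hy.le.trans hW2)
  refine ⟨by rw [abs_le]; omega, by rw [Nat.abs_cast]; exact_mod_cast hCW, by simp, by simp, ?_⟩
  refine halts_while (N := N) (T := 4 * B + 25) (fun j s' => j ≤ N ∧ s'.reg 24 = (j : ℕ) ∧
    s'.reg 25 = ((∑ x ∈ S with x < j, 2 ^ x : ℕ) : ℤ) ∧
    s'.reg 26 = (((S.filter fun x => j ≤ x).card % 2 : ℕ) : ℤ) ∧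
    s'.reg 28 = ∑ x ∈ S with j ≤ x, T x ∧
    (∀ x, (x < 24 ∨ 30 ≤ x) → x ≠ 36 → x ≠ 37 → s'.reg x = s.reg x) ∧ s'.arr = s.arr) ?_ ?_ ?_
  · have h1 : (S.filter fun x => x < N) = S := Finset.filter_true_of_mem hSN
    have h2 : (S.filter fun x => N ≤ x) = ∅ := Finset.filter_false_of_mem fun x hx => by
      have := hSN x hx
      omega
    refine ⟨le_rfl, by simp, ?_, by simp [h2], by simp [h2], fun x hx hx1 hx2 => ?_, rfl⟩
    · rw [h1, hS, sum_bitSet]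
      simp
    · simp only [reg_setReg]
      rw [if_neg (by omega), if_neg (by omega), if_neg (by omega), if_neg (by omega)]
  · rintro j s' ⟨hjN, h24, h25, h26, h28, hfr, harr⟩ hlt
    have b3 : s'.reg 3 = 1 := (hfr 3 (by norm_num) (by norm_num) (by norm_num)).trans h3
    have b5 : s'.reg 5 = 0 := (hfr 5 (by norm_num) (by norm_num) (by norm_num)).trans h5
    have b22 : s'.reg 22 = y := (hfr 22 (by norm_num) (by norm_num) (by norm_num)).trans h22
    have b35 : s'.reg 35 = ((i * N : ℕ) : ℤ) :=
      (hfr 35 (by norm_num) (by norm_num) (by norm_num)).trans h35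
    rw [b5, h24] at hlt
    obtain ⟨k, rfl⟩ : ∃ k, j = k + 1 := ⟨j - 1, by omega⟩
    refine ⟨k, rfl, ?_⟩
    have hkN : k < N := hjN
    have e1 : ((k + 1 : ℕ) : ℤ) - 1 = (k : ℤ) := by push_cast; ring
    have hlow : ∑ x ∈ S with x < k, 2 ^ x < 2 ^ k := sum_two_pow_lt fun x hx =>
      (Finset.mem_filter.1 hx).2
    rw [sum_filter_lt_succ] at h25
    have hcard : ∀ j, (S.filter fun x => j ≤ x).card =
        (if j ∈ S then 1 else 0) + (S.filter fun x => j < x).card := by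
      intro j
      rw [Finset.card_eq_sum_ones, sum_filter_le_succ, ← Finset.card_eq_sum_ones]
    have hsucc : ∀ F : Finset ℕ → Prop, F (S.filter fun x => k + 1 ≤ x) ↔
      F (S.filter fun x => k < x) := fun F => Iff.rfl
    simp only [halts_seqs_cons, halts_sub, halts_load, halts_ite, reg_setReg, arr_setReg, h24, b3,
      e1, harr, a9, natCells_natCast, hP k hkN, h25, if_true, if_false, Nat.reduceEqDiff]
    refine ⟨by rw [abs_le]; omega, ?_⟩
    by_cases hk : k ∈ S
    · obtain ⟨hg1, hg2, hg3⟩ := hgy k hk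
      have hk2 : (2 : ℕ) ^ k ≤ y := hg3
      rw [if_pos hk, if_neg (by rw [Nat.cast_lt]; omega)]
      have e2 : ((2 ^ k + ∑ x ∈ S with x < k, 2 ^ x : ℕ) : ℤ) - ((2 ^ k : ℕ) : ℤ) =
          ((∑ x ∈ S with x < k, 2 ^ x : ℕ) : ℤ) := by
        rw [Nat.cast_add]
        ring
      have e3 : (y : ℤ) - ((2 ^ k : ℕ) : ℤ) = ((y - 2 ^ k : ℕ) : ℤ) := by
        rw [Nat.cast_sub hk2]
      have e4 : ((i * N : ℕ) : ℤ) + k = ((i * N + k : ℕ) : ℤ) := by push_cast; rfl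
      have hW1' : (N : ℤ) * (B * U) ≤ W := by exact_mod_cast hW1
      have hbU : (minorAt A N (y - 2 ^ k)) ≤ U ∧ -(U : ℤ) ≤ minorAt A N (y - 2 ^ k) := by
        have := abs_le.1 hg2
        exact ⟨this.2, this.1⟩
      have hS2 : (S.filter fun x => k + 1 ≤ x).card + 1 ≤ N := by
        have h1 := hcard k
        rw [if_pos hk] at h1
        have h2 := Finset.card_filter_le S fun x => k ≤ x
        have h3 : (S.filter fun x => k + 1 ≤ x).card = (S.filter fun x => k < x).card := rfl
        omega
      set p := (S.filter fun x => k + 1 ≤ x).card with hp'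
      -- Both signs end in the same multiplication: `t` is the smaller minor with its sign, `q` the
      -- new parity, `τ` the time spent before.
      have hmain : ∀ (s₁ : State) (t : ℤ) (q : ℕ) (τ : ℕ), τ ≤ 10 → |t| ≤ U →
          M (i * N + k) * t = T k → q = (p + 1) % 2 →
          s₁.reg 24 = k → s₁.reg 25 = ((∑ x ∈ S with x < k, 2 ^ x : ℕ) : ℤ) → s₁.reg 26 = q →
          s₁.reg 28 = ∑ x ∈ S with k + 1 ≤ x, T x → s₁.reg 29 = t →
          (∀ x, (x < 24 ∨ 30 ≤ x) → x ≠ 36 → x ≠ 37 → s₁.reg x = s.reg x) → s₁.arr = s.arr →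
          Halts W addMultiple s₁ fun t' s' =>
            τ + t' ≤ 4 * B + 20 ∧ k ≤ N ∧ s'.reg 24 = (k : ℕ) ∧
            s'.reg 25 = ((∑ x ∈ S with x < k, 2 ^ x : ℕ) : ℤ) ∧
            s'.reg 26 = (((S.filter fun x => k ≤ x).card % 2 : ℕ) : ℤ) ∧
            s'.reg 28 = ∑ x ∈ S with k ≤ x, T x ∧
            (∀ x, (x < 24 ∨ 30 ≤ x) → x ≠ 36 → x ≠ 37 → s'.reg x = s.reg x) ∧
            s'.arr = s.arr := by
        intro s₁ t q τ hτ ht hMt hq g24 g25 g26 g28 g29 gfr garr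
        have g3 : s₁.reg 3 = 1 := (gfr 3 (by norm_num) (by norm_num) (by norm_num)).trans h3
        have g35 : s₁.reg 35 = ((i * N : ℕ) : ℤ) :=
          (gfr 35 (by norm_num) (by norm_num) (by norm_num)).trans h35
        have hMB := hB k hkN
        simp only [addMultiple, halts_seqs_cons, halts_add, halts_load, halts_const, reg_setReg,
          arr_setReg, garr, a7, g35, g24, e4, natCells_natCast, if_true]
        refine ⟨by rw [abs_le]; omega, by simp, ?_⟩
        refine halts_mulAdd (c := M (i * N + k)) (acc := ∑ x ∈ S with k + 1 ≤ x, T x) (t := t)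
          (by simpa using g3) (by simpa using g28) (by simpa using g29) (by simp) (by simp) ?_
          (by omega) ?_
        · have h1 := hsumb (S.filter fun x => k + 1 ≤ x) (Finset.filter_subset _ _)
          have h2 : (M (i * N + k) : ℤ) * |t| ≤ B * U :=
            mul_le_mul (by exact_mod_cast hMB) ht (abs_nonneg _) (by positivity)
          have h4 : ((p : ℤ) + 1) * (B * U) ≤ N * (B * U) :=
            mul_le_mul_of_nonneg_right (by exact_mod_cast hS2) (by positivity)
          rw [← hp'] at h1
          push_cast at h1
          linarith
        · intro τ' s₂ hτ' k28 kfr karr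
          have hk' := hcard k
          rw [if_pos hk] at hk'
          simp only [halts_seqs_nil]
          refine ⟨by omega, by omega, ?_, ?_, ?_, ?_, fun x hx hx1 hx2 => ?_, ?_⟩
          · rw [kfr 24 (by norm_num) (by norm_num)]
            simpa using g24
          · rw [kfr 25 (by norm_num) (by norm_num)]
            simpa using g25
          · rw [kfr 26 (by norm_num) (by norm_num)]
            have h4 : (S.filter fun x => k ≤ x).card = p + 1 := by
              rw [hk', add_comm]
              rfl
            rw [h4, ← hq]
            simpa using g26
          · rw [k28, sum_filter_le_succ S T k, if_pos hk, hMt, add_comm]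
            rfl
          · rw [kfr x (by omega) hx2]
            simp only [reg_setReg]
            rw [if_neg hx2, if_neg hx1, if_neg hx1]
            exact gfr x hx hx1 hx2
          · rw [karr]
            exact garr
      simp only [b22, e2, e3,
        a10, cells_natCast, hg1, b5, h26]
      refine ⟨by rw [abs_le]; omega, by rw [abs_le]; omega, ?_⟩
      have hsign : (-1 : ℤ) ^ (S.filter fun j' => k < j').card = (-1) ^ (p % 2) := by
        rw [neg_one_pow_eq_pow_mod_two]
        rfl
      rcases Nat.mod_two_eq_zero_or_one p with hp0 | hp1
      · rw [hp0, if_neg (by norm_num)]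
        simp only [halts_const]
        refine ⟨by simp; omega, (hmain _ (minorAt A N (y - 2 ^ k)) 1 10 le_rfl hg2 ?_
          (by omega) (by simp) (by simp) (by simp) (by simpa using h28) (by simp)
          (fun x hx hx1 hx2 => ?_) ?_).mono ?_⟩
        · simp only [hT, hsign, hp0, pow_zero, one_mul, hA k hkN]
        · simp only [reg_setReg]
          rw [if_neg (by omega), if_neg (by omega), if_neg (by omega), if_neg (by omega),
            if_neg (by omega), if_neg (by omega)]
          exact hfr x hx hx1 hx2
        · exact harr
        · rintro t s' ⟨ht, hrest⟩
          simp only [halts_seqs_nil]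
          exact ⟨by omega, hrest⟩
      · rw [hp1, if_pos (by norm_num)]
        simp only [halts_const, halts_seqs_nil]
        refine ⟨by rw [abs_le]; omega, by simp, (hmain _ (0 - minorAt A N (y - 2 ^ k)) 0 10 le_rfl
          (by rw [abs_le]; omega) ?_
          (by omega) (by simp) (by simp) (by simp) (by simpa using h28) (by simp)
          (fun x hx hx1 hx2 => ?_) ?_).mono ?_⟩
        · simp only [hT, hsign, hp1, hA k hkN]
          ring
        · simp only [reg_setReg]
          rw [if_neg (by omega), if_neg (by omega), if_neg (by omega), if_neg (by omega),
            if_neg (by omega), if_neg (by omega), if_neg (by omega)]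
          exact hfr x hx hx1 hx2
        · exact harr
        · rintro t s' ⟨ht, hrest⟩
          exact ⟨by omega, hrest⟩
    · rw [if_neg hk, zero_add, if_pos (by exact_mod_cast hlow)]
      have hk' := hcard k
      rw [if_neg hk, zero_add] at hk'
      simp only [halts_skip, halts_seqs_nil]
      refine ⟨by omega, by omega, by simp, ?_, ?_, ?_, fun x hx hx1 hx2 => ?_, harr⟩
      · simpa [hk] using h25
      · rw [hk']
        simpa using h26
      · rw [sum_filter_le_succ, if_neg hk, zero_add]
        simpa using h28
      · simp only [reg_setReg]
        rw [if_neg (by omega), if_neg (by omega)]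
        exact hfr x hx hx1 hx2
  · rintro t j s' ht ⟨hjN, h24, h25, h26, h28, hfr, harr⟩ hlt
    have b5 : s'.reg 5 = 0 := (hfr 5 (by norm_num) (by norm_num) (by norm_num)).trans h5
    rw [b5, h24] at hlt
    obtain rfl : j = 0 := by omega
    simp only [halts_seqs_nil]
    refine hQ _ _ ?_ ?_ hfr harr
    · have : N * (4 * B + 25 + 1) ≤ N * (4 * B + 30) := Nat.mul_le_mul_left N (by omega)
      omega
    · rw [h28, minorAt_high A hy, Finset.filter_true_of_mem fun _ _ => Nat.zero_le _]

end RAM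

namespace RAM

/-- Tabulate the powers of two. -/
def powers : Program :=
  seqs [.const 20 0, .add 32 9 9, .add 32 32 3, .const 21 1,
    .while 20 32 (seqs [.store 9 20 21, .add 21 21 21, .add 20 20 3]), .load 33 9 9]

theorem halts_powers {W N : ℕ} {s : State} {Q : ℕ → State → Prop} {r : ℕ → ℤ}
    (hr : Agree r s) (hr3 : r 3 = 1) (hr9 : r 9 = N) (hz : ZeroFrom 9 s)
    (hW : 2 ^ (2 * N + 1) ≤ W)
    (hQ : ∀ t s' P, t ≤ 5 * (2 * N + 1) + 10 → Agree r s' → (∀ a, a ≠ 9 → s'.arr a = s.arr a) →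
      s'.arr 9 = natCells P → (∀ j ≤ 2 * N, P j = 2 ^ j) → s'.reg 33 = ((2 ^ N : ℕ) : ℤ) → Q t s') :
    Halts W powers s Q := by
  have hNW : 2 * N + 1 ≤ W := Nat.lt_two_pow_self.le.trans hW
  have c3 : s.reg 3 = 1 := (hr 3 (by norm_num)).trans hr3
  have c9 : s.reg 9 = N := (hr 9 (by norm_num)).trans hr9
  have e1 : (N : ℤ) + N + 1 = ((2 * N + 1 : ℕ) : ℤ) := by push_cast; ring
  simp only [powers, halts_seqs_cons, halts_const, halts_add, reg_setReg, c3, c9, e1, if_true,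
    if_false, Nat.reduceEqDiff]
  refine ⟨by simp, by rw [abs_le]; omega, by rw [abs_le]; omega, by simp; omega, ?_⟩
  refine halts_for (N := 2 * N + 1) (T := 4) (fun k s' => Agree r s' ∧ s'.reg 20 = k ∧
    s'.reg 32 = ((2 * N + 1 : ℕ) : ℤ) ∧ s'.reg 21 = ((2 ^ k : ℕ) : ℤ) ∧
    (∀ a, a ≠ 9 → s'.arr a = s.arr a) ∧
    ∃ P, s'.arr 9 = natCells P ∧ ∀ j < k, P j = 2 ^ j) ?_ ?_ ?_ ?_
  · exact ⟨by simpa using hr, by simp, by simp, by simp, fun a ha => rfl, fun _ => 0,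
      hz 9 le_rfl, by simp⟩
  · rintro k s' ⟨h1, h2, h3, -⟩
    exact ⟨h2, h3⟩
  · rintro k s' hk ⟨hr, h20, h32, h21, ha, P, hP, hPj⟩
    have c3 : s'.reg 3 = 1 := (hr 3 (by norm_num)).trans hr3
    have e2 : ((2 ^ k : ℕ) : ℤ) + ((2 ^ k : ℕ) : ℤ) = ((2 ^ (k + 1) : ℕ) : ℤ) := by
      push_cast
      ring
    have hb : 2 ^ (k + 1) ≤ W := (Nat.pow_le_pow_right (by norm_num) hk).trans hW
    simp only [halts_seqs_cons, halts_store, halts_add, halts_seqs_nil, reg_setReg, reg_setArr,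
      arr_setReg, arr_setArr, h20, h21, hP, c3, e2, update_natCells, if_true, if_false,
      Nat.reduceEqDiff, h32]
    refine ⟨by rw [Nat.abs_cast]; exact_mod_cast hb, by rw [abs_le]; omega, by omega,
      by simpa using hr, by push_cast; rfl, trivial, trivial, fun a ha' => ?_, _, rfl,
      fun j hj => ?_⟩
    · rw [if_neg ha', ha a ha']
    · rw [Function.update_apply]
      split_ifs with h
      · rw [h]
      · exact hPj j (by omega)
  · rintro t s' ht ⟨hr, h20, h32, h21, ha, P, hP, hPj⟩
    have c9 : s'.reg 9 = N := (hr 9 (by norm_num)).trans hr9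
    simp only [halts_load, halts_seqs_nil, c9, hP, natCells_natCast, hPj N (by omega)]
    exact hQ _ _ P (by omega) (by simpa using hr) (by simpa using ha) (by simpa using hP)
      (fun j hj => hPj j (by omega)) (by simp)

/-- Compute one entry of the table of minors. -/
def tableStep : Program :=
  seqs [expandRow, .add 36 21 22, .store 10 36 28, .ite 34 28 (.add 34 28 5) .skip,
    .sub 29 5 28, .ite 34 29 (.add 34 29 5) .skip, .add 22 22 3, .add 23 23 3,
    ifEq 23 33 (.const 23 0) .skip]

/-- Replace the register `34` by the register `x` if that is larger. -/
theorem halts_ite_max {W b x : ℕ} {v : ℤ} {s : State} {Q : ℕ → State → Prop} (h5 : s.reg 5 = 0)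
    (h34 : s.reg 34 = b) (hx : s.reg x = v) (hv : |v| ≤ W)
    (hQ : ∀ t s' (b' : ℕ), t ≤ 2 → ((b' : ℕ) : ℤ) = max (b : ℤ) v → s'.reg 34 = ((b' : ℕ) : ℤ) →
      (∀ y, y ≠ 34 → s'.reg y = s.reg y) → s'.arr = s.arr → Q t s') :
    Halts W (.ite 34 x (.add 34 x 5) .skip) s Q := by
  simp only [halts_ite, halts_add, halts_skip, h34, hx, h5, add_zero]
  split_ifs with h
  · refine ⟨hv, hQ _ _ v.toNat le_rfl (by omega) ?_ (fun y hy => by simp [hy]) rfl⟩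
    simp only [reg_setReg, if_true]
    omega
  · exact hQ _ _ b le_rfl (by omega) h34 (fun _ _ => rfl) rfl

/-- The running maximum is compared with the new minor and with its negative. Register 23 follows
`y` modulo `2 ^ N`, the column mask, by counting and resetting, so no division is needed. -/
theorem halts_tableStep {W N B i y b : ℕ} {s : State} {Q : ℕ → State → Prop} {A : ℕ → ℕ → ℤ}
    {g : ℕ → ℤ} {M P : ℕ → ℕ}
    (h3 : s.reg 3 = 1) (h5 : s.reg 5 = 0) (h9 : s.reg 9 = N)
    (h21 : s.reg 21 = ((2 ^ (i + N) : ℕ) : ℤ))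
    (h22 : s.reg 22 = y) (h33 : s.reg 33 = ((2 ^ N : ℕ) : ℤ)) (h34 : s.reg 34 = b)
    (h23 : s.reg 23 = ((y % 2 ^ N : ℕ) : ℤ)) (h35 : s.reg 35 = ((i * N : ℕ) : ℤ))
    (a7 : s.arr 7 = natCells M) (a9 : s.arr 9 = natCells P) (a10 : s.arr 10 = cells g)
    (hP : ∀ j ≤ 2 * N, P j = 2 ^ j) (hA : ∀ i < N, ∀ j < N, A i j = M (i * N + j))
    (hAB : ∀ i j, |A i j| ≤ B) (hi : i < N) (hB : 1 ≤ B)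
    (hg : ∀ x < y, g x = minorAt A N x) (hy : y < 2 ^ (i + N))
    (hW1 : (N * B) ^ N + N * N + 2 * N + B + 3 ≤ W) (hW2 : 2 ^ (2 * N + 1) ≤ W)
    (hQ : ∀ t s' (b' : ℕ), t ≤ N * (4 * B + 30) + 30 →
      ((b' : ℕ) : ℤ) = max (b : ℤ) |minorAt A N (2 ^ (i + N) + y)| → s'.reg 34 = ((b' : ℕ) : ℤ) →
      s'.reg 22 = ((y + 1 : ℕ) : ℤ) → s'.reg 23 = (((y + 1) % 2 ^ N : ℕ) : ℤ) →
      (∀ x, x < 22 ∨ x = 33 ∨ x = 35 → s'.reg x = s.reg x) → (∀ a, a ≠ 10 → s'.arr a = s.arr a) →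
      s'.arr 10 = cells (Function.update g (2 ^ (i + N) + y) (minorAt A N (2 ^ (i + N) + y))) →
      Q t s') :
    Halts W tableStep s Q := by
  have hNB : 1 ≤ N * B := Nat.mul_pos (by omega) hB
  have hpow : 2 ^ (i + N) + 2 ^ (i + N) ≤ 2 ^ (2 * N + 1) := by
    rw [← Nat.two_mul, ← pow_succ']
    exact Nat.pow_le_pow_right (by norm_num) (by omega)
  have hU : (N * B) ^ i ≤ (N * B) ^ N := Nat.pow_le_pow_right hNB hi.le
  have hU' : (N * B) ^ (i + 1) ≤ (N * B) ^ N := Nat.pow_le_pow_right hNB hi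
  have hiN : i * N + N ≤ N * N := by
    rw [← Nat.succ_mul]
    exact Nat.mul_le_mul_right N hi
  have hval : |minorAt A N (2 ^ (i + N) + y)| ≤ W := by
    refine (abs_minorAt_le A hAB (i := i + 1) ?_ hNB).trans (by exact_mod_cast by omega)
    rw [show i + 1 + N = (i + N) + 1 by omega, pow_succ]
    omega
  have hC : y % 2 ^ N < 2 ^ N := Nat.mod_lt y (by positivity)
  have hCW : 2 ^ N ≤ W := (Nat.pow_le_pow_right (by norm_num) (by omega)).trans hW2
  simp only [tableStep, halts_seqs_cons]
  refine halts_expandRow (A := A) (B := B) (U := (N * B) ^ i) h3 h5 h9 h22 h23 h35 a7 a9 a10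
    (fun j hj => hP j (by omega)) (fun j hj => hA i hi j hj) (fun j hj => ?_)
    (fun x hx => ⟨hg x hx, abs_minorAt_le A hAB (hx.trans hy) hNB⟩) hy ?_ (by omega) (by omega) ?_
  · have h1 := hAB i j
    rw [hA i hi j hj, Nat.abs_cast] at h1
    exact_mod_cast h1
  · calc N * (B * (N * B) ^ i) = (N * B) ^ (i + 1) := by rw [pow_succ]; ring
      _ ≤ W := by omega
  · intro t s₁ ht k28 kfr karr
    set v := minorAt A N (2 ^ (i + N) + y) with hv
    have k3 := (kfr 3 (by norm_num) (by norm_num) (by norm_num)).trans h3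
    have k5 := (kfr 5 (by norm_num) (by norm_num) (by norm_num)).trans h5
    have k21 := (kfr 21 (by norm_num) (by norm_num) (by norm_num)).trans h21
    have k22 := (kfr 22 (by norm_num) (by norm_num) (by norm_num)).trans h22
    have k34 := (kfr 34 (by norm_num) (by norm_num) (by norm_num)).trans h34
    have k23 := (kfr 23 (by norm_num) (by norm_num) (by norm_num)).trans h23
    have k33 := (kfr 33 (by norm_num) (by norm_num) (by norm_num)).trans h33
    have e1 : ((2 ^ (i + N) : ℕ) : ℤ) + y = ((2 ^ (i + N) + y : ℕ) : ℤ) := by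
      rw [Nat.cast_add]
    simp only [halts_add, halts_store, k21, k22, e1]
    refine ⟨by rw [Nat.abs_cast]; exact_mod_cast by omega, ?_⟩
    refine halts_ite_max (v := v) (by simpa using k5) (by simpa using k34) (by simpa using k28)
      hval ?_
    intro t₂ s₂ b₂ ht₂ hb₂ l34 lfr larr
    simp only [halts_sub]
    have l5 : s₂.reg 5 = 0 := by
      rw [lfr 5 (by norm_num)]
      simpa using k5
    have l28 : s₂.reg 28 = v := by
      rw [lfr 28 (by norm_num)]
      simpa using k28
    rw [l5, l28, zero_sub]
    refine ⟨by rwa [abs_neg], ?_⟩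
    refine halts_ite_max (v := -v) (by simpa using l5) (by simpa using l34) (by simp)
      (by rwa [abs_neg]) ?_
    intro t₃ s₃ b₃ ht₃ hb₃ m34 mfr marr
    have hreg : ∀ x, x < 24 ∨ (30 ≤ x ∧ x < 34) ∨ x = 35 → s₃.reg x = s₁.reg x := by
      intro x hx
      rw [mfr x (by omega)]
      simp only [reg_setReg]
      rw [if_neg (by omega), lfr x (by omega)]
      simp only [reg_setArr, reg_setReg]
      rw [if_neg (by omega)]
    have m22 := (hreg 22 (by norm_num)).trans k22
    have m23 := (hreg 23 (by norm_num)).trans k23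
    have m3 := (hreg 3 (by norm_num)).trans k3
    have m33 := (hreg 33 (by norm_num)).trans k33
    have hb : (b₃ : ℤ) = max (b : ℤ) |v| := by
      rw [hb₃, hb₂]
      have := max_assoc (b : ℤ) v (-v)
      rw [this]
      rfl
    have e2 : (y : ℤ) + 1 = ((y + 1 : ℕ) : ℤ) := by push_cast; rfl
    have e3 : ((y % 2 ^ N : ℕ) : ℤ) + 1 = ((y % 2 ^ N + 1 : ℕ) : ℤ) := by
      rw [Nat.cast_add, Nat.cast_one]
    have hmod : (y + 1) % 2 ^ N = if y % 2 ^ N + 1 = 2 ^ N then 0 else y % 2 ^ N + 1 := by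
      rw [← Nat.mod_add_mod]
      split_ifs with h
      · rw [h, Nat.mod_self]
      · exact Nat.mod_eq_of_lt (by omega)
    have harr : ∀ a, s₃.arr a = if a = 10 then
        cells (Function.update g (2 ^ (i + N) + y) v) else s.arr a := by
      intro a
      rw [marr]
      simp only [arr_setReg]
      rw [larr]
      simp only [arr_setArr, arr_setReg, reg_setReg, if_true, karr, a10, k28, if_false,
        Nat.reduceEqDiff, update_cells]
    simp only [reg_setReg, m22, m3, m23, e2, e3, if_false, Nat.reduceEqDiff]
    refine ⟨by rw [Nat.abs_cast]; exact_mod_cast by omega,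
      by rw [Nat.abs_cast]; exact_mod_cast by omega, ?_⟩
    have hfin : ∀ (τ : ℕ) (s' : State), τ ≤ N * (4 * B + 30) + 30 →
        (∀ x, x ≠ 22 → x ≠ 23 → s'.reg x = s₃.reg x) → s'.arr = s₃.arr →
        s'.reg 22 = ((y + 1 : ℕ) : ℤ) → s'.reg 23 = (((y + 1) % 2 ^ N : ℕ) : ℤ) → Q τ s' := by
      intro τ s' hτ hs harr' h22 h23
      refine hQ τ s' b₃ hτ hb ((hs 34 (by norm_num) (by norm_num)).trans m34) h22 h23 ?_ ?_ ?_
      · intro x hx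
        rw [hs x (by omega) (by omega), hreg x (by omega)]
        exact kfr x (by omega) (by omega) (by omega)
      · intro a ha
        rw [harr', harr, if_neg ha]
      · rw [harr', harr, if_pos rfl]
    refine halts_ifEq (fun h => ?_) (fun h => ?_)
    · have h : y % 2 ^ N + 1 = 2 ^ N := by
        have h' : ((y % 2 ^ N + 1 : ℕ) : ℤ) = ((2 ^ N : ℕ) : ℤ) := by
          simpa only [reg_setReg, m33, if_true, if_false, Nat.reduceEqDiff] using h
        exact Nat.cast_injective h'
      rw [if_pos h] at hmod
      simp only [halts_const, halts_seqs_nil]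
      refine ⟨by simp, hfin _ _ (by omega) (fun x h1 h2 => by simp [h1, h2]) rfl ?_ ?_⟩
      · simp only [reg_setReg, if_true, if_false, Nat.reduceEqDiff]
      · simp only [reg_setReg, if_true, hmod, Nat.cast_zero]
    · have h : y % 2 ^ N + 1 ≠ 2 ^ N := fun h' => h (by
        simp only [reg_setReg, m33, if_true, if_false, Nat.reduceEqDiff, h'])
      rw [if_neg h] at hmod
      simp only [halts_skip, halts_seqs_nil]
      constructor
      all_goals
        refine hfin _ _ (by omega) (fun x h1 h2 => by simp [h1, h2]) rfl ?_ ?_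
        · simp only [reg_setReg, if_true, if_false, Nat.reduceEqDiff]
        · simp only [reg_setReg, if_true, hmod]

end RAM

namespace RAM

/-- Tabulate all minors that consist of the first rows, and find the largest absolute value. -/
def fillTable : Program :=
  seqs [.const 34 1, .const 20 0, .const 35 0, .store 10 5 3,
    .while 20 9 (seqs [.add 21 20 9, .load 21 9 21, .const 22 0, .const 23 0,
      .while 22 21 tableStep, .add 35 35 9, .add 20 20 3])]

/-- Round `i` doubles the table: it fills the cells from `2 ^ (i + N)` up to `2 ^ (i + 1 + N)`,
whose largest row is `i`, from the cells below. The maximum starts at 1, the empty minor. -/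
theorem halts_fillTable {W N B : ℕ} {s : State} {Q : ℕ → State → Prop} {r : ℕ → ℤ}
    {A : ℕ → ℕ → ℤ} {M P : ℕ → ℕ} (hr : Agree r s)
    (hr3 : r 3 = 1) (hr5 : r 5 = 0) (hr9 : r 9 = N) (h33 : s.reg 33 = ((2 ^ N : ℕ) : ℤ))
    (a7 : s.arr 7 = natCells M) (a9 : s.arr 9 = natCells P) (hz : ZeroFrom 10 s)
    (hP : ∀ j ≤ 2 * N, P j = 2 ^ j) (hA : ∀ i < N, ∀ j < N, A i j = M (i * N + j))
    (hAB : ∀ i j, |A i j| ≤ B) (hN : 1 ≤ N) (hB : 1 ≤ B)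
    (hW1 : (N * B) ^ N + N * N + 2 * N + B + 3 ≤ W) (hW2 : 2 ^ (2 * N + 1) ≤ W)
    (hQ : ∀ t s', t ≤ N * (2 ^ (2 * N) * (N * (4 * B + 30) + 31) + 20) + 20 → Agree r s' →
      s'.reg 34 = (maxSubdet (Matrix.of fun i j : Fin N => A i j) : ℤ) →
      maxSubdet (Matrix.of fun i j : Fin N => A i j) ≤ W → Q t s') :
    Halts W fillTable s Q := by
  have c3 : s.reg 3 = 1 := (hr 3 (by norm_num)).trans hr3
  have c5 : s.reg 5 = 0 := (hr 5 (by norm_num)).trans hr5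
  obtain ⟨J, hJ⟩ : ∃ J : ℕ → State → Prop, ∀ Y s', J Y s' ↔ ∃ (b : ℕ) (g : ℕ → ℤ),
      s'.reg 34 = b ∧ s'.arr 10 = cells g ∧
      (∀ x < Y, g x = minorAt A N x ∧ (minorAt A N x).natAbs ≤ b) ∧
      ∃ x < 2 ^ (N + N), (minorAt A N x).natAbs = b := ⟨_, fun _ _ => Iff.rfl⟩
  simp only [fillTable, halts_seqs_cons, halts_const, halts_store, reg_setReg, c3, c5,
    if_false, Nat.reduceEqDiff]
  refine ⟨by simp; omega, by simp, by simp, ?_⟩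
  refine halts_for (N := N) (T := 2 ^ (2 * N) * (N * (4 * B + 30) + 31) + 15)
    (fun i s' => i ≤ N ∧ Agree r s' ∧ s'.reg 20 = i ∧ s'.reg 33 = ((2 ^ N : ℕ) : ℤ) ∧
      s'.reg 35 = ((i * N : ℕ) : ℤ) ∧ s'.arr 7 = natCells M ∧ s'.arr 9 = natCells P ∧
      J (2 ^ (i + N)) s') ?_ ?_ ?_ ?_
  · refine ⟨Nat.zero_le _, by simpa using hr, by simp, by simpa using h33, by simp,
      by simpa using a7, by simpa using a9, (hJ _ _).2 ⟨1, fun x => if x = 0 then 1 else 0, by simp,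
      ?_, fun x hx => ?_, 0, by positivity, ?_⟩⟩
    -- Of the first `2 ^ N` cells, those without rows, only cell 0 is nonzero; the others are
    -- correct because arrays start with zeros.
    · have h0 : Function.update (cells fun _ => 0) ((0 : ℕ) : ℤ) 1 =
          cells fun x => if x = 0 then 1 else 0 := by
        rw [update_cells]
        congr 1
        funext x
        rw [Function.update_apply]
      simpa [hz 10 le_rfl, natCells] using h0
    · rw [zero_add] at hx
      rw [minorAt_low A hx]
      exact ⟨rfl, by split_ifs <;> simp⟩
    · rw [minorAt_low A (by positivity)]
      simp
  · rintro i s' ⟨-, h1, h2, -⟩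
    exact ⟨h2, (h1 9 (by norm_num)).trans hr9⟩
  · rintro i s' hi ⟨-, kr, k20, k33, k35, k7, k9, kJ⟩
    have c3 : s'.reg 3 = 1 := (kr 3 (by norm_num)).trans hr3
    have c9 : s'.reg 9 = N := (kr 9 (by norm_num)).trans hr9
    have hiN : i * N + N ≤ N * N := by
      rw [← Nat.succ_mul]
      exact Nat.mul_le_mul_right N hi
    have e1 : (i : ℤ) + N = ((i + N : ℕ) : ℤ) := by push_cast; rfl
    have hpow : 2 ^ (i + N) ≤ 2 ^ (2 * N) := Nat.pow_le_pow_right (by norm_num) (by omega)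
    have hpow' : 2 ^ (i + N) ≤ W := hpow.trans
      ((Nat.pow_le_pow_right (by norm_num) (by omega)).trans hW2)
    simp only [halts_seqs_cons, halts_add, halts_load, halts_const, reg_setReg, arr_setReg, k20, c9,
      k9, e1, natCells_natCast, hP (i + N) (by omega), if_true]
    refine ⟨by rw [Nat.abs_cast]; exact_mod_cast by omega, by simp, by simp, ?_⟩
    refine halts_for (N := 2 ^ (i + N)) (T := N * (4 * B + 30) + 30)
      (fun y s' => y ≤ 2 ^ (i + N) ∧ Agree r s' ∧ s'.reg 20 = i ∧
      s'.reg 21 = ((2 ^ (i + N) : ℕ) : ℤ) ∧ s'.reg 22 = y ∧ s'.reg 23 = ((y % 2 ^ N : ℕ) : ℤ) ∧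
      s'.reg 33 = ((2 ^ N : ℕ) : ℤ) ∧
      s'.reg 35 = ((i * N : ℕ) : ℤ) ∧ s'.arr 7 = natCells M ∧ s'.arr 9 = natCells P ∧
      J (2 ^ (i + N) + y) s') ?_ ?_ ?_ ?_
    · refine ⟨Nat.zero_le _, by simpa using kr, by simpa using k20, by simp, by simp, by simp,
        by simpa using k33, by simpa using k35, k7, k9, ?_⟩
      rw [hJ] at kJ ⊢
      simpa using kJ
    · rintro y s' ⟨-, -, -, h1, h2, -⟩
      exact ⟨h2, h1⟩
    · rintro y s₁ hy ⟨-, lr, l20, l21, l22, l23, l33, l35, l7, l9, lJ⟩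
      obtain ⟨b, g, l34, l10, lg, x₀, hx₀, hbx⟩ := (hJ _ _).1 lJ
      refine halts_tableStep (A := A) (B := B) ((lr 3 (by norm_num)).trans hr3)
        ((lr 5 (by norm_num)).trans hr5) ((lr 9 (by norm_num)).trans hr9) l21 l22 l33 l34 l23 l35
        l7 l9 l10 hP hA hAB hi hB (fun x hx => (lg x (by omega)).1) hy hW1 hW2 ?_
      intro t s₂ b' ht hb' m34 m22 m23 mreg marr m10
      have hb'' : b' = max b (minorAt A N (2 ^ (i + N) + y)).natAbs := by
        have : ((minorAt A N (2 ^ (i + N) + y)).natAbs : ℤ) = |minorAt A N (2 ^ (i + N) + y)| :=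
          Int.natCast_natAbs _
        omega
      refine ⟨ht, hy, fun x hx => (mreg x (by omega)).trans (lr x hx),
        (mreg 20 (by norm_num)).trans l20, (mreg 21 (by norm_num)).trans l21, m22, m23,
        (mreg 33 (by norm_num)).trans l33, (mreg 35 (by norm_num)).trans l35,
        (marr 7 (by norm_num)).trans l7, (marr 9 (by norm_num)).trans l9,
        (hJ _ _).2 ⟨b', _, m34, m10, fun x hx => ?_, ?_⟩⟩
      · rw [Function.update_apply]
        split_ifs with h
        · rw [h]
          exact ⟨rfl, by omega⟩
        · obtain ⟨h1, h2⟩ := lg x (by omega)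
          exact ⟨h1, by omega⟩
      · rcases le_total b (minorAt A N (2 ^ (i + N) + y)).natAbs with h | h
        · refine ⟨2 ^ (i + N) + y, ?_, by omega⟩
          have : 2 ^ (i + N) + 2 ^ (i + N) ≤ 2 ^ (N + N) := by
            rw [← Nat.two_mul, ← pow_succ']
            exact Nat.pow_le_pow_right (by norm_num) (by omega)
          omega
        · exact ⟨x₀, hx₀, by omega⟩
    · rintro t s₁ ht ⟨-, lr, l20, l21, l22, l23, l33, l35, l7, l9, lJ⟩
      have c3 : s₁.reg 3 = 1 := (lr 3 (by norm_num)).trans hr3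
      have c9 : s₁.reg 9 = N := (lr 9 (by norm_num)).trans hr9
      have e2 : ((i * N : ℕ) : ℤ) + N = (((i + 1) * N : ℕ) : ℤ) := by push_cast; ring
      have e3 : (i + 1) * N = i * N + N := Nat.succ_mul i N
      simp only [halts_seqs_nil, reg_setReg, l35, c9, e2, l20, c3,
        if_false, Nat.reduceEqDiff]
      have ht' : t ≤ 2 ^ (2 * N) * (N * (4 * B + 30) + 31) + 1 :=
        ht.trans (Nat.add_le_add_right (Nat.mul_le_mul_right _ hpow) 1)
      refine ⟨by rw [Nat.abs_cast]; exact_mod_cast by omega, by rw [abs_le]; omega, by omega, hi,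
        by simpa using lr, by simp, by simpa using l33, by simp, l7, l9, ?_⟩
      rw [hJ] at lJ ⊢
      rw [← Nat.two_mul, ← pow_succ', show i + N + 1 = i + 1 + N by omega] at lJ
      simpa using lJ
  · rintro t s' ht ⟨-, kr, k20, k33, k35, k7, k9, kJ⟩
    obtain ⟨b, g, k34, k10, kg, hb⟩ := (hJ _ _).1 kJ
    simp only [halts_seqs_nil]
    have hmax := maxSubdet_eq_of_table A (fun x hx => (kg x hx).2) hb
    refine hQ _ _ ?_ kr (by rw [k34, hmax]) ?_
    · have : N * (2 ^ (2 * N) * (N * (4 * B + 30) + 31) + 15 + 1) ≤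
        N * (2 ^ (2 * N) * (N * (4 * B + 30) + 31) + 20) := Nat.mul_le_mul_left N (by omega)
      omega
    · obtain ⟨x, hx, hxb⟩ := hb
      have h1 := abs_minorAt_le A hAB hx (Nat.mul_pos hN hB)
      rw [← Int.natCast_natAbs, hxb] at h1
      have h2 : b ≤ (N * B) ^ N := by exact_mod_cast h1
      omega

end RAM

/-! ### The algorithm -/

namespace EdgeList

variable {V : Type*} {G : SimpleGraph V} (e : EdgeList G)

/-- The graph of the edge list, with a length for all numbers. -/
noncomputable def initialGraph : PathGraph :=
  { e.pathGraph with len := fun i => if i < Nat.card G.edgeSet then 1 else 0 }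

theorem counts_initialGraph : e.initialGraph.counts = e.pathGraph.counts := by
  refine PathGraph.counts_congr rfl (fun _ _ => rfl) (fun _ _ => rfl) fun i hi => ?_
  have hi' : i < Nat.card G.edgeSet := Finset.mem_range.1 hi
  simp only [initialGraph, if_pos hi']
  rfl

theorem tables_initialGraph [Finite V] {cap : ℕ} (hcap : 2 ≤ cap) {deg P Q : ℕ → ℕ}
    (h : Slots (Finset.range (Nat.card G.edgeSet)) (fun i v => if i < Nat.card G.edgeSet then
      (if e.fstNum i = v then 1 else 0) + (if e.sndNum i = v then 1 else 0) else 0) deg P Q) :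
    Tables (Nat.card V) (Nat.card G.edgeSet) cap deg e.initialGraph deg P Q where
  mem i := by
    simp only [initialGraph, pathGraph, Finset.mem_range]
    split_ifs with hi <;> simp [-Nat.card_coe_set_eq, hi]
  len_lt i := by
    simp only [initialGraph]
    split_ifs <;> omega
  loop i hi h' := absurd h' (e.fstNum_ne_sndNum (Finset.mem_range.1 hi))
  lt i hi := ⟨e.fstNum_lt (Finset.mem_range.1 hi), e.sndNum_lt (Finset.mem_range.1 hi)⟩
  slots := by
    have h1 : e.initialGraph.incidence = fun i v => if i < Nat.card G.edgeSet then
        (if e.fstNum i = v then 1 else 0) + (if e.sndNum i = v then 1 else 0) else 0 := by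
      funext i v
      simp only [PathGraph.incidence, initialGraph, pathGraph, Finset.mem_range]
      congr
    rw [h1]
    exact h
  deg v := Or.inr rfl

theorem edgeDeg_pathGraph {deg P Q : ℕ → ℕ}
    (h : Slots (Finset.range (Nat.card G.edgeSet)) (fun i v => if i < Nat.card G.edgeSet then
      (if e.fstNum i = v then 1 else 0) + (if e.sndNum i = v then 1 else 0) else 0) deg P Q)
    (v : ℕ) : e.pathGraph.edgeDeg v = deg v := by
  rw [← h.sum v, PathGraph.edgeDeg, Finset.card_filter]
  refine Finset.sum_congr rfl fun i hi => ?_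
  have hi' := Finset.mem_range.1 hi
  have := e.fstNum_ne_sndNum hi'
  simp only [pathGraph, if_pos hi']
  by_cases h1 : e.fstNum i = v
  · have h2 : e.sndNum i ≠ v := by omega
    simp [h1, h2]
  · simp [h1]

/-- Loops account for at most Δ(G) edges and vertices of degree at least three for at most 16 Δ(G).
-/
theorem card_keep_le [Finite V] {cap : ℕ} {deg₀ P Q deg P' Q' : ℕ → ℕ} {W : PathGraph}
    (h₀ : Slots (Finset.range (Nat.card G.edgeSet)) (fun i v => if i < Nat.card G.edgeSet then
      (if e.fstNum i = v then 1 else 0) + (if e.sndNum i = v then 1 else 0) else 0) deg₀ P Q)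
    (h : Tables (Nat.card V) (Nat.card G.edgeSet) cap deg₀ W deg P' Q')
    (hc : W.counts = e.initialGraph.counts) (hPQ : ∀ v < Nat.card V, deg v = 2 → P' v = Q' v) :
    (W.keep deg).card ≤ 17 * G.subdetDelta := by
  have hM : ∀ c ∈ e.pathGraph.counts, c ≤ G.subdetDelta := fun c hc =>
    e.isGreatest_counts_pathGraph.2 hc
  have := h.card_keep_le (M := G.subdetDelta) (B := 16 * G.subdetDelta) hPQ ?_ fun X hX => ?_
  · omega
  · rw [hc, e.counts_initialGraph]
    exact hM
  · have h1 := e.pathGraph.sum_edgeDeg_le (fun _ _ => rfl)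
      (fun i hi => e.fstNum_ne_sndNum (Finset.mem_range.1 hi)) hM X
    simp only [e.edgeDeg_pathGraph h₀] at h1
    exact h1 hX

end EdgeList

/-- The entries of a quadratic matrix that is stored row by row. -/
def tableEntry (N : ℕ) (M : ℕ → ℕ) (i j : ℕ) : ℤ := if i < N ∧ j < N then M (i * N + j) else 0

/-- With all edges processed, `X` has no inner vertices and the stored table is its matrix. Numbers
below `N` that name no vertex of `X` only add unit rows and columns. -/
theorem Expansion.isGreatest {n m N S K cnt : ℕ} {f : ℕ → ℕ} {W X : PathGraph} {L : Finset ℕ}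
    {M : ℕ → ℕ} (h : Expansion n m N S K f W L m m X cnt M) (hf : Function.Injective f)
    (hcnt : cnt < N) :
    IsGreatest W.counts (maxSubdet (Matrix.of fun i j : Fin N => tableEntry N M i j)) := by
  rw [← h.counts]
  have hd := fun i hi => h.done i hi (lt_or_ge i m)
  refine X.isGreatest_counts (fun i hi => (hd i hi).1) ⟨fun x : Fin N => f x, fun x y hxy =>
    Fin.ext (hf hxy)⟩ (fun i hi => ?_) _ fun x y => ?_
  · obtain ⟨-, x, y, hx, hy, h1, h2⟩ := hd i hi
    exact ⟨⟨⟨x, by omega⟩, h1.symm⟩, ⟨⟨y, by omega⟩, h2.symm⟩⟩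
  · rw [Matrix.of_apply, tableEntry, if_pos ⟨x.2, y.2⟩, h.mat x x.2 y y.2,
      Finset.filter_true_of_mem fun i _ => lt_or_ge i m]
    simp only [edgeEntry, Fin.val_inj]
    push_cast
    rfl

theorem Expansion.abs_tableEntry_le {n m N S K cnt : ℕ} {f : ℕ → ℕ} {W X : PathGraph}
    {L : Finset ℕ} {M : ℕ → ℕ} (h : Expansion n m N S K f W L m m X cnt M)
    (hcnt : cnt < N) (hK : K ≤ N) (i j : ℕ) : |tableEntry N M i j| ≤ (4 * N + 1 : ℕ) := by
  rw [tableEntry]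
  split_ifs with hij
  · have := h.mat_le hij.1 hij.2
    rw [Nat.abs_cast]
    exact_mod_cast by omega
  · simp
    omega

/-! ### The size of the numbers -/

section bounds

variable {N : ℕ}

/-- One quantity dominates everything about the table: its size `4 ^ N`, the size of the minors, and
the time to fill it. -/
theorem le_pow_four_mul (hN : 64 ≤ N) :
    N ≤ N ^ (4 * N) ∧ N * N ≤ N ^ (4 * N) ∧ (N * (4 * N + 1)) ^ N ≤ N ^ (4 * N) ∧
      2 ^ (2 * N + 1) ≤ N ^ (4 * N) ∧
      N * (2 ^ (2 * N) * (N * (4 * (4 * N + 1) + 30) + 31) + 20) ≤ N ^ (4 * N) := by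
  have hN0 : 0 < N := by omega
  have h4 : 2 ^ (2 * N) ≤ N ^ N := by
    rw [pow_mul]
    exact Nat.pow_le_pow_left (by omega) N
  have h2 : N * N ≤ N ^ (4 * N) := by
    rw [← pow_two]
    exact Nat.pow_le_pow_right hN0 (by omega)
  refine ⟨(Nat.le_mul_of_pos_left N hN0).trans h2, h2, ?_, ?_, ?_⟩
  · rw [pow_mul]
    exact Nat.pow_le_pow_left (by nlinarith [Nat.pow_le_pow_right hN0 (show 2 ≤ 3 by norm_num)]) N
  · calc 2 ^ (2 * N + 1) = 2 ^ (2 * N) * 2 := pow_succ _ _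
      _ ≤ N ^ N * N := Nat.mul_le_mul h4 (by omega)
      _ = N ^ (N + 1) := (pow_succ _ _).symm
      _ ≤ N ^ (4 * N) := Nat.pow_le_pow_right hN0 (by omega)
  · have h5 : N * (4 * (4 * N + 1) + 30) + 31 + 20 ≤ N ^ 3 := by
      have : N ^ 3 = N * (N * N) := by ring
      nlinarith
    have h6 : 0 < 2 ^ (2 * N) := by positivity
    calc N * (2 ^ (2 * N) * (N * (4 * (4 * N + 1) + 30) + 31) + 20)
        ≤ N * (2 ^ (2 * N) * (N * (4 * (4 * N + 1) + 30) + 31 + 20)) :=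
          Nat.mul_le_mul_left N (by nlinarith)
      _ ≤ N * (N ^ N * N ^ 3) := Nat.mul_le_mul_left N (Nat.mul_le_mul h4 h5)
      _ = N ^ (N + 4) := by ring
      _ ≤ N ^ (4 * N) := Nat.pow_le_pow_right hN0 (by omega)

end bounds

/-- For `D ≥ 2` one has `c * D ≤ D ^ (c + 1)`, which turns the power into one with exponent linear
in `D` and base `D`. For `D = 1` the logarithm vanishes and the leading factor must absorb the
constant, hence the summand `c ^ (4 * c)`. -/
theorem exists_pow_le_two_rpow (c : ℕ) : ∃ C : ℕ, ∀ D : ℕ, 1 ≤ D →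
    (((c * D) ^ (4 * (c * D)) : ℕ) : ℝ) ≤ C * (2 : ℝ) ^ ((C : ℝ) * (D * Real.logb 2 D)) := by
  refine ⟨c ^ (4 * c) + 4 * c * (c + 1) + 1, fun D hD => ?_⟩
  rcases hD.eq_or_lt with rfl | hD
  · simp only [mul_one, Nat.cast_one, Real.logb_one, mul_zero, Real.rpow_zero]
    exact_mod_cast by omega
  · have h1 : (c * D) ^ (4 * (c * D)) ≤ D ^ (4 * c * (c + 1) * D) := by
      have h2 : c * D ≤ D ^ (c + 1) := by
        rw [pow_succ]
        exact Nat.mul_le_mul_right D (Nat.lt_pow_self hD).le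
      calc (c * D) ^ (4 * (c * D)) ≤ (D ^ (c + 1)) ^ (4 * (c * D)) := Nat.pow_le_pow_left h2 _
        _ = D ^ (4 * c * (c + 1) * D) := by rw [← pow_mul]; congr 1; ring
    have hD0 : (0 : ℝ) < D := by exact_mod_cast by omega
    have hlog : 0 ≤ Real.logb 2 D := Real.logb_nonneg (by norm_num) (by exact_mod_cast hD.le)
    set C : ℕ := c ^ (4 * c) + 4 * c * (c + 1) + 1 with hC
    have h3 : (D : ℝ) ^ (4 * c * (c + 1) * D) =
        (2 : ℝ) ^ (((4 * c * (c + 1) : ℕ) : ℝ) * (D * Real.logb 2 D)) := by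
      rw [← Real.rpow_natCast]
      nth_rewrite 1 [← Real.rpow_logb (b := 2) (by norm_num) (by norm_num) hD0]
      rw [← Real.rpow_mul (by norm_num)]
      congr 1
      push_cast
      ring
    calc (((c * D) ^ (4 * (c * D)) : ℕ) : ℝ) ≤ (D : ℝ) ^ (4 * c * (c + 1) * D) := by
          exact_mod_cast h1
      _ = (2 : ℝ) ^ (((4 * c * (c + 1) : ℕ) : ℝ) * (D * Real.logb 2 D)) := h3
      _ ≤ (2 : ℝ) ^ ((C : ℝ) * (D * Real.logb 2 D)) :=
          Real.rpow_le_rpow_of_exponent_le (by norm_num)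
            (mul_le_mul_of_nonneg_right (by exact_mod_cast by omega) (by positivity))
      _ ≤ C * (2 : ℝ) ^ ((C : ℝ) * (D * Real.logb 2 D)) :=
          le_mul_of_one_le_left (by positivity) (by exact_mod_cast by omega)

theorem exists_le_resourceBound (c c' : ℕ) : ∃ C : ℕ, 1 ≤ C ∧ ∀ D n m : ℕ, 1 ≤ D →
    ((c' * (n + m + (c * D) ^ (4 * (c * D))) : ℕ) : ℝ) ≤ resourceBound C D n m ∧
      1 ≤ resourceBound C D n m := by
  obtain ⟨C, hC⟩ := exists_pow_le_two_rpow c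
  refine ⟨c' * (C + 1) + C + 1, by omega, fun D n m hD => ?_⟩
  set C' := c' * (C + 1) + C + 1 with hC'
  have h0 : (C : ℝ) ≤ C' := by exact_mod_cast by omega
  have hlog : 0 ≤ (D : ℝ) * Real.logb 2 D :=
    mul_nonneg (Nat.cast_nonneg _) (Real.logb_nonneg (by norm_num) (by exact_mod_cast hD))
  set x : ℝ := (2 : ℝ) ^ ((C' : ℝ) * (D * Real.logb 2 D)) with hx
  have hx1 : 1 ≤ x := Real.one_le_rpow (by norm_num) (by positivity)
  have h1 : (((c * D) ^ (4 * (c * D)) : ℕ) : ℝ) ≤ C * x := (hC D hD).trans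
    (mul_le_mul_of_nonneg_left (Real.rpow_le_rpow_of_exponent_le (by norm_num)
      (mul_le_mul_of_nonneg_right h0 hlog)) (Nat.cast_nonneg _))
  have h2 : (1 : ℝ) ≤ C' := by exact_mod_cast by omega
  have h3 : (C' : ℝ) = c' * (C + 1) + C + 1 := by rw [hC']; push_cast; rfl
  have hn : (0 : ℝ) ≤ n + m := by positivity
  have hC0 : (0 : ℝ) ≤ C := Nat.cast_nonneg _
  have hc0 : (0 : ℝ) ≤ c' := Nat.cast_nonneg _
  simp only [resourceBound, ← hx]
  constructor
  · rw [Nat.cast_mul, Nat.cast_add, Nat.cast_add]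
    calc (c' : ℝ) * (n + m + (((c * D) ^ (4 * (c * D)) : ℕ) : ℝ))
        ≤ c' * ((C + 1) * (n + m + x)) := by
          refine mul_le_mul_of_nonneg_left ?_ hc0
          nlinarith [mul_nonneg hC0 hn]
      _ ≤ C' * (n + m + x) := by
          rw [h3, ← mul_assoc]
          exact mul_le_mul_of_nonneg_right (by linarith) (by linarith)
  · nlinarith

namespace RAM

/-! ### Assembling the program -/

theorem halts_replicate_add {W x y v : ℕ} (hxy : y ≠ x) (k : ℕ) {a : ℕ} {s : State}
    {Q : ℕ → State → Prop} (hx : s.reg x = a) (hy : s.reg y = v) (hW : a + k * v ≤ W)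
    (hQ : ∀ s', s'.reg x = ((a + k * v : ℕ) : ℤ) → (∀ z, z ≠ x → s'.reg z = s.reg z) →
      s'.arr = s.arr → Q (k + 1) s') :
    Halts W (seqs (List.replicate k (.add x x y))) s Q := by
  induction k generalizing a s Q with
  | zero =>
    rw [List.replicate_zero, halts_seqs_nil]
    exact hQ s (by simpa using hx) (fun _ _ => rfl) rfl
  | succ k ih =>
    have e : a + (k + 1) * v = a + v + k * v := by ring
    rw [e] at hW hQ
    rw [List.replicate_succ, halts_seqs_cons, halts_add, hx, hy]
    refine ⟨by rw [abs_le]; omega, ih (a := a + v) (by simp) (by simpa [hxy] using hy) hW ?_⟩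
    intro s' h1 h2 h3
    rw [show 1 + (k + 1) = k + 1 + 1 by omega]
    refine hQ s' h1 (fun z hz => ?_) h3
    rw [h2 z hz, reg_setReg, if_neg hz]

/-- Multiply a register by a constant. -/
def mulConst (x y k : ℕ) : Program := .seq (.const x 0) (seqs (List.replicate k (.add x x y)))

theorem halts_mulConst {W x y v k : ℕ} {s : State} {Q : ℕ → State → Prop} (hxy : y ≠ x)
    (hy : s.reg y = v) (hW : k * v ≤ W)
    (hQ : ∀ s', s'.reg x = ((k * v : ℕ) : ℤ) → (∀ z, z ≠ x → s'.reg z = s.reg z) →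
      s'.arr = s.arr → Q (k + 2) s') :
    Halts W (mulConst x y k) s Q := by
  rw [mulConst, halts_seq, halts_const]
  refine ⟨by simp, halts_replicate_add hxy k (a := 0) (by simp) (by simpa [hxy] using hy)
    (by omega) fun s' h1 h2 h3 => ?_⟩
  rw [show 1 + (k + 1) = k + 2 by omega]
  refine hQ s' (by simpa using h1) (fun z hz => ?_) h3
  rw [h2 z hz, reg_setReg, if_neg hz]

/-- Find the largest subdeterminant if only few edges are left. -/
def solveSmall : Program :=
  seqs [unitMatrix, expandEdges, powers, fillTable, .const 0 1, .add 1 34 5]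

theorem halts_solveSmall {W n m N K cap cnt₀ : ℕ} {s : State} {Q : ℕ → State → Prop} {r : ℕ → ℤ}
    {G : PathGraph} {new len : ℕ → ℕ}
    (hr : Agree r s) (hr2 : r 2 = m) (hr3 : r 3 = 1) (hr5 : r 5 = 0) (hr9 : r 9 = N)
    (h0 : s.arr 0 = natCells G.a) (h1 : s.arr 1 = natCells G.b)
    (h5 : s.arr 5 = natCells len) (h6 : s.arr 6 = natCells new)
    (h31 : s.reg 31 = cnt₀) (hz : ZeroFrom 7 s)
    (hN : VertexNumbering n new cnt₀) (hLm : ∀ e ∈ G.L, e < m)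
    (hlen : ∀ e < m, len e = if e ∈ G.L then G.len e else 0)
    (hpos : ∀ e ∈ G.L, G.len e ≠ 0) (hcap : ∀ e ∈ G.L, G.len e < cap) (hcard : G.L.card = K)
    (hvert : ∀ e ∈ G.L, G.a e < n ∧ G.b e < n)
    (hnew : ∀ e ∈ G.L, new (G.a e) ≠ 0 ∧ new (G.b e) ≠ 0)
    (hcnt : cnt₀ + K * cap < N) (hKN : K ≤ N) (hN64 : 64 ≤ N) (hcapN : cap ≤ N)
    (hW : m + 100 * N ^ (4 * N) ≤ W)
    (hQ : ∀ t s' (d : ℕ), t ≤ (30 * cap + 50) * (m + 1) + 20 * N + N ^ (4 * N) + 100 →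
      s'.reg 0 = 1 → s'.reg 1 = ((d : ℕ) : ℤ) → IsGreatest G.counts d → Q t s') :
    Halts W solveSmall s Q := by
  obtain ⟨b1, b2, b3, b4, b5⟩ := le_pow_four_mul hN64
  set Y := N ^ (4 * N) with hY
  simp only [solveSmall, halts_seqs_cons]
  refine halts_unitMatrix hr hr3 hr9 hz (by omega) ?_
  intro t₁ s₁ M₀ R ht₁ hr₁ harr₁ hreg₁ h7 h8 hz₁ hR hM₀
  refine halts_expandEdges (K := K) (cap := cap) (N := N) (G := G) hr₁ hr2 hr3 hr5
    ((harr₁ 0 (by norm_num)).trans h0) ((harr₁ 1 (by norm_num)).trans h1)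
    ((harr₁ 5 (by norm_num)).trans h5) ((harr₁ 6 (by norm_num)).trans h6) h7 h8
    ((hreg₁ 31 (by norm_num)).trans h31) hz₁ hN hR rfl hLm hlen hpos hcap hcard hvert hnew hM₀ hcnt
    (by omega) hKN ?_
  intro t₂ s₂ X cnt M ht₂ hr₂ hcntN h7 hz₂ hX
  refine halts_powers hr₂ hr3 hr9 hz₂ (by omega) ?_
  intro t₃ s₃ P ht₃ hr₃ harr₃ h9 hP h33
  refine halts_fillTable (A := tableEntry N M) (B := 4 * N + 1) hr₃ hr3 hr5 hr9 h33
    ((harr₃ 7 (by norm_num)).trans h7) h9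
    (fun a ha => (harr₃ a (by omega)).trans (hz₂ a (by omega))) hP
    (fun i hi j hj => by rw [tableEntry, if_pos ⟨hi, hj⟩])
    (hX.abs_tableEntry_le hcntN hKN) (by omega) (by omega) (by omega) (by omega) ?_
  intro t₄ s₄ ht₄ hr₄ h34 hdW
  have c5 : s₄.reg 5 = 0 := (hr₄ 5 (by norm_num)).trans hr5
  have hg := hX.isGreatest hN.vertexName_injective hcntN
  set d := maxSubdet (Matrix.of fun i j : Fin N => tableEntry N M i j) with hd
  simp only [halts_const, halts_add, halts_seqs_nil, reg_setReg, h34, c5, add_zero, if_false,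
    Nat.reduceEqDiff]
  exact ⟨by simp; omega, by rw [Nat.abs_cast]; exact_mod_cast hdW,
    hQ _ _ d (by omega) (by simp) (by simp) hg⟩

/-- Compute the largest subdeterminant, or report that it is large. -/
def solve (q : ℕ) : Program :=
  seqs [.const 3 1, .const 4 (q + 2), .const 6 2, .const 7 3, mulConst 8 0 17,
    mulConst 9 0 (17 * (q + 5) + 1), scanEdges, contractAll, selectEdges,
    .ite 8 30 (.const 0 0) solveSmall]

/-- The order `N` of the matrix leaves room for the case that at most `17 D` edges are kept: these
have at most `2 · 17 D` ends and fewer than `17 D (q + 3)` inner vertices, together at most `17 (q +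
5) D < N`. -/
theorem halts_solve {W q D : ℕ} (hq : ∀ k, q ≤ k → pathTypes k = pathTypes (k + 3)) (hq3 : 3 ≤ q)
    (hD : 1 ≤ D) {V : Type*} [Finite V] {G : SimpleGraph V} (e : EdgeList G) {N c T : ℕ}
    (hN : N = (17 * (q + 5) + 1) * D) (hc : c = 34 * (q + 3) + 1000)
    (hT : T = c * (Nat.card V + Nat.card G.edgeSet + N ^ (4 * N))) (hW : T ≤ W) :
    Halts W (solve q) (e.initState D) fun t s => t ≤ T ∧
      ((s.reg 0 = 1 ∧ s.reg 1 = (G.subdetDelta : ℤ)) ∨ (s.reg 0 = 0 ∧ D < G.subdetDelta)) := by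
  set n := Nat.card V with hn
  set m := Nat.card G.edgeSet with hm
  have hND : 17 * (q + 5) + 1 ≤ N := by
    rw [hN]
    exact Nat.le_mul_of_pos_right _ hD
  have hN64 : 64 ≤ N := by omega
  obtain ⟨b1, b2, b3, b4, b5⟩ := le_pow_four_mul hN64
  set Y := N ^ (4 * N) with hY
  have hT' : T = 34 * (q * n) + 34 * (q * m) + 34 * (q * Y) + 1102 * n + 1102 * m + 1102 * Y := by
    rw [hT, hc]
    ring
  have hqY : q ≤ q * Y := Nat.le_mul_of_pos_right _ (by omega)
  have hN' : N = 17 * (q * D) + 86 * D := by rw [hN]; ring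
  have hs0 : (e.initState D).reg 0 = D := by simp [EdgeList.initState]
  simp only [solve, halts_seqs_cons, halts_const]
  refine ⟨by simp; omega, by rw [abs_le]; omega, by simp; omega, by simp; omega, ?_⟩
  refine halts_mulConst (v := D) (by norm_num) (by simp [hs0]) (by omega) ?_
  intro s₁ r8 hreg₁ harr₁
  refine halts_mulConst (v := D) (by norm_num) (by rw [hreg₁ 0 (by norm_num)]; simp [hs0])
    (by omega) ?_
  intro s₂ r9 hreg₂ harr₂
  rw [← hN] at r9
  have hr : Agree s₂.reg s₂ := fun _ _ => rfl
  have hreg : ∀ x, x ≠ 8 → x ≠ 9 → s₂.reg x = if x = 7 then 3 else if x = 6 then 2 else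
      if x = 4 then (q : ℤ) + 2 else if x = 3 then 1 else (e.initState D).reg x := by
    intro x h8 h9
    rw [hreg₂ x h9, hreg₁ x h8]
    simp only [reg_setReg]
  have hr1 : s₂.reg 1 = n := by simp [hreg, EdgeList.initState, hn]
  have hr2 : s₂.reg 2 = m := by
    rw [hreg 2 (by norm_num) (by norm_num)]
    rfl
  have hr3 : s₂.reg 3 = 1 := by simp [hreg]
  have hr4 : s₂.reg 4 = ((q + 3 : ℕ) : ℤ) - 1 := by
    simp [hreg]
    ring
  have hr5 : s₂.reg 5 = 0 := by simp [hreg, EdgeList.initState]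
  have hr6 : s₂.reg 6 = 2 := by simp [hreg]
  have hr7 : s₂.reg 7 = 3 := by simp [hreg]
  have hr8 : s₂.reg 8 = ((17 * D : ℕ) : ℤ) := by rw [hreg₂ 8 (by norm_num), r8]
  have harr : s₂.arr = (e.initState D).arr := by rw [harr₂, harr₁]; rfl
  have ha : s₂.arr 0 = natCells e.fstNum := by
    rw [harr]
    funext i
    simp only [EdgeList.initState, natCells, cells, EdgeList.fstNum, if_true]
    split_ifs <;> first | rfl | omega
  have hb : s₂.arr 1 = natCells e.sndNum := by
    rw [harr]
    funext i
    simp only [EdgeList.initState, natCells, cells, EdgeList.sndNum, if_true, one_ne_zero, if_false]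
    split_ifs <;> first | rfl | omega
  have hz : ZeroFrom 2 s₂ := by
    intro a ha
    rw [harr]
    funext i
    simp only [EdgeList.initState, natCells, cells, if_neg (show a ≠ 0 by omega),
      if_neg (show a ≠ 1 by omega)]
    split_ifs <;> rfl
  refine halts_scanEdges hr hr2 hr3 ha hb hz (by omega) ?_
  intro t₃ s₃ deg₀ P Q ht₃ hr₃ h0 h1 h2 h3 h4 h5 hz hslots
  refine halts_contractAll (G := e.initialGraph) hq hq3 rfl hr₃ hr1 hr3 hr4 hr5 hr6 hr7 h0 h1 h2 h3
    h4 h5 hz (e.tables_initialGraph (by omega) hslots) (by omega) ?_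
  intro t₄ s₄ W' deg P' Q' ht₄ hr₄ h0 h1 h2 h5 hz hT₄ hcounts hPQ
  have hdeg : ∀ v, deg v ≤ 2 * m := by
    intro v
    have h1 : deg₀ v ≤ 2 * m := by
      rw [← hslots.sum v]
      refine (Finset.sum_le_card_nsmul _ _ 2 fun i _ => ?_).trans (by simp [mul_comm])
      split_ifs <;> omega
    rcases hT₄.deg v with h | h <;> omega
  refine halts_selectEdges hr₄ hr2 hr3 hr5 hr6 h0 h1 h2 h5 hz hT₄ hdeg (by omega) ?_
  intro t₅ s₅ cnt new ht₅ hr₅ h30 h31 hcnt h0 h1 h5 h6 hz hnum hnew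
  have hcard := e.card_keep_le hslots hT₄ hcounts hPQ
  set K := (W'.keep deg).card with hK
  have c8 : s₅.reg 8 = ((17 * D : ℕ) : ℤ) := (hr₅ 8 (by norm_num)).trans hr8
  have et₃ : (4 * (q + 3) + 50) * (n + 1) = 4 * (q * n) + 4 * q + 62 * n + 62 := by ring
  rw [halts_ite, c8, h30]
  split_ifs with hlt
  · rw [halts_const]
    have hlt' : 17 * D < K := by exact_mod_cast hlt
    simp only [halts_seqs_nil]
    -- More than `17 D` edges are kept, but never more than `17 Δ(G)`; hence `D < Δ(G)`.
    exact ⟨by simp, by omega, Or.inr ⟨by simp, by omega⟩⟩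
  · have hlt' : K ≤ 17 * D := by
      have : ¬ 17 * D < K := by exact_mod_cast hlt
      omega
    have hKq : K * (q + 3) ≤ 17 * (q * D) + 51 * D := by
      calc K * (q + 3) ≤ 17 * D * (q + 3) := Nat.mul_le_mul_right _ hlt'
        _ = 17 * (q * D) + 51 * D := by ring
    have et : (30 * (q + 3) + 50) * (m + 1) = 30 * (q * m) + 30 * q + 140 * m + 140 := by ring
    have hmem : ∀ i ∈ W'.keep deg, i ∈ W'.L := fun i hi => (Finset.mem_filter.1 hi).1
    refine halts_solveSmall (G := W'.restrict (W'.keep deg)) (K := K) (cap := q + 3) hr₅ hr2 hr3 hr5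
      r9 h0 h1 h5 h6 h31 hz hnum (fun i hi => ((hT₄.mem i).1 (hmem i hi)).1) (fun i hi => ?_)
      (fun i hi => ((hT₄.mem i).1 (hmem i hi)).2) (fun i _ => hT₄.len_lt i) rfl
      (fun i hi => hT₄.lt i (hmem i hi)) hnew (by omega) (by omega) hN64 (by omega) (by omega) ?_
    · simp only [PathGraph.restrict, hi, true_and]
      split_ifs <;> simp_all
    · intro t s' d ht h0 h1 hd
      simp only [halts_seqs_nil]
      rw [hT₄.counts_keep, hcounts, e.counts_initialGraph] at hd
      refine ⟨by omega, Or.inl ⟨h0, ?_⟩⟩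
      -- Selection and contraction preserve `counts`, so its greatest element, computed for the
      -- small graph, is Δ(G).
      rw [h1, hd.unique e.isGreatest_counts_pathGraph]

end RAM

/-- There are one program and one constant `C` such that for every threshold `D ≥ 1` and every
finite graph `G`, the program halts on input `(D, G)` within `C (|V| + |E| + 2 ^ (C D log D))`
steps, computing with words of `O(log (|V| + |E| + 2 ^ (C D log D)))` bits only, and either it
outputs (`1` in register `0`, `Δ(G)` in register `1`), or it reports `Δ(G) > D` (by `0` in
register `0`) and this report is correct. -/
theorem mainTheorem2 :
    ∃ (P : RAM.Program) (C : ℕ), ∀ (D : ℕ), 1 ≤ D →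
      ∀ {V : Type*} [Finite V] (G : SimpleGraph V) (e : EdgeList G),
        ∃ (t : ℕ) (s : RAM.State),
          RAM.Exec ⌊resourceBound C D (Nat.card V) (Nat.card G.edgeSet) ^ C⌋₊
            P (e.initState D) t s ∧
          (t : ℝ) ≤ resourceBound C D (Nat.card V) (Nat.card G.edgeSet) ∧
          ((s.reg 0 = 1 ∧ s.reg 1 = (G.subdetDelta : ℤ)) ∨
            (s.reg 0 = 0 ∧ D < G.subdetDelta)) := by
  obtain ⟨q₀, hq₀⟩ := exists_pathTypes_periodic
  -- The shift ensures `3 ≤ q`, so that reduced lengths stay at least three, as required for cycles.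
  set q := q₀ + 3 with hq
  obtain ⟨C, hC, hbound⟩ := exists_le_resourceBound (17 * (q + 5) + 1) (34 * (q + 3) + 1000)
  refine ⟨RAM.solve q, C, fun D hD V _ G e => ?_⟩
  obtain ⟨h1, h2⟩ := hbound D (Nat.card V) (Nat.card G.edgeSet) hD
  -- The program needs words only as large as its integral time bound, which is below the resource
  -- bound and, as that is at least 1, below its `C`-th power.
  have hW := Nat.le_floor (h1.trans (le_self_pow₀ h2 (show C ≠ 0 by omega)))
  obtain ⟨t, s, hs, ht, hout⟩ := RAM.halts_solve (q := q) (fun k hk => hq₀ k (by omega)) (by omega)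
    hD e rfl rfl rfl hW
  exact ⟨t, s, hs, le_trans (by exact_mod_cast ht) h1, hout⟩
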